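/- Let $\Gamma$ be a finitely generated torsion-free nilpotent group and let $\mathcal G$ be the unipotent algebraic group over $\mathbb Q$ whose Lie algebra $\mathrm{Lie}(\mathcal G)$ is the Lie algebra of primitive elements of the completed group algebra $\mathbb Q[\Gamma]^\wedge=\varprojlim_n \mathbb Q[\Gamma]/I^n$ ($I$ the augmentation ideal), so that $\Gamma\subset\mathcal G(\mathbb Q)$ via $\gamma\mapsto\exp(\log\gamma)$. Let $\mathrm{Lie}(\mathcal G)$ be equipped with a $\mathbb Q$-mixed Hodge structure of weights $\le -1$ for which the Lie bracket is a morphism of mixed Hodge structures, let $F^0\mathcal G(\mathbb C)\subset\mathcal G(\mathbb C)$ be the algebraic subgroup corresponding to the Lie subalgebra $F^0\mathrm{Lie}(\mathcal G)_{\mathbb C}$, and put $A_\Gamma:=\Gamma\backslash\mathcal G(\mathbb C)/F^0\mathcal G(\mathbb C)$. (If $X$ is a connected smooth complex algebraic variety, $b\in X$, $\Gamma$ is a torsion-free nilpotent quotient of $\pi_1(X,b)$, and $\mathrm{Lie}(\mathcal G)$ carries the mixed Hodge structure of Hain and Zucker, then $A_\Gamma$ is the higher Albanese manifold $A_{X,\Gamma}$.)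 Let $V_0$ be a $\mathbb Q$-mixed Hodge structure with polarizable $\mathrm{gr}^W$ having $\mathrm{Lie}(\mathcal G)$ as a direct summand, and let $Q$ be its Mumford–Tate group, i.e. the Tannaka group of the Tannakian category $\langle V_0\rangle$ generated by $V_0$. The action of $Q$ on $\mathrm{Lie}(\mathcal G)$ induces an action on $\mathcal G$; let $G=\mathcal G\rtimes Q$. Let $S$ be the Weil restriction of $\mathbb G_m$ from $\mathbb C$ to $\mathbb R$, and let $h_0:S\to (Q/Q_u)_{\mathbb R}=(G/G_u)_{\mathbb R}$ be the homomorphism given by the Hodge decomposition of $\mathrm{gr}^W V_0$ (where $(\cdot)_u$ denotes the unipotent radical). For $P\in\{G,Q\}$ let $D_P$ be the set of isomorphism classes of exact $\otimes$-functors from the category $\mathrm{Rep}(P)$ of finite-dimensional representations of $P$ over $\mathbb Q$ to $\mathbb Q$-mixed Hodge structures, keeping the underlying vector spaces with their weight filtrations (the weight filtration being the one defined by any lift to $P$ of the restriction of $h_0$ to $\mathbb G_m$), whose associated homomorphism $S\to(P/P_u)_{\mathbb R}$ is $(P/P_u)(\mathbb R)$-conjugate to $h_0$; $D_P$ is open in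 a $P(\mathbb C)$-homogeneous complex manifold, on which $P(\mathbb C)$ acts by changing the Hodge filtrations. Let $b_Q$ be the class of the evident functor $\mathrm{Rep}(Q)\simeq\langle V_0\rangle\to\mathbb Q\text{-MHS}$ and $b_G$ that of its composite with the restriction functor $\mathrm{Rep}(G)\to\mathrm{Rep}(Q)$. Let $\mathcal D$ be the fibre over $b_Q$ of the map $D_G\to D_Q$ induced by $G\to Q$. Then $b_Q\in D_Q$, $b_G\in\mathcal D$, $g\,b_G\in\mathcal D$ for all $g\in\mathcal G(\mathbb C)$, and the map $g\mapsto g\,b_G$ induces isomorphisms of complex analytic manifolds (1) $\mathcal G(\mathbb C)/F^0\mathcal G(\mathbb C)\;\cong\;\mathcal D$, (2) $A_{\Gamma}=\Gamma\backslash\mathcal G(\mathbb C)/F^0\mathcal G(\mathbb C)\;\cong\;\Gamma\backslash\mathcal D$. -/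

import Mathlib

open scoped TensorProduct Topology

noncomputable section

namespace HigherAlbanese

/-! ## Complex analytic spaces as spaces with holomorphic functions -/

/-- A reduced complex analytic structure on `M`, given by its topology and by the predicate
"`f` is holomorphic in a neighbourhood of `x`" on functions `f : M → ℂ`. -/
structure HolStr (M : Type*) where
  top : TopologicalSpace M
  holAt : (M → ℂ) → M → Prop

/-- The structure induced on a subset (a locally closed submanifold): the subspace topology;
holomorphic functions are locally the restrictions of holomorphic functions. -/
def HolStr.sub {M : Type*} (S : HolStr M) (s : Set M) : HolStr s where
  top := S.top.induced Subtype.val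
  holAt f x := ∃ F : M → ℂ, S.holAt F x.1 ∧
    ∀ᶠ y in @nhds s (S.top.induced Subtype.val) x, f y = F y.1

/-- The quotient structure along a surjection (a holomorphic submersion): the quotient topology;
a function is holomorphic iff its pullback is. -/
def HolStr.quot {M N : Type*} (S : HolStr M) (π : M → N) : HolStr N where
  top := S.top.coinduced π
  holAt f y := ∀ x, π x = y → S.holAt (f ∘ π) x

/-- `e` is an isomorphism of complex analytic spaces (a biholomorphic map). -/
def IsBiholomorphic {M N : Type*} (S : HolStr M) (T : HolStr N) (e : M → N) : Prop :=
  @IsHomeomorph M N S.top T.top e ∧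
    ∀ (f : N → ℂ) (x : M), T.holAt f (e x) ↔ S.holAt (f ∘ e) x

/-! ## Linear algebraic groups over `ℚ` and their representations

A linear algebraic group over `ℚ` is given, in the classical way, by the group `G` of its complex
points together with the `ℚ`-algebra of those functions `G → ℂ` that are regular functions
defined over `ℚ`. -/

/-- The `ℚ`-algebra of regular functions defined over `ℚ` on a group `G` of complex points. -/
class AlgGp (G : Type*) [Group G] where
  coord : Subalgebra ℚ (G → ℂ)

/-- The complex Lie group `G(ℂ)`: the coarsest topology for which the regular functions are
continuous; the holomorphic functions are locally the analytic functions of finitely many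
regular functions. -/
def AlgGp.hol (G : Type*) [Group G] [AlgGp G] : HolStr G where
  top := ⨅ u : AlgGp.coord (G := G), TopologicalSpace.induced u.1 inferInstance
  holAt f g := ∃ (n : ℕ) (u : Fin n → AlgGp.coord (G := G)) (Φ : (Fin n → ℂ) → ℂ),
    AnalyticAt ℂ Φ (fun i => (u i).1 g) ∧
    ∀ᶠ x in @nhds G (⨅ u : AlgGp.coord (G := G), TopologicalSpace.induced u.1 inferInstance) g,
      f x = Φ (fun i => (u i).1 x)

/-- An object of `Rep(G)`: a finite-dimensional representation of `G` over `ℚ`, that is, a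
`ℚ`-vector space `V` with an action of `G(ℂ)` on `V_ℂ` whose matrix coefficients with respect to
`V` are regular functions defined over `ℚ`. -/
structure AlgRep (G : Type*) [Group G] [AlgGp G] where
  V : Type
  [addCommGroup : AddCommGroup V]
  [module : Module ℚ V]
  [finite : Module.Finite ℚ V]
  ρ : G →* Module.End ℂ (ℂ ⊗[ℚ] V)
  regular : ∀ (v : V) (l : Module.Dual ℚ V),
    (fun g => Module.Dual.baseChange ℂ l (ρ g (1 ⊗ₜ v))) ∈ AlgGp.coord (G := G)

attribute [instance] AlgRep.addCommGroup AlgRep.module AlgRep.finite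

/-- Morphisms of `Rep(G)`: `ℚ`-linear maps that are `G`-equivariant. -/
def AlgRep.IsHom {G : Type*} [Group G] [AlgGp G] (A B : AlgRep G) (f : A.V →ₗ[ℚ] B.V) : Prop :=
  ∀ (g : G) (x : ℂ ⊗[ℚ] A.V), f.baseChange ℂ (A.ρ g x) = B.ρ g (f.baseChange ℂ x)

/-- The isomorphism `A ⊗ B ≅ T` of vector spaces is an isomorphism of representations. -/
def AlgRep.IsTensorIso {G : Type*} [Group G] [AlgGp G] (A B T : AlgRep G)
    (e : (A.V ⊗[ℚ] B.V) ≃ₗ[ℚ] T.V) : Prop :=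
  ∀ (g : G) (x : ℂ ⊗[ℚ] (A.V ⊗[ℚ] B.V)),
    T.ρ g (e.toLinearMap.baseChange ℂ x) = e.toLinearMap.baseChange ℂ
      ((TensorProduct.AlgebraTensorModule.distribBaseChange ℚ ℂ A.V B.V).symm
        (TensorProduct.map (A.ρ g) (B.ρ g)
          (TensorProduct.AlgebraTensorModule.distribBaseChange ℚ ℂ A.V B.V x)))

/-- The restriction of a representation along a homomorphism of algebraic groups. -/
def AlgRep.pull {G H : Type*} [Group G] [AlgGp G] [Group H] [AlgGp H] (φ : G →* H)
    (hφ : ∀ u ∈ AlgGp.coord (G := H), u ∘ φ ∈ AlgGp.coord (G := G)) (A : AlgRep H) :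
    AlgRep G where
  V := A.V
  ρ := A.ρ.comp φ
  regular v l := hφ _ (A.regular v l)

/-- The unipotent radical `G_u(ℂ)`, the largest normal unipotent subgroup.  A subgroup is unipotent
if its elements act unipotently on all representations.  (In characteristic zero unipotent
groups are connected.) -/
def unipotentRadical (G : Type*) [Group G] [AlgGp G] : Subgroup G :=
  sSup {N : Subgroup G | N.Normal ∧ ∀ g ∈ N, ∀ A : AlgRep G, IsNilpotent (A.ρ g - 1)}

/-- The class of `r ∈ G(ℂ)` in `(G/G_u)(ℂ)` is a real point: the regular functions on `G/G_u`
that are defined over `ℚ` (those on `G` that are invariant under `G_u`) take real values there. -/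
def IsRealModUnipotent {G : Type*} [Group G] [AlgGp G] (r : G) : Prop :=
  ∀ u ∈ AlgGp.coord (G := G), (∀ g, ∀ n ∈ unipotentRadical G, u (g * n) = u g) → (u r).im = 0

/-! ## Mixed Hodge structures -/

/-- Complex conjugation on `V_ℂ = ℂ ⊗ V`. -/
def conjC (V : Type*) [AddCommGroup V] [Module ℚ V] :
    (ℂ ⊗[ℚ] V) →ₛₗ[starRingEnd ℂ] (ℂ ⊗[ℚ] V) where
  toFun := LinearMap.rTensor V ((starRingEnd ℂ).toRatAlgHom.toLinearMap : ℂ →ₗ[ℚ] ℂ)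
  map_add' := map_add _
  map_smul' z x := by
    induction x using TensorProduct.induction_on with
    | zero => simp
    | tmul a v => simp [TensorProduct.smul_tmul']
    | add x y hx hy => rw [smul_add, map_add, map_add, smul_add, hx, hy]

section MHS

variable {V : Type*} [AddCommGroup V] [Module ℚ V]

/-- `F^p gr^W_w`, as a subspace between `W_{w-1,ℂ}` and `W_{w,ℂ}`. -/
def grF (W : ℤ → Submodule ℚ V) (F : ℤ → Submodule ℂ (ℂ ⊗[ℚ] V)) (w p : ℤ) :
    Submodule ℂ (ℂ ⊗[ℚ] V) :=
  (F p ⊓ (W w).baseChange ℂ) ⊔ (W (w - 1)).baseChange ℂ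

/-- The preimage in `W_{p+q,ℂ}` of the Hodge component
`(gr^W_{p+q})^{p,q} = F^p gr ∩ conj (F^q gr)`. -/
def hodgeComp (W : ℤ → Submodule ℚ V) (F : ℤ → Submodule ℂ (ℂ ⊗[ℚ] V)) (p q : ℤ) :
    Submodule ℂ (ℂ ⊗[ℚ] V) :=
  grF W F (p + q) p ⊓ (grF W F (p + q) q).map (conjC V)

/-- `(V, W, F)` is a `ℚ`-mixed Hodge structure: `V` is finite-dimensional, `W` and `F` are finite
filtrations and `F` induces on each `gr^W_w` a pure Hodge structure of weight `w`, that is,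
`gr^W_w = F^p ⊕ conj F^q` whenever `p + q = w + 1`. -/
structure IsMHS (W : ℤ → Submodule ℚ V) (F : ℤ → Submodule ℂ (ℂ ⊗[ℚ] V)) : Prop where
  finite : Module.Finite ℚ V
  W_mono : Monotone W
  W_bot : ∃ n, W n = ⊥
  W_top : ∃ n, W n = ⊤
  F_anti : Antitone F
  F_bot : ∃ p, F p = ⊥
  F_top : ∃ p, F p = ⊤
  opposed_sup : ∀ w p q : ℤ, p + q = w + 1 →
    grF W F w p ⊔ (grF W F w q).map (conjC V) = (W w).baseChange ℂ
  opposed_inf : ∀ w p q : ℤ, p + q = w + 1 →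
    grF W F w p ⊓ (grF W F w q).map (conjC V) = (W (w - 1)).baseChange ℂ

/-- `gr^W` is polarizable: for each `w` there is a rational bilinear form on `gr^W_w` (given by
a form `S` on `V`, of which only the values on `W_w` matter) which is `(-1)^w`-symmetric, with
`S(F^p, F^{w-p+1}) = 0` and with `i^{p-q} S(x, conj x) > 0` for `0 ≠ x ∈ (gr^W_w)^{p,q}`. -/
def GrPolarizable (W : ℤ → Submodule ℚ V) (F : ℤ → Submodule ℂ (ℂ ⊗[ℚ] V)) : Prop :=
  ∀ w : ℤ, ∃ S : LinearMap.BilinForm ℚ V,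
    (∀ x ∈ W w, ∀ y ∈ W (w - 1), S x y = 0) ∧
    (∀ x ∈ W w, ∀ y ∈ W w, S y x = (-1) ^ w * S x y) ∧
    (∀ p : ℤ, ∀ x ∈ grF W F w p, ∀ y ∈ grF W F w (w - p + 1), S.baseChange ℂ x y = 0) ∧
    ∀ p q : ℤ, p + q = w → ∀ x ∈ hodgeComp W F p q, x ∉ (W (w - 1)).baseChange ℂ →
      ∃ r : ℝ, 0 < r ∧ Complex.I ^ (p - q) * S.baseChange ℂ x (conjC V x) = r

/-- The endomorphism `a` of `V_ℂ` induces on `gr^W` the action of the point `(z, w)` of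
`S(ℂ) = ℂˣ × ℂˣ` (`S` being the Weil restriction of `𝔾_m` from `ℂ` to `ℝ`, with
`z ∈ ℂˣ = S(ℝ)` corresponding to `(z, conj z)`) that is given by the Hodge decomposition:
multiplication by `z ^ p * w ^ q` on the component of type `(p, q)`. -/
def ActsAsHodge (W : ℤ → Submodule ℚ V) (F : ℤ → Submodule ℂ (ℂ ⊗[ℚ] V))
    (a : Module.End ℂ (ℂ ⊗[ℚ] V)) (z w : ℂˣ) : Prop :=
  ∀ p q : ℤ, ∀ x ∈ hodgeComp W F p q,
    a x - ((z : ℂ) ^ p * (w : ℂ) ^ q) • x ∈ (W (p + q - 1)).baseChange ℂ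

end MHS

/-- Triples `(V, W, F)`: a `ℚ`-vector space, a weight filtration on it and a Hodge filtration on its
complexification. -/
structure FilSp where
  V : Type
  [addCommGroup : AddCommGroup V]
  [module : Module ℚ V]
  W : ℤ → Submodule ℚ V
  F : ℤ → Submodule ℂ (ℂ ⊗[ℚ] V)

attribute [instance] FilSp.addCommGroup FilSp.module

namespace FilSp

/-- Morphisms of (mixed Hodge) triples. -/
structure IsHom (A B : FilSp) (f : A.V →ₗ[ℚ] B.V) : Prop where
  map_W : ∀ n, (A.W n).map f ≤ B.W n
  map_F : ∀ p, (A.F p).map (f.baseChange ℂ) ≤ B.F p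

/-- `A` is a direct summand of `B`. -/
def IsDirectSummand (A B : FilSp) : Prop :=
  ∃ (i : A.V →ₗ[ℚ] B.V) (r : B.V →ₗ[ℚ] A.V),
    A.IsHom B i ∧ B.IsHom A r ∧ r ∘ₗ i = LinearMap.id

/-- The unit object `ℚ(0)`. -/
def unit : FilSp where
  V := ℚ
  W n := if 0 ≤ n then ⊤ else ⊥
  F p := if p ≤ 0 then ⊤ else ⊥

/-- The tensor product. -/
def tensor (A B : FilSp) : FilSp where
  V := A.V ⊗[ℚ] B.V
  W n := ⨆ i : ℤ, Submodule.map₂ (TensorProduct.mk ℚ A.V B.V) (A.W i) (B.W (n - i))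
  F p := ⨆ i : ℤ, (Submodule.map₂ (TensorProduct.mk ℂ (ℂ ⊗[ℚ] A.V) (ℂ ⊗[ℚ] B.V))
    (A.F i) (B.F (p - i))).map
      (TensorProduct.AlgebraTensorModule.distribBaseChange ℚ ℂ A.V B.V).symm.toLinearMap

/-- The dual. -/
def dual (A : FilSp) : FilSp where
  V := Module.Dual ℚ A.V
  W n := (A.W (-n - 1)).dualAnnihilator
  F p := ((A.F (1 - p)).dualAnnihilator).comap
    (LinearMap.liftBaseChange ℂ (Module.Dual.baseChange (R := ℚ) (V := A.V) ℂ))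

/-- The direct sum. -/
def prod (A B : FilSp) : FilSp where
  V := A.V × B.V
  W n := (A.W n).prod (B.W n)
  F p := (A.F p).comap ((LinearMap.fst ℚ A.V B.V).baseChange ℂ) ⊓
    (B.F p).comap ((LinearMap.snd ℚ A.V B.V).baseChange ℂ)

end FilSp

/-! ## The Mumford–Tate group -/

/-- The objects of the Tannakian category generated by the mixed Hodge structure `V₀`. -/
inductive TannakaGen (V₀ : FilSp) : FilSp → Prop
  | self : TannakaGen V₀ V₀
  | unit : TannakaGen V₀ FilSp.unit
  | tensor {A B : FilSp} : TannakaGen V₀ A → TannakaGen V₀ B → TannakaGen V₀ (A.tensor B)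
  | dual {A : FilSp} : TannakaGen V₀ A → TannakaGen V₀ A.dual
  | prod {A B : FilSp} : TannakaGen V₀ A → TannakaGen V₀ B → TannakaGen V₀ (A.prod B)
  | sub {A B : FilSp} (f : B.V →ₗ[ℚ] A.V) : TannakaGen V₀ A → IsMHS B.W B.F → B.IsHom A f →
      Function.Injective f → TannakaGen V₀ B
  | quot {A B : FilSp} (f : A.V →ₗ[ℚ] B.V) : TannakaGen V₀ A → IsMHS B.W B.F → A.IsHom B f →
      Function.Surjective f → TannakaGen V₀ B

/-- The Tannakian category generated by `V₀`. -/
abbrev TannakaObj (V₀ : FilSp) := {A : FilSp // TannakaGen V₀ A}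

/-- The canonical isomorphism `A_ℂ ⊗ B_ℂ ≅ (A ⊗ B)_ℂ`. -/
def FilSp.tensorIso (A B : FilSp) :
    (ℂ ⊗[ℚ] A.V) ⊗[ℂ] (ℂ ⊗[ℚ] B.V) ≃ₗ[ℂ] ℂ ⊗[ℚ] (A.tensor B).V :=
  (TensorProduct.AlgebraTensorModule.distribBaseChange ℚ ℂ A.V B.V).symm

/-- The complex points of the Mumford–Tate group of `V₀`, that is, of the Tannaka group of the
Tannakian category generated by `V₀`: the tensor automorphisms of the fibre functor `A ↦ A_ℂ`. -/
def mumfordTate (V₀ : FilSp) :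
    Subgroup (∀ A : TannakaObj V₀, (ℂ ⊗[ℚ] A.1.V) ≃ₗ[ℂ] (ℂ ⊗[ℚ] A.1.V)) where
  carrier := {g |
    (∀ (A B : TannakaObj V₀) (f : A.1.V →ₗ[ℚ] B.1.V), A.1.IsHom B.1 f →
      ∀ x, g B (f.baseChange ℂ x) = f.baseChange ℂ (g A x)) ∧
    (∀ (A B : TannakaObj V₀) (x : ℂ ⊗[ℚ] A.1.V) (y : ℂ ⊗[ℚ] B.1.V),
      g ⟨A.1.tensor B.1, A.2.tensor B.2⟩ (A.1.tensorIso B.1 (x ⊗ₜ y)) =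
        A.1.tensorIso B.1 (g A x ⊗ₜ g B y)) ∧
    g ⟨FilSp.unit, TannakaGen.unit⟩ = 1}
  one_mem' := ⟨fun A B f _ x => rfl, fun A B x y => rfl, rfl⟩
  mul_mem' := by
    rintro g h ⟨hg1, hg2, hg3⟩ ⟨hh1, hh2, hh3⟩
    refine ⟨fun A B f hf x => ?_, fun A B x y => ?_, ?_⟩
    · change g B (h B _) = f.baseChange ℂ (g A (h A x))
      rw [hh1 A B f hf, hg1 A B f hf]
    · exact (congrArg _ (hh2 A B x y)).trans (hg2 A B _ _)
    · rw [Pi.mul_apply, hg3, hh3, one_mul]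
  inv_mem' := by
    rintro g ⟨hg1, hg2, hg3⟩
    refine ⟨fun A B f hf x => ?_, fun A B x y => ?_, ?_⟩
    · apply (g B).injective
      rw [hg1 A B f hf]
      change g B ((g B).symm _) = f.baseChange ℂ (g A ((g A).symm x))
      simp
    · apply (g ⟨A.1.tensor B.1, A.2.tensor B.2⟩).injective
      rw [hg2]
      change g ⟨A.1.tensor B.1, A.2.tensor B.2⟩ ((g ⟨A.1.tensor B.1, A.2.tensor B.2⟩).symm
          (A.1.tensorIso B.1 (x ⊗ₜ y))) =
        A.1.tensorIso B.1 (g A ((g A).symm x) ⊗ₜ g B ((g B).symm y))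
      simp
    · rw [Pi.inv_apply, hg3, inv_one]

/-- The regular functions on the Mumford–Tate group: the algebra generated by the rational matrix
coefficients of the objects of the Tannakian category. -/
instance (V₀ : FilSp) : AlgGp (mumfordTate V₀) where
  coord := Algebra.adjoin ℚ {u | ∃ (A : TannakaObj V₀) (v : A.1.V) (l : Module.Dual ℚ A.1.V),
    u = fun g => Module.Dual.baseChange ℂ l (g.1 A (1 ⊗ₜ v))}

/-- The homomorphism `h₀ : S → (Q/Q_u)_ℝ` given by the Hodge decomposition of `gr^W V₀`, for the
Mumford–Tate group `Q` of `V₀`; the point `h₀(z, w)` of `(Q/Q_u)(ℂ)` is given as a coset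
in `Q(ℂ)`, the set of the elements that act on `gr^W V₀` in the prescribed way. -/
def hodgeHom (V₀ : FilSp) (z w : ℂˣ) : Set (mumfordTate V₀) :=
  {q | ActsAsHodge V₀.W V₀.F (q.1 ⟨V₀, TannakaGen.self⟩).toLinearMap z w}

/-! ## `G`-mixed Hodge structures and period domains -/

section PeriodDomain

variable {G : Type*} [Group G] [AlgGp G]

/-- `lam` is an algebraic cocharacter `𝔾_m → G` over `ℂ`. -/
def IsCocharacter (lam : ℂˣ →* G) : Prop :=
  ∀ u ∈ AlgGp.coord (G := G),
    (fun t => u (lam t)) ∈ Submodule.span ℂ (Set.range fun (k : ℤ) (t : ℂˣ) => (t : ℂ) ^ k)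

/-- The weight filtration on a representation: the one defined by a lifting to `G` of the
composite of `𝔾_m → S` and `h₀ : S → G/G_u` (all liftings define the same filtration).  Here
and below `h₀` is given by the cosets of `G_u` that are its values. -/
def weightFil (h₀ : ℂˣ → ℂˣ → Set G) (A : AlgRep G) (n : ℤ) : Submodule ℚ A.V :=
  ⨆ (lam : ℂˣ →* G) (_ : IsCocharacter lam ∧ ∀ t, lam t ∈ h₀ t t),
    ((⨆ (k : ℤ) (_ : k ≤ n), ⨅ t : ℂˣ,
      LinearMap.ker (A.ρ (lam t) - ((t : ℂ) ^ k) • 1)).restrictScalars ℚ).comap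
        (TensorProduct.mk ℚ ℂ A.V 1)

/-- A family of filtrations on the complexifications of all representations of `G`: the Hodge
filtrations of a functor on `Rep(G)` that keeps the underlying vector spaces. -/
abbrev FilFam (G : Type*) [Group G] [AlgGp G] :=
  ∀ A : AlgRep G, ℤ → Submodule ℂ (ℂ ⊗[ℚ] A.V)

/-- `H` is a `G`-mixed Hodge structure: an exact tensor functor from `Rep(G)` to the
category of `ℚ`-mixed Hodge structures that keeps the underlying vector spaces with the weight
filtrations. Two such functors are isomorphic (by isomorphisms that are the identity on
the underlying vector spaces) iff the families of filtrations are equal. -/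
structure IsGMHS (h₀ : ℂˣ → ℂˣ → Set G) (H : FilFam G) : Prop where
  mhs : ∀ A, IsMHS (weightFil h₀ A) (H A)
  functorial : ∀ (A B : AlgRep G) (f : A.V →ₗ[ℚ] B.V), A.IsHom B f →
    ∀ p, (H A p).map (f.baseChange ℂ) ≤ H B p
  exact_left : ∀ (A B : AlgRep G) (f : A.V →ₗ[ℚ] B.V), A.IsHom B f → Function.Injective f →
    ∀ p, H A p = (H B p).comap (f.baseChange ℂ)
  exact_right : ∀ (A B : AlgRep G) (f : A.V →ₗ[ℚ] B.V), A.IsHom B f → Function.Surjective f →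
    ∀ p, (H A p).map (f.baseChange ℂ) = H B p
  unit : ∀ A : AlgRep G, Module.finrank ℚ A.V = 1 → (∀ g, A.ρ g = 1) →
    ∀ p, H A p = if p ≤ 0 then ⊤ else ⊥
  tensor : ∀ (A B T : AlgRep G) (e : (A.V ⊗[ℚ] B.V) ≃ₗ[ℚ] T.V), A.IsTensorIso B T e →
    ∀ p, H T p = ((⨆ i : ℤ, (Submodule.map₂ (TensorProduct.mk ℂ (ℂ ⊗[ℚ] A.V) (ℂ ⊗[ℚ] B.V))
      (H A i) (H B (p - i))).map
        (TensorProduct.AlgebraTensorModule.distribBaseChange ℚ ℂ A.V B.V).symm.toLinearMap)).map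
          (e.toLinearMap.baseChange ℂ)

/-- The period domain `D` of type `(G, h₀)`: the (isomorphism classes of) `G`-mixed Hodge
structures `H` whose associated homomorphism `S → (G/G_u)_ℝ`, the one given by the Hodge
decompositions of `gr^W H(A)` for the representations `A`, is conjugate to `h₀`
under a point `r` of `(G/G_u)(ℝ)`. -/
def periodDomain (h₀ : ℂˣ → ℂˣ → Set G) : Set (FilFam G) :=
  {H | IsGMHS h₀ H ∧ ∃ r : G, IsRealModUnipotent r ∧
    ∀ (A : AlgRep G) (z w : ℂˣ), ∀ g ∈ h₀ z w,
      ActsAsHodge (weightFil h₀ A) (H A) (A.ρ (r * g * r⁻¹)) z w}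

/-- The action of `G(ℂ)` by changing the Hodge filtrations. -/
def FilFam.act (g : G) (H : FilFam G) : FilFam G := fun A p => (H A p).map (A.ρ g)

theorem FilFam.act_one (H : FilFam G) : FilFam.act 1 H = H := by
  funext A p
  simp only [FilFam.act, map_one]
  exact Submodule.map_id _

theorem FilFam.act_mul (g g' : G) (H : FilFam G) :
    FilFam.act (g * g') H = FilFam.act g (FilFam.act g' H) := by
  funext A p
  simp only [FilFam.act, map_mul]
  exact Submodule.map_comp _ _ _

/-- The complex analytic structure on the `G(ℂ)`-orbits as homogeneous spaces of `G(ℂ)`.  The period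
domain, which is open in one orbit, and its subspaces carry the structure
induced by it. -/
def FilFam.hol (G : Type*) [Group G] [AlgGp G] : HolStr (FilFam G) where
  top := ⨆ H : FilFam G, (AlgGp.hol G).top.coinduced (fun g => FilFam.act g H)
  holAt f H := (AlgGp.hol G).holAt (fun g => f (FilFam.act g H)) 1

/-- The map on families induced by a homomorphism `φ : G → H` of algebraic groups: composition with
the restriction functor `Rep(H) → Rep(G)`. -/
def FilFam.push {H : Type*} [Group H] [AlgGp H] (φ : G →* H)
    (hφ : ∀ u ∈ AlgGp.coord (G := H), u ∘ φ ∈ AlgGp.coord (G := G)) (x : FilFam G) :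
    FilFam H :=
  fun A => x (A.pull φ hφ)

end PeriodDomain

/-- The point `b_Q` given by the evident functor from `Rep(Q)` to mixed Hodge structures,
for the Mumford–Tate group `Q` of `V₀`: it sends an object of the Tannakian category
generated by `V₀`, regarded as a representation of `Q`, to itself. -/
def basePointQ (V₀ : FilSp) : FilFam (mumfordTate V₀) := fun B p =>
  ⨆ (A : TannakaObj V₀) (f : A.1.V →ₗ[ℚ] B.V)
    (_ : ∀ (g : mumfordTate V₀) (x : ℂ ⊗[ℚ] A.1.V),
      f.baseChange ℂ (g.1 A x) = B.ρ g (f.baseChange ℂ x)),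
    (A.1.F p).map (f.baseChange ℂ)

/-! ## Completed augmented algebras -/

section Completion

variable {k : Type*} [CommRing k]

theorem ker_pow_le {A B : Type*} [Ring A] [Algebra k A] [Ring B] [Algebra k B]
    {ε : A →ₐ[k] k} {ε' : B →ₐ[k] k} (f : A →ₐ[k] B) (hf : ε'.comp f = ε) (m : ℕ) :
    RingHom.ker ε ^ m ≤ (RingHom.ker ε' ^ m).comap f.toRingHom := by
  have h0 : RingHom.ker ε ≤ (RingHom.ker ε').comap f.toRingHom := by
    intro x hx
    rw [Ideal.mem_comap, RingHom.mem_ker]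
    rw [RingHom.mem_ker, ← hf] at hx
    exact hx
  induction m with
  | zero =>
    intro x _
    rw [Ideal.mem_comap, Submodule.pow_zero, Ideal.one_eq_top]
    trivial
  | succ m ih =>
    rw [Submodule.pow_succ, Submodule.pow_succ, Ideal.mul_le]
    intro x hx y hy
    rw [Ideal.mem_comap, map_mul]
    exact Ideal.mul_mem_mul (ih hx) (h0 hy)

variable (k) in
/-- Augmented algebras with a comultiplication, such as group algebras and universal enveloping
algebras. -/
class AugAlg (A : Type*) [Ring A] [Algebra k A] where
  ε : A →ₐ[k] k
  Δ : A →ₐ[k] A ⊗[k] A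
  ε_Δ : ((Algebra.TensorProduct.lmul' k).comp (Algebra.TensorProduct.map ε ε)).comp Δ = ε

/-- The completion `lim_m A / I^m`, where `I` is the kernel of the augmentation `ε`. -/
def compl {A : Type*} [Ring A] [Algebra k A] (ε : A →ₐ[k] k) :
    Subalgebra k (∀ m : ℕ, A ⧸ (RingHom.ker ε) ^ m) where
  carrier := {x | ∀ m n : ℕ, ∀ h : m ≤ n,
    Ideal.Quotient.factor (Ideal.pow_le_pow_right h) (x n) = x m}
  mul_mem' hx hy m n h := by simp [hx m n h, hy m n h]
  add_mem' hx hy m n h := by simp [hx m n h, hy m n h]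
  algebraMap_mem' c m n h := rfl

/-- The canonical map from `A` to its completion. -/
def compl.of {A : Type*} [Ring A] [Algebra k A] (ε : A →ₐ[k] k) (a : A) : compl ε :=
  ⟨fun _ => Ideal.Quotient.mk _ a, fun _ _ _ => rfl⟩

section map

variable {A B C : Type*} [Ring A] [Algebra k A] [Ring B] [Algebra k B] [Ring C] [Algebra k C]
  {ε : A →ₐ[k] k} {ε' : B →ₐ[k] k} {ε'' : C →ₐ[k] k}

/-- The map induced on completions by a homomorphism of augmented algebras. -/
def compl.map (f : A →ₐ[k] B) (hf : ε'.comp f = ε) : compl ε →ₐ[k] compl ε' where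
  toFun x := ⟨fun m => Ideal.quotientMap _ f.toRingHom (ker_pow_le f hf m) (x.1 m), by
    intro m n h
    have hx := x.2 m n h
    obtain ⟨a, ha⟩ := Ideal.Quotient.mk_surjective (x.1 n)
    change Ideal.Quotient.factor _ (Ideal.quotientMap _ _ _ (x.1 n)) =
      Ideal.quotientMap _ _ (ker_pow_le f hf m) (x.1 m)
    rw [← hx, ← ha]
    rfl⟩
  map_one' := Subtype.ext (funext fun m => map_one _)
  map_mul' x y := Subtype.ext (funext fun m => map_mul _ _ _)
  map_zero' := Subtype.ext (funext fun m => map_zero _)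
  map_add' x y := Subtype.ext (funext fun m => map_add _ _ _)
  commutes' c := Subtype.ext (funext fun m => by
    change Ideal.Quotient.mk _ (f (algebraMap k A c)) = Ideal.Quotient.mk _ (algebraMap k B c)
    rw [f.commutes])

theorem compl.map_id (h : ε.comp (AlgHom.id k A) = ε) (x : compl ε) :
    compl.map (AlgHom.id k A) h x = x := by
  refine Subtype.ext (funext fun m => ?_)
  obtain ⟨a, ha⟩ := Ideal.Quotient.mk_surjective (x.1 m)
  change Ideal.quotientMap _ _ (ker_pow_le _ h m) (x.1 m) = x.1 m
  rw [← ha]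
  rfl

theorem compl.map_map (f : A →ₐ[k] B) (hf : ε'.comp f = ε) (g : B →ₐ[k] C)
    (hg : ε''.comp g = ε') (u : A →ₐ[k] C) (hu : ε''.comp u = ε) (h : u = g.comp f)
    (x : compl ε) : compl.map g hg (compl.map f hf x) = compl.map u hu x := by
  subst h
  refine Subtype.ext (funext fun m => ?_)
  obtain ⟨a, ha⟩ := Ideal.Quotient.mk_surjective (x.1 m)
  change Ideal.quotientMap _ _ (ker_pow_le g hg m)
      (Ideal.quotientMap _ _ (ker_pow_le f hf m) (x.1 m)) =
    Ideal.quotientMap _ _ (ker_pow_le (g.comp f) hu m) (x.1 m)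
  rw [← ha]
  rfl

theorem compl.commute_map (f g : A →ₐ[k] B) (hf : ε'.comp f = ε) (hg : ε'.comp g = ε)
    (h : ∀ a b, Commute (f a) (g b)) (x y : compl ε) :
    Commute (compl.map f hf x) (compl.map g hg y) := by
  refine Subtype.ext (funext fun m => ?_)
  obtain ⟨a, ha⟩ := Ideal.Quotient.mk_surjective (x.1 m)
  obtain ⟨b, hb⟩ := Ideal.Quotient.mk_surjective (y.1 m)
  change Ideal.quotientMap _ _ (ker_pow_le f hf m) (x.1 m) *
      Ideal.quotientMap _ _ (ker_pow_le g hg m) (y.1 m) =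
    Ideal.quotientMap _ _ (ker_pow_le g hg m) (y.1 m) *
      Ideal.quotientMap _ _ (ker_pow_le f hf m) (x.1 m)
  rw [← ha, ← hb]
  exact congrArg (Ideal.Quotient.mk (RingHom.ker ε' ^ m)) (h a b)

end map

section Abstract

attribute [local instance 100] LieRing.ofAssociativeRing

variable {H K : Type*} [Ring H] [Algebra k H] [Ring K] [Algebra k K]

/-- The elements `x` with `D x = i x + j x`, for commuting homomorphisms `i` and `j`. -/
def primitivesOf (D i j : H →ₐ[k] K) (hc : ∀ x y, Commute (i x) (j y)) : LieSubalgebra k H where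
  carrier := {x | D x = i x + j x}
  zero_mem' := by
    change D 0 = i 0 + j 0
    rw [map_zero, map_zero, map_zero, add_zero]
  add_mem' {x y} hx hy := by
    change D (x + y) = i (x + y) + j (x + y)
    change D x = i x + j x at hx
    change D y = i y + j y at hy
    rw [map_add, map_add, map_add, hx, hy]
    exact add_add_add_comm _ _ _ _
  smul_mem' c x hx := by
    change D (c • x) = i (c • x) + j (c • x)
    change D x = i x + j x at hx
    rw [map_smul, map_smul, map_smul, hx, smul_add]
  lie_mem' {x y} hx hy := by
    change D (x * y - y * x) = i (x * y - y * x) + j (x * y - y * x)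
    change D x = i x + j x at hx
    change D y = i y + j y at hy
    have h1 := (hc x y).eq
    have h2 := (hc y x).eq
    simp only [map_sub, map_mul, hx, hy, mul_add, add_mul]
    rw [h1, h2]
    abel

/-- The units `u` with `D u = i u * j u`, for commuting homomorphisms `i` and `j`. -/
def groupLikesOf (D i j : H →ₐ[k] K) (hc : ∀ x y, Commute (i x) (j y)) : Subgroup Hˣ where
  carrier := {u | D u = i u * j u}
  one_mem' := by
    change D 1 = i 1 * j 1
    rw [map_one, map_one, map_one, mul_one]
  mul_mem' {u v} hu hv := by
    change D u = i u * j u at hu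
    change D v = i v * j v at hv
    change D (u * v) = i (u * v) * j (u * v)
    rw [map_mul, map_mul, map_mul, hu, hv, mul_assoc, mul_assoc, ← mul_assoc (j (u : H)),
      ← (hc v u).eq, mul_assoc]
  inv_mem' {u} hu := by
    have h : Units.map (D : H →* K) u =
        Units.map (i : H →* K) u * Units.map (j : H →* K) u := Units.ext hu
    have h' := congrArg (fun w => ((w⁻¹ : Kˣ) : K)) h
    simp only [mul_inv_rev, ← map_inv, Units.val_mul] at h'
    exact h'.trans (hc _ _).eq.symm

end Abstract

section Hopf

variable (k) (A : Type*) [Ring A] [Algebra k A] [AugAlg k A]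

/-- The completion `Â` at the augmentation ideal. -/
abbrev Hat := compl (AugAlg.ε (k := k) (A := A))

/-- The augmentation of `A ⊗ A`. -/
abbrev ε₂ : A ⊗[k] A →ₐ[k] k :=
  (Algebra.TensorProduct.lmul' k).comp (Algebra.TensorProduct.map AugAlg.ε AugAlg.ε)

/-- The completion of `A ⊗ A`. -/
abbrev Hat₂ := compl (ε₂ k A)

theorem ε₂_left : (ε₂ k A).comp Algebra.TensorProduct.includeLeft = AugAlg.ε := by
  ext a; simp

theorem ε₂_right : (ε₂ k A).comp Algebra.TensorProduct.includeRight = AugAlg.ε := by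
  ext a; simp

/-- The comultiplication `Δ : Â → (A ⊗ A)^`. -/
def comul : Hat k A →ₐ[k] Hat₂ k A := compl.map AugAlg.Δ AugAlg.ε_Δ

/-- The map `x ↦ x ⊗ 1` from `Â` to `(A ⊗ A)^`. -/
def incl₁ : Hat k A →ₐ[k] Hat₂ k A :=
  compl.map Algebra.TensorProduct.includeLeft (ε₂_left k A)

/-- The map `x ↦ 1 ⊗ x` from `Â` to `(A ⊗ A)^`. -/
def incl₂ : Hat k A →ₐ[k] Hat₂ k A :=
  compl.map Algebra.TensorProduct.includeRight (ε₂_right k A)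

theorem incl_commute (x y : Hat k A) : Commute (incl₁ k A x) (incl₂ k A y) :=
  compl.commute_map _ _ _ _ (fun a b => by simp [Commute, SemiconjBy]) x y

attribute [local instance 100] LieRing.ofAssociativeRing

/-- The Lie algebra of primitive elements of `Â`: `Δ(x) = x ⊗ 1 + 1 ⊗ x`. -/
def primitives : LieSubalgebra k (Hat k A) :=
  primitivesOf (comul k A) (incl₁ k A) (incl₂ k A) (incl_commute k A)

/-- The group of group-like elements of `Â`: `Δ(x) = x ⊗ x`. -/
def groupLikes : Subgroup (Hat k A)ˣ :=
  groupLikesOf (comul k A) (incl₁ k A) (incl₂ k A) (incl_commute k A)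

variable {k A}

/-- `y = exp(x)` in `Â`; this is meant for `x` in the augmentation ideal of `Â`, so that the
`m`-th powers vanish modulo `I^m`. -/
def IsExp [Algebra ℚ k] (x y : Hat k A) : Prop :=
  ∀ m : ℕ, y.1 m = ∑ j ∈ Finset.range m, algebraMap ℚ k (j.factorial : ℚ)⁻¹ • (x.1 m) ^ j

/-- Homomorphisms of augmented algebras with comultiplication. -/
structure IsAugHom {A B : Type*} [Ring A] [Algebra k A] [AugAlg k A] [Ring B] [Algebra k B]
    [AugAlg k B] (f : A →ₐ[k] B) : Prop where
  ε : AugAlg.ε.comp f = AugAlg.ε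
  Δ : AugAlg.Δ.comp f = (Algebra.TensorProduct.map f f).comp AugAlg.Δ

/-- The homomorphism induced on group-like elements. -/
def groupLikes.map {A B : Type*} [Ring A] [Algebra k A] [AugAlg k A] [Ring B] [Algebra k B]
    [AugAlg k B] (f : A →ₐ[k] B) (hf : IsAugHom f) : groupLikes k A →* groupLikes k B :=
  ((Units.map (compl.map f hf.ε : Hat k A →* Hat k B)).comp (groupLikes k A).subtype).codRestrict
    (groupLikes k B) (by
      rintro ⟨u, hu⟩
      have h2 : (ε₂ k B).comp (Algebra.TensorProduct.map f f) = ε₂ k A := by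
        have := hf.ε
        ext a
        · simpa using DFunLike.congr_fun this a
        · simpa using DFunLike.congr_fun this a
      change comul k B (compl.map f hf.ε u) =
        incl₁ k B (compl.map f hf.ε u) * incl₂ k B (compl.map f hf.ε u)
      have e0 : comul k B (compl.map f hf.ε u) =
          compl.map (Algebra.TensorProduct.map f f) h2 (comul k A u) := by
        rw [comul, comul, compl.map_map f hf.ε AugAlg.Δ AugAlg.ε_Δ (AugAlg.Δ.comp f)
          (by rw [← AlgHom.comp_assoc, AugAlg.ε_Δ, hf.ε]) rfl,
          compl.map_map AugAlg.Δ AugAlg.ε_Δ (Algebra.TensorProduct.map f f) h2 (AugAlg.Δ.comp f)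
          (by rw [← AlgHom.comp_assoc, AugAlg.ε_Δ, hf.ε]) hf.Δ]
      have e1 : incl₁ k B (compl.map f hf.ε u) =
          compl.map (Algebra.TensorProduct.map f f) h2 (incl₁ k A u) := by
        rw [incl₁, incl₁, compl.map_map _ _ _ _ (Algebra.TensorProduct.includeLeft.comp f)
          (by rw [← AlgHom.comp_assoc, ε₂_left, hf.ε]) rfl,
          compl.map_map _ _ _ _ (Algebra.TensorProduct.includeLeft.comp f)
          (by rw [← AlgHom.comp_assoc, ε₂_left, hf.ε]) (by ext a; simp)]
      have e2 : incl₂ k B (compl.map f hf.ε u) =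
          compl.map (Algebra.TensorProduct.map f f) h2 (incl₂ k A u) := by
        rw [incl₂, incl₂, compl.map_map _ _ _ _ (Algebra.TensorProduct.includeRight.comp f)
          (by rw [← AlgHom.comp_assoc, ε₂_right, hf.ε]) rfl,
          compl.map_map _ _ _ _ (Algebra.TensorProduct.includeRight.comp f)
          (by rw [← AlgHom.comp_assoc, ε₂_right, hf.ε]) (by ext a; simp)]
      rw [e0, e1, e2, ← map_mul]
      exact congrArg _ hu)

end Hopf

end Completion

/-! ## The unipotent group attached to a Lie algebra -/

section Unipotent

attribute [local instance 100] LieRing.ofAssociativeRing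

variable {k : Type*} [CommRing k]
variable {L L' L'' : Type*} [LieRing L] [LieAlgebra k L] [LieRing L'] [LieAlgebra k L']
  [LieRing L''] [LieAlgebra k L'']

/-- The Lie algebra map `x ↦ x ⊗ 1 + 1 ⊗ x`. -/
def comulLie (k L : Type*) [CommRing k] [LieRing L] [LieAlgebra k L] :
    L →ₗ⁅k⁆ UniversalEnvelopingAlgebra k L ⊗[k] UniversalEnvelopingAlgebra k L :=
  { (Algebra.TensorProduct.includeLeft.toLinearMap +
      Algebra.TensorProduct.includeRight.toLinearMap) ∘ₗ
        (UniversalEnvelopingAlgebra.ι k : L →ₗ⁅k⁆ UniversalEnvelopingAlgebra k L).toLinearMap with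
    map_lie' := by
      intro x y
      simp [LieRing.of_associative_ring_bracket, mul_add, add_mul, TensorProduct.sub_tmul,
        TensorProduct.tmul_sub]
      abel }

theorem comulLie_apply (x : L) : comulLie k L x =
    UniversalEnvelopingAlgebra.ι k x ⊗ₜ 1 + 1 ⊗ₜ UniversalEnvelopingAlgebra.ι k x := rfl

/-- The universal enveloping algebra, with its augmentation and its comultiplication. -/
instance : AugAlg k (UniversalEnvelopingAlgebra k L) where
  ε := UniversalEnvelopingAlgebra.lift k (0 : L →ₗ⁅k⁆ k)
  Δ := UniversalEnvelopingAlgebra.lift k (comulLie k L)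
  ε_Δ := by
    ext x
    simp [comulLie_apply]

variable (k L) in
/-- The group `exp(L)` attached to a finite-dimensional nilpotent Lie algebra `L` over a field of
characteristic zero (the points of the unipotent algebraic group with Lie algebra `L`),
as the group of the group-like elements of the completed enveloping algebra. -/
def UniGp : Type _ := groupLikes k (UniversalEnvelopingAlgebra k L)

instance : Group (UniGp k L) :=
  inferInstanceAs (Group (groupLikes k (UniversalEnvelopingAlgebra k L)))

/-- The element of the completed enveloping algebra underlying an element of `exp(L)`. -/
def UniGp.val (u : UniGp k L) : Hat k (UniversalEnvelopingAlgebra k L) :=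
  ((Subtype.val u : (Hat k (UniversalEnvelopingAlgebra k L))ˣ) :
    Hat k (UniversalEnvelopingAlgebra k L))

/-- The homomorphism of enveloping algebras induced by a homomorphism of Lie algebras. -/
def ueMap (f : L →ₗ⁅k⁆ L') : UniversalEnvelopingAlgebra k L →ₐ[k] UniversalEnvelopingAlgebra k L' :=
  UniversalEnvelopingAlgebra.lift k ((UniversalEnvelopingAlgebra.ι k).comp f)

theorem ueMap_isAugHom (f : L →ₗ⁅k⁆ L') : IsAugHom (ueMap f) where
  ε := by
    ext x
    simp [AugAlg.ε, ueMap]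
  Δ := by
    ext x
    simp [AugAlg.Δ, ueMap, comulLie_apply]

/-- The homomorphism of groups `exp(f) : exp(L) → exp(L')`. -/
def UniGp.map (f : L →ₗ⁅k⁆ L') : UniGp k L →* UniGp k L' :=
  groupLikes.map (ueMap f) (ueMap_isAugHom f)

theorem UniGp.map_id (f : L →ₗ⁅k⁆ L) (hf : ∀ x, f x = x) (u : UniGp k L) :
    UniGp.map f u = u := by
  have h : ueMap f = AlgHom.id k _ := by
    ext x
    simp [ueMap, hf]
  refine Subtype.ext (Units.ext ?_)
  change compl.map (ueMap f) (ueMap_isAugHom f).ε u.1.1 = u.1.1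
  have := compl.map_id (ε := AugAlg.ε (k := k) (A := UniversalEnvelopingAlgebra k L)) rfl u.1.1
  simp only [h]
  exact this

theorem UniGp.map_map (f : L →ₗ⁅k⁆ L') (g : L' →ₗ⁅k⁆ L'') (e : L →ₗ⁅k⁆ L'')
    (h : ∀ x, e x = g (f x)) (u : UniGp k L) :
    UniGp.map g (UniGp.map f u) = UniGp.map e u := by
  refine Subtype.ext (Units.ext ?_)
  exact compl.map_map (ueMap f) (ueMap_isAugHom f).ε (ueMap g) (ueMap_isAugHom g).ε
    (ueMap e) (ueMap_isAugHom e).ε (by ext x; simp [ueMap, h]) _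

end Unipotent

/-- The regular functions defined over `ℚ` on the group `exp(L_ℂ)` attached to a Lie algebra `L`
over `ℚ`: the algebra generated by the linear functionals on `U(L_ℂ)/I^m` that take rational
values on the products of elements of `L` (these span `U(L)`). -/
instance (L : Type*) [LieRing L] [LieAlgebra ℚ L] : AlgGp (UniGp ℂ (ℂ ⊗[ℚ] L)) where
  coord := Algebra.adjoin ℚ {u | ∃ (m : ℕ) (l : (UniversalEnvelopingAlgebra ℂ (ℂ ⊗[ℚ] L) ⧸
        RingHom.ker (AugAlg.ε (k := ℂ) (A := UniversalEnvelopingAlgebra ℂ (ℂ ⊗[ℚ] L))) ^ m)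
          →ₗ[ℂ] ℂ),
    (∀ a ∈ Submonoid.closure (Set.range fun x : L =>
        UniversalEnvelopingAlgebra.ι ℂ ((1 : ℂ) ⊗ₜ[ℚ] x)),
      ∃ c : ℚ, l (Ideal.Quotient.mk _ a) = c) ∧
    u = fun g => l (g.val.1 m)}

theorem UniGp.coord_one_mem {L : Type*} [LieRing L] [LieAlgebra ℚ L]
    (u : UniGp ℂ (ℂ ⊗[ℚ] L) → ℂ) (hu : u ∈ AlgGp.coord (G := UniGp ℂ (ℂ ⊗[ℚ] L))) :
    ∃ c : ℚ, u 1 = c := by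
  induction hu using Algebra.adjoin_induction with
  | mem u hu =>
    obtain ⟨m, l, hl, rfl⟩ := hu
    exact hl 1 (Submonoid.one_mem _)
  | algebraMap r => exact ⟨r, rfl⟩
  | add x y _ _ hx hy =>
    obtain ⟨a, ha⟩ := hx
    obtain ⟨b, hb⟩ := hy
    exact ⟨a + b, by rw [Pi.add_apply, ha, hb, Rat.cast_add]⟩
  | mul x y _ _ hx hy =>
    obtain ⟨a, ha⟩ := hx
    obtain ⟨b, hb⟩ := hy
    exact ⟨a * b, by rw [Pi.mul_apply, ha, hb, Rat.cast_mul]⟩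

/-! ## The Malcev Lie algebra of a group -/

/-- The group algebra, with its augmentation and the comultiplication `γ ↦ γ ⊗ γ`. -/
instance (k : Type*) [CommRing k] (Γ : Type*) [Group Γ] : AugAlg k (MonoidAlgebra k Γ) where
  ε := MonoidAlgebra.lift k k Γ 1
  Δ := MonoidAlgebra.lift k (MonoidAlgebra k Γ ⊗[k] MonoidAlgebra k Γ) Γ
    { toFun := fun γ => MonoidAlgebra.of k Γ γ ⊗ₜ MonoidAlgebra.of k Γ γ
      map_one' := by rw [map_one (MonoidAlgebra.of k Γ), Algebra.TensorProduct.one_def]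
      map_mul' := fun x y => by
        rw [map_mul (MonoidAlgebra.of k Γ), Algebra.TensorProduct.tmul_mul_tmul] }
  ε_Δ := by
    refine MonoidAlgebra.algHom_ext (fun γ => ?_) (Subsingleton.elim _ _)
    simp

section Malcev

attribute [local instance 100] LieRing.ofAssociativeRing

/-- The Lie algebra `Lie(𝒢)` over `ℚ` attached to a group `Γ`: the primitive elements of the
completed group algebra `ℚ[Γ]^`. -/
def MalcevLie (Γ : Type*) [Group Γ] : Type _ := primitives ℚ (MonoidAlgebra ℚ Γ)

instance (Γ : Type*) [Group Γ] : LieRing (MalcevLie Γ) :=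
  inferInstanceAs (LieRing (primitives ℚ (MonoidAlgebra ℚ Γ)))

instance (Γ : Type*) [Group Γ] : LieAlgebra ℚ (MalcevLie Γ) :=
  inferInstanceAs (LieAlgebra ℚ (primitives ℚ (MonoidAlgebra ℚ Γ)))

/-- The inclusion of `Lie(𝒢)` in `ℚ[Γ]^`. -/
def MalcevLie.val {Γ : Type*} [Group Γ] (x : MalcevLie Γ) : Hat ℚ (MonoidAlgebra ℚ Γ) :=
  Subtype.val x

end Malcev

/-- The group `𝒢(ℂ)` of complex points of the unipotent group `𝒢` over `ℚ` with Lie algebra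
`Lie(𝒢)`. -/
abbrev MalcevGp (Γ : Type) [Group Γ] := UniGp ℂ (ℂ ⊗[ℚ] MalcevLie Γ)

/-- The image of `Γ` in `𝒢(ℚ) ⊆ 𝒢(ℂ)`, that is, the subgroup (generated by the set) of the
`exp(log γ)` for `γ ∈ Γ`, where `x = log γ ∈ Lie(𝒢)` is determined by `exp(x) = γ` in `ℚ[Γ]^`. -/
def latticeImage (Γ : Type) [Group Γ] : Subgroup (MalcevGp Γ) :=
  Subgroup.closure {g | ∃ (γ : Γ) (x : MalcevLie Γ),
    IsExp x.val (compl.of _ (MonoidAlgebra.of ℚ Γ γ)) ∧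
    IsExp (compl.of _ (UniversalEnvelopingAlgebra.ι ℂ ((1 : ℂ) ⊗ₜ[ℚ] x))) g.val}

/-- A mixed Hodge structure on a Lie algebra `L` over `ℚ`, of weights `≤ -1`, for which the bracket
`L ⊗ L → L` is a morphism of mixed Hodge structures. -/
structure LieMHS (L : Type) [LieRing L] [LieAlgebra ℚ L] where
  W : ℤ → Submodule ℚ L
  F : ℤ → Submodule ℂ (ℂ ⊗[ℚ] L)
  isMHS : IsMHS W F
  lie_W : ∀ a b : ℤ, ∀ x ∈ W a, ∀ y ∈ W b, ⁅x, y⁆ ∈ W (a + b)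
  lie_F : ∀ a b : ℤ, ∀ x ∈ F a, ∀ y ∈ F b, ⁅x, y⁆ ∈ F (a + b)
  weights : W (-1) = ⊤

namespace LieMHS

variable {L : Type} [LieRing L] [LieAlgebra ℚ L] (M : LieMHS L)

/-- The underlying mixed Hodge structure. -/
def fil : FilSp where
  V := L
  W := M.W
  F := M.F

/-- The Lie subalgebra `F^0` of `L_ℂ`. -/
def F0 : LieSubalgebra ℂ (ℂ ⊗[ℚ] L) where
  toSubmodule := M.F 0
  lie_mem' {x y} hx hy := by simpa using M.lie_F 0 0 x hx y hy

/-- The subgroup `F^0 𝒢(ℂ)` of `𝒢(ℂ)` corresponding to the Lie subalgebra `F^0`. -/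
def F0Gp : Subgroup (UniGp ℂ (ℂ ⊗[ℚ] L)) := (UniGp.map M.F0.incl).range

variable {M} {V₀ : FilSp}

/-- A direct summand `L` of `V₀` is an object of the Tannakian category generated by `V₀`. -/
theorem mem_tannakaGen (hS : M.fil.IsDirectSummand V₀) : TannakaGen V₀ M.fil := by
  obtain ⟨i, r, hi, -, h⟩ := hS
  exact TannakaGen.sub i TannakaGen.self M.isMHS hi
    (Function.LeftInverse.injective (g := r) fun x => LinearMap.congr_fun h x)

/-- `L` as an object of the Tannakian category generated by `V₀`. -/
def obj (hS : M.fil.IsDirectSummand V₀) : TannakaObj V₀ := ⟨M.fil, mem_tannakaGen hS⟩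

/-- The bracket `L ⊗ L → L`. -/
def bracket (M : LieMHS L) : (M.fil.tensor M.fil).V →ₗ[ℚ] M.fil.V :=
  (LieModule.toModuleHom ℚ L L : L ⊗[ℚ] L →ₗ[ℚ] L)

theorem bracket_aux (x y : ℂ ⊗[ℚ] L) :
    (LieModule.toModuleHom ℚ L L : L ⊗[ℚ] L →ₗ[ℚ] L).baseChange ℂ
      ((TensorProduct.AlgebraTensorModule.distribBaseChange ℚ ℂ L L).symm (x ⊗ₜ y)) = ⁅x, y⁆ := by
  induction x using TensorProduct.induction_on with
  | zero => rw [TensorProduct.zero_tmul, map_zero, map_zero, zero_lie]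
  | add x x' hx hx' => rw [TensorProduct.add_tmul, map_add, map_add, hx, hx', add_lie]
  | tmul a u =>
    induction y using TensorProduct.induction_on with
    | zero => rw [TensorProduct.tmul_zero, map_zero, map_zero, lie_zero]
    | add y y' hy hy' => rw [TensorProduct.tmul_add, map_add, map_add, hy, hy', lie_add]
    | tmul b v => simp

theorem bracket_tensorIso (x y : ℂ ⊗[ℚ] L) :
    M.bracket.baseChange ℂ (M.fil.tensorIso M.fil (x ⊗ₜ y)) = ⁅x, y⁆ :=
  bracket_aux x y

theorem bracket_isHom : (M.fil.tensor M.fil).IsHom M.fil M.bracket where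
  map_W n := by
    rw [Submodule.map_le_iff_le_comap]
    refine iSup_le fun i => Submodule.map₂_le.2 fun x hx y hy => ?_
    have h := M.lie_W i (n - i) x hx y hy
    rw [add_sub_cancel] at h
    exact h
  map_F p := by
    refine Submodule.map_le_iff_le_comap.2 (iSup_le fun i => ?_)
    refine Submodule.map_le_iff_le_comap.2 (Submodule.map₂_le.2 fun x hx y hy => ?_)
    have h := M.lie_F i (p - i) x hx y hy
    rw [add_sub_cancel] at h
    exact (congrArg (· ∈ M.F p) (bracket_tensorIso (M := M) x y)).mpr h

/-- The action of the Mumford–Tate group of `V₀` on `L_ℂ`. -/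
def actLie (hS : M.fil.IsDirectSummand V₀) (q : mumfordTate V₀) :
    (ℂ ⊗[ℚ] L) →ₗ⁅ℂ⁆ (ℂ ⊗[ℚ] L) :=
  { (q.1 (obj hS)).toLinearMap with
    map_lie' := by
      intro x y
      have h1 := q.2.1 ⟨M.fil.tensor M.fil, (mem_tannakaGen hS).tensor (mem_tannakaGen hS)⟩
        (obj hS) M.bracket bracket_isHom (M.fil.tensorIso M.fil (x ⊗ₜ y))
      have h2 := q.2.2.1 (obj hS) (obj hS) x y
      have h3 := congrArg (M.bracket.baseChange ℂ) h2
      refine Eq.trans ?_ (h1.trans (h3.trans (bracket_tensorIso _ _)))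
      exact congrArg (q.1 (obj hS)) (bracket_tensorIso x y).symm }

/-- The action of the Mumford–Tate group of `V₀` on `𝒢(ℂ)` induced by its action
on `L_ℂ`. -/
def actGp (hS : M.fil.IsDirectSummand V₀) : mumfordTate V₀ →* MulAut (UniGp ℂ (ℂ ⊗[ℚ] L)) where
  toFun q := MonoidHom.toMulEquiv (UniGp.map (actLie hS q)) (UniGp.map (actLie hS q⁻¹))
    (by
      ext1 u
      rw [MonoidHom.comp_apply, UniGp.map_map _ _ LieHom.id]
      · exact UniGp.map_id _ (fun _ => rfl) u
      · intro x
        exact ((q.1 (obj hS)).symm_apply_apply x).symm)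
    (by
      ext1 u
      rw [MonoidHom.comp_apply, UniGp.map_map _ _ LieHom.id]
      · exact UniGp.map_id _ (fun _ => rfl) u
      · intro x
        exact ((q.1 (obj hS)).apply_symm_apply x).symm)
  map_one' := by
    ext1 u
    exact UniGp.map_id _ (fun _ => rfl) u
  map_mul' q q' := by
    ext1 u
    exact (UniGp.map_map _ _ _ (fun _ => rfl) u).symm

/-- The complex points of the semidirect product `G` of the Mumford–Tate group `Q` of `V₀` and
of `𝒢`. -/
abbrev SemiGp (hS : M.fil.IsDirectSummand V₀) :=
  UniGp ℂ (ℂ ⊗[ℚ] L) ⋊[actGp hS] mumfordTate V₀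

/-- The regular functions on `G`: as a variety, `G = 𝒢 × Q`. -/
instance (hS : M.fil.IsDirectSummand V₀) : AlgGp (SemiGp hS) where
  coord := Algebra.adjoin ℚ
    ({u | ∃ v ∈ AlgGp.coord (G := UniGp ℂ (ℂ ⊗[ℚ] L)), u = fun g => v g.left} ∪
      {u | ∃ v ∈ AlgGp.coord (G := mumfordTate V₀), u = fun g => v g.right})

/-- The projection `G → Q` is a homomorphism of algebraic groups over `ℚ`. -/
theorem regular_rightHom (hS : M.fil.IsDirectSummand V₀) :
    ∀ u ∈ AlgGp.coord (G := mumfordTate V₀),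
      u ∘ (SemidirectProduct.rightHom : SemiGp hS →* mumfordTate V₀) ∈
        AlgGp.coord (G := SemiGp hS) :=
  fun u hu => Algebra.subset_adjoin (Or.inr ⟨u, hu, rfl⟩)

/-- The inclusion `Q → G` is a homomorphism of algebraic groups over `ℚ`. -/
theorem regular_inr (hS : M.fil.IsDirectSummand V₀) :
    ∀ u ∈ AlgGp.coord (G := SemiGp hS),
      u ∘ (SemidirectProduct.inr : mumfordTate V₀ →* SemiGp hS) ∈
        AlgGp.coord (G := mumfordTate V₀) := by
  intro u hu
  induction hu using Algebra.adjoin_induction with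
  | mem u hu =>
    rcases hu with ⟨v, hv, rfl⟩ | ⟨v, hv, rfl⟩
    · obtain ⟨c, hc⟩ := UniGp.coord_one_mem v hv
      have h : (fun g : SemiGp hS => v g.left) ∘ SemidirectProduct.inr =
          algebraMap ℚ (mumfordTate V₀ → ℂ) c := by
        funext q
        exact hc
      rw [h]
      exact Subalgebra.algebraMap_mem _ _
    · exact hv
  | algebraMap r => exact Subalgebra.algebraMap_mem _ _
  | add x y _ _ hx hy => exact Subalgebra.add_mem _ hx hy
  | mul x y _ _ hx hy => exact Subalgebra.mul_mem _ hx hy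

variable (hS : M.fil.IsDirectSummand V₀)

/-- The homomorphism `h₀ : S → (Q/Q_u)_ℝ = (G/G_u)_ℝ`, given by cosets in `G(ℂ)`. -/
def hodgeHomG (z w : ℂˣ) : Set (SemiGp hS) :=
  SemidirectProduct.rightHom ⁻¹' hodgeHom V₀ z w

/-- The map from `D_G` to `D_Q` induced by `G → Q`. -/
def toQ (x : FilFam (SemiGp hS)) : FilFam (mumfordTate V₀) :=
  FilFam.push SemidirectProduct.rightHom (regular_rightHom hS) x

/-- The point `b_G`: the composite of the restriction functor `Rep(G) → Rep(Q)` and `b_Q`. -/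
def basePointG : FilFam (SemiGp hS) :=
  FilFam.push SemidirectProduct.inr (regular_inr hS) (basePointQ V₀)

/-- The fibre `𝒟` of `D_G → D_Q` over `b_Q`. -/
def fiber : Set (FilFam (SemiGp hS)) :=
  {x | x ∈ periodDomain (hodgeHomG hS) ∧ toQ hS x = basePointQ V₀}

/-- The orbit map `𝒢(ℂ) → D_G`, `g ↦ g b_G`. -/
def orbitMap (g : UniGp ℂ (ℂ ⊗[ℚ] L)) : FilFam (SemiGp hS) :=
  FilFam.act (SemidirectProduct.inl g) (basePointG hS)

/-- The complex manifold `𝒟`. -/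
def fiberHol : HolStr (fiber hS) := (FilFam.hol (SemiGp hS)).sub (fiber hS)

/-- The equivalence relation on `𝒟` whose classes are the orbits of a subgroup of `𝒢(ℂ)`. -/
def orbitRel (N : Subgroup (UniGp ℂ (ℂ ⊗[ℚ] L))) : Setoid (fiber hS) where
  r x y := ∃ n ∈ N, y.1 = FilFam.act (SemidirectProduct.inl n : SemiGp hS) x.1
  iseqv := by
    refine ⟨fun x => ⟨1, N.one_mem, ?_⟩, ?_, ?_⟩
    · rw [map_one, FilFam.act_one]
    · rintro x y ⟨n, hn, h⟩
      refine ⟨n⁻¹, N.inv_mem hn, ?_⟩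
      rw [h, ← FilFam.act_mul, ← map_mul, inv_mul_cancel, map_one, FilFam.act_one]
    · rintro x y z ⟨n, hn, h⟩ ⟨n', hn', h'⟩
      refine ⟨n' * n, N.mul_mem hn' hn, ?_⟩
      rw [h', h, ← FilFam.act_mul, ← map_mul]

end LieMHS

/-- The space `𝒢(ℂ) / F^0 𝒢(ℂ)` as a complex manifold. -/
def flagHol {L : Type} [LieRing L] [LieAlgebra ℚ L] (M : LieMHS L) :
    HolStr (UniGp ℂ (ℂ ⊗[ℚ] L) ⧸ M.F0Gp) :=
  (AlgGp.hol (UniGp ℂ (ℂ ⊗[ℚ] L))).quot (fun g => (QuotientGroup.mk g))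

/-- The higher Albanese manifold `A_Γ = Γ \ 𝒢(ℂ) / F^0 𝒢(ℂ)`. -/
abbrev Albanese (Γ : Type) [Group Γ] (M : LieMHS (MalcevLie Γ)) :=
  DoubleCoset.Quotient (latticeImage Γ : Set (MalcevGp Γ)) (M.F0Gp : Set (MalcevGp Γ))

/-- The class in `A_Γ` of an element of `𝒢(ℂ)`. -/
def Albanese.mk {Γ : Type} [Group Γ] (M : LieMHS (MalcevLie Γ)) (g : MalcevGp Γ) :
    Albanese Γ M :=
  DoubleCoset.mk (latticeImage Γ) M.F0Gp g

/-- The complex manifold `A_Γ`. -/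
def Albanese.hol {Γ : Type} [Group Γ] (M : LieMHS (MalcevLie Γ)) : HolStr (Albanese Γ M) :=
  (AlgGp.hol (MalcevGp Γ)).quot (Albanese.mk M)

/-- The quotient `Γ \ 𝒟`. -/
abbrev FiberQuot {Γ : Type} [Group Γ] {M : LieMHS (MalcevLie Γ)} {V₀ : FilSp}
    (hS : M.fil.IsDirectSummand V₀) :=
  Quotient (LieMHS.orbitRel hS (latticeImage Γ))

/-- The class in `Γ \ 𝒟` of a point of `𝒟`. -/
def FiberQuot.mk {Γ : Type} [Group Γ] {M : LieMHS (MalcevLie Γ)} {V₀ : FilSp}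
    (hS : M.fil.IsDirectSummand V₀) (x : LieMHS.fiber hS) : FiberQuot hS :=
  Quotient.mk (LieMHS.orbitRel hS (latticeImage Γ)) x

/-- The complex manifold `Γ \ 𝒟`. -/
def FiberQuot.hol {Γ : Type} [Group Γ] {M : LieMHS (MalcevLie Γ)} {V₀ : FilSp}
    (hS : M.fil.IsDirectSummand V₀) : HolStr (FiberQuot hS) :=
  (LieMHS.fiberHol hS).quot (FiberQuot.mk hS)

end HigherAlbanese

end

open HigherAlbanese

open scoped TensorProduct Topology

noncomputable section

namespace HigherAlbanese

/-! ## Rational subspaces of a complexification -/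

section Rational

variable {V V' : Type*} [AddCommGroup V] [Module ℚ V] [AddCommGroup V'] [Module ℚ V']

/-- The contraction `ℂ ⊗ V → V` with a `ℚ`-linear functional on `ℂ`. -/
def contr (V : Type*) [AddCommGroup V] [Module ℚ V] (χ : Module.Dual ℚ ℂ) :
    (ℂ ⊗[ℚ] V) →ₗ[ℚ] V :=
  (TensorProduct.lid ℚ V).toLinearMap ∘ₗ χ.rTensor V

@[simp] theorem contr_tmul (χ : Module.Dual ℚ ℂ) (a : ℂ) (v : V) :
    contr V χ (a ⊗ₜ v) = χ a • v := by simp [contr]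

theorem contr_baseChange (χ : Module.Dual ℚ ℂ) (f : V →ₗ[ℚ] V') (x : ℂ ⊗[ℚ] V) :
    contr V' χ (f.baseChange ℂ x) = f (contr V χ x) := by
  induction x using TensorProduct.induction_on with
  | zero => simp
  | tmul a v => simp
  | add x y hx hy => rw [map_add, map_add, hx, hy, map_add, map_add]

theorem exists_contr_sum (x : ℂ ⊗[ℚ] V) :
    ∃ (s : Finset (Module.Free.ChooseBasisIndex ℚ ℂ)),
      x = ∑ i ∈ s, Module.Free.chooseBasis ℚ ℂ i ⊗ₜ[ℚ]
        contr V ((Module.Free.chooseBasis ℚ ℂ).coord i) x := by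
  classical
  set b := Module.Free.chooseBasis ℚ ℂ with hb
  have key : ∀ x : ℂ ⊗[ℚ] V, ∃ s : Finset (Module.Free.ChooseBasisIndex ℚ ℂ), ∀ t, s ⊆ t →
      x = ∑ i ∈ t, b i ⊗ₜ[ℚ] contr V (b.coord i) x := by
    intro x
    induction x using TensorProduct.induction_on with
    | zero => exact ⟨∅, fun t _ => by simp⟩
    | tmul a v =>
      refine ⟨(b.repr a).support, fun t ht => ?_⟩
      have h1 : a = ∑ i ∈ t, b.repr a i • b i := by
        conv_lhs => rw [← b.linearCombination_repr a, Finsupp.linearCombination_apply]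
        exact Finsupp.sum_of_support_subset _ ht _ (by simp)
      conv_lhs => rw [h1, TensorProduct.sum_tmul]
      refine Finset.sum_congr rfl fun i _ => ?_
      rw [contr_tmul, TensorProduct.smul_tmul, Module.Basis.coord_apply]
    | add x y hx hy =>
      obtain ⟨s, hs⟩ := hx
      obtain ⟨t, ht⟩ := hy
      refine ⟨s ∪ t, fun u hu => ?_⟩
      conv_lhs => rw [hs u (Finset.union_subset_left hu), ht u (Finset.union_subset_right hu)]
      simp only [map_add, TensorProduct.tmul_add, Finset.sum_add_distrib]
  obtain ⟨s, hs⟩ := key x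
  exact ⟨s, hs s subset_rfl⟩

theorem mem_baseChange_iff (W : Submodule ℚ V) (x : ℂ ⊗[ℚ] V) :
    x ∈ W.baseChange ℂ ↔ ∀ χ : Module.Dual ℚ ℂ, contr V χ x ∈ W := by
  constructor
  · intro h χ
    rw [Submodule.baseChange_eq_span] at h
    have : ∀ c : ℂ, ∀ y ∈ Submodule.span ℂ ((W.map (TensorProduct.mk ℚ ℂ V 1) :
        Submodule ℚ (ℂ ⊗[ℚ] V)) : Set (ℂ ⊗[ℚ] V)), contr V χ (c • y) ∈ W := by
      intro c y hy
      induction hy using Submodule.span_induction generalizing c with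
      | mem y hy =>
        obtain ⟨v, hv, rfl⟩ := hy
        simpa [TensorProduct.smul_tmul'] using W.smul_mem _ hv
      | zero => simp
      | add y z _ _ hy hz => rw [smul_add, map_add]; exact W.add_mem (hy c) (hz c)
      | smul d y _ hy => rw [smul_smul]; exact hy _
    simpa using this 1 x h
  · intro h
    obtain ⟨s, hs⟩ := exists_contr_sum x
    rw [hs]
    exact Submodule.sum_mem _ fun i _ => Submodule.tmul_mem_baseChange_of_mem _ (h _)

theorem one_tmul_mem_baseChange_iff (W : Submodule ℚ V) (v : V) :
    (1 : ℂ) ⊗ₜ[ℚ] v ∈ W.baseChange ℂ ↔ v ∈ W := by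
  refine ⟨fun h => ?_, fun h => Submodule.tmul_mem_baseChange_of_mem _ h⟩
  obtain ⟨g, hg⟩ := Module.Projective.exists_dual_ne_zero ℚ (one_ne_zero : (1 : ℂ) ≠ 0)
  have hχ : ((g 1)⁻¹ • g) 1 = 1 := by simp [inv_mul_cancel₀ hg]
  generalize (g 1)⁻¹ • g = χ at hχ
  have := (mem_baseChange_iff W _).1 h χ
  simpa [hχ] using this

theorem baseChange_le_iff {W W' : Submodule ℚ V} :
    W.baseChange ℂ ≤ W'.baseChange ℂ ↔ W ≤ W' :=
  ⟨fun h v hv => (one_tmul_mem_baseChange_iff W' v).1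
    (h ((one_tmul_mem_baseChange_iff W v).2 hv)), fun h => Submodule.baseChange_mono ℂ h⟩

theorem baseChange_inj {W W' : Submodule ℚ V} (h : W.baseChange ℂ = W'.baseChange ℂ) :
    W = W' := le_antisymm (baseChange_le_iff.1 h.le) (baseChange_le_iff.1 h.ge)

theorem baseChange_inf (W W' : Submodule ℚ V) :
    (W ⊓ W').baseChange ℂ = W.baseChange ℂ ⊓ W'.baseChange ℂ := by
  ext x
  simp only [Submodule.mem_inf, mem_baseChange_iff, forall_and]

theorem baseChange_comap (f : V →ₗ[ℚ] V') (W : Submodule ℚ V') :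
    (W.comap f).baseChange ℂ = (W.baseChange ℂ).comap (f.baseChange ℂ) := by
  ext x
  simp only [Submodule.mem_comap, mem_baseChange_iff, contr_baseChange]

theorem baseChange_map (f : V →ₗ[ℚ] V') (W : Submodule ℚ V) :
    (W.map f).baseChange ℂ = (W.baseChange ℂ).map (f.baseChange ℂ) := by
  rw [Submodule.baseChange_eq_span, Submodule.baseChange_eq_span, Submodule.map_span]
  congr 1
  ext x
  constructor
  · rintro ⟨_, ⟨v, hv, rfl⟩, rfl⟩
    exact ⟨1 ⊗ₜ v, ⟨v, hv, rfl⟩, by simp⟩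
  · rintro ⟨_, ⟨v, hv, rfl⟩, rfl⟩
    exact ⟨f v, ⟨v, hv, rfl⟩, by simp⟩

theorem baseChange_iSup {ι : Sort*} (W : ι → Submodule ℚ V) :
    (⨆ i, W i).baseChange ℂ = ⨆ i, (W i).baseChange ℂ := by
  refine le_antisymm ?_ (iSup_le fun i => Submodule.baseChange_mono ℂ (le_iSup W i))
  rw [Submodule.baseChange_eq_span, Submodule.span_le]
  rintro _ ⟨v, hv, rfl⟩
  have : (⨆ i, W i) ≤ ((⨆ i, (W i).baseChange ℂ).restrictScalars ℚ).comap
      (TensorProduct.mk ℚ ℂ V 1) := iSup_le fun i v hv =>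
    (le_iSup (fun i => (W i).baseChange ℂ) i) (Submodule.tmul_mem_baseChange_of_mem _ hv)
  exact this hv

theorem baseChange_injective {f : V →ₗ[ℚ] V'} (hf : Function.Injective f) :
    Function.Injective (f.baseChange ℂ) := by
  rw [LinearMap.baseChange_eq_ltensor]
  exact Module.Flat.lTensor_preserves_injective_linearMap f hf

theorem baseChange_surjective {f : V →ₗ[ℚ] V'} (hf : Function.Surjective f) :
    Function.Surjective (f.baseChange ℂ) := by
  rw [LinearMap.baseChange_eq_ltensor]
  exact LinearMap.lTensor_surjective ℂ hf

theorem one_tmul_injective : Function.Injective fun v : V => (1 : ℂ) ⊗ₜ[ℚ] v := by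
  intro v w h
  have h' : (1 : ℂ) ⊗ₜ[ℚ] (v - w) ∈ (⊥ : Submodule ℚ V).baseChange ℂ := by
    rw [Submodule.baseChange_bot, Submodule.mem_bot, TensorProduct.tmul_sub]
    exact sub_eq_zero.2 h
  exact sub_eq_zero.1 ((one_tmul_mem_baseChange_iff _ _).1 h')

theorem dual_baseChange_eq (l : Module.Dual ℚ V) (x : ℂ ⊗[ℚ] V) :
    Module.Dual.baseChange ℂ l x = TensorProduct.rid ℚ ℂ (LinearMap.baseChange ℂ l x) := by
  induction x using TensorProduct.induction_on with
  | zero => simp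
  | tmul a v =>
    rw [LinearMap.baseChange_tmul]
    simp [Module.Dual.baseChange_apply_tmul, Algebra.smul_def, mul_comm]
  | add x y hx hy => rw [map_add, map_add, map_add, hx, hy]

theorem dual_baseChange_tmul (l : Module.Dual ℚ V) (a : ℂ) (v : V) :
    Module.Dual.baseChange ℂ l (a ⊗ₜ v) = a * (l v : ℂ) := by
  simp [Module.Dual.baseChange_apply_tmul, Algebra.smul_def, mul_comm]

end Rational

/-! ## Automorphisms of `ℂ` and Galois descent -/

section Aut

theorem exists_ringEquiv_of_mvPolynomial {R ι : Type} [Field R] [Algebra R ℂ] {v : ι → ℂ}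
    (hv : IsTranscendenceBasis R v) (τ : MvPolynomial ι R ≃+* MvPolynomial ι R) :
    ∃ σ : ℂ ≃+* ℂ, ∀ p, σ (MvPolynomial.aeval v p) = MvPolynomial.aeval v (τ p) := by
  have := IsAlgClosed.isAlgClosure_of_transcendence_basis v hv
  let e := hv.1.aevalEquiv.toRingEquiv
  let τ' := (e.symm.trans τ).trans e
  refine ⟨IsAlgClosure.equivOfEquiv ℂ ℂ τ', fun p => ?_⟩
  have h := IsAlgClosure.equivOfEquiv_algebraMap ℂ ℂ τ' (e p)
  have h1 : τ' (e p) = e (τ p) := by simp [τ']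
  rw [h1] at h
  have h2 : ∀ q, algebraMap _ ℂ (e q) = MvPolynomial.aeval v q :=
    fun q => hv.1.algebraMap_aevalEquiv q
  rwa [h2, h2] at h

/-- The field of invariants of the automorphisms of `ℂ` is `ℚ`. -/
theorem exists_ringEquiv_ne {c : ℂ} (hc : ∀ r : ℚ, (r : ℂ) ≠ c) : ∃ σ : ℂ ≃+* ℂ, σ c ≠ c := by
  classical
  by_cases ha : IsAlgebraic ℚ c
  · let K := algebraicClosure ℚ ℂ
    have hK : IsAlgClosure ℚ K := algebraicClosure.isAlgClosure ℚ ℂ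
    have : Normal ℚ K := IsAlgClosure.normal ℚ K
    have : IsGalois ℚ K := ⟨⟩
    let c' : K := ⟨c, mem_algebraicClosure_iff.2 ha⟩
    have hb : c' ∉ (⊥ : IntermediateField ℚ K) := by
      rw [IntermediateField.mem_bot]
      rintro ⟨r, hr⟩
      exact hc r (congrArg Subtype.val hr)
    rw [InfiniteGalois.mem_bot_iff_fixed] at hb
    push Not at hb
    obtain ⟨f, hf⟩ := hb
    obtain ⟨ι, v, hv⟩ := exists_isTranscendenceBasis' K ℂ
    obtain ⟨σ, hσ⟩ := exists_ringEquiv_of_mvPolynomial hv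
      (MvPolynomial.mapEquiv ι (f : K ≃+* K))
    refine ⟨σ, fun h => hf ?_⟩
    have := hσ (MvPolynomial.C c')
    rw [MvPolynomial.mapEquiv_apply, MvPolynomial.map_C, MvPolynomial.algHom_C,
      MvPolynomial.algHom_C] at this
    exact Subtype.ext (this.symm.trans h)
  · have h1 : AlgebraicIndepOn ℚ id ({c} : Set ℂ) :=
      algebraicIndependent_unique_type_iff.2 ha
    obtain ⟨t, ht, hv⟩ := exists_isTranscendenceBasis_superset h1
    let i : t := ⟨c, ht rfl⟩
    let τ1 : MvPolynomial t ℚ →ₐ[ℚ] MvPolynomial t ℚ :=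
      MvPolynomial.aeval fun j => MvPolynomial.X j + if j = i then 1 else 0
    let τ2 : MvPolynomial t ℚ →ₐ[ℚ] MvPolynomial t ℚ :=
      MvPolynomial.aeval fun j => MvPolynomial.X j - if j = i then 1 else 0
    have h12 : τ1.comp τ2 = AlgHom.id ℚ _ := by
      ext1 j
      by_cases h : j = i <;> simp [τ1, τ2, h]
    have h21 : τ2.comp τ1 = AlgHom.id ℚ _ := by
      ext1 j
      by_cases h : j = i <;> simp [τ1, τ2, h]
    obtain ⟨σ, hσ⟩ := exists_ringEquiv_of_mvPolynomial hv
      (AlgEquiv.ofAlgHom τ1 τ2 h12 h21).toRingEquiv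
    refine ⟨σ, fun h => ?_⟩
    have := hσ (MvPolynomial.X i)
    have h3 : (AlgEquiv.ofAlgHom τ1 τ2 h12 h21).toRingEquiv (MvPolynomial.X i) =
        MvPolynomial.X i + 1 := by
      change τ1 (MvPolynomial.X i) = _
      simp [τ1]
    rw [h3] at this
    simp [i, h] at this

end Aut

section Twist

variable {V V' : Type*} [AddCommGroup V] [Module ℚ V] [AddCommGroup V'] [Module ℚ V']

/-- The semilinear map `σ ⊗ 1` of `ℂ ⊗ V`. -/
def twist (σ : ℂ →+* ℂ) (V : Type*) [AddCommGroup V] [Module ℚ V] :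
    (ℂ ⊗[ℚ] V) →ₛₗ[σ] (ℂ ⊗[ℚ] V) where
  toFun := LinearMap.rTensor V (σ.toRatAlgHom.toLinearMap : ℂ →ₗ[ℚ] ℂ)
  map_add' := map_add _
  map_smul' z x := by
    induction x using TensorProduct.induction_on with
    | zero => simp
    | tmul a v => simp [TensorProduct.smul_tmul']
    | add x y hx hy => rw [smul_add, map_add, map_add, smul_add, hx, hy]

@[simp] theorem twist_tmul (σ : ℂ →+* ℂ) (a : ℂ) (v : V) :
    twist σ V (a ⊗ₜ v) = σ a ⊗ₜ v := rfl

@[simp] theorem conjC_tmul (a : ℂ) (v : V) :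
    conjC V (a ⊗ₜ v) = starRingEnd ℂ a ⊗ₜ v := rfl

@[simp] theorem conjC_conjC (x : ℂ ⊗[ℚ] V) : conjC V (conjC V x) = x := by
  induction x using TensorProduct.induction_on with
  | zero => simp
  | tmul a v => simp
  | add x y hx hy => rw [map_add, map_add, hx, hy]

theorem twist_baseChange (σ : ℂ →+* ℂ) (f : V →ₗ[ℚ] V') (x : ℂ ⊗[ℚ] V) :
    twist σ V' (f.baseChange ℂ x) = f.baseChange ℂ (twist σ V x) := by
  induction x using TensorProduct.induction_on with
  | zero => simp
  | tmul a v => simp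
  | add x y hx hy => rw [map_add, map_add, map_add, map_add, hx, hy]

theorem conjC_baseChange (f : V →ₗ[ℚ] V') (x : ℂ ⊗[ℚ] V) :
    conjC V' (f.baseChange ℂ x) = f.baseChange ℂ (conjC V x) := twist_baseChange _ f x

theorem twist_dual (σ : ℂ →+* ℂ) (l : Module.Dual ℚ V) (x : ℂ ⊗[ℚ] V) :
    Module.Dual.baseChange ℂ l (twist σ V x) = σ (Module.Dual.baseChange ℂ l x) := by
  induction x using TensorProduct.induction_on with
  | zero => simp
  | tmul a v => simp only [twist_tmul, dual_baseChange_tmul, map_mul, map_ratCast]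
  | add x y hx hy => rw [map_add, map_add, map_add, map_add, hx, hy]

theorem twist_mem_baseChange (σ : ℂ →+* ℂ) (W : Submodule ℚ V) {x : ℂ ⊗[ℚ] V}
    (hx : x ∈ W.baseChange ℂ) : twist σ V x ∈ W.baseChange ℂ := by
  rw [Submodule.baseChange_eq_span] at hx
  induction hx using Submodule.span_induction with
  | mem x hx =>
    obtain ⟨v, hv, rfl⟩ := hx
    exact Submodule.tmul_mem_baseChange_of_mem _ hv
  | zero => simp
  | add x y _ _ hx hy => rw [map_add]; exact add_mem hx hy
  | smul c x _ hx => rw [map_smulₛₗ]; exact Submodule.smul_mem _ _ hx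

theorem conjC_mem_baseChange (W : Submodule ℚ V) {x : ℂ ⊗[ℚ] V} :
    conjC V x ∈ W.baseChange ℂ ↔ x ∈ W.baseChange ℂ := by
  refine ⟨fun h => ?_, fun h => twist_mem_baseChange _ W h⟩
  rw [← conjC_conjC x]
  exact twist_mem_baseChange _ W h

theorem mem_map_conjC (Z : Submodule ℂ (ℂ ⊗[ℚ] V)) (x : ℂ ⊗[ℚ] V) :
    x ∈ Z.map (conjC V) ↔ conjC V x ∈ Z := by
  constructor
  · rintro ⟨y, hy, rfl⟩
    rwa [conjC_conjC]
  · intro h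
    exact ⟨conjC V x, h, conjC_conjC x⟩

/-- Galois descent: a subspace of `ℂ ⊗ V` that is stable under the automorphisms of `ℂ` is defined
over `ℚ`. -/
theorem exists_baseChange_of_twist (Z : Submodule ℂ (ℂ ⊗[ℚ] V))
    (hZ : ∀ σ : ℂ ≃+* ℂ, ∀ x ∈ Z, twist (σ : ℂ →+* ℂ) V x ∈ Z) :
    ((Z.restrictScalars ℚ).comap (TensorProduct.mk ℚ ℂ V 1)).baseChange ℂ = Z := by
  classical
  set W := (Z.restrictScalars ℚ).comap (TensorProduct.mk ℚ ℂ V 1) with hW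
  have hWZ : W.baseChange ℂ ≤ Z := by
    rw [Submodule.baseChange_eq_span, Submodule.span_le]
    rintro _ ⟨v, hv, rfl⟩
    exact hv
  refine le_antisymm hWZ fun x hx => ?_
  let b := Module.Free.chooseBasis ℚ V
  let B := b.baseChange ℂ
  have hB : ∀ (σ : ℂ →+* ℂ) (y : ℂ ⊗[ℚ] V) i, B.repr (twist σ V y) i = σ (B.repr y i) := by
    intro σ y i
    induction y using TensorProduct.induction_on with
    | zero => simp
    | tmul a v => simp [B, Module.Basis.baseChange_repr_tmul, Algebra.smul_def]
    | add x y hx hy => simp only [map_add, Finsupp.add_apply, hx, hy]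
  induction hn : (B.repr x).support.card using Nat.strong_induction_on generalizing x with
  | _ n ih =>
    by_cases hx0 : x = 0
    · rw [hx0]; exact zero_mem _
    have hsupp : (B.repr x).support.Nonempty := by
      rw [Finsupp.support_nonempty_iff]
      simpa using hx0
    obtain ⟨i, hi⟩ := hsupp
    have hi0 : B.repr x i ≠ 0 := Finsupp.mem_support_iff.1 hi
    wlog h1 : B.repr x i = 1 generalizing x
    · have := this ((B.repr x i)⁻¹ • x) (Z.smul_mem _ hx) (by
        rw [map_smul, Finsupp.support_smul_eq (inv_ne_zero hi0)]; exact hn)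
        (smul_ne_zero (inv_ne_zero hi0) hx0) (by
        rw [map_smul, Finsupp.support_smul_eq (inv_ne_zero hi0)]; exact hi)
        (by simp [hi0]) (by simp [hi0])
      have h2 := Submodule.smul_mem _ (B.repr x i) this
      rwa [smul_smul, mul_inv_cancel₀ hi0, one_smul] at h2
    by_cases hr : ∀ j, ∃ r : ℚ, (r : ℂ) = B.repr x j
    · choose r hr using hr
      have hxr : x = (1 : ℂ) ⊗ₜ[ℚ] (∑ j ∈ (B.repr x).support, r j • b j) := by
        conv_lhs => rw [← B.linearCombination_repr x, Finsupp.linearCombination_apply, Finsupp.sum]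
        rw [TensorProduct.tmul_sum]
        refine Finset.sum_congr rfl fun j _ => ?_
        rw [← hr, Module.Basis.baseChange_apply, TensorProduct.smul_tmul', TensorProduct.tmul_smul,
          TensorProduct.smul_tmul']
        simp [Algebra.smul_def]
      rw [hxr]
      refine Submodule.tmul_mem_baseChange_of_mem _ ?_
      rw [hW, Submodule.mem_comap, TensorProduct.mk_apply, ← hxr]
      exact hx
    · push Not at hr
      obtain ⟨j, hj⟩ := hr
      obtain ⟨σ, hσ⟩ := exists_ringEquiv_ne hj
      have key : ∀ z ∈ Z, (B.repr z).support ⊂ (B.repr x).support → z ∈ W.baseChange ℂ :=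
        fun z hz hs => ih _ (hn ▸ Finset.card_lt_card hs) z hz rfl
      have hs : (B.repr (twist (σ : ℂ →+* ℂ) V x)).support ⊆ (B.repr x).support := by
        intro k hk
        rw [Finsupp.mem_support_iff, hB] at hk
        rw [Finsupp.mem_support_iff]
        exact fun h => hk (by rw [h, map_zero])
      set y := twist (σ : ℂ →+* ℂ) V x - x with hy
      have hyZ : y ∈ Z := Z.sub_mem (hZ σ x hx) hx
      have hys : (B.repr y).support ⊆ (B.repr x).support := by
        rw [hy, map_sub]
        exact (Finsupp.support_sub).trans (Finset.union_subset hs subset_rfl)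
      have hyW : y ∈ W.baseChange ℂ := by
        refine key y hyZ (Finset.ssubset_iff_subset_ne.2 ⟨hys, fun h => ?_⟩)
        rw [← h, Finsupp.mem_support_iff, hy, map_sub, Finsupp.sub_apply, hB, h1] at hi
        simp at hi
      have hyj : B.repr y j ≠ 0 := by
        rw [hy, map_sub, Finsupp.sub_apply, hB]
        exact sub_ne_zero.2 hσ
      have hxj : B.repr x j ≠ 0 := fun h => hσ (by rw [h, map_zero])
      have hz : x - (B.repr x j / B.repr y j) • y ∈ W.baseChange ℂ := by
        refine key _ (Z.sub_mem hx (Z.smul_mem _ hyZ)) (Finset.ssubset_iff_subset_ne.2 ⟨?_, ?_⟩)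
        · rw [map_sub, map_smul]
          exact (Finsupp.support_sub).trans
            (Finset.union_subset subset_rfl (Finsupp.support_smul.trans hys))
        · intro h
          have hj' := Finsupp.mem_support_iff.2 hxj
          rw [← h, Finsupp.mem_support_iff, map_sub, map_smul, Finsupp.sub_apply,
            Finsupp.smul_apply, smul_eq_mul, div_mul_cancel₀ _ hyj, sub_self] at hj'
          exact hj' rfl
      have := Submodule.add_mem _ hz (Submodule.smul_mem _ (B.repr x j / B.repr y j) hyW)
      rwa [sub_add_cancel] at this

end Twist

/-! ## Internal gradings -/

section Grading

variable {ι : Type*} {M N : Type*} [AddCommGroup M] [Module ℂ M]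
  [AddCommGroup N] [Module ℂ N] {I : ι → Submodule ℂ M} {J : ι → Submodule ℂ N}

/-- Induction over sums of homogeneous elements. -/
theorem grading_induction (h : ⨆ s, I s = ⊤) {p : M → Prop} (x : M)
    (hom : ∀ s, ∀ y ∈ I s, p y) (zero : p 0) (add : ∀ y z, p y → p z → p (y + z)) : p x := by
  have hx : x ∈ ⨆ s, I s := h ▸ Submodule.mem_top
  exact Submodule.iSup_induction I (motive := p) hx hom zero add

/-- The sum of the homogeneous components with index in `S`. -/
def gspan (I : ι → Submodule ℂ M) (S : Set ι) : Submodule ℂ M := ⨆ s ∈ S, I s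

theorem le_gspan {S : Set ι} {s : ι} (hs : s ∈ S) : I s ≤ gspan I S := le_biSup I hs

theorem gspan_le {S : Set ι} {Z : Submodule ℂ M} : gspan I S ≤ Z ↔ ∀ s ∈ S, I s ≤ Z :=
  iSup₂_le_iff

theorem gspan_mono {S T : Set ι} (h : S ⊆ T) : gspan I S ≤ gspan I T :=
  gspan_le.2 fun _ hs => le_gspan (h hs)

theorem gspan_sup (S T : Set ι) : gspan I S ⊔ gspan I T = gspan I (S ∪ T) :=
  le_antisymm (sup_le (gspan_mono Set.subset_union_left) (gspan_mono Set.subset_union_right))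
    (gspan_le.2 fun _ hs => hs.elim (fun h => (le_gspan h).trans le_sup_left)
      fun h => (le_gspan h).trans le_sup_right)

theorem gspan_empty : gspan I ∅ = ⊥ := by simp [gspan]

theorem gspan_singleton (s : ι) : gspan I {s} = I s := by simp [gspan]

theorem map_gspan_le {f : M →ₗ[ℂ] N} (hf : ∀ s, ∀ x ∈ I s, f x ∈ J s) (S : Set ι) :
    (gspan I S).map f ≤ gspan J S := by
  rw [Submodule.map_le_iff_le_comap]
  exact gspan_le.2 fun s hs x hx => le_gspan hs (hf s x hx)

variable [DecidableEq ι]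

/-- The endomorphism that multiplies the component of index `s` by `c s`. -/
def gscale (h : DirectSum.IsInternal I) (c : ι → ℂ) : M →ₗ[ℂ] M :=
  DirectSum.toModule ℂ ι M (fun s => c s • (I s).subtype) ∘ₗ
    (LinearEquiv.ofBijective (DirectSum.coeLinearMap I) h).symm.toLinearMap

theorem gscale_of_mem (h : DirectSum.IsInternal I) (c : ι → ℂ) {s : ι} {x : M} (hx : x ∈ I s) :
    gscale h c x = c s • x := by
  have h1 : (LinearEquiv.ofBijective (DirectSum.coeLinearMap I) h).symm x =
      DirectSum.lof ℂ ι (fun i => I i) s ⟨x, hx⟩ := by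
    rw [LinearEquiv.symm_apply_eq]
    exact (DirectSum.coeLinearMap_lof I s ⟨x, hx⟩).symm
  rw [gscale, LinearMap.comp_apply, LinearEquiv.coe_coe, h1, DirectSum.toModule_lof]
  rfl

/-- The projection to the component of index `s`. -/
def gcomp (h : DirectSum.IsInternal I) (s : ι) : M →ₗ[ℂ] M :=
  gscale h fun t => if t = s then 1 else 0

theorem gcomp_of_mem (h : DirectSum.IsInternal I) {s : ι} {x : M} (hx : x ∈ I s) :
    gcomp h s x = x := by rw [gcomp, gscale_of_mem h _ hx, if_pos rfl, one_smul]

theorem gcomp_of_ne (h : DirectSum.IsInternal I) {s t : ι} (hst : t ≠ s) {x : M} (hx : x ∈ I t) :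
    gcomp h s x = 0 := by rw [gcomp, gscale_of_mem h _ hx, if_neg hst, zero_smul]

theorem gcomp_mem (h : DirectSum.IsInternal I) (s : ι) (x : M) : gcomp h s x ∈ I s := by
  induction x using grading_induction h.submodule_iSup_eq_top with
  | hom t x hx =>
    by_cases hst : t = s
    · subst hst; rwa [gcomp_of_mem h hx]
    · rw [gcomp_of_ne h hst hx]; exact zero_mem _
  | zero => rw [map_zero]; exact zero_mem _
  | add x y hx hy => rw [map_add]; exact add_mem hx hy

theorem exists_sum_gcomp (h : DirectSum.IsInternal I) (x : M) :
    ∃ T : Finset ι, ∀ U, T ⊆ U → x = ∑ s ∈ U, gcomp h s x := by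
  induction x using grading_induction h.submodule_iSup_eq_top with
  | hom t x hx =>
    refine ⟨{t}, fun U hU => ?_⟩
    rw [Finset.sum_eq_single t, gcomp_of_mem h hx]
    · exact fun s _ hst => gcomp_of_ne h (Ne.symm hst) hx
    · exact fun ht => absurd (hU (Finset.mem_singleton_self t)) ht
  | zero => exact ⟨∅, fun U _ => by simp⟩
  | add x y hx hy =>
    obtain ⟨s, hs⟩ := hx
    obtain ⟨t, ht⟩ := hy
    refine ⟨s ∪ t, fun u hu => ?_⟩
    conv_lhs => rw [hs u (Finset.union_subset_left hu), ht u (Finset.union_subset_right hu)]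
    simp only [map_add, Finset.sum_add_distrib]

theorem eq_zero_of_gcomp (h : DirectSum.IsInternal I) {x : M} (hx : ∀ s, gcomp h s x = 0) :
    x = 0 := by
  obtain ⟨T, hT⟩ := exists_sum_gcomp h x
  rw [hT T subset_rfl]
  exact Finset.sum_eq_zero fun s _ => hx s

theorem mem_of_gcomp (h : DirectSum.IsInternal I) {Z : Submodule ℂ M} {x : M}
    (hx : ∀ s, gcomp h s x ∈ Z) : x ∈ Z := by
  obtain ⟨T, hT⟩ := exists_sum_gcomp h x
  rw [hT T subset_rfl]
  exact Submodule.sum_mem _ fun s _ => hx s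

theorem mem_gspan_iff (h : DirectSum.IsInternal I) {S : Set ι} {x : M} :
    x ∈ gspan I S ↔ ∀ s ∉ S, gcomp h s x = 0 := by
  constructor
  · intro hx s hs
    have : gspan I S ≤ LinearMap.ker (gcomp h s) := gspan_le.2 fun t ht y hy => by
      rw [LinearMap.mem_ker]
      exact gcomp_of_ne h (fun e : t = s => hs (e ▸ ht)) hy
    exact this hx
  · intro hx
    refine mem_of_gcomp h fun s => ?_
    by_cases hs : s ∈ S
    · exact le_gspan hs (gcomp_mem h s x)
    · rw [hx s hs]; exact zero_mem _

theorem gspan_inf (h : DirectSum.IsInternal I) (S T : Set ι) :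
    gspan I S ⊓ gspan I T = gspan I (S ∩ T) := by
  ext x
  simp only [Submodule.mem_inf, mem_gspan_iff h, Set.mem_inter_iff, not_and_or]
  constructor
  · rintro ⟨h1, h2⟩ s (hs | hs)
    exacts [h1 s hs, h2 s hs]
  · exact fun h1 => ⟨fun s hs => h1 s (Or.inl hs), fun s hs => h1 s (Or.inr hs)⟩

theorem gspan_univ (h : DirectSum.IsInternal I) : gspan I Set.univ = ⊤ := by
  rw [gspan, ← h.submodule_iSup_eq_top]; simp

theorem gcomp_map (hI : DirectSum.IsInternal I) (hJ : DirectSum.IsInternal J) {f : M →ₗ[ℂ] N}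
    (hf : ∀ s, ∀ x ∈ I s, f x ∈ J s) (s : ι) (x : M) :
    gcomp hJ s (f x) = f (gcomp hI s x) := by
  induction x using grading_induction hI.submodule_iSup_eq_top with
  | hom t x hx =>
    by_cases hst : t = s
    · subst hst; rw [gcomp_of_mem hI hx, gcomp_of_mem hJ (hf _ _ hx)]
    · rw [gcomp_of_ne hI hst hx, gcomp_of_ne hJ hst (hf _ _ hx), map_zero]
  | zero => simp
  | add x y hx hy => simp only [map_add, hx, hy]

theorem gscale_map (hI : DirectSum.IsInternal I) (hJ : DirectSum.IsInternal J) {f : M →ₗ[ℂ] N}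
    (hf : ∀ s, ∀ x ∈ I s, f x ∈ J s) (c : ι → ℂ) (x : M) :
    gscale hJ c (f x) = f (gscale hI c x) := by
  induction x using grading_induction hI.submodule_iSup_eq_top with
  | hom t x hx => rw [gscale_of_mem hI c hx, gscale_of_mem hJ c (hf _ _ hx), map_smul]
  | zero => simp
  | add x y hx hy => simp only [map_add, hx, hy]

theorem map_gspan_eq (hI : DirectSum.IsInternal I) (hJ : DirectSum.IsInternal J) {f : M →ₗ[ℂ] N}
    (hf : ∀ s, ∀ x ∈ I s, f x ∈ J s) (hs : Function.Surjective f) (S : Set ι) :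
    (gspan I S).map f = gspan J S := by
  refine le_antisymm (map_gspan_le hf S) (gspan_le.2 fun s hs' y hy => ?_)
  obtain ⟨x, rfl⟩ := hs y
  refine ⟨gcomp hI s x, le_gspan hs' (gcomp_mem hI s x), ?_⟩
  rw [← gcomp_map hI hJ hf, gcomp_of_mem hJ hy]

theorem comap_gspan_eq (hI : DirectSum.IsInternal I) (hJ : DirectSum.IsInternal J) {f : M →ₗ[ℂ] N}
    (hf : ∀ s, ∀ x ∈ I s, f x ∈ J s) (hinj : Function.Injective f) (S : Set ι) :
    (gspan J S).comap f = gspan I S := by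
  ext x
  rw [Submodule.mem_comap, mem_gspan_iff hI, mem_gspan_iff hJ]
  refine forall₂_congr fun s _ => ?_
  rw [gcomp_map hI hJ hf, map_eq_zero_iff f hinj]

/-- A family of subspaces of the components of a grading that generates the whole space is the
family of components. -/
theorem eq_of_le_grading (h : DirectSum.IsInternal I) {K : ι → Submodule ℂ M}
    (hK : ∀ s, K s ≤ I s) (htop : ⨆ s, K s = ⊤) : K = I := by
  funext s
  refine le_antisymm (hK s) fun x hx => ?_
  have : ∀ y, gcomp h s y ∈ K s := by
    intro y
    induction y using grading_induction htop with
    | hom t y hy =>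
      by_cases hst : t = s
      · subst hst; rwa [gcomp_of_mem h (hK _ hy)]
      · rw [gcomp_of_ne h hst (hK _ hy)]; exact zero_mem _
    | zero => rw [map_zero]; exact zero_mem _
    | add x y hx hy => rw [map_add]; exact add_mem hx hy
  rw [← gcomp_of_mem h hx]
  exact this x

theorem isInternal_of_eigen {K : ι → Submodule ℂ M} (T : M →ₗ[ℂ] M) {χ : ι → ℂ}
    (hχ : Function.Injective χ) (hT : ∀ s, ∀ x ∈ K s, T x = χ s • x) (htop : ⨆ s, K s = ⊤) :
    DirectSum.IsInternal K := by
  refine DirectSum.isInternal_submodule_of_iSupIndep_of_iSup_eq_top ?_ htop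
  have h := (Module.End.eigenspaces_iSupIndep T).comp hχ
  exact h.mono fun s x hx => Module.End.mem_eigenspace_iff.2 (hT s x hx)

end Grading

/-- Types of Hodge components. -/
abbrev Bideg := ℤ × ℤ

/-- The character `(z, w) ↦ z ^ p * w ^ q`. -/
def bichar (z w : ℂˣ) (s : Bideg) : ℂ := (z : ℂ) ^ s.1 * (w : ℂ) ^ s.2

theorem bichar_add (z w : ℂˣ) (s t : Bideg) :
    bichar z w (s + t) = bichar z w s * bichar z w t := by
  simp only [bichar, Prod.fst_add, Prod.snd_add, zpow_add₀ z.ne_zero, zpow_add₀ w.ne_zero]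
  ring

theorem bichar_neg (z w : ℂˣ) (s : Bideg) : bichar z w (-s) = (bichar z w s)⁻¹ := by
  simp [bichar, mul_comm]

theorem bichar_ne_zero (z w : ℂˣ) (s : Bideg) : bichar z w s ≠ 0 :=
  mul_ne_zero (zpow_ne_zero _ z.ne_zero) (zpow_ne_zero _ w.ne_zero)

@[simp] theorem bichar_zero (z w : ℂˣ) : bichar z w 0 = 1 := by simp [bichar]

theorem bichar_mul (z w z' w' : ℂˣ) (s : Bideg) :
    bichar (z * z') (w * w') s = bichar z w s * bichar z' w' s := by
  simp only [bichar, Units.val_mul, mul_zpow]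
  ring

@[simp] theorem bichar_one (s : Bideg) : bichar 1 1 s = 1 := by simp [bichar]

/-- The unit `2` of `ℂ`. -/
def twoU : ℂˣ := Units.mk0 2 two_ne_zero

/-- The unit `3` of `ℂ`. -/
def threeU : ℂˣ := Units.mk0 3 three_ne_zero

theorem bichar_injective : Function.Injective (bichar twoU threeU) := by
  have key : ∀ s : Bideg, bichar twoU threeU s = 1 → s = 0 := by
    rintro ⟨p, q⟩ h
    simp only [bichar, twoU, threeU, Units.val_mk0] at h
    have h' : ((2 : ℚ) ^ p * 3 ^ q) = 1 := by
      have h1 : (((2 : ℚ) ^ p * 3 ^ q : ℚ) : ℂ) = ((1 : ℚ) : ℂ) := by push_cast; exact h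
      exact_mod_cast h1
    have h2 := congrArg (padicValRat 2) h'
    have h3 := congrArg (padicValRat 3) h'
    have e23 : padicValRat 2 (3 : ℚ) = 0 := by
      have : padicValRat 2 ((3 : ℕ) : ℚ) = 0 := by
        rw [padicValRat.of_nat, padicValNat.eq_zero_of_not_dvd (by norm_num)]; rfl
      exact_mod_cast this
    have e32 : padicValRat 3 (2 : ℚ) = 0 := by
      have : padicValRat 3 ((2 : ℕ) : ℚ) = 0 := by
        rw [padicValRat.of_nat, padicValNat.eq_zero_of_not_dvd (by norm_num)]; rfl
      exact_mod_cast this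
    have e22 : padicValRat 2 (2 : ℚ) = 1 := by
      exact_mod_cast padicValRat.self (p := 2) (by norm_num)
    have e33 : padicValRat 3 (3 : ℚ) = 1 := by
      exact_mod_cast padicValRat.self (p := 3) (by norm_num)
    rw [padicValRat.mul (by positivity) (by positivity), padicValRat.zpow,
      padicValRat.zpow, padicValRat.one] at h2 h3
    rw [e22, e23] at h2
    rw [e32, e33] at h3
    ext <;> simp <;> linarith
  intro s t hst
  have := key (s - t) (by
    rw [sub_eq_add_neg, bichar_add, bichar_neg, hst, mul_inv_cancel₀ (bichar_ne_zero _ _ _)])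
  exact sub_eq_zero.1 this

theorem isInternal_of_torus {M : Type*} [AddCommGroup M] [Module ℂ M]
    {K : Bideg → Submodule ℂ M} (T : M →ₗ[ℂ] M)
    (hT : ∀ s, ∀ x ∈ K s, T x = bichar twoU threeU s • x) (htop : ⨆ s, K s = ⊤) :
    DirectSum.IsInternal K :=
  isInternal_of_eigen T bichar_injective hT htop

/-! ## The Deligne splitting -/

section Deligne

variable {M : Type*} [AddCommGroup M] [Module ℂ M]

/-- Finite filtrations `W`, `F`, `F'` such that `F` and `F'` are `w`-opposed on `gr^W_w`. -/
structure Opposed (W F F' : ℤ → Submodule ℂ M) : Prop where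
  W_mono : Monotone W
  W_bot : ∃ n, W n = ⊥
  W_top : ∃ n, W n = ⊤
  F_anti : Antitone F
  F_bot : ∃ p, F p = ⊥
  F_top : ∃ p, F p = ⊤
  F'_anti : Antitone F'
  sup : ∀ w p q : ℤ, p + q = w + 1 → ∀ x ∈ W w,
    ∃ a ∈ F p ⊓ W w, ∃ b ∈ F' q ⊓ W w, x - a - b ∈ W (w - 1)
  inf : ∀ w p q : ℤ, p + q = w + 1 → ∀ a ∈ F p ⊓ W w, ∀ b ∈ F' q ⊓ W w,
    a - b ∈ W (w - 1) → a ∈ W (w - 1)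

/-- The third term in Deligne's formula for the bigrading of a mixed Hodge structure. -/
def deligneK (W F' : ℤ → Submodule ℂ M) (q n : ℤ) : Submodule ℂ M :=
  (F' q ⊓ W n) ⊔ ⨆ j : ℕ, F' (q - j) ⊓ W (n - 1 - j)

/-- Deligne's bigrading of a mixed Hodge structure. -/
def deligne (W F F' : ℤ → Submodule ℂ M) (s : Bideg) : Submodule ℂ M :=
  F s.1 ⊓ W (s.1 + s.2) ⊓ deligneK W F' s.2 (s.1 + s.2)

variable {W F F' : ℤ → Submodule ℂ M}

namespace Opposed

theorem deligneK_approx (h : Opposed W F F') {q n : ℤ} {x : M} (hx : x ∈ deligneK W F' q n)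
    (k : ℕ) : ∃ y ∈ F' (q - k), x - y ∈ W (n - 2 - k) := by
  have : deligneK W F' q n ≤ F' (q - k) ⊔ W (n - 2 - k) := by
    refine sup_le (inf_le_left.trans ((h.F'_anti (by omega)).trans le_sup_left))
      (iSup_le fun j => ?_)
    by_cases hj : j ≤ k
    · exact inf_le_left.trans ((h.F'_anti (by omega)).trans le_sup_left)
    · exact inf_le_right.trans ((h.W_mono (by omega)).trans le_sup_right)
  obtain ⟨y, hy, z, hz, rfl⟩ := Submodule.mem_sup.1 (this hx)
  exact ⟨y, hy, by simpa using hz⟩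

theorem eq_zero_of_mem_W (h : Opposed W F F') {n : ℤ} {x : M} (hx : ∀ k : ℕ, x ∈ W (n - k)) :
    x = 0 := by
  obtain ⟨m, hm⟩ := h.W_bot
  have : x ∈ W m := h.W_mono (show n - ((n - m).toNat : ℤ) ≤ m by omega) (hx _)
  rwa [hm, Submodule.mem_bot] at this

theorem deligne_inter (h : Opposed W F F') {s : Bideg} {x : M} (hx : x ∈ deligne W F F' s)
    (hW : x ∈ W (s.1 + s.2 - 1)) : x = 0 := by
  obtain ⟨⟨hF, -⟩, hK⟩ := hx
  refine h.eq_zero_of_mem_W (n := s.1 + s.2 - 1) fun k => ?_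
  induction k with
  | zero => simpa using hW
  | succ k ih =>
    obtain ⟨y, hy, hxy⟩ := h.deligneK_approx hK k
    have hyW : y ∈ W (s.1 + s.2 - 1 - k) := by
      have := sub_mem ih (h.W_mono (show s.1 + s.2 - 2 - k ≤ s.1 + s.2 - 1 - k by omega) hxy)
      simpa using this
    have := h.inf (s.1 + s.2 - 1 - k) s.1 (s.2 - k) (by omega) x ⟨hF, ih⟩ y ⟨hy, hyW⟩
      (h.W_mono (by omega) hxy)
    exact h.W_mono (by push_cast; omega) this

/-- Every Hodge class in `gr^W` lifts to Deligne's subspace. -/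
theorem deligne_lift (h : Opposed W F F') {p q : ℤ} {a b : M} (ha : a ∈ F p ⊓ W (p + q))
    (hb : b ∈ F' q ⊓ W (p + q)) (hab : a - b ∈ W (p + q - 1)) :
    ∃ x ∈ deligne W F F' (p, q), x - a ∈ W (p + q - 1) := by
  have key : ∀ k : ℕ, ∃ a' ∈ F p ⊓ W (p + q), ∃ b' ∈ deligneK W F' q (p + q),
      a' - b' ∈ W (p + q - 1 - k) ∧ a' - a ∈ W (p + q - 1) := by
    intro k
    induction k with
    | zero => exact ⟨a, ha, b, Submodule.mem_sup_left hb, by simpa using hab, by simp⟩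
    | succ k ih =>
      obtain ⟨a', ha', b', hb', hab', ha''⟩ := ih
      obtain ⟨c, hc, d, hd, hcd⟩ := h.sup (p + q - 1 - k) p (q - k) (by omega) _ hab'
      refine ⟨a' - c, sub_mem ha' ⟨hc.1, h.W_mono (by omega) hc.2⟩, b' + d,
        add_mem hb' (Submodule.mem_sup_right (Submodule.mem_iSup_of_mem k hd)), ?_, ?_⟩
      · have e : a' - c - (b' + d) = a' - b' - c - d := by abel
        rw [e]
        exact h.W_mono (by push_cast; omega) hcd
      · have e : a' - c - a = (a' - a) - c := by abel
        rw [e]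
        exact sub_mem ha'' (h.W_mono (by omega) hc.2)
  obtain ⟨m, hm⟩ := h.W_bot
  obtain ⟨a', ha', b', hb', hab', ha''⟩ := key (p + q - 1 - m).toNat
  have h0 : a' - b' ∈ W m := h.W_mono (by omega) hab'
  rw [hm, Submodule.mem_bot, sub_eq_zero] at h0
  exact ⟨a', ⟨ha', h0 ▸ hb'⟩, ha''⟩

theorem F_inf_W_le (h : Opposed W F F') (n p : ℤ) :
    F p ⊓ W n ≤ gspan (deligne W F F') {s | p ≤ s.1 ∧ s.1 + s.2 ≤ n} := by
  obtain ⟨m, hm⟩ := h.W_bot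
  obtain ⟨r, hr⟩ := h.F_bot
  have key : ∀ (k : ℕ) (j : ℕ) (n p : ℤ), n ≤ m + k → r ≤ p + j →
      F p ⊓ W n ≤ gspan (deligne W F F') {s | p ≤ s.1 ∧ s.1 + s.2 ≤ n} := by
    intro k
    induction k with
    | zero =>
      intro j n p hn _
      refine inf_le_right.trans ((h.W_mono (by simpa using hn)).trans ?_)
      rw [hm]; exact bot_le
    | succ k ihk =>
      intro j
      induction j with
      | zero =>
        intro n p _ hp
        refine inf_le_left.trans ((h.F_anti (by simpa using hp)).trans ?_)
        rw [hr]; exact bot_le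
      | succ j ihj =>
        intro n p hn hp x hx
        obtain ⟨a, ha, b, hb, hab⟩ := h.sup n (p + 1) (n - p) (by omega) x hx.2
        obtain ⟨i, hi, hia⟩ := h.deligne_lift (p := p) (q := n - p) (a := x - a) (b := b)
          (by rw [add_sub_cancel]; exact sub_mem hx ⟨h.F_anti (by omega) ha.1, ha.2⟩)
          (by rw [add_sub_cancel]; exact hb) (by rw [add_sub_cancel]; exact hab)
        rw [add_sub_cancel] at hia
        have hiW : i ∈ W n := by
          have := hi.1.2
          simpa using this
        have e : x = i + (a + (x - a - i)) := by abel
        rw [e]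
        refine add_mem (le_gspan ?_ hi) (add_mem ?_ ?_)
        · exact ⟨le_rfl, by simp⟩
        · refine gspan_mono ?_ (ihj n (p + 1) hn (by push_cast at hp; omega) ha)
          rintro s ⟨h1, h2⟩
          exact ⟨by omega, h2⟩
        · refine gspan_mono ?_
            (ihk (r - p).toNat (n - 1) p (by push_cast at hn; omega) (by omega) (x := x - a - i)
              ⟨?_, ?_⟩)
          · rintro s ⟨h1, h2⟩
            exact ⟨h1, by omega⟩
          · exact sub_mem (sub_mem hx.1 (h.F_anti (by omega) ha.1)) hi.1.1
          · rw [← neg_sub i]; exact neg_mem hia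
  exact key (n - m).toNat (r - p).toNat n p (by omega) (by omega)

theorem W_eq (h : Opposed W F F') (n : ℤ) :
    W n = gspan (deligne W F F') {s | s.1 + s.2 ≤ n} := by
  refine le_antisymm ?_ (gspan_le.2 fun s hs x hx => h.W_mono hs hx.1.2)
  obtain ⟨r, hr⟩ := h.F_top
  intro x hx
  exact gspan_mono (fun s hs => hs.2) (h.F_inf_W_le n r ⟨hr ▸ Submodule.mem_top, hx⟩)

theorem F_eq (h : Opposed W F F') (p : ℤ) : F p = gspan (deligne W F F') {s | p ≤ s.1} := by
  refine le_antisymm ?_ (gspan_le.2 fun s hs x hx => h.F_anti hs hx.1.1)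
  obtain ⟨n, hn⟩ := h.W_top
  intro x hx
  exact gspan_mono (fun s hs => hs.1) (h.F_inf_W_le n p ⟨hx, hn ▸ Submodule.mem_top⟩)

theorem iSup_deligne (h : Opposed W F F') : ⨆ s, deligne W F F' s = ⊤ := by
  obtain ⟨n, hn⟩ := h.W_top
  rw [eq_top_iff, ← hn, h.W_eq]
  exact gspan_le.2 fun s _ => le_iSup _ s

theorem iSupIndep_deligne (h : Opposed W F F') : iSupIndep (deligne W F F') := by
  classical
  rw [iSupIndep_iff_finsetSum_eq_zero_imp_eq_zero]
  intro S
  induction hn : S.card generalizing S with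
  | zero =>
    intro f _ _ s hs
    rw [Finset.card_eq_zero] at hn
    simp [hn] at hs
  | succ n ih =>
    intro f hf hsum
    obtain ⟨t, ht, hmax⟩ := Finset.exists_max_image S
      (fun s : Bideg => toLex ((s.1 + s.2, -s.1) : ℤ × ℤ))
      (Finset.card_pos.1 (by omega))
    have hS : ∑ s ∈ S.erase t, f s = - f t := by
      rw [← Finset.add_sum_erase S f ht] at hsum
      exact eq_neg_of_add_eq_zero_right hsum
    have hft : f t = 0 := by
      refine h.deligne_inter (hf t ht) ?_
      obtain ⟨y, hy, hty⟩ := h.deligneK_approx (hf t ht).2 0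
      have h1 : ∀ s ∈ S.erase t, f s ∈ (F (t.1 + 1) ⊓ W (t.1 + t.2)) ⊔ W (t.1 + t.2 - 1) := by
        intro s hs
        have h2 := hmax s (Finset.mem_of_mem_erase hs)
        have h3 := hf s (Finset.mem_of_mem_erase hs)
        have h4 := Finset.ne_of_mem_erase hs
        rw [Prod.Lex.toLex_le_toLex] at h2
        rcases h2 with h2 | ⟨h2, h5⟩
        · exact Submodule.mem_sup_right (h.W_mono (by simp only at h2; omega) h3.1.2)
        · simp only at h2 h5
          have h6 : s.1 ≠ t.1 := fun e => h4 (Prod.ext e (by omega))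
          exact Submodule.mem_sup_left ⟨h.F_anti (by omega) h3.1.1, h2 ▸ h3.1.2⟩
      have h2 := Submodule.sum_mem _ h1
      rw [hS] at h2
      obtain ⟨a, ha, w, hw, haw⟩ := Submodule.mem_sup.1 (neg_mem h2)
      rw [neg_neg] at haw
      have hyW : y ∈ W (t.1 + t.2) := by
        have := sub_mem (hf t ht).1.2
          (h.W_mono (show t.1 + t.2 - 2 - ((0 : ℕ) : ℤ) ≤ t.1 + t.2 by simp) hty)
        simpa using this
      have h3 : a ∈ W (t.1 + t.2 - 1) := by
        refine h.inf (t.1 + t.2) (t.1 + 1) t.2 (by omega) a ha y ⟨by simpa using hy, hyW⟩ ?_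
        have e : a - y = (f t - y) - w := by rw [← haw]; abel
        rw [e]
        exact sub_mem (h.W_mono (by simp) hty) hw
      rw [← haw]
      exact add_mem h3 hw
    intro s hs
    by_cases hst : s = t
    · rw [hst, hft]
    · refine ih (S.erase t) (by rw [Finset.card_erase_of_mem ht, hn]; rfl) f
        (fun s hs => hf s (Finset.mem_of_mem_erase hs)) ?_ s (Finset.mem_erase.2 ⟨hst, hs⟩)
      rw [hS, hft, neg_zero]

theorem isInternal_deligne (h : Opposed W F F') : DirectSum.IsInternal (deligne W F F') :=
  DirectSum.isInternal_submodule_of_iSupIndep_of_iSup_eq_top h.iSupIndep_deligne h.iSup_deligne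

end Opposed

end Deligne

/-! ## Hodge splittings -/

section Splitting

variable {V V' : Type*} [AddCommGroup V] [Module ℚ V] [AddCommGroup V'] [Module ℚ V']

/-- A bigrading that splits the weight and the Hodge filtration and is compatible with complex
conjugation modulo lower weights. -/
structure IsHodgeSplitting (W : ℤ → Submodule ℚ V) (F : ℤ → Submodule ℂ (ℂ ⊗[ℚ] V))
    (I : Bideg → Submodule ℂ (ℂ ⊗[ℚ] V)) : Prop where
  internal : DirectSum.IsInternal I
  W_eq : ∀ n, (W n).baseChange ℂ = gspan I {s | s.1 + s.2 ≤ n}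
  F_eq : ∀ p, F p = gspan I {s | p ≤ s.1}
  conj : ∀ s, ∀ x ∈ I s, conjC V x ∈ I s.swap ⊔ (W (s.1 + s.2 - 1)).baseChange ℂ

/-- The conjugate of the Hodge filtration. -/
def conjF (F : ℤ → Submodule ℂ (ℂ ⊗[ℚ] V)) (q : ℤ) : Submodule ℂ (ℂ ⊗[ℚ] V) :=
  (F q).map (conjC V)

/-- The Deligne splitting of a mixed Hodge structure. -/
def delSplit (W : ℤ → Submodule ℚ V) (F : ℤ → Submodule ℂ (ℂ ⊗[ℚ] V)) :
    Bideg → Submodule ℂ (ℂ ⊗[ℚ] V) :=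
  deligne (fun n => (W n).baseChange ℂ) F (conjF F)

variable {W : ℤ → Submodule ℚ V} {F : ℤ → Submodule ℂ (ℂ ⊗[ℚ] V)}

theorem mem_grF {w p : ℤ} {x : ℂ ⊗[ℚ] V} : x ∈ grF W F w p ↔
    ∃ a ∈ F p ⊓ (W w).baseChange ℂ, x - a ∈ (W (w - 1)).baseChange ℂ := by
  rw [grF, Submodule.mem_sup]
  constructor
  · rintro ⟨a, ha, b, hb, rfl⟩
    exact ⟨a, ha, by simpa using hb⟩
  · rintro ⟨a, ha, hb⟩
    exact ⟨a, ha, _, hb, by abel⟩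

theorem mem_conjF {q : ℤ} {x : ℂ ⊗[ℚ] V} : x ∈ conjF F q ↔ conjC V x ∈ F q := mem_map_conjC _ _

theorem mem_grF_conj {w q : ℤ} {x : ℂ ⊗[ℚ] V} : x ∈ (grF W F w q).map (conjC V) ↔
    ∃ a ∈ conjF F q ⊓ (W w).baseChange ℂ, x - a ∈ (W (w - 1)).baseChange ℂ := by
  rw [mem_map_conjC, mem_grF]
  constructor
  · rintro ⟨a, ha, hx⟩
    refine ⟨conjC V a, ⟨mem_conjF.2 (by rw [conjC_conjC]; exact ha.1),
      (conjC_mem_baseChange _).2 ha.2⟩, ?_⟩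
    rw [← conjC_mem_baseChange, map_sub, conjC_conjC]
    exact hx
  · rintro ⟨a, ha, hx⟩
    refine ⟨conjC V a, ⟨mem_conjF.1 ha.1, (conjC_mem_baseChange _).2 ha.2⟩, ?_⟩
    rw [← map_sub, conjC_mem_baseChange]
    exact hx

theorem IsMHS.opposed (h : IsMHS W F) :
    Opposed (fun n => (W n).baseChange ℂ) F (conjF F) where
  W_mono _ _ hab := Submodule.baseChange_mono ℂ (h.W_mono hab)
  W_bot := by
    obtain ⟨n, hn⟩ := h.W_bot
    exact ⟨n, by simp [hn]⟩
  W_top := by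
    obtain ⟨n, hn⟩ := h.W_top
    exact ⟨n, by simp [hn]⟩
  F_anti := h.F_anti
  F_bot := h.F_bot
  F_top := h.F_top
  F'_anti _ _ hab := Submodule.map_mono (h.F_anti hab)
  sup w p q hpq x hx := by
    rw [← h.opposed_sup w p q hpq] at hx
    obtain ⟨a, ha, b, hb, rfl⟩ := Submodule.mem_sup.1 hx
    obtain ⟨a', ha', ha⟩ := mem_grF.1 ha
    obtain ⟨b', hb', hb⟩ := mem_grF_conj.1 hb
    refine ⟨a', ha', b', hb', ?_⟩
    have e : a + b - a' - b' = (a - a') + (b - b') := by abel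
    rw [e]
    exact add_mem ha hb
  inf w p q hpq a ha b hb hab := by
    change a ∈ (W (w - 1)).baseChange ℂ
    rw [← h.opposed_inf w p q hpq]
    exact ⟨mem_grF.2 ⟨a, ha, by simp⟩, mem_grF_conj.2 ⟨b, hb, hab⟩⟩

/-- Every mixed Hodge structure has a Hodge splitting, the Deligne splitting. -/
theorem IsMHS.isHodgeSplitting (h : IsMHS W F) : IsHodgeSplitting W F (delSplit W F) where
  internal := h.opposed.isInternal_deligne
  W_eq := h.opposed.W_eq
  F_eq := h.opposed.F_eq
  conj := by
    rintro ⟨p, q⟩ x ⟨⟨hF, hW⟩, hK⟩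
    simp only at hF hW hK ⊢
    obtain ⟨y, hy, hxy⟩ := h.opposed.deligneK_approx hK 0
    have hxy' : x - y ∈ (W (p + q - 1)).baseChange ℂ :=
      Submodule.baseChange_mono ℂ (h.W_mono (by simp)) hxy
    have hyW : y ∈ (W (p + q)).baseChange ℂ := by
      have := sub_mem hW (Submodule.baseChange_mono ℂ (h.W_mono (by omega)) hxy')
      simpa using this
    have hd := (conjC_mem_baseChange (W (p + q - 1))).2 hxy'
    rw [map_sub] at hd
    obtain ⟨i, hi, hi'⟩ := h.opposed.deligne_lift (p := q) (q := p) (a := conjC V y)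
      (b := conjC V x) ⟨mem_conjF.1 (by simpa using hy), (conjC_mem_baseChange _).2
        (by rwa [add_comm] at hyW)⟩
      ⟨mem_conjF.2 (by rwa [conjC_conjC]), (conjC_mem_baseChange _).2 (by rwa [add_comm] at hW)⟩
      (by rw [← neg_sub (conjC V x), add_comm q p]; exact neg_mem hd)
    rw [add_comm q p] at hi'
    refine Submodule.mem_sup.2 ⟨i, hi, conjC V x - i, ?_, by abel⟩
    have e : conjC V x - i = (conjC V x - conjC V y) - (i - conjC V y) := by abel
    rw [e]
    exact sub_mem hd hi'

namespace IsHodgeSplitting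

variable {I : Bideg → Submodule ℂ (ℂ ⊗[ℚ] V)}

theorem grF_eq (h : IsHodgeSplitting W F I) (w p : ℤ) :
    grF W F w p = gspan I {s | (p ≤ s.1 ∧ s.1 + s.2 ≤ w) ∨ s.1 + s.2 ≤ w - 1} := by
  rw [grF, h.F_eq, h.W_eq, h.W_eq, gspan_inf h.internal, gspan_sup]
  rfl

theorem grF_conj_eq (h : IsHodgeSplitting W F I) (w q : ℤ) : (grF W F w q).map (conjC V) =
    gspan I {s | (q ≤ s.2 ∧ s.1 + s.2 ≤ w) ∨ s.1 + s.2 ≤ w - 1} := by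
  have key : ∀ (T T' : Set Bideg) , (∀ s ∈ T, s.swap ∈ T' ∧
      ∀ t : Bideg, t.1 + t.2 ≤ s.1 + s.2 - 1 → t ∈ T') →
      ∀ x ∈ gspan I T, conjC V x ∈ gspan I T' := by
    intro T T' hT x hx
    have : gspan I T ≤ (gspan I T').comap (conjC V) := gspan_le.2 fun s hs y hy => by
      refine (sup_le (le_gspan (hT s hs).1) ?_ : _ ≤ gspan I T') (h.conj s y hy)
      rw [h.W_eq]
      exact gspan_mono (hT s hs).2
    exact this hx
  rw [h.grF_eq]
  ext x
  rw [mem_map_conjC]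
  constructor
  · intro hx
    rw [← conjC_conjC x]
    refine key _ _ ?_ _ hx
    rintro ⟨a, b⟩ hs
    simp only [Set.mem_ofPred_eq, Prod.swap_prod_mk] at hs ⊢
    exact ⟨by omega, fun t ht => by omega⟩
  · intro hx
    refine key _ _ ?_ _ hx
    rintro ⟨a, b⟩ hs
    simp only [Set.mem_ofPred_eq, Prod.swap_prod_mk] at hs ⊢
    exact ⟨by omega, fun t ht => by omega⟩

/-- Only finitely many components are nonzero. -/
theorem exists_bound [Module.Finite ℚ V] (h : DirectSum.IsInternal I) :
    ∃ N : ℕ, ∀ s : Bideg, (N < |s.1| ∨ N < |s.2| ∨ N < |s.1 + s.2|) → I s = ⊥ := by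
  have hind := h.submodule_iSupIndep
  have hfin : {s | I s ≠ ⊥}.Finite := WellFoundedGT.finite_ne_bot_of_iSupIndep hind
  obtain ⟨N, hN⟩ : ∃ N : ℕ, ∀ s ∈ hfin.toFinset, (|s.1| + |s.2|).toNat ≤ N :=
    ⟨hfin.toFinset.sup fun s => (|s.1| + |s.2|).toNat, fun s hs =>
      Finset.le_sup (f := fun s : Bideg => (|s.1| + |s.2|).toNat) hs⟩
  refine ⟨N, fun s hs => by_contra fun h0 => ?_⟩
  have h1 := hN s (by simpa using h0)
  have h2 := abs_add_le s.1 s.2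
  have h3 := abs_nonneg s.1
  have h4 := abs_nonneg s.2
  omega

/-- A Hodge splitting defines a mixed Hodge structure. -/
theorem isMHS [Module.Finite ℚ V] (h : IsHodgeSplitting W F I) : IsMHS W F where
  finite := inferInstance
  W_mono a b hab := baseChange_le_iff.1 (by
    rw [h.W_eq, h.W_eq]
    exact gspan_mono fun s (hs : _ ≤ _) => hs.trans hab)
  W_bot := by
    obtain ⟨N, hN⟩ := exists_bound h.internal
    refine ⟨-N - 1, baseChange_inj ?_⟩
    rw [h.W_eq, Submodule.baseChange_bot, eq_bot_iff]
    refine gspan_le.2 fun s hs => (hN s ?_).le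
    have := neg_abs_le (s.1 + s.2)
    simp only [Set.mem_ofPred_eq] at hs
    omega
  W_top := by
    obtain ⟨N, hN⟩ := exists_bound h.internal
    refine ⟨N, baseChange_inj ?_⟩
    rw [h.W_eq, Submodule.baseChange_top, eq_top_iff, ← h.internal.submodule_iSup_eq_top]
    refine iSup_le fun s => ?_
    by_cases hs : s.1 + s.2 ≤ N
    · exact le_gspan hs
    · rw [hN s (Or.inr (Or.inr (by have := le_abs_self (s.1 + s.2); omega)))]
      exact bot_le
  F_anti a b hab := by
    rw [h.F_eq, h.F_eq]
    exact gspan_mono fun s (hs : _ ≤ _) => hab.trans hs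
  F_bot := by
    obtain ⟨N, hN⟩ := exists_bound h.internal
    refine ⟨N + 1, ?_⟩
    rw [h.F_eq, eq_bot_iff]
    refine gspan_le.2 fun s hs => (hN s ?_).le
    have := le_abs_self s.1
    simp only [Set.mem_ofPred_eq] at hs
    omega
  F_top := by
    obtain ⟨N, hN⟩ := exists_bound h.internal
    refine ⟨-N, ?_⟩
    rw [h.F_eq, eq_top_iff, ← h.internal.submodule_iSup_eq_top]
    refine iSup_le fun s => ?_
    by_cases hs : -(N : ℤ) ≤ s.1
    · exact le_gspan hs
    · rw [hN s (Or.inl (by have := neg_abs_le s.1; omega))]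
      exact bot_le
  opposed_sup w p q hpq := by
    rw [h.grF_eq, h.grF_conj_eq, gspan_sup, h.W_eq]
    congr 1
    ext s
    simp only [Set.mem_union, Set.mem_ofPred_eq]
    omega
  opposed_inf w p q hpq := by
    rw [h.grF_eq, h.grF_conj_eq, gspan_inf h.internal, h.W_eq]
    congr 1
    ext s
    simp only [Set.mem_inter_iff, Set.mem_ofPred_eq]
    omega

theorem hodgeComp_eq (h : IsHodgeSplitting W F I) (p q : ℤ) :
    hodgeComp W F p q = I (p, q) ⊔ (W (p + q - 1)).baseChange ℂ := by
  rw [hodgeComp, h.grF_eq, h.grF_conj_eq, gspan_inf h.internal, h.W_eq, ← gspan_singleton (I := I) (p, q),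
    gspan_sup]
  congr 1
  ext s
  simp only [Set.mem_inter_iff, Set.mem_ofPred_eq, Set.mem_union, Set.mem_singleton_iff,
    Prod.ext_iff]
  omega

end IsHodgeSplitting

variable {W' : ℤ → Submodule ℚ V'} {F' : ℤ → Submodule ℂ (ℂ ⊗[ℚ] V')}

/-- The Deligne splitting is functorial. -/
theorem delSplit_map {f : V →ₗ[ℚ] V'} (hW : ∀ n, (W n).map f ≤ W' n)
    (hF : ∀ p, (F p).map (f.baseChange ℂ) ≤ F' p) (s : Bideg) (x : ℂ ⊗[ℚ] V)
    (hx : x ∈ delSplit W F s) : f.baseChange ℂ x ∈ delSplit W' F' s := by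
  have hWx : ∀ n, ∀ y ∈ (W n).baseChange ℂ, f.baseChange ℂ y ∈ (W' n).baseChange ℂ :=
    fun n y hy => Submodule.baseChange_mono ℂ (hW n)
      (by rw [baseChange_map]; exact Submodule.mem_map_of_mem hy)
  have hFx : ∀ p, ∀ y ∈ F p, f.baseChange ℂ y ∈ F' p :=
    fun p y hy => hF p (Submodule.mem_map_of_mem hy)
  have hF'x : ∀ p, ∀ y ∈ conjF F p, f.baseChange ℂ y ∈ conjF F' p := fun p y hy => by
    rw [mem_conjF] at hy ⊢
    rw [conjC_baseChange]
    exact hFx p _ hy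
  obtain ⟨⟨h1, h2⟩, h3⟩ := hx
  refine ⟨⟨hFx _ _ h1, hWx _ _ h2⟩, ?_⟩
  have : deligneK (fun n => (W n).baseChange ℂ) (conjF F) s.2 (s.1 + s.2) ≤
      (deligneK (fun n => (W' n).baseChange ℂ) (conjF F') s.2 (s.1 + s.2)).comap
        (f.baseChange ℂ) := by
    refine sup_le (fun y hy => Submodule.mem_sup_left ⟨hF'x _ _ hy.1, hWx _ _ hy.2⟩)
      (iSup_le fun j y hy => Submodule.mem_sup_right (Submodule.mem_iSup_of_mem j
        ⟨hF'x _ _ hy.1, hWx _ _ hy.2⟩))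
  exact this h3

/-- Two mixed Hodge structures with the same weight filtration and comparable Hodge filtrations
are equal. -/
theorem IsMHS.eq_of_le {F₂ : ℤ → Submodule ℂ (ℂ ⊗[ℚ] V)} (h : IsMHS W F) (h₂ : IsMHS W F₂)
    (hle : ∀ p, F p ≤ F₂ p) : F = F₂ := by
  have : delSplit W F = delSplit W F₂ := by
    refine eq_of_le_grading h₂.isHodgeSplitting.internal (fun s x hx => ?_)
      h.isHodgeSplitting.internal.submodule_iSup_eq_top
    have := delSplit_map (f := LinearMap.id) (W := W) (W' := W) (F := F) (F' := F₂)
      (fun n => by simp) (fun p => by simpa using hle p) s x hx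
    simpa using this
  funext p
  rw [h.isHodgeSplitting.F_eq, h₂.isHodgeSplitting.F_eq, this]

end Splitting

/-! ## Operations on mixed Hodge structures -/

section TensorOp

variable {V V' : Type*} [AddCommGroup V] [Module ℚ V] [AddCommGroup V'] [Module ℚ V']

/-- The bilinear map `V_ℂ × V'_ℂ → (V ⊗ V')_ℂ`. -/
def tmulC (V V' : Type*) [AddCommGroup V] [Module ℚ V] [AddCommGroup V'] [Module ℚ V'] :
    (ℂ ⊗[ℚ] V) →ₗ[ℂ] (ℂ ⊗[ℚ] V') →ₗ[ℂ] ℂ ⊗[ℚ] (V ⊗[ℚ] V') :=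
  (TensorProduct.mk ℂ (ℂ ⊗[ℚ] V) (ℂ ⊗[ℚ] V')).compr₂
    (TensorProduct.AlgebraTensorModule.distribBaseChange ℚ ℂ V V').symm.toLinearMap

theorem tmulC_apply (x : ℂ ⊗[ℚ] V) (y : ℂ ⊗[ℚ] V') : tmulC V V' x y =
    (TensorProduct.AlgebraTensorModule.distribBaseChange ℚ ℂ V V').symm (x ⊗ₜ y) := rfl

@[simp] theorem tmulC_tmul (a b : ℂ) (v : V) (v' : V') :
    tmulC V V' (a ⊗ₜ v) (b ⊗ₜ v') = (a * b) ⊗ₜ (v ⊗ₜ v') := by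
  simp [tmulC_apply]

/-- The tensor product of endomorphisms. -/
def tensorEnd (S : Module.End ℂ (ℂ ⊗[ℚ] V)) (T : Module.End ℂ (ℂ ⊗[ℚ] V')) :
    Module.End ℂ (ℂ ⊗[ℚ] (V ⊗[ℚ] V')) :=
  (TensorProduct.AlgebraTensorModule.distribBaseChange ℚ ℂ V V').symm.toLinearMap ∘ₗ
    TensorProduct.map S T ∘ₗ
      (TensorProduct.AlgebraTensorModule.distribBaseChange ℚ ℂ V V').toLinearMap

@[simp] theorem tensorEnd_tmulC (S : Module.End ℂ (ℂ ⊗[ℚ] V)) (T : Module.End ℂ (ℂ ⊗[ℚ] V'))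
    (x : ℂ ⊗[ℚ] V) (y : ℂ ⊗[ℚ] V') :
    tensorEnd S T (tmulC V V' x y) = tmulC V V' (S x) (T y) := by
  simp [tensorEnd, tmulC_apply]

theorem map₂_mk_map (Z : Submodule ℂ (ℂ ⊗[ℚ] V)) (Z' : Submodule ℂ (ℂ ⊗[ℚ] V')) :
    (Submodule.map₂ (TensorProduct.mk ℂ (ℂ ⊗[ℚ] V) (ℂ ⊗[ℚ] V')) Z Z').map
      (TensorProduct.AlgebraTensorModule.distribBaseChange ℚ ℂ V V').symm.toLinearMap =
    Submodule.map₂ (tmulC V V') Z Z' := Submodule.map_map₂ _ _ _ _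

theorem map₂_tmulC_top : Submodule.map₂ (tmulC V V') ⊤ ⊤ = ⊤ := by
  rw [← map₂_mk_map, TensorProduct.map₂_mk_top_top_eq_top, Submodule.map_top]
  exact LinearEquiv.range _

theorem tmulC_induction {p : ℂ ⊗[ℚ] (V ⊗[ℚ] V') → Prop} (z : ℂ ⊗[ℚ] (V ⊗[ℚ] V'))
    (tmul : ∀ x y, p (tmulC V V' x y)) (add : ∀ x y, p x → p y → p (x + y)) : p z := by
  obtain ⟨t, rfl⟩ :=
    (TensorProduct.AlgebraTensorModule.distribBaseChange ℚ ℂ V V').symm.surjective z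
  induction t using TensorProduct.induction_on with
  | zero => simpa using tmul 0 0
  | tmul x y => exact tmul x y
  | add x y hx hy => rw [map_add]; exact add _ _ hx hy

theorem baseChange_map₂ (W : Submodule ℚ V) (W' : Submodule ℚ V') :
    (Submodule.map₂ (TensorProduct.mk ℚ V V') W W').baseChange ℂ =
      Submodule.map₂ (tmulC V V') (W.baseChange ℂ) (W'.baseChange ℂ) := by
  rw [Submodule.baseChange_eq_span, Submodule.baseChange_eq_span, Submodule.baseChange_eq_span,
    Submodule.map₂_span_span]
  apply le_antisymm
  · rw [Submodule.span_le]
    rintro _ ⟨t, ht, rfl⟩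
    have : Submodule.map₂ (TensorProduct.mk ℚ V V') W W' ≤ ((Submodule.span ℂ (Set.image2
        (fun x y => tmulC V V' x y) (W.map (TensorProduct.mk ℚ ℂ V 1))
        (W'.map (TensorProduct.mk ℚ ℂ V' 1)))).restrictScalars ℚ).comap
        (TensorProduct.mk ℚ ℂ (V ⊗[ℚ] V') 1) := Submodule.map₂_le.2 fun x hx y hy =>
      Submodule.subset_span ⟨1 ⊗ₜ x, ⟨x, hx, rfl⟩, 1 ⊗ₜ y, ⟨y, hy, rfl⟩, by simp⟩
    exact this ht
  · rw [Submodule.span_le]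
    rintro _ ⟨_, ⟨x, hx, rfl⟩, _, ⟨y, hy, rfl⟩, rfl⟩
    exact Submodule.subset_span ⟨x ⊗ₜ y, Submodule.apply_mem_map₂ _ hx hy, by simp⟩

theorem twist_tmulC (σ : ℂ →+* ℂ) (x : ℂ ⊗[ℚ] V) (y : ℂ ⊗[ℚ] V') :
    twist σ (V ⊗[ℚ] V') (tmulC V V' x y) = tmulC V V' (twist σ V x) (twist σ V' y) := by
  induction x using TensorProduct.induction_on with
  | zero => simp
  | add x x' hx hx' => simp only [map_add, LinearMap.add_apply, hx, hx']
  | tmul a v =>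
    induction y using TensorProduct.induction_on with
    | zero => simp
    | add y y' hy hy' => simp only [map_add, hy, hy']
    | tmul b v' => simp

theorem conjC_tmulC (x : ℂ ⊗[ℚ] V) (y : ℂ ⊗[ℚ] V') :
    conjC (V ⊗[ℚ] V') (tmulC V V' x y) = tmulC V V' (conjC V x) (conjC V' y) :=
  twist_tmulC _ x y

/-- The bigrading of a tensor product. -/
def tensorGr (I : Bideg → Submodule ℂ (ℂ ⊗[ℚ] V)) (J : Bideg → Submodule ℂ (ℂ ⊗[ℚ] V'))
    (s : Bideg) : Submodule ℂ (ℂ ⊗[ℚ] (V ⊗[ℚ] V')) :=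
  ⨆ a, Submodule.map₂ (tmulC V V') (I a) (J (s - a))

variable {I : Bideg → Submodule ℂ (ℂ ⊗[ℚ] V)} {J : Bideg → Submodule ℂ (ℂ ⊗[ℚ] V')}

theorem map₂_le_tensorGr (a b : Bideg) :
    Submodule.map₂ (tmulC V V') (I a) (J b) ≤ tensorGr I J (a + b) := by
  refine le_trans (le_of_eq ?_) (le_iSup _ a)
  rw [add_sub_cancel_left]

theorem tmulC_mem_tensorGr {a b : Bideg} {x y} (hx : x ∈ I a) (hy : y ∈ J b) :
    tmulC V V' x y ∈ tensorGr I J (a + b) :=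
  map₂_le_tensorGr a b (Submodule.apply_mem_map₂ _ hx hy)

theorem iSup_tensorGr (hI : ⨆ s, I s = ⊤) (hJ : ⨆ s, J s = ⊤) : ⨆ s, tensorGr I J s = ⊤ := by
  rw [eq_top_iff, ← map₂_tmulC_top, ← hI, ← hJ, Submodule.map₂_iSup_left]
  refine iSup_le fun a => ?_
  rw [Submodule.map₂_iSup_right]
  exact iSup_le fun b => (map₂_le_tensorGr a b).trans (le_iSup _ _)

theorem tmulC_smul_smul (c d : ℂ) (x : ℂ ⊗[ℚ] V) (y : ℂ ⊗[ℚ] V') :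
    tmulC V V' (c • x) (d • y) = (c * d) • tmulC V V' x y := by
  have h : tmulC V V' (c • x) = c • tmulC V V' x := map_smul _ c x
  rw [h, LinearMap.smul_apply, (tmulC V V' x).map_smul, smul_smul]

theorem tensorEnd_smul {S : Module.End ℂ (ℂ ⊗[ℚ] V)} {T : Module.End ℂ (ℂ ⊗[ℚ] V')}
    {c : Bideg → ℂ} (hc : ∀ a b, c (a + b) = c a * c b) (hS : ∀ a, ∀ x ∈ I a, S x = c a • x)
    (hT : ∀ a, ∀ x ∈ J a, T x = c a • x) (s : Bideg) (x) (hx : x ∈ tensorGr I J s) :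
    tensorEnd S T x = c s • x := by
  have key : ∀ a, ∀ z ∈ Submodule.map₂ (tmulC V V') (I a) (J (s - a)),
      tensorEnd S T z = c s • z := by
    intro a z hz
    rw [Submodule.map₂_eq_span_image2] at hz
    induction hz using Submodule.span_induction with
    | mem z hz =>
      obtain ⟨x, hx, y, hy, rfl⟩ := hz
      rw [tensorEnd_tmulC, hS _ _ hx, hT _ _ hy, tmulC_smul_smul, ← hc, add_sub_cancel]
    | zero => rw [map_zero, smul_zero]
    | add x y _ _ h1 h2 => rw [map_add, h1, h2, smul_add]
    | smul d x _ h1 => rw [map_smul, h1, smul_comm]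
  rw [tensorGr] at hx
  induction hx using Submodule.iSup_induction' with
  | mem a x hx => exact key a x hx
  | zero => rw [map_zero, smul_zero]
  | add x y _ _ h1 h2 => rw [map_add, h1, h2, smul_add]

theorem gscale_tensorGr (hI : DirectSum.IsInternal I) (hJ : DirectSum.IsInternal J) (z w : ℂˣ)
    (s : Bideg) (x) (hx : x ∈ tensorGr I J s) :
    tensorEnd (gscale hI (bichar z w)) (gscale hJ (bichar z w)) x = bichar z w s • x := by
  have h1 : ∀ a, ∀ x ∈ I a, gscale hI (bichar z w) x = bichar z w a • x :=
    fun a x h => gscale_of_mem hI _ h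
  have h2 : ∀ a, ∀ x ∈ J a, gscale hJ (bichar z w) x = bichar z w a • x :=
    fun a x h => gscale_of_mem hJ _ h
  generalize gscale hI (bichar z w) = S at h1 ⊢
  generalize gscale hJ (bichar z w) = T at h2 ⊢
  exact tensorEnd_smul (bichar_add z w) h1 h2 s x hx

theorem isInternal_tensorGr (hI : DirectSum.IsInternal I) (hJ : DirectSum.IsInternal J) :
    DirectSum.IsInternal (tensorGr I J) := by
  refine isInternal_of_torus (tensorEnd (gscale hI (bichar twoU threeU))
    (gscale hJ (bichar twoU threeU))) ?_
    (iSup_tensorGr hI.submodule_iSup_eq_top hJ.submodule_iSup_eq_top)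
  exact fun s x hx => gscale_tensorGr hI hJ twoU threeU s x hx

theorem map₂_gspan_le {S T : Set Bideg} {Z : Submodule ℂ (ℂ ⊗[ℚ] (V ⊗[ℚ] V'))}
    (h : ∀ a ∈ S, ∀ b ∈ T, Submodule.map₂ (tmulC V V') (I a) (J b) ≤ Z) :
    Submodule.map₂ (tmulC V V') (gspan I S) (gspan J T) ≤ Z := by
  simp only [gspan, Submodule.map₂_iSup_left, Submodule.map₂_iSup_right]
  exact iSup₂_le fun b hb => iSup₂_le fun a ha => h a ha b hb

theorem iSup_map₂_gspan {S T : ℤ → Set Bideg} {U : Set Bideg}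
    (h1 : ∀ i, ∀ a ∈ S i, ∀ b ∈ T i, a + b ∈ U) (h2 : ∀ a b, a + b ∈ U → ∃ i, a ∈ S i ∧ b ∈ T i) :
    ⨆ i, Submodule.map₂ (tmulC V V') (gspan I (S i)) (gspan J (T i)) =
      gspan (tensorGr I J) U := by
  apply le_antisymm
  · refine iSup_le fun i => map₂_gspan_le fun a ha b hb => ?_
    exact (map₂_le_tensorGr a b).trans (le_gspan (h1 i a ha b hb))
  · refine gspan_le.2 fun s hs => iSup_le fun a => ?_
    obtain ⟨i, ha, hb⟩ := h2 a (s - a) (by rwa [add_sub_cancel])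
    have h : Submodule.map₂ (tmulC V V') (I a) (J (s - a)) ≤
        Submodule.map₂ (tmulC V V') (gspan I (S i)) (gspan J (T i)) :=
      Submodule.map₂_le_map₂ (le_gspan ha) (le_gspan hb)
    exact le_iSup_of_le i h

/-- The Hodge filtration of a tensor product. -/
def tensorF (F : ℤ → Submodule ℂ (ℂ ⊗[ℚ] V)) (F' : ℤ → Submodule ℂ (ℂ ⊗[ℚ] V')) (p : ℤ) :
    Submodule ℂ (ℂ ⊗[ℚ] (V ⊗[ℚ] V')) :=
  ⨆ i : ℤ, (Submodule.map₂ (TensorProduct.mk ℂ (ℂ ⊗[ℚ] V) (ℂ ⊗[ℚ] V')) (F i) (F' (p - i))).map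
    (TensorProduct.AlgebraTensorModule.distribBaseChange ℚ ℂ V V').symm.toLinearMap

/-- The weight filtration of a tensor product. -/
def tensorW (W : ℤ → Submodule ℚ V) (W' : ℤ → Submodule ℚ V') (n : ℤ) : Submodule ℚ (V ⊗[ℚ] V') :=
  ⨆ i : ℤ, Submodule.map₂ (TensorProduct.mk ℚ V V') (W i) (W' (n - i))

variable {W : ℤ → Submodule ℚ V} {F : ℤ → Submodule ℂ (ℂ ⊗[ℚ] V)}
  {W' : ℤ → Submodule ℚ V'} {F' : ℤ → Submodule ℂ (ℂ ⊗[ℚ] V')}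

theorem tensorF_eq (hF : ∀ p, F p = gspan I {s | p ≤ s.1}) (hF' : ∀ p, F' p = gspan J {s | p ≤ s.1})
    (p : ℤ) : tensorF F F' p = gspan (tensorGr I J) {s | p ≤ s.1} := by
  simp only [tensorF, map₂_mk_map, hF, hF']
  refine iSup_map₂_gspan (fun i a ha b hb => ?_) fun a b hab => ⟨a.1, ?_⟩
  · simp only [Set.mem_ofPred_eq, Prod.fst_add] at *
    omega
  · simp only [Set.mem_ofPred_eq, Prod.fst_add] at *
    omega

theorem tensorW_eq (hW : ∀ n, (W n).baseChange ℂ = gspan I {s | s.1 + s.2 ≤ n})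
    (hW' : ∀ n, (W' n).baseChange ℂ = gspan J {s | s.1 + s.2 ≤ n}) (n : ℤ) :
    (tensorW W W' n).baseChange ℂ = gspan (tensorGr I J) {s | s.1 + s.2 ≤ n} := by
  simp only [tensorW, baseChange_iSup, baseChange_map₂, hW, hW']
  refine iSup_map₂_gspan (fun i a ha b hb => ?_) fun a b hab => ⟨a.1 + a.2, ?_⟩
  · simp only [Set.mem_ofPred_eq, Prod.fst_add, Prod.snd_add] at *
    omega
  · simp only [Set.mem_ofPred_eq, Prod.fst_add, Prod.snd_add] at *
    omega

theorem IsHodgeSplitting.tensor (h : IsHodgeSplitting W F I) (h' : IsHodgeSplitting W' F' J) :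
    IsHodgeSplitting (tensorW W W') (tensorF F F') (tensorGr I J) where
  internal := isInternal_tensorGr h.internal h'.internal
  W_eq := tensorW_eq h.W_eq h'.W_eq
  F_eq := tensorF_eq h.F_eq h'.F_eq
  conj s := by
    have hle : ∀ i n : ℤ, Submodule.map₂ (tmulC V V') ((W i).baseChange ℂ)
        ((W' (n - i)).baseChange ℂ) ≤ (tensorW W W' n).baseChange ℂ := fun i n => by
      rw [← baseChange_map₂, tensorW]
      exact Submodule.baseChange_mono ℂ (le_iSup
        (fun i => Submodule.map₂ (TensorProduct.mk ℚ V V') (W i) (W' (n - i))) i)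
    have : tensorGr I J s ≤ (tensorGr I J s.swap ⊔
        (tensorW W W' (s.1 + s.2 - 1)).baseChange ℂ).comap (conjC _) := by
      refine iSup_le fun a => Submodule.map₂_le.2 fun x hx y hy => ?_
      rw [Submodule.mem_comap, conjC_tmulC]
      obtain ⟨x1, hx1, x2, hx2, hxe⟩ := Submodule.mem_sup.1 (h.conj a x hx)
      obtain ⟨y1, hy1, y2, hy2, hye⟩ := Submodule.mem_sup.1 (h'.conj _ y hy)
      have hyW : conjC V' y ∈ (W' (s.1 + s.2 - (a.1 + a.2))).baseChange ℂ := by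
        rw [conjC_mem_baseChange, h'.W_eq]
        refine le_gspan (s := s - a) ?_ hy
        simp only [Set.mem_ofPred_eq, Prod.fst_sub, Prod.snd_sub]
        omega
      have hxW : x1 ∈ (W (a.1 + a.2)).baseChange ℂ := by
        rw [h.W_eq]
        refine le_gspan (s := a.swap) ?_ hx1
        simp only [Set.mem_ofPred_eq, Prod.fst_swap, Prod.snd_swap]
        omega
      have e : tmulC V V' (conjC V x) (conjC V' y) =
          tmulC V V' x1 y1 + (tmulC V V' x1 y2 + tmulC V V' x2 (conjC V' y)) := by
        rw [← hxe, ← hye]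
        simp only [map_add, LinearMap.add_apply]
        abel
      rw [e]
      refine add_mem (Submodule.mem_sup_left ?_) (Submodule.mem_sup_right (add_mem ?_ ?_))
      · have h1 := tmulC_mem_tensorGr (I := I) (J := J) hx1 hy1
        rwa [← Prod.swap_add, add_sub_cancel] at h1
      · refine hle (a.1 + a.2) _ (Submodule.apply_mem_map₂ _ hxW ?_)
        convert hy2 using 3
        simp only [Prod.fst_sub, Prod.snd_sub]
        ring
      · refine hle (a.1 + a.2 - 1) _ (Submodule.apply_mem_map₂ _ hx2 ?_)
        convert hyW using 3
        ring
    exact this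

/-- The Deligne splitting is compatible with tensor products. -/
theorem tmulC_mem_delSplit {s t : Bideg} {x : ℂ ⊗[ℚ] V} {y : ℂ ⊗[ℚ] V'}
    (hx : x ∈ delSplit W F s) (hy : y ∈ delSplit W' F' t)
    {W₂ : ℤ → Submodule ℚ (V ⊗[ℚ] V')} (hW₂ : ∀ n, tensorW W W' n ≤ W₂ n) (hW₂m : Monotone W₂)
    {F₂ : ℤ → Submodule ℂ (ℂ ⊗[ℚ] (V ⊗[ℚ] V'))} (hF₂ : ∀ n, tensorF F F' n ≤ F₂ n) :
    tmulC V V' x y ∈ delSplit W₂ F₂ (s + t) := by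
  have hWm : ∀ i j n : ℤ, i + j ≤ n → ∀ x ∈ (W i).baseChange ℂ, ∀ y ∈ (W' j).baseChange ℂ,
      tmulC V V' x y ∈ (W₂ n).baseChange ℂ := fun i j n hij x hx y hy => by
    refine Submodule.baseChange_mono ℂ ((hW₂ (i + j)).trans (hW₂m hij)) ?_
    refine Submodule.baseChange_mono ℂ (le_iSup
        (fun i' => Submodule.map₂ (TensorProduct.mk ℚ V V') (W i') (W' (i + j - i'))) i) ?_
    rw [baseChange_map₂, add_sub_cancel_left]
    exact Submodule.apply_mem_map₂ _ hx hy
  have hFm : ∀ i j n : ℤ, i + j = n → ∀ x ∈ F i, ∀ y ∈ F' j, tmulC V V' x y ∈ F₂ n := by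
    rintro i j _ rfl x hx y hy
    refine hF₂ _ (le_iSup (fun i' => Submodule.map _ (Submodule.map₂ (TensorProduct.mk ℂ
      (ℂ ⊗[ℚ] V) (ℂ ⊗[ℚ] V')) (F i') (F' (i + j - i')))) i ?_)
    simp only [map₂_mk_map, add_sub_cancel_left]
    exact Submodule.apply_mem_map₂ _ hx hy
  have hFm' : ∀ i j n : ℤ, i + j = n → ∀ x ∈ conjF F i, ∀ y ∈ conjF F' j,
      tmulC V V' x y ∈ conjF F₂ n := by
    intro i j n hij x hx y hy
    rw [mem_conjF] at hx hy ⊢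
    rw [conjC_tmulC]
    exact hFm i j n hij _ hx _ hy
  obtain ⟨⟨hxF, hxW⟩, hxK⟩ := hx
  obtain ⟨⟨hyF, hyW⟩, hyK⟩ := hy
  refine ⟨⟨hFm _ _ _ rfl _ hxF _ hyF, hWm _ _ _ ?_ _ hxW _ hyW⟩, ?_⟩
  · simp only [Prod.fst_add, Prod.snd_add]; omega
  have : Submodule.map₂ (tmulC V V')
      (deligneK (fun n => (W n).baseChange ℂ) (conjF F) s.2 (s.1 + s.2))
      (deligneK (fun n => (W' n).baseChange ℂ) (conjF F') t.2 (t.1 + t.2)) ≤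
      deligneK (fun n => (W₂ n).baseChange ℂ) (conjF F₂) (s + t).2 ((s + t).1 + (s + t).2) := by
    simp only [deligneK, Submodule.map₂_sup_left, Submodule.map₂_sup_right,
      Submodule.map₂_iSup_left, Submodule.map₂_iSup_right, Prod.fst_add, Prod.snd_add]
    refine sup_le (sup_le ?_ (iSup_le fun j => ?_)) (iSup_le fun i => sup_le ?_
      (iSup_le fun j => ?_))
    · refine Submodule.map₂_le.2 fun x hx y hy => Submodule.mem_sup_left
        ⟨hFm' _ _ _ rfl x hx.1 y hy.1, hWm _ _ _ (by omega) x hx.2 y hy.2⟩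
    · refine Submodule.map₂_le.2 fun x hx y hy => Submodule.mem_sup_right
        (Submodule.mem_iSup_of_mem j
        ⟨hFm' _ _ _ (by omega) x hx.1 y hy.1, hWm _ _ _ (by omega) x hx.2 y hy.2⟩)
    · refine Submodule.map₂_le.2 fun x hx y hy => Submodule.mem_sup_right
        (Submodule.mem_iSup_of_mem i
        ⟨hFm' _ _ _ (by omega) x hx.1 y hy.1, hWm _ _ _ (by omega) x hx.2 y hy.2⟩)
    · refine Submodule.map₂_le.2 fun x hx y hy => Submodule.mem_sup_right
        (Submodule.mem_iSup_of_mem (i + j)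
        ⟨hFm' _ _ _ (by push_cast; omega) x hx.1 y hy.1,
          hWm _ _ _ (by push_cast; omega) x hx.2 y hy.2⟩)
  exact this (Submodule.apply_mem_map₂ _ hxK hyK)

end TensorOp

section ProdOp

variable {V V' : Type*} [AddCommGroup V] [Module ℚ V] [AddCommGroup V'] [Module ℚ V']

/-- The bigrading of a direct sum. -/
def prodGr (I : Bideg → Submodule ℂ (ℂ ⊗[ℚ] V)) (J : Bideg → Submodule ℂ (ℂ ⊗[ℚ] V'))
    (s : Bideg) : Submodule ℂ (ℂ ⊗[ℚ] (V × V')) :=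
  (I s).comap ((LinearMap.fst ℚ V V').baseChange ℂ) ⊓
    (J s).comap ((LinearMap.snd ℚ V V').baseChange ℂ)

theorem baseChange_fst_inl (x : ℂ ⊗[ℚ] V) : (LinearMap.fst ℚ V V').baseChange ℂ
    ((LinearMap.inl ℚ V V').baseChange ℂ x) = x := by
  rw [← LinearMap.comp_apply, ← LinearMap.baseChange_comp, LinearMap.fst_comp_inl,
    LinearMap.baseChange_id, LinearMap.id_apply]

theorem baseChange_snd_inr (x : ℂ ⊗[ℚ] V') : (LinearMap.snd ℚ V V').baseChange ℂ
    ((LinearMap.inr ℚ V V').baseChange ℂ x) = x := by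
  rw [← LinearMap.comp_apply, ← LinearMap.baseChange_comp, LinearMap.snd_comp_inr,
    LinearMap.baseChange_id, LinearMap.id_apply]

theorem baseChange_fst_inr (x : ℂ ⊗[ℚ] V') : (LinearMap.fst ℚ V V').baseChange ℂ
    ((LinearMap.inr ℚ V V').baseChange ℂ x) = 0 := by
  rw [← LinearMap.comp_apply, ← LinearMap.baseChange_comp, LinearMap.fst_comp_inr,
    LinearMap.baseChange_zero, LinearMap.zero_apply]

theorem baseChange_snd_inl (x : ℂ ⊗[ℚ] V) : (LinearMap.snd ℚ V V').baseChange ℂ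
    ((LinearMap.inl ℚ V V').baseChange ℂ x) = 0 := by
  rw [← LinearMap.comp_apply, ← LinearMap.baseChange_comp, LinearMap.snd_comp_inl,
    LinearMap.baseChange_zero, LinearMap.zero_apply]

theorem baseChange_prod_sum (x : ℂ ⊗[ℚ] (V × V')) :
    (LinearMap.inl ℚ V V').baseChange ℂ ((LinearMap.fst ℚ V V').baseChange ℂ x) +
      (LinearMap.inr ℚ V V').baseChange ℂ ((LinearMap.snd ℚ V V').baseChange ℂ x) = x := by
  induction x using TensorProduct.induction_on with
  | zero => simp
  | tmul a v =>
    simp only [LinearMap.baseChange_tmul, ← TensorProduct.tmul_add]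
    simp
  | add x y hx hy =>
    conv_rhs => rw [← hx, ← hy]
    simp only [map_add]
    abel

variable {I : Bideg → Submodule ℂ (ℂ ⊗[ℚ] V)} {J : Bideg → Submodule ℂ (ℂ ⊗[ℚ] V')}

theorem inl_mem_prodGr {s : Bideg} {x} (hx : x ∈ I s) :
    (LinearMap.inl ℚ V V').baseChange ℂ x ∈ prodGr I J s := by
  refine ⟨?_, ?_⟩
  · rw [SetLike.mem_coe, Submodule.mem_comap, baseChange_fst_inl]; exact hx
  · rw [SetLike.mem_coe, Submodule.mem_comap, baseChange_snd_inl]; exact zero_mem _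

theorem inr_mem_prodGr {s : Bideg} {x} (hx : x ∈ J s) :
    (LinearMap.inr ℚ V V').baseChange ℂ x ∈ prodGr I J s := by
  refine ⟨?_, ?_⟩
  · rw [SetLike.mem_coe, Submodule.mem_comap, baseChange_fst_inr]; exact zero_mem _
  · rw [SetLike.mem_coe, Submodule.mem_comap, baseChange_snd_inr]; exact hx

theorem gspan_prodGr (S : Set Bideg) :
    (gspan I S).comap ((LinearMap.fst ℚ V V').baseChange ℂ) ⊓
      (gspan J S).comap ((LinearMap.snd ℚ V V').baseChange ℂ) = gspan (prodGr I J) S := by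
  apply le_antisymm
  · rintro x ⟨h1, h2⟩
    rw [← baseChange_prod_sum x]
    exact add_mem (map_gspan_le (J := prodGr I J) (fun s y hy => inl_mem_prodGr hy) S
      (Submodule.mem_map_of_mem h1)) (map_gspan_le (J := prodGr I J)
      (fun s y hy => inr_mem_prodGr hy) S (Submodule.mem_map_of_mem h2))
  · exact gspan_le.2 fun s hs x hx => ⟨le_gspan hs hx.1, le_gspan hs hx.2⟩

theorem isInternal_prodGr (hI : DirectSum.IsInternal I) (hJ : DirectSum.IsInternal J) :
    DirectSum.IsInternal (prodGr I J) := by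
  refine isInternal_of_torus
    ((LinearMap.inl ℚ V V').baseChange ℂ ∘ₗ gscale hI (bichar twoU threeU) ∘ₗ
      (LinearMap.fst ℚ V V').baseChange ℂ +
    (LinearMap.inr ℚ V V').baseChange ℂ ∘ₗ gscale hJ (bichar twoU threeU) ∘ₗ
      (LinearMap.snd ℚ V V').baseChange ℂ) (fun s x hx => ?_) ?_
  · rw [LinearMap.add_apply, LinearMap.comp_apply, LinearMap.comp_apply, LinearMap.comp_apply,
      LinearMap.comp_apply, gscale_of_mem hI _ hx.1, gscale_of_mem hJ _ hx.2, LinearMap.map_smul,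
      LinearMap.map_smul, ← smul_add, baseChange_prod_sum]
  · have h := gspan_prodGr (I := I) (J := J) Set.univ
    rw [gspan_univ hI, gspan_univ hJ] at h
    rw [eq_top_iff]
    calc (⊤ : Submodule ℂ _) = gspan (prodGr I J) Set.univ := by rw [← h]; simp
      _ ≤ _ := gspan_le.2 fun s _ => le_iSup _ s

variable {W : ℤ → Submodule ℚ V} {F : ℤ → Submodule ℂ (ℂ ⊗[ℚ] V)}
  {W' : ℤ → Submodule ℚ V'} {F' : ℤ → Submodule ℂ (ℂ ⊗[ℚ] V')}

theorem IsHodgeSplitting.prod (h : IsHodgeSplitting W F I) (h' : IsHodgeSplitting W' F' J) :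
    IsHodgeSplitting (fun n => (W n).prod (W' n))
      (fun p => (F p).comap ((LinearMap.fst ℚ V V').baseChange ℂ) ⊓
        (F' p).comap ((LinearMap.snd ℚ V V').baseChange ℂ)) (prodGr I J) where
  internal := isInternal_prodGr h.internal h'.internal
  W_eq n := by
    have : (W n).prod (W' n) = (W n).comap (LinearMap.fst ℚ V V') ⊓
        (W' n).comap (LinearMap.snd ℚ V V') := rfl
    rw [this, baseChange_inf, baseChange_comap, baseChange_comap, h.W_eq, h'.W_eq, gspan_prodGr]
  F_eq p := by rw [h.F_eq, h'.F_eq, gspan_prodGr]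
  conj s x hx := by
    have e : ((W (s.1 + s.2 - 1)).prod (W' (s.1 + s.2 - 1))).baseChange ℂ =
        (((W (s.1 + s.2 - 1)).baseChange ℂ).comap ((LinearMap.fst ℚ V V').baseChange ℂ)) ⊓
        ((W' (s.1 + s.2 - 1)).baseChange ℂ).comap ((LinearMap.snd ℚ V V').baseChange ℂ) := by
      rw [← baseChange_comap, ← baseChange_comap, ← baseChange_inf]
      rfl
    rw [e, h.W_eq, h'.W_eq, gspan_prodGr, ← gspan_singleton (I := prodGr I J) s.swap, gspan_sup,
      ← gspan_prodGr]
    have h1 := h.conj s _ hx.1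
    have h2 := h'.conj s _ hx.2
    rw [h.W_eq, ← gspan_singleton (I := I) s.swap, gspan_sup, conjC_baseChange] at h1
    rw [h'.W_eq, ← gspan_singleton (I := J) s.swap, gspan_sup, conjC_baseChange] at h2
    exact ⟨h1, h2⟩

end ProdOp

section DualOp

variable {V : Type*} [AddCommGroup V] [Module ℚ V]

/-- The canonical map `(V^∨)_ℂ → (V_ℂ)^∨`. -/
def dualC (V : Type*) [AddCommGroup V] [Module ℚ V] :
    (ℂ ⊗[ℚ] Module.Dual ℚ V) →ₗ[ℂ] Module.Dual ℂ (ℂ ⊗[ℚ] V) :=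
  LinearMap.liftBaseChange ℂ (Module.Dual.baseChange (R := ℚ) (V := V) ℂ)

theorem dualC_tmul (a : ℂ) (l : Module.Dual ℚ V) (x : ℂ ⊗[ℚ] V) :
    dualC V (a ⊗ₜ l) x = a * Module.Dual.baseChange ℂ l x := by
  simp [dualC]

theorem contr_dualC (χ : Module.Dual ℚ ℂ) (φ : ℂ ⊗[ℚ] Module.Dual ℚ V) (v : V) :
    contr _ χ φ v = χ (dualC V φ (1 ⊗ₜ v)) := by
  induction φ using TensorProduct.induction_on with
  | zero => simp
  | tmul a l =>
    rw [contr_tmul, dualC_tmul, dual_baseChange_tmul, one_mul, mul_comm, ← Rat.smul_def, map_smul,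
      LinearMap.smul_apply, smul_eq_mul, smul_eq_mul, mul_comm]
  | add x y hx hy => simp only [map_add, LinearMap.add_apply, hx, hy]

theorem dualC_conj (φ : ℂ ⊗[ℚ] Module.Dual ℚ V) (x : ℂ ⊗[ℚ] V) :
    dualC V (conjC _ φ) x = starRingEnd ℂ (dualC V φ (conjC V x)) := by
  induction φ using TensorProduct.induction_on with
  | zero => simp
  | tmul a l =>
    rw [conjC_tmul, dualC_tmul, dualC_tmul, map_mul, ← twist_dual]
    congr 2
    exact (conjC_conjC x).symm
  | add x y hx hy => simp only [map_add, LinearMap.add_apply, hx, hy]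

theorem baseChange_dualAnnihilator (U : Submodule ℚ V) : U.dualAnnihilator.baseChange ℂ =
    (U.baseChange ℂ).dualAnnihilator.comap (dualC V) := by
  ext φ
  rw [Submodule.mem_comap, Submodule.mem_dualAnnihilator]
  constructor
  · intro h x hx
    rw [Submodule.baseChange_eq_span] at h
    induction h using Submodule.span_induction with
    | mem φ hφ =>
      obtain ⟨l, hl, rfl⟩ := hφ
      rw [TensorProduct.mk_apply, dualC_tmul, one_mul, dual_baseChange_eq,
        LinearEquiv.map_eq_zero_iff]
      have : x ∈ (LinearMap.ker l).baseChange ℂ := Submodule.baseChange_mono ℂ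
        (fun u hu => (Submodule.mem_dualAnnihilator _).1 hl u hu) hx
      rw [← Submodule.comap_bot, baseChange_comap, Submodule.baseChange_bot] at this
      exact this
    | zero => simp
    | add φ ψ _ _ h1 h2 => rw [map_add, LinearMap.add_apply, h1, h2, add_zero]
    | smul c φ _ h1 => rw [map_smul, LinearMap.smul_apply, h1, smul_zero]
  · intro h
    rw [mem_baseChange_iff]
    intro χ
    rw [Submodule.mem_dualAnnihilator]
    intro u hu
    rw [contr_dualC, h _ (Submodule.tmul_mem_baseChange_of_mem _ hu), map_zero]

theorem dualC_injective : Function.Injective (dualC V) := by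
  rw [← LinearMap.ker_eq_bot, eq_bot_iff]
  intro φ hφ
  rw [LinearMap.mem_ker] at hφ
  have : φ ∈ (⊥ : Submodule ℚ (Module.Dual ℚ V)).baseChange ℂ := by
    rw [mem_baseChange_iff]
    intro χ
    rw [Submodule.mem_bot]
    ext v
    rw [contr_dualC, hφ, LinearMap.zero_apply, map_zero, LinearMap.zero_apply]
  simpa using this

theorem dualC_surjective [Module.Finite ℚ V] : Function.Surjective (dualC V) := by
  intro ψ
  let b := Module.finBasis ℚ V
  refine ⟨∑ i, ψ (1 ⊗ₜ b i) ⊗ₜ b.coord i, (b.baseChange ℂ).ext fun j => ?_⟩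
  rw [map_sum, LinearMap.sum_apply, Finset.sum_eq_single j]
  · rw [dualC_tmul, Module.Basis.baseChange_apply, dual_baseChange_tmul]
    simp
  · intro i _ hij
    rw [dualC_tmul, Module.Basis.baseChange_apply, dual_baseChange_tmul]
    simp [hij.symm]
  · simp

/-- `(V^∨)_ℂ` is the dual of `V_ℂ`. -/
def dualCEquiv (V : Type*) [AddCommGroup V] [Module ℚ V] [Module.Finite ℚ V] :
    (ℂ ⊗[ℚ] Module.Dual ℚ V) ≃ₗ[ℂ] Module.Dual ℂ (ℂ ⊗[ℚ] V) :=
  LinearEquiv.ofBijective (dualC V) ⟨dualC_injective, dualC_surjective⟩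

theorem dualC_dualCEquiv_symm [Module.Finite ℚ V] (ψ : Module.Dual ℂ (ℂ ⊗[ℚ] V)) :
    dualC V ((dualCEquiv V).symm ψ) = ψ := (dualCEquiv V).apply_symm_apply ψ

/-- The bigrading of a dual. -/
def dualGr (I : Bideg → Submodule ℂ (ℂ ⊗[ℚ] V)) (s : Bideg) :
    Submodule ℂ (ℂ ⊗[ℚ] Module.Dual ℚ V) :=
  (gspan I {t | t ≠ -s}).dualAnnihilator.comap (dualC V)

variable {I : Bideg → Submodule ℂ (ℂ ⊗[ℚ] V)}

theorem mem_ann_gspan {S : Set Bideg} {φ : ℂ ⊗[ℚ] Module.Dual ℚ V} :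
    φ ∈ (gspan I S).dualAnnihilator.comap (dualC V) ↔ ∀ s ∈ S, ∀ x ∈ I s, dualC V φ x = 0 := by
  rw [Submodule.mem_comap, Submodule.mem_dualAnnihilator]
  refine ⟨fun h s hs x hx => h x (le_gspan hs hx), fun h x hx => ?_⟩
  exact (gspan_le.2 fun s hs x hx => h s hs x hx : gspan I S ≤ LinearMap.ker (dualC V φ)) hx

theorem exists_sum_gcomp_eq [Module.Finite ℚ V] (hI : DirectSum.IsInternal I) :
    ∃ T : Finset Bideg, ∀ x, x = ∑ s ∈ T, gcomp hI s x := by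
  obtain ⟨N, hN⟩ := IsHodgeSplitting.exists_bound hI
  refine ⟨Finset.Icc (-(N : ℤ)) N ×ˢ Finset.Icc (-(N : ℤ)) N, fun x => ?_⟩
  induction x using grading_induction hI.submodule_iSup_eq_top with
  | hom t x hx =>
    by_cases ht : t ∈ Finset.Icc (-(N : ℤ)) N ×ˢ Finset.Icc (-(N : ℤ)) N
    · rw [Finset.sum_eq_single t (fun s _ hs => gcomp_of_ne hI hs.symm hx)
        fun h => absurd ht h, gcomp_of_mem hI hx]
    · have : x = 0 := by
        rw [Finset.mem_product, Finset.mem_Icc, Finset.mem_Icc, ← abs_le, ← abs_le] at ht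
        have := hN t (by by_contra h; exact ht ⟨by omega, by omega⟩)
        rwa [this, Submodule.mem_bot] at hx
      simp [this]
  | zero => simp
  | add x y hx hy =>
    conv_lhs => rw [hx, hy]
    simp only [map_add, Finset.sum_add_distrib]

theorem ann_gspan [Module.Finite ℚ V] (hI : DirectSum.IsInternal I) (S : Set Bideg) :
    (gspan I S).dualAnnihilator.comap (dualC V) = gspan (dualGr I) {s | -s ∉ S} := by
  apply le_antisymm
  · intro φ hφ
    rw [mem_ann_gspan] at hφ
    obtain ⟨T, hT⟩ := exists_sum_gcomp_eq hI
    have : φ = ∑ t ∈ T, (dualCEquiv V).symm (dualC V φ ∘ₗ gcomp hI t) := by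
      apply dualC_injective
      rw [map_sum]
      ext x
      simp only [dualC_dualCEquiv_symm, LinearMap.sum_apply, TensorProduct.AlgebraTensorModule.curry_apply, LinearMap.coe_restrictScalars, TensorProduct.curry_apply]
      conv_lhs => rw [hT (1 ⊗ₜ x), map_sum]
      rfl
    rw [this]
    refine Submodule.sum_mem _ fun t _ => ?_
    by_cases ht : t ∈ S
    · have : dualC V φ ∘ₗ gcomp hI t = 0 := by
        ext x
        exact hφ t ht _ (gcomp_mem hI t _)
      rw [this, map_zero]
      exact zero_mem _
    · refine le_gspan (s := -t) (by simpa using ht) (mem_ann_gspan.2 fun s hs x hx => ?_)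
      rw [neg_neg] at hs
      rw [dualC_dualCEquiv_symm, LinearMap.comp_apply, gcomp_of_ne hI hs hx, map_zero]
  · refine gspan_le.2 fun s hs φ hφ => mem_ann_gspan.2 fun t ht x hx =>
      mem_ann_gspan.1 hφ t ?_ x hx
    rintro rfl
    exact hs ht

theorem isInternal_dualGr [Module.Finite ℚ V] (hI : DirectSum.IsInternal I) :
    DirectSum.IsInternal (dualGr I) := by
  refine isInternal_of_torus ((dualCEquiv V).symm.toLinearMap ∘ₗ
    (LinearMap.lcomp ℂ ℂ (gscale hI fun t => bichar twoU threeU (-t))) ∘ₗ dualC V)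
    (fun s φ hφ => ?_) ?_
  · apply dualC_injective
    rw [LinearMap.comp_apply, LinearMap.comp_apply, LinearEquiv.coe_coe, dualC_dualCEquiv_symm,
      map_smul]
    refine LinearMap.ext fun x => ?_
    rw [LinearMap.lcomp_apply, LinearMap.smul_apply]
    induction x using grading_induction hI.submodule_iSup_eq_top with
    | hom t x hx =>
      rw [gscale_of_mem hI _ hx, map_smul]
      by_cases hts : t = -s
      · rw [hts, neg_neg]
      · rw [mem_ann_gspan.1 hφ t hts x hx, smul_zero, smul_zero]
    | zero => simp
    | add x y hx hy => simp only [map_add, smul_add, hx, hy]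
  · have h := ann_gspan hI ∅
    rw [gspan_empty, Submodule.dualAnnihilator_bot, Submodule.comap_top] at h
    rw [eq_top_iff, h]
    exact gspan_le.2 fun s _ => le_iSup _ s

variable {W : ℤ → Submodule ℚ V} {F : ℤ → Submodule ℂ (ℂ ⊗[ℚ] V)}

theorem IsHodgeSplitting.dual [Module.Finite ℚ V] (h : IsHodgeSplitting W F I) :
    IsHodgeSplitting (fun n => (W (-n - 1)).dualAnnihilator)
      (fun p => (F (1 - p)).dualAnnihilator.comap (dualC V)) (dualGr I) where
  internal := isInternal_dualGr h.internal
  W_eq n := by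
    rw [baseChange_dualAnnihilator, h.W_eq, ann_gspan h.internal]
    congr 1
    ext s
    simp only [Set.mem_ofPred_eq, Prod.fst_neg, Prod.snd_neg]
    omega
  F_eq p := by
    rw [h.F_eq, ann_gspan h.internal]
    congr 1
    ext s
    simp only [Set.mem_ofPred_eq, Prod.fst_neg]
    omega
  conj s φ hφ := by
    have e : dualGr I s.swap ⊔ ((W (-(s.1 + s.2 - 1) - 1)).dualAnnihilator).baseChange ℂ =
        (gspan I {t | t ≠ -s.swap ∧ t.1 + t.2 ≤ -(s.1 + s.2)}).dualAnnihilator.comap (dualC V) := by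
      rw [baseChange_dualAnnihilator, h.W_eq, ann_gspan h.internal, ann_gspan h.internal,
        ← gspan_singleton (I := dualGr I) s.swap, gspan_sup]
      congr 1
      ext t
      simp only [Set.mem_union, Set.mem_singleton_iff, Set.mem_ofPred_eq, Prod.fst_neg,
        Prod.snd_neg, not_and]
      constructor
      · rintro (h | h) h'
        · exact absurd (congrArg Neg.neg h) h'
        · omega
      · intro h
        by_cases h' : t = s.swap
        · exact Or.inl h'
        · exact Or.inr (by have := h fun e => h' (neg_injective e); omega)
    rw [e, mem_ann_gspan]
    rintro t ⟨ht, ht'⟩ x hx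
    have key : gspan I {t | t ≠ -s} ≤ LinearMap.ker (dualC V φ) :=
      gspan_le.2 fun u hu x hx => mem_ann_gspan.1 hφ u hu x hx
    rw [dualC_conj]
    obtain ⟨a, ha, b, hb, hab⟩ := Submodule.mem_sup.1 (h.conj t x hx)
    rw [← hab, map_add]
    have h1 : dualC V φ a = 0 := by
      refine key (le_gspan (s := t.swap) ?_ ha)
      intro h
      exact ht (by rw [← Prod.swap_swap t, h]; rfl)
    have h2 : dualC V φ b = 0 := by
      rw [h.W_eq] at hb
      refine key (gspan_mono ?_ hb)
      rintro u hu rfl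
      simp only [Set.mem_ofPred_eq, Prod.fst_neg, Prod.snd_neg] at hu
      omega
    rw [h1, h2, add_zero, map_zero]

end DualOp

section UnitOp

/-- The bigrading of a trivial object. -/
def unitGr (V : Type*) [AddCommGroup V] [Module ℚ V] (s : Bideg) : Submodule ℂ (ℂ ⊗[ℚ] V) :=
  if s = 0 then ⊤ else ⊥

variable (V : Type*) [AddCommGroup V] [Module ℚ V]

theorem gspan_unitGr (S : Set Bideg) [Decidable ((0 : Bideg) ∈ S)] :
    gspan (unitGr V) S = if (0 : Bideg) ∈ S then ⊤ else ⊥ := by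
  split_ifs with h
  · rw [eq_top_iff]
    have := le_gspan (I := unitGr V) h
    rwa [unitGr, if_pos rfl] at this
  · rw [eq_bot_iff]
    refine gspan_le.2 fun s hs => ?_
    rw [unitGr, if_neg]
    rintro rfl
    exact h hs

theorem isInternal_unitGr : DirectSum.IsInternal (unitGr V) := by
  refine isInternal_of_torus 1 (fun s x hx => ?_) ?_
  · rw [unitGr] at hx
    split_ifs at hx with h
    · rw [h, bichar_zero, one_smul]; rfl
    · rw [Submodule.mem_bot] at hx
      rw [hx, smul_zero, map_zero]
  · rw [eq_top_iff]
    have := le_iSup (unitGr V) 0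
    rwa [unitGr, if_pos rfl] at this

theorem IsHodgeSplitting.unit : IsHodgeSplitting (fun n : ℤ => if 0 ≤ n then (⊤ : Submodule ℚ V)
    else ⊥) (fun p : ℤ => if p ≤ 0 then ⊤ else ⊥) (unitGr V) where
  internal := isInternal_unitGr V
  W_eq n := by
    classical
    rw [gspan_unitGr]
    by_cases h : 0 ≤ n <;> simp [h]
  F_eq p := by
    classical
    rw [gspan_unitGr]
    simp
  conj s x hx := by
    refine Submodule.mem_sup_left ?_
    rw [unitGr] at hx ⊢
    split_ifs at hx with h
    · rw [if_pos (by rw [h]; rfl)]; exact Submodule.mem_top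
    · rw [Submodule.mem_bot] at hx
      rw [hx, map_zero]
      exact zero_mem _

end UnitOp

/-! ## The torus of the Mumford–Tate group -/

section Triv

variable {V : Type*} [AddCommGroup V] [Module ℚ V] {W : ℤ → Submodule ℚ V}
  {F : ℤ → Submodule ℂ (ℂ ⊗[ℚ] V)} {I : Bideg → Submodule ℂ (ℂ ⊗[ℚ] V)}

/-- The endomorphism `a` preserves `W` and acts trivially on `gr^W`. -/
def GrTriv (W : ℤ → Submodule ℚ V) (a : Module.End ℂ (ℂ ⊗[ℚ] V)) : Prop :=
  ∀ k, ∀ x ∈ (W k).baseChange ℂ, a x - x ∈ (W (k - 1)).baseChange ℂ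

theorem GrTriv.mem (hW : Monotone W) {a : Module.End ℂ (ℂ ⊗[ℚ] V)} (h : GrTriv W a) {k : ℤ}
    {x : ℂ ⊗[ℚ] V} (hx : x ∈ (W k).baseChange ℂ) : a x ∈ (W k).baseChange ℂ := by
  have := add_mem (Submodule.baseChange_mono ℂ (hW (by omega : k - 1 ≤ k)) (h k x hx)) hx
  rwa [sub_add_cancel] at this

theorem GrTriv.symm [Module.Finite ℚ V] (hW : Monotone W) {e : (ℂ ⊗[ℚ] V) ≃ₗ[ℂ] (ℂ ⊗[ℚ] V)}
    (h : GrTriv W e.toLinearMap) : GrTriv W e.symm.toLinearMap := fun k x hx => by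
  have h1 : ((W k).baseChange ℂ).map e.toLinearMap = (W k).baseChange ℂ := by
    refine Submodule.eq_of_le_of_finrank_eq ?_ (LinearEquiv.finrank_map_eq e _)
    rintro _ ⟨y, hy, rfl⟩
    exact h.mem hW hy
  rw [← h1] at hx
  obtain ⟨y, hy, rfl⟩ := hx
  have := neg_mem (h k y hy)
  rw [neg_sub] at this
  simpa using this

/-- The endomorphism `a` acts on the graded pieces of the bigrading `I` as the point `(z, w)`,
modulo lower weights. -/
def ActsOnSplit (W : ℤ → Submodule ℚ V) (I : Bideg → Submodule ℂ (ℂ ⊗[ℚ] V))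
    (a : Module.End ℂ (ℂ ⊗[ℚ] V)) (z w : ℂˣ) : Prop :=
  ∀ s, ∀ x ∈ I s, a x - bichar z w s • x ∈ (W (s.1 + s.2 - 1)).baseChange ℂ

theorem ActsOnSplit.mem (h : IsHodgeSplitting W F I) (hW : Monotone W)
    {a : Module.End ℂ (ℂ ⊗[ℚ] V)} {z w : ℂˣ}
    (ha : ActsOnSplit W I a z w) {n : ℤ} {x : ℂ ⊗[ℚ] V} (hx : x ∈ (W n).baseChange ℂ) :
    a x ∈ (W n).baseChange ℂ := by
  have : gspan I {s | s.1 + s.2 ≤ n} ≤ ((W n).baseChange ℂ).comap a :=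
    gspan_le.2 fun s hs y hy => by
      have h1 := Submodule.baseChange_mono ℂ (hW (by
        simp only [Set.mem_ofPred_eq] at hs; omega : s.1 + s.2 - 1 ≤ n)) (ha s y hy)
      have h2 : y ∈ (W n).baseChange ℂ := by rw [h.W_eq]; exact le_gspan hs hy
      have := add_mem h1 (Submodule.smul_mem _ (bichar z w s) h2)
      rwa [sub_add_cancel] at this
  exact this (h.W_eq n ▸ hx)

theorem actsAsHodge_iff (h : IsHodgeSplitting W F I) (hW : Monotone W)
    {a : Module.End ℂ (ℂ ⊗[ℚ] V)} {z w : ℂˣ} :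
    ActsAsHodge W F a z w ↔ ActsOnSplit W I a z w := by
  constructor
  · intro ha s x hx
    exact ha s.1 s.2 x (by rw [h.hodgeComp_eq]; exact Submodule.mem_sup_left hx)
  · intro ha p q x hx
    rw [h.hodgeComp_eq] at hx
    obtain ⟨y, hy, t, ht, rfl⟩ := Submodule.mem_sup.1 hx
    have e : a (y + t) - ((z : ℂ) ^ p * (w : ℂ) ^ q) • (y + t) =
        (a y - ((z : ℂ) ^ p * (w : ℂ) ^ q) • y) + (a t - ((z : ℂ) ^ p * (w : ℂ) ^ q) • t) := by
      rw [map_add, smul_add]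
      abel
    rw [e]
    exact add_mem (ha (p, q) y hy) (sub_mem (ha.mem h hW ht) (Submodule.smul_mem _ _ ht))

theorem ActsOnSplit.mul_left (h : IsHodgeSplitting W F I) (hW : Monotone W)
    {a b : Module.End ℂ (ℂ ⊗[ℚ] V)} {z w : ℂˣ}
    (ha : GrTriv W a) (hb : ActsOnSplit W I b z w) :
    ActsOnSplit W I (a * b) z w := fun s x hx => by
  have h1 : b x ∈ (W (s.1 + s.2)).baseChange ℂ := hb.mem h hW (by
    rw [h.W_eq]; exact le_gspan (s := s) (by simp) hx)
  have := add_mem (ha _ _ h1) (hb s x hx)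
  rwa [sub_add_sub_cancel] at this

theorem ActsOnSplit.mul (h : IsHodgeSplitting W F I) (hW : Monotone W)
    {a b : Module.End ℂ (ℂ ⊗[ℚ] V)} {z w z' w' : ℂˣ}
    (ha : ActsOnSplit W I a z w) (hb : ActsOnSplit W I b z' w') :
    ActsOnSplit W I (a * b) (z * z') (w * w') := fun s x hx => by
  have h1 := add_mem (ha.mem h hW (hb s x hx)) (Submodule.smul_mem _ (bichar z' w' s) (ha s x hx))
  rw [bichar_mul]
  convert h1 using 1
  rw [map_sub, map_smul, smul_sub, smul_smul, mul_comm (bichar z w s), sub_add_sub_cancel]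
  rfl

theorem ActsOnSplit.grTriv (h : IsHodgeSplitting W F I) (hW : Monotone W)
    {a : Module.End ℂ (ℂ ⊗[ℚ] V)}
    (ha : ActsOnSplit W I a 1 1) : GrTriv W a := fun k x hx => by
  have : gspan I {s | s.1 + s.2 ≤ k} ≤ ((W (k - 1)).baseChange ℂ).comap (a - LinearMap.id) :=
    gspan_le.2 fun s hs y hy => by
      have h1 := ha s y hy
      rw [bichar_one, one_smul] at h1
      exact Submodule.baseChange_mono ℂ (hW (by
        simp only [Set.mem_ofPred_eq] at hs; omega : s.1 + s.2 - 1 ≤ k - 1)) h1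
  exact this (h.W_eq k ▸ hx)

section

variable {V' : Type*} [AddCommGroup V'] [Module ℚ V'] {W' : ℤ → Submodule ℚ V'}
  {F' : ℤ → Submodule ℂ (ℂ ⊗[ℚ] V')}

theorem tmulC_mem_tensorW {i k : ℤ} {x : ℂ ⊗[ℚ] V} {y : ℂ ⊗[ℚ] V'}
    (hx : x ∈ (W i).baseChange ℂ) (hy : y ∈ (W' (k - i)).baseChange ℂ) :
    tmulC V V' x y ∈ (tensorW W W' k).baseChange ℂ := by
  refine Submodule.baseChange_mono ℂ (le_iSup (fun i => Submodule.map₂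
    (TensorProduct.mk ℚ V V') (W i) (W' (k - i))) i) ?_
  rw [baseChange_map₂]
  exact Submodule.apply_mem_map₂ _ hx hy

theorem GrTriv.tensor (hW' : Monotone W') {a : Module.End ℂ (ℂ ⊗[ℚ] V)}
    {b : Module.End ℂ (ℂ ⊗[ℚ] V')} {c : Module.End ℂ (ℂ ⊗[ℚ] (V ⊗[ℚ] V'))} (ha : GrTriv W a)
    (hb : GrTriv W' b) (hc : ∀ x y, c (tmulC V V' x y) = tmulC V V' (a x) (b y)) :
    GrTriv (tensorW W W') c := fun k x hx => by
  have : (tensorW W W' k).baseChange ℂ ≤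
      ((tensorW W W' (k - 1)).baseChange ℂ).comap (c - LinearMap.id) := by
    rw [tensorW, baseChange_iSup]
    refine iSup_le fun i => ?_
    rw [baseChange_map₂]
    refine Submodule.map₂_le.2 fun x hx y hy => ?_
    rw [Submodule.mem_comap, LinearMap.sub_apply, hc, LinearMap.id_apply]
    have e2 : tmulC V V' (a x) (b y) - tmulC V V' x y =
        tmulC V V' (a x - x) (b y) + tmulC V V' x (b y - y) := by
      rw [map_sub, map_sub, LinearMap.sub_apply]
      abel
    rw [e2]
    refine add_mem (tmulC_mem_tensorW (i := i - 1) (ha i x hx) ?_)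
      (tmulC_mem_tensorW (i := i) hx ?_)
    · have := hb.mem hW' hy
      convert this using 3
      ring
    · have := hb _ y hy
      convert this using 3
      ring
  exact this hx

theorem GrTriv.dual [Module.Finite ℚ V] (hW : Monotone W)
    {a : (ℂ ⊗[ℚ] V) ≃ₗ[ℂ] (ℂ ⊗[ℚ] V)} {c : Module.End ℂ (ℂ ⊗[ℚ] Module.Dual ℚ V)}
    (ha : GrTriv W a.toLinearMap) (hc : ∀ x φ, dualC V (c φ) (a x) = dualC V φ x) :
    GrTriv (fun n => (W (-n - 1)).dualAnnihilator) c := fun k φ hφ => by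
  rw [baseChange_dualAnnihilator, Submodule.mem_comap, Submodule.mem_dualAnnihilator] at hφ ⊢
  intro x hx
  rw [map_sub, LinearMap.sub_apply, sub_eq_zero]
  have h2 := hc (a.symm x) φ
  rw [LinearEquiv.apply_symm_apply] at h2
  rw [h2, ← sub_eq_zero, ← map_sub]
  apply hφ
  have := ha.symm hW _ x hx
  rwa [show -(k - 1) - 1 - 1 = -k - 1 by ring] at this

theorem GrTriv.prod {a : Module.End ℂ (ℂ ⊗[ℚ] V)}
    {b : Module.End ℂ (ℂ ⊗[ℚ] V')} {c : Module.End ℂ (ℂ ⊗[ℚ] (V × V'))} (ha : GrTriv W a)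
    (hb : GrTriv W' b)
    (h1 : ∀ x, a ((LinearMap.fst ℚ V V').baseChange ℂ x) = (LinearMap.fst ℚ V V').baseChange ℂ (c x))
    (h2 : ∀ x, b ((LinearMap.snd ℚ V V').baseChange ℂ x) =
      (LinearMap.snd ℚ V V').baseChange ℂ (c x)) :
    GrTriv (fun n => (W n).prod (W' n)) c := fun k x hx => by
  have e : ∀ k, ((W k).prod (W' k)).baseChange ℂ =
      (((W k).baseChange ℂ).comap ((LinearMap.fst ℚ V V').baseChange ℂ)) ⊓
      ((W' k).baseChange ℂ).comap ((LinearMap.snd ℚ V V').baseChange ℂ) := by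
    intro k
    rw [← baseChange_comap, ← baseChange_comap, ← baseChange_inf]
    rfl
  rw [e] at hx ⊢
  refine ⟨?_, ?_⟩
  · rw [SetLike.mem_coe, Submodule.mem_comap, map_sub, ← h1]
    exact ha k _ hx.1
  · rw [SetLike.mem_coe, Submodule.mem_comap, map_sub, ← h2]
    exact hb k _ hx.2

theorem baseChange_W_comap (h : IsMHS W F) (h' : IsMHS W' F') {f : V →ₗ[ℚ] V'}
    (hW : ∀ n, (W n).map f ≤ W' n) (hF : ∀ p, (F p).map (f.baseChange ℂ) ≤ F' p)
    (hinj : Function.Injective f) (k : ℤ) :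
    (W k).baseChange ℂ = ((W' k).baseChange ℂ).comap (f.baseChange ℂ) := by
  rw [h.isHodgeSplitting.W_eq, h'.isHodgeSplitting.W_eq]
  exact (comap_gspan_eq h.isHodgeSplitting.internal h'.isHodgeSplitting.internal
    (delSplit_map hW hF) (baseChange_injective hinj) _).symm

theorem baseChange_W_map (h : IsMHS W F) (h' : IsMHS W' F') {f : V →ₗ[ℚ] V'}
    (hW : ∀ n, (W n).map f ≤ W' n) (hF : ∀ p, (F p).map (f.baseChange ℂ) ≤ F' p)
    (hs : Function.Surjective f) (k : ℤ) :
    (W' k).baseChange ℂ = ((W k).baseChange ℂ).map (f.baseChange ℂ) := by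
  rw [h.isHodgeSplitting.W_eq, h'.isHodgeSplitting.W_eq]
  exact (map_gspan_eq h.isHodgeSplitting.internal h'.isHodgeSplitting.internal
    (delSplit_map hW hF) (baseChange_surjective hs) _).symm

end

/-- The evaluation `V ⊗ V^∨ → ℚ`. -/
def evalLin (V : Type*) [AddCommGroup V] [Module ℚ V] : V ⊗[ℚ] Module.Dual ℚ V →ₗ[ℚ] ℚ :=
  TensorProduct.lift (Module.Dual.eval ℚ V)

theorem evalLin_tmulC (x : ℂ ⊗[ℚ] V) (φ : ℂ ⊗[ℚ] Module.Dual ℚ V) :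
    (evalLin V).baseChange ℂ (tmulC V (Module.Dual ℚ V) x φ) = dualC V φ x ⊗ₜ 1 := by
  induction x using TensorProduct.induction_on with
  | zero => simp only [map_zero, LinearMap.zero_apply, TensorProduct.zero_tmul]
  | add x x' hx hx' => simp only [map_add, LinearMap.add_apply, hx, hx', TensorProduct.add_tmul]
  | tmul a v =>
    induction φ using TensorProduct.induction_on with
    | zero => simp only [map_zero, LinearMap.zero_apply, TensorProduct.zero_tmul]
    | add y y' hy hy' => simp only [map_add, LinearMap.add_apply, hy, hy', TensorProduct.add_tmul]
    | tmul b l =>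
      rw [tmulC_tmul, dualC_tmul, dual_baseChange_tmul]
      have : (evalLin V).baseChange ℂ ((a * b) ⊗ₜ (v ⊗ₜ l)) = (a * b) ⊗ₜ (l v) := rfl
      have e : l v = l v • (1 : ℚ) := by simp
      rw [this, e, TensorProduct.tmul_smul, TensorProduct.smul_tmul', Rat.smul_def]
      congr 1
      simp
      ring

theorem tmul_one_injective {a b : ℂ} (h : a ⊗ₜ[ℚ] (1 : ℚ) = b ⊗ₜ[ℚ] (1 : ℚ)) : a = b := by
  simpa using congrArg (TensorProduct.rid ℚ ℂ) h

end Triv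

variable {V₀ : FilSp}

/-- The objects of the Tannakian category generated by a mixed Hodge structure are mixed Hodge
structures. -/
theorem TannakaGen.isMHS (h₀ : IsMHS V₀.W V₀.F) {A : FilSp} (hA : TannakaGen V₀ A) :
    IsMHS A.W A.F := by
  induction hA with
  | self => exact h₀
  | unit => exact (IsHodgeSplitting.unit ℚ).isMHS
  | @tensor A B _ _ h1 h2 =>
    have := h1.finite
    have := h2.finite
    exact (h1.isHodgeSplitting.tensor h2.isHodgeSplitting).isMHS
  | @dual A _ h1 =>
    have := h1.finite
    exact h1.isHodgeSplitting.dual.isMHS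
  | @prod A B _ _ h1 h2 =>
    have := h1.finite
    have := h2.finite
    exact (h1.isHodgeSplitting.prod h2.isHodgeSplitting).isMHS
  | sub f _ h _ _ _ => exact h
  | quot f _ h _ _ _ => exact h

/-- The Deligne bigrading of an object. -/
abbrev FilSp.gr (A : FilSp) : Bideg → Submodule ℂ (ℂ ⊗[ℚ] A.V) := delSplit A.W A.F

theorem TannakaGen.splitting (h₀ : IsMHS V₀.W V₀.F) {A : FilSp} (hA : TannakaGen V₀ A) :
    IsHodgeSplitting A.W A.F A.gr := (hA.isMHS h₀).isHodgeSplitting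

theorem FilSp.IsHom.gr {A B : FilSp} {f : A.V →ₗ[ℚ] B.V} (hf : A.IsHom B f) (s : Bideg)
    (x : ℂ ⊗[ℚ] A.V) (hx : x ∈ A.gr s) : f.baseChange ℂ x ∈ B.gr s :=
  delSplit_map hf.map_W hf.map_F s x hx

theorem tmulC_mem_gr {A B : FilSp} (h : Monotone (A.tensor B).W) {s t : Bideg}
    {x : ℂ ⊗[ℚ] A.V} {y : ℂ ⊗[ℚ] B.V} (hx : x ∈ A.gr s) (hy : y ∈ B.gr t) :
    tmulC A.V B.V x y ∈ (A.tensor B).gr (s + t) :=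
  tmulC_mem_delSplit hx hy (fun _ => le_rfl) h (fun _ => le_rfl)

theorem mem_gr_unit (x : ℂ ⊗[ℚ] FilSp.unit.V) : x ∈ FilSp.unit.gr 0 := by
  have hF : FilSp.unit.F 0 = ⊤ := by
    change (if (0 : ℤ) ≤ 0 then ⊤ else ⊥) = _
    exact if_pos le_rfl
  have hW : FilSp.unit.W 0 = ⊤ := by
    change (if (0 : ℤ) ≤ 0 then ⊤ else ⊥) = _
    exact if_pos le_rfl
  have hx : x ∈ (FilSp.unit.W 0).baseChange ℂ := by
    rw [hW, Submodule.baseChange_top]; exact Submodule.mem_top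
  refine ⟨⟨?_, hx⟩, Submodule.mem_sup_left ⟨mem_conjF.2 ?_, hx⟩⟩
  · rw [Prod.fst_zero, hF]; exact Submodule.mem_top
  · rw [Prod.snd_zero, hF]; exact Submodule.mem_top

/-- The action of the torus on an object, given by the Deligne bigrading. -/
def torusEquiv (h₀ : IsMHS V₀.W V₀.F) (z : ℂˣ × ℂˣ) (A : TannakaObj V₀) :
    (ℂ ⊗[ℚ] A.1.V) ≃ₗ[ℂ] (ℂ ⊗[ℚ] A.1.V) :=
  LinearEquiv.ofLinearMap (gscale (A.2.splitting h₀).internal (bichar z.1 z.2))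
    (gscale (A.2.splitting h₀).internal (bichar z.1⁻¹ z.2⁻¹))
    (by
      refine LinearMap.ext fun x => ?_
      induction x using grading_induction (A.2.splitting h₀).internal.submodule_iSup_eq_top with
      | hom s x hx =>
        rw [LinearMap.comp_apply, gscale_of_mem _ _ hx, map_smul, gscale_of_mem _ _ hx, smul_smul,
          ← bichar_mul, inv_mul_cancel, inv_mul_cancel, bichar_one, one_smul, LinearMap.id_apply]
      | zero => rw [map_zero, map_zero]
      | add x y hx hy => rw [map_add, map_add, hx, hy])
    (by
      refine LinearMap.ext fun x => ?_
      induction x using grading_induction (A.2.splitting h₀).internal.submodule_iSup_eq_top with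
      | hom s x hx =>
        rw [LinearMap.comp_apply, gscale_of_mem _ _ hx, map_smul, gscale_of_mem _ _ hx, smul_smul,
          ← bichar_mul, mul_inv_cancel, mul_inv_cancel, bichar_one, one_smul, LinearMap.id_apply]
      | zero => rw [map_zero, map_zero]
      | add x y hx hy => rw [map_add, map_add, hx, hy])

theorem torusEquiv_of_mem (h₀ : IsMHS V₀.W V₀.F) (z : ℂˣ × ℂˣ) (A : TannakaObj V₀) {s : Bideg}
    {x : ℂ ⊗[ℚ] A.1.V} (hx : x ∈ A.1.gr s) :
    torusEquiv h₀ z A x = bichar z.1 z.2 s • x :=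
  gscale_of_mem (A.2.splitting h₀).internal _ hx

/-- The homomorphism from the torus to the Mumford–Tate group defined by the Deligne bigradings. -/
def torus (h₀ : IsMHS V₀.W V₀.F) : ℂˣ × ℂˣ →* mumfordTate V₀ where
  toFun z := ⟨torusEquiv h₀ z, by
    refine ⟨fun A B f hf x => ?_, fun A B x y => ?_, ?_⟩
    · exact gscale_map (A.2.splitting h₀).internal (B.2.splitting h₀).internal hf.gr _ x
    · change torusEquiv h₀ z ⟨A.1.tensor B.1, A.2.tensor B.2⟩ (tmulC A.1.V B.1.V x y) =
        tmulC A.1.V B.1.V (torusEquiv h₀ z A x) (torusEquiv h₀ z B y)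
      induction x using grading_induction (A.2.splitting h₀).internal.submodule_iSup_eq_top with
      | hom s x hx =>
        induction y using grading_induction (B.2.splitting h₀).internal.submodule_iSup_eq_top with
        | hom t y hy =>
          rw [torusEquiv_of_mem h₀ z A hx, torusEquiv_of_mem h₀ z B hy, tmulC_smul_smul,
            ← bichar_add]
          exact torusEquiv_of_mem h₀ z ⟨A.1.tensor B.1, A.2.tensor B.2⟩
            (tmulC_mem_gr ((A.2.tensor B.2).isMHS h₀).W_mono hx hy)
        | zero => rw [map_zero, map_zero, map_zero]; exact map_zero _
        | add y y' hy hy' => 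
          rw [map_add, map_add, map_add, ← hy, ← hy']; exact map_add _ _ _
      | zero => rw [map_zero, map_zero, map_zero]; exact map_zero _
      | add y y' hy hy' => 
        rw [map_add, map_add, map_add, LinearMap.add_apply, LinearMap.add_apply, ← hy, ← hy']
        exact map_add _ _ _
    · refine LinearEquiv.ext fun x => ?_
      rw [torusEquiv_of_mem h₀ z ⟨FilSp.unit, TannakaGen.unit⟩ (mem_gr_unit x), bichar_zero,
        one_smul]
      rfl⟩
  map_one' := by
    refine Subtype.ext (funext fun A => LinearEquiv.ext fun x => ?_)
    change torusEquiv h₀ 1 A x = x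
    induction x using grading_induction (A.2.splitting h₀).internal.submodule_iSup_eq_top with
    | hom s x hx => rw [torusEquiv_of_mem h₀ 1 A hx, Prod.fst_one, Prod.snd_one, bichar_one, one_smul]
    | zero => rw [map_zero]
    | add x y hx hy => rw [map_add, hx, hy]
  map_mul' z z' := by
    refine Subtype.ext (funext fun A => LinearEquiv.ext fun x => ?_)
    change torusEquiv h₀ (z * z') A x = torusEquiv h₀ z A (torusEquiv h₀ z' A x)
    induction x using grading_induction (A.2.splitting h₀).internal.submodule_iSup_eq_top with
    | hom s x hx =>
      rw [torusEquiv_of_mem h₀ _ A hx, torusEquiv_of_mem h₀ _ A hx, map_smul,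
        torusEquiv_of_mem h₀ _ A hx, smul_smul, Prod.fst_mul, Prod.snd_mul, bichar_mul, mul_comm]
    | zero => rw [map_zero, map_zero, map_zero]
    | add x y hx hy => rw [map_add, map_add, map_add, hx, hy]

theorem torus_of_mem (h₀ : IsMHS V₀.W V₀.F) (z : ℂˣ × ℂˣ) (A : TannakaObj V₀) {s : Bideg}
    {x : ℂ ⊗[ℚ] A.1.V} (hx : x ∈ A.1.gr s) :
    (torus h₀ z).1 A x = bichar z.1 z.2 s • x := torusEquiv_of_mem h₀ z A hx

theorem evalLin_isHom (A : FilSp) (hW : Monotone A.W) (hF : Antitone A.F) :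
    (A.tensor A.dual).IsHom FilSp.unit (evalLin A.V) where
  map_W n := by
    refine Submodule.map_le_iff_le_comap.2 (iSup_le fun i => Submodule.map₂_le.2
      fun x hx (l : Module.Dual ℚ A.V) hl => ?_)
    change l x ∈ (if 0 ≤ n then (⊤ : Submodule ℚ ℚ) else ⊥)
    split_ifs with h
    · trivial
    · exact (Submodule.mem_dualAnnihilator _).1 hl x (hW (by omega) hx)
  map_F p := by
    refine Submodule.map_le_iff_le_comap.2 (iSup_le fun i => ?_)
    refine (map₂_mk_map (V := A.V) (V' := Module.Dual ℚ A.V) _ _).le.trans ?_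
    refine Submodule.map₂_le.2 fun x hx φ hφ => ?_
    suffices (evalLin A.V).baseChange ℂ (tmulC A.V (Module.Dual ℚ A.V) x φ) ∈
      (if p ≤ 0 then (⊤ : Submodule ℂ (ℂ ⊗[ℚ] ℚ)) else ⊥) from this
    split_ifs with h
    · trivial
    · have h1 : dualC A.V φ x = 0 := (Submodule.mem_dualAnnihilator _).1 hφ x (hF (by omega) hx)
      rw [evalLin_tmulC, h1, TensorProduct.zero_tmul]
      exact zero_mem _

theorem mumfordTate_eval (h₀ : IsMHS V₀.W V₀.F) (q : mumfordTate V₀) (A : TannakaObj V₀)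
    (x : ℂ ⊗[ℚ] A.1.V) (φ : ℂ ⊗[ℚ] Module.Dual ℚ A.1.V) :
    dualC A.1.V (q.1 ⟨A.1.dual, A.2.dual⟩ φ) (q.1 A x) = dualC A.1.V φ x := by
  have hA := A.2.isMHS h₀
  have h1 := q.2.1 ⟨A.1.tensor A.1.dual, A.2.tensor A.2.dual⟩ ⟨FilSp.unit, TannakaGen.unit⟩
    (evalLin A.1.V) (evalLin_isHom A.1 hA.W_mono hA.F_anti)
    (tmulC A.1.V (Module.Dual ℚ A.1.V) x φ)
  have h2 := q.2.2.1 A ⟨A.1.dual, A.2.dual⟩ x φ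
  rw [q.2.2.2] at h1
  apply tmul_one_injective
  refine (evalLin_tmulC _ _).symm.trans (Eq.trans ?_ (evalLin_tmulC _ _))
  exact (congrArg ((evalLin A.1.V).baseChange ℂ) h2.symm).trans h1.symm

theorem GrTriv.tannaka (h₀ : IsMHS V₀.W V₀.F) {A : FilSp} (hA : TannakaGen V₀ A) :
    ∀ n : mumfordTate V₀, GrTriv V₀.W (n.1 ⟨V₀, TannakaGen.self⟩).toLinearMap →
      GrTriv A.W (n.1 ⟨A, hA⟩).toLinearMap := by
  induction hA with
  | self => exact fun n hn => hn
  | unit =>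
    intro n hn k x hx
    have : n.1 ⟨FilSp.unit, TannakaGen.unit⟩ x = x := by rw [n.2.2.2]; rfl
    rw [LinearEquiv.coe_coe, this, sub_self]
    exact zero_mem _
  | @tensor A B hA hB h1 h2 =>
    intro n hn
    exact GrTriv.tensor (hB.isMHS h₀).W_mono (h1 n hn) (h2 n hn)
      fun x y => n.2.2.1 ⟨A, hA⟩ ⟨B, hB⟩ x y
  | @dual A hA h1 =>
    intro n hn
    have := (hA.isMHS h₀).finite
    exact GrTriv.dual (hA.isMHS h₀).W_mono (h1 n hn)
      fun x φ => mumfordTate_eval h₀ n ⟨A, hA⟩ x φ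
  | @prod A B hA hB h1 h2 =>
    intro n hn
    have f1 : (A.prod B).IsHom A (LinearMap.fst ℚ A.V B.V) :=
      ⟨fun n => Submodule.map_le_iff_le_comap.2 fun x hx => hx.1,
        fun n => Submodule.map_le_iff_le_comap.2 fun x hx => hx.1⟩
    have f2 : (A.prod B).IsHom B (LinearMap.snd ℚ A.V B.V) :=
      ⟨fun n => Submodule.map_le_iff_le_comap.2 fun x hx => hx.2,
        fun n => Submodule.map_le_iff_le_comap.2 fun x hx => hx.2⟩
    exact GrTriv.prod (h1 n hn) (h2 n hn)
      (fun x => n.2.1 ⟨A.prod B, hA.prod hB⟩ ⟨A, hA⟩ _ f1 x)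
      fun x => n.2.1 ⟨A.prod B, hA.prod hB⟩ ⟨B, hB⟩ _ f2 x
  | @sub A B f hA hB hf hinj h1 =>
    intro n hn k x hx
    have e := baseChange_W_comap hB (hA.isMHS h₀) hf.map_W hf.map_F hinj
    rw [e] at hx ⊢
    rw [Submodule.mem_comap, map_sub]
    have h3 := n.2.1 ⟨B, hA.sub f hB hf hinj⟩ ⟨A, hA⟩ f hf x
    rw [LinearEquiv.coe_coe, ← h3]
    exact h1 n hn k _ hx
  | @quot A B f hA hB hf hs h1 =>
    intro n hn k x hx
    have e := baseChange_W_map (hA.isMHS h₀) hB hf.map_W hf.map_F hs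
    rw [e] at hx ⊢
    obtain ⟨y, hy, rfl⟩ := hx
    refine ⟨n.1 ⟨A, hA⟩ y - y, h1 n hn k y hy, ?_⟩
    rw [map_sub]
    exact congrArg (· - _) (n.2.1 ⟨A, hA⟩ ⟨B, hA.quot f hB hf hs⟩ f hf y).symm

theorem torus_actsOnSplit (h₀ : IsMHS V₀.W V₀.F) (z w : ℂˣ) (A : TannakaObj V₀) :
    ActsOnSplit A.1.W A.1.gr ((torus h₀ (z, w)).1 A).toLinearMap z w := fun s x hx => by
  rw [LinearEquiv.coe_coe, torus_of_mem h₀ _ A hx, sub_self]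
  exact zero_mem _

/-- The elements of `h₀(z, w)` act in the prescribed way on all objects. -/
theorem hodgeHom_acts (h₀ : IsMHS V₀.W V₀.F) {z w : ℂˣ} {q : mumfordTate V₀}
    (hq : q ∈ hodgeHom V₀ z w) (A : TannakaObj V₀) :
    ActsOnSplit A.1.W A.1.gr (q.1 A).toLinearMap z w := by
  have hs := h₀.isHodgeSplitting
  have h1 : ActsOnSplit V₀.W V₀.gr (q.1 ⟨V₀, TannakaGen.self⟩).toLinearMap z w :=
    (actsAsHodge_iff hs h₀.W_mono).1 hq
  have h2 := torus_actsOnSplit h₀ z⁻¹ w⁻¹ ⟨V₀, TannakaGen.self⟩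
  have h3 := h1.mul hs h₀.W_mono h2
  rw [mul_inv_cancel, mul_inv_cancel] at h3
  have h4 : GrTriv A.1.W ((q * torus h₀ (z⁻¹, w⁻¹)).1 A).toLinearMap :=
    GrTriv.tannaka h₀ A.2 (q * torus h₀ (z⁻¹, w⁻¹)) (h3.grTriv hs h₀.W_mono)
  have hA := A.2.splitting h₀
  have h5 := ActsOnSplit.mul_left hA (A.2.isMHS h₀).W_mono h4 (torus_actsOnSplit h₀ z w A)
  have e : ((q * torus h₀ (z⁻¹, w⁻¹)).1 A).toLinearMap * ((torus h₀ (z, w)).1 A).toLinearMap =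
      (q.1 A).toLinearMap := by
    have : (q * torus h₀ (z⁻¹, w⁻¹)) * torus h₀ (z, w) = q := by
      rw [mul_assoc, ← map_mul, Prod.mk_mul_mk, inv_mul_cancel, inv_mul_cancel]
      exact (congrArg (q * ·) (map_one (torus h₀))).trans (mul_one q)
    conv_rhs => rw [← this]
    rfl
  rwa [e] at h5

theorem torus_mem_hodgeHom (h₀ : IsMHS V₀.W V₀.F) (z w : ℂˣ) :
    torus h₀ (z, w) ∈ hodgeHom V₀ z w :=
  (actsAsHodge_iff h₀.isHodgeSplitting h₀.W_mono).2 (torus_actsOnSplit h₀ z w ⟨V₀, TannakaGen.self⟩)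

/-! ## Subobjects of gradings -/

section GradedSub

variable {M N : Type*} [AddCommGroup M] [Module ℂ M] [AddCommGroup N] [Module ℂ N]
  {I : Bideg → Submodule ℂ M}

theorem gcomp_gscale (hI : DirectSum.IsInternal I) (c : Bideg → ℂ) (s : Bideg) (x : M) :
    gcomp hI s (gscale hI c x) = c s • gcomp hI s x := by
  induction x using grading_induction hI.submodule_iSup_eq_top with
  | hom t x hx =>
    rw [gscale_of_mem hI c hx, map_smul]
    by_cases hst : t = s
    · rw [hst]
    · rw [gcomp_of_ne hI hst hx, smul_zero, smul_zero]
  | zero => simp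
  | add x y hx hy => simp only [map_add, smul_add, hx, hy]

/-- A subspace that is stable under the torus is graded. -/
theorem gcomp_mem_of_stable [FiniteDimensional ℂ M] (hI : DirectSum.IsInternal I)
    {Z : Submodule ℂ M} (hZ : ∀ x ∈ Z, gscale hI (bichar twoU threeU) x ∈ Z) (s : Bideg)
    {x : M} (hx : x ∈ Z) : gcomp hI s x ∈ Z := by
  set T : Module.End ℂ M := gscale hI (bichar twoU threeU) with hT
  have h1 := Submodule.inf_iSup_genEigenspace (p := Z) (f := T) hZ 1
  have h2 : ⨆ μ, T.genEigenspace μ 1 = ⊤ := by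
    rw [eq_top_iff, ← hI.submodule_iSup_eq_top]
    refine iSup_le fun t => le_trans ?_ (le_iSup _ (bichar twoU threeU t))
    intro y hy
    exact Module.End.mem_eigenspace_iff.2 (gscale_of_mem hI _ hy)
  rw [h2, inf_top_eq] at h1
  have h3 : ∀ μ, Z ⊓ T.genEigenspace μ 1 ≤ Z.comap (gcomp hI s) := by
    rintro μ y ⟨hy1, hy2⟩
    have hy3 : T y = μ • y := Module.End.mem_eigenspace_iff.1 hy2
    have hy4 : ∀ t, (bichar twoU threeU t - μ) • gcomp hI t y = 0 := fun t => by
      rw [sub_smul, ← gcomp_gscale, ← hT, hy3, map_smul, sub_self]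
    rw [Submodule.mem_comap]
    by_cases hs : gcomp hI s y = 0
    · rw [hs]; exact zero_mem _
    · have hμ : bichar twoU threeU s = μ :=
        sub_eq_zero.1 ((smul_eq_zero.1 (hy4 s)).resolve_right hs)
      have : y - gcomp hI s y = 0 := by
        refine eq_zero_of_gcomp hI fun t => ?_
        rw [map_sub]
        by_cases hst : s = t
        · subst hst
          rw [gcomp_of_mem hI (gcomp_mem hI s y), sub_self]
        · rw [gcomp_of_ne hI hst (gcomp_mem hI s y), sub_zero]
          refine (smul_eq_zero.1 (hy4 t)).resolve_left fun h => hst ?_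
          exact bichar_injective (hμ.trans (sub_eq_zero.1 h).symm)
      rw [← sub_eq_zero.1 this]
      exact hy1
  have h4 : Z ≤ Z.comap (gcomp hI s) := by
    conv_lhs => rw [h1]
    exact iSup_le h3
  exact h4 hx

theorem isInternal_comap (hI : DirectSum.IsInternal I) {j : N →ₗ[ℂ] M}
    (hj : Function.Injective j) (h : ∀ s x, gcomp hI s (j x) ∈ LinearMap.range j) :
    DirectSum.IsInternal fun s => (I s).comap j := by
  have h1 : ∀ x, (gscale hI (bichar twoU threeU) ∘ₗ j) x ∈ LinearMap.range j := fun x =>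
    mem_of_gcomp hI fun s => by
      rw [LinearMap.comp_apply, gcomp_gscale]
      exact Submodule.smul_mem _ _ (h s x)
  let T := (LinearEquiv.ofInjective j hj).symm.toLinearMap ∘ₗ
    (gscale hI (bichar twoU threeU) ∘ₗ j).codRestrict (LinearMap.range j) h1
  have hT : ∀ x, j (T x) = gscale hI (bichar twoU threeU) (j x) := fun x => by
    have := LinearEquiv.apply_symm_apply (LinearEquiv.ofInjective j hj)
      ((gscale hI (bichar twoU threeU) ∘ₗ j).codRestrict (LinearMap.range j) h1 x)
    exact congrArg Subtype.val this
  refine isInternal_of_torus T (fun s x hx => hj ?_) ?_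
  · rw [hT, map_smul]
    exact gscale_of_mem hI _ hx
  · rw [eq_top_iff]
    intro x _
    choose y hy using fun s => h s x
    obtain ⟨U, hU⟩ := exists_sum_gcomp hI (j x)
    have : x = ∑ s ∈ U, y s := hj (by rw [hU U subset_rfl, map_sum]; simp only [hy])
    rw [this]
    refine Submodule.sum_mem _ fun s _ => Submodule.mem_iSup_of_mem s ?_
    rw [Submodule.mem_comap, hy]
    exact gcomp_mem hI s _

end GradedSub

theorem IsHodgeSplitting.comap {V : Type*} [AddCommGroup V] [Module ℚ V]
    {W : ℤ → Submodule ℚ V} {F : ℤ → Submodule ℂ (ℂ ⊗[ℚ] V)}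
    {I : Bideg → Submodule ℂ (ℂ ⊗[ℚ] V)} (h : IsHodgeSplitting W F I)
    {V' : Type*} [AddCommGroup V'] [Module ℚ V'] {f : V' →ₗ[ℚ] V} (hf : Function.Injective f)
    (hg : ∀ s x, gcomp h.internal s (f.baseChange ℂ x) ∈ LinearMap.range (f.baseChange ℂ)) :
    IsHodgeSplitting (fun n => (W n).comap f) (fun p => (F p).comap (f.baseChange ℂ))
      (fun s => (I s).comap (f.baseChange ℂ)) := by
  have hI := isInternal_comap h.internal (baseChange_injective hf) hg
  have hc : ∀ S, (gspan I S).comap (f.baseChange ℂ) =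
      gspan (fun s => (I s).comap (f.baseChange ℂ)) S := fun S =>
    comap_gspan_eq hI h.internal (fun s x hx => hx) (baseChange_injective hf) S
  have hW : ∀ n, ((W n).comap f).baseChange ℂ =
      gspan (fun s => (I s).comap (f.baseChange ℂ)) {s | s.1 + s.2 ≤ n} := fun n => by
    rw [baseChange_comap, h.W_eq, hc]
  refine ⟨hI, hW, fun p => by rw [h.F_eq, hc], fun s x hx => ?_⟩
  have h1 := h.conj s _ hx
  rw [conjC_baseChange, h.W_eq, ← gspan_singleton (I := I) s.swap, gspan_sup] at h1
  have h2 := (hc _).le h1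
  rw [← gspan_sup, gspan_singleton, ← hW] at h2
  exact h2

/-! ## Representations of the Mumford–Tate group -/

section

variable {V V' : Type*} [AddCommGroup V] [Module ℚ V] [AddCommGroup V'] [Module ℚ V']

theorem dual_baseChange_prod (l : Module.Dual ℚ V) (l' : Module.Dual ℚ V') (z : ℂ ⊗[ℚ] (V × V')) :
    Module.Dual.baseChange ℂ (l ∘ₗ LinearMap.fst ℚ V V' + l' ∘ₗ LinearMap.snd ℚ V V') z =
      Module.Dual.baseChange ℂ l ((LinearMap.fst ℚ V V').baseChange ℂ z) +
      Module.Dual.baseChange ℂ l' ((LinearMap.snd ℚ V V').baseChange ℂ z) := by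
  generalize hL : l ∘ₗ LinearMap.fst ℚ V V' + l' ∘ₗ LinearMap.snd ℚ V V' = L
  induction z using TensorProduct.induction_on with
  | zero => simp
  | tmul a v =>
    rw [LinearMap.baseChange_tmul, LinearMap.baseChange_tmul, dual_baseChange_tmul,
      dual_baseChange_tmul, dual_baseChange_tmul, ← hL]
    simp [mul_add]
  | add x y hx hy => simp only [map_add, hx, hy]; ring

theorem dual_baseChange_tmulC (l : Module.Dual ℚ V) (l' : Module.Dual ℚ V') (x : ℂ ⊗[ℚ] V)
    (y : ℂ ⊗[ℚ] V') :
    Module.Dual.baseChange ℂ (LinearMap.mul' ℚ ℚ ∘ₗ TensorProduct.map l l') (tmulC V V' x y) =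
      Module.Dual.baseChange ℂ l x * Module.Dual.baseChange ℂ l' y := by
  induction x using TensorProduct.induction_on with
  | zero => simp
  | add x x' hx hx' => simp only [map_add, LinearMap.add_apply, hx, hx', add_mul]
  | tmul a v =>
    induction y using TensorProduct.induction_on with
    | zero => simp
    | add y y' hy hy' => simp only [map_add, hy, hy', mul_add]
    | tmul b v' =>
      rw [tmulC_tmul, dual_baseChange_tmul, dual_baseChange_tmul, dual_baseChange_tmul]
      simp
      ring

theorem twist_twist_symm (σ : ℂ ≃+* ℂ) (x : ℂ ⊗[ℚ] V) :
    twist (σ : ℂ →+* ℂ) V (twist (σ.symm : ℂ →+* ℂ) V x) = x := by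
  induction x using TensorProduct.induction_on with
  | zero => simp
  | add x y hx hy => simp only [map_add, hx, hy]
  | tmul a v => simp

theorem twist_symm_twist (σ : ℂ ≃+* ℂ) (x : ℂ ⊗[ℚ] V) :
    twist (σ.symm : ℂ →+* ℂ) V (twist (σ : ℂ →+* ℂ) V x) = x := by
  induction x using TensorProduct.induction_on with
  | zero => simp
  | add x y hx hy => simp only [map_add, hx, hy]
  | tmul a v => simp

end

section Rep

variable {V₀ : FilSp}

/-- The regular functions on the Mumford–Tate group are the matrix coefficients of the objects
of the Tannakian category. -/
theorem exists_eq_coeff {u : mumfordTate V₀ → ℂ} (hu : u ∈ AlgGp.coord (G := mumfordTate V₀)) :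
    ∃ (A : TannakaObj V₀) (v : A.1.V) (l : Module.Dual ℚ A.1.V),
      u = fun g => Module.Dual.baseChange ℂ l (g.1 A (1 ⊗ₜ v)) := by
  induction hu using Algebra.adjoin_induction with
  | mem u hu => exact hu
  | algebraMap r =>
    refine ⟨⟨FilSp.unit, TannakaGen.unit⟩, (r : ℚ), (LinearMap.id : ℚ →ₗ[ℚ] ℚ), ?_⟩
    funext g
    rw [g.2.2.2]
    refine Eq.trans ?_ (dual_baseChange_tmul (LinearMap.id : ℚ →ₗ[ℚ] ℚ) (1 : ℂ) r).symm
    simp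
  | add x y _ _ hx hy =>
    obtain ⟨A, v, l, rfl⟩ := hx
    obtain ⟨B, v', l', rfl⟩ := hy
    have f1 : (A.1.prod B.1).IsHom A.1 (LinearMap.fst ℚ A.1.V B.1.V) :=
      ⟨fun n => Submodule.map_le_iff_le_comap.2 fun x hx => hx.1,
        fun n => Submodule.map_le_iff_le_comap.2 fun x hx => hx.1⟩
    have f2 : (A.1.prod B.1).IsHom B.1 (LinearMap.snd ℚ A.1.V B.1.V) :=
      ⟨fun n => Submodule.map_le_iff_le_comap.2 fun x hx => hx.2,
        fun n => Submodule.map_le_iff_le_comap.2 fun x hx => hx.2⟩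
    refine ⟨⟨A.1.prod B.1, A.2.prod B.2⟩, (v, v'),
      (l ∘ₗ LinearMap.fst ℚ A.1.V B.1.V + l' ∘ₗ LinearMap.snd ℚ A.1.V B.1.V :
        Module.Dual ℚ (A.1.V × B.1.V)), ?_⟩
    funext g
    have h1 := g.2.1 ⟨A.1.prod B.1, A.2.prod B.2⟩ A _ f1 (1 ⊗ₜ[ℚ] (v, v'))
    have h2 := g.2.1 ⟨A.1.prod B.1, A.2.prod B.2⟩ B _ f2 (1 ⊗ₜ[ℚ] (v, v'))
    refine Eq.trans ?_ (dual_baseChange_prod l l' _).symm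
    change Module.Dual.baseChange ℂ l _ + Module.Dual.baseChange ℂ l' _ = _
    refine congrArg₂ (· + ·) (congrArg _ ?_) (congrArg _ ?_)
    · exact h1
    · exact h2
  | mul x y _ _ hx hy =>
    obtain ⟨A, v, l, rfl⟩ := hx
    obtain ⟨B, v', l', rfl⟩ := hy
    refine ⟨⟨A.1.tensor B.1, A.2.tensor B.2⟩, (v ⊗ₜ[ℚ] v' : A.1.V ⊗[ℚ] B.1.V),
      (LinearMap.mul' ℚ ℚ ∘ₗ TensorProduct.map l l' : Module.Dual ℚ (A.1.V ⊗[ℚ] B.1.V)), ?_⟩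
    funext g
    have h1 := g.2.2.1 A B (1 ⊗ₜ v) (1 ⊗ₜ v')
    refine (dual_baseChange_tmulC l l' _ _).symm.trans (congrArg _ ?_)
    refine h1.symm.trans (congrArg _ ?_)
    exact (tmulC_tmul 1 1 v v').trans (congrArg (· ⊗ₜ[ℚ] (v ⊗ₜ[ℚ] v')) (mul_one 1))

/-- The conjugate of an element of the Mumford–Tate group by an automorphism of `ℂ`. -/
def mtTwist (σ : ℂ ≃+* ℂ) (g : mumfordTate V₀) : mumfordTate V₀ :=
  ⟨fun A => LinearEquiv.ofBijective
    ({ toFun := fun x => twist (σ : ℂ →+* ℂ) A.1.V (g.1 A (twist (σ.symm : ℂ →+* ℂ) A.1.V x))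
       map_add' := fun x y => by simp only [map_add]
       map_smul' := fun c x => by
        simp only [LinearMap.map_smulₛₗ, map_smul]
        simp } : (ℂ ⊗[ℚ] A.1.V) →ₗ[ℂ] (ℂ ⊗[ℚ] A.1.V))
    (by
      refine Function.bijective_iff_has_inverse.2
        ⟨fun x => twist (σ : ℂ →+* ℂ) A.1.V ((g.1 A).symm (twist (σ.symm : ℂ →+* ℂ) A.1.V x)),
        fun x => ?_, fun x => ?_⟩
      · simp [twist_twist_symm, twist_symm_twist]
      · simp [twist_twist_symm, twist_symm_twist]), by
    refine ⟨fun A B f hf x => ?_, fun A B x y => ?_, LinearEquiv.ext fun x => ?_⟩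
    · change twist (σ : ℂ →+* ℂ) B.1.V (g.1 B (twist (σ.symm : ℂ →+* ℂ) B.1.V (f.baseChange ℂ x))) =
        f.baseChange ℂ (twist (σ : ℂ →+* ℂ) A.1.V (g.1 A (twist (σ.symm : ℂ →+* ℂ) A.1.V x)))
      rw [twist_baseChange, g.2.1 A B f hf, twist_baseChange]
    · have h1 := twist_tmulC (σ.symm : ℂ →+* ℂ) x y
      have h2 := g.2.2.1 A B (twist (σ.symm : ℂ →+* ℂ) A.1.V x) (twist (σ.symm : ℂ →+* ℂ) B.1.V y)
      refine (congrArg (fun t => twist (σ : ℂ →+* ℂ) (A.1.tensor B.1).V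
        (g.1 ⟨A.1.tensor B.1, A.2.tensor B.2⟩ t)) h1).trans ?_
      refine (congrArg (twist (σ : ℂ →+* ℂ) (A.1.tensor B.1).V) h2).trans ?_
      exact twist_tmulC (σ : ℂ →+* ℂ) _ _
    · change twist (σ : ℂ →+* ℂ) _ (g.1 ⟨FilSp.unit, TannakaGen.unit⟩
        (twist (σ.symm : ℂ →+* ℂ) _ x)) = x
      rw [g.2.2.2]
      exact twist_twist_symm σ x⟩

theorem mtTwist_apply (σ : ℂ ≃+* ℂ) (g : mumfordTate V₀) (A : TannakaObj V₀) (x : ℂ ⊗[ℚ] A.1.V) :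
    (mtTwist σ g).1 A (twist (σ : ℂ →+* ℂ) A.1.V x) = twist (σ : ℂ →+* ℂ) A.1.V (g.1 A x) := by
  change twist (σ : ℂ →+* ℂ) A.1.V (g.1 A (twist (σ.symm : ℂ →+* ℂ) A.1.V
    (twist (σ : ℂ →+* ℂ) A.1.V x))) = _
  rw [twist_symm_twist]

/-- The homomorphisms from an object of the Tannakian category to a representation. -/
def IsMor (A : TannakaObj V₀) (B : AlgRep (mumfordTate V₀)) (f : A.1.V →ₗ[ℚ] B.V) : Prop :=
  ∀ (g : mumfordTate V₀) (x : ℂ ⊗[ℚ] A.1.V),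
      f.baseChange ℂ (g.1 A x) = B.ρ g (f.baseChange ℂ x)

/-- The orbit of a vector in a representation is the image of the orbit of a vector in an object
of the Tannakian category. -/
theorem exists_orbit_map (B : AlgRep (mumfordTate V₀)) (v : B.V) :
    ∃ (A : TannakaObj V₀) (x : A.1.V) (f : A.1.V →ₗ[ℚ] B.V), ∀ g : mumfordTate V₀,
      f.baseChange ℂ (g.1 A (1 ⊗ₜ x)) = B.ρ g (1 ⊗ₜ v) := by
  classical
  let b := Module.finBasis ℚ B.V
  have key : ∀ S : Finset (Fin (Module.finrank ℚ B.V)),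
      ∃ (A : TannakaObj V₀) (x : A.1.V) (f : A.1.V →ₗ[ℚ] B.V), ∀ g : mumfordTate V₀,
      f.baseChange ℂ (g.1 A (1 ⊗ₜ x)) =
        ∑ i ∈ S, Module.Dual.baseChange ℂ (b.coord i) (B.ρ g (1 ⊗ₜ v)) ⊗ₜ[ℚ] b i := by
    intro S
    induction S using Finset.induction_on with
    | empty => exact ⟨⟨FilSp.unit, TannakaGen.unit⟩, 0, 0, fun g => by simp⟩
    | insert i S hi ih =>
      obtain ⟨A, x, f, hf⟩ := ih
      obtain ⟨C, y, l, hl⟩ := exists_eq_coeff (B.regular v (b.coord i))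
      have f1 : (C.1.prod A.1).IsHom C.1 (LinearMap.fst ℚ C.1.V A.1.V) :=
        ⟨fun n => Submodule.map_le_iff_le_comap.2 fun x hx => hx.1,
          fun n => Submodule.map_le_iff_le_comap.2 fun x hx => hx.1⟩
      have f2 : (C.1.prod A.1).IsHom A.1 (LinearMap.snd ℚ C.1.V A.1.V) :=
        ⟨fun n => Submodule.map_le_iff_le_comap.2 fun x hx => hx.2,
          fun n => Submodule.map_le_iff_le_comap.2 fun x hx => hx.2⟩
      let f' : (C.1.V × A.1.V) →ₗ[ℚ] B.V :=
        (LinearMap.toSpanSingleton ℚ B.V (b i) ∘ₗ l) ∘ₗ LinearMap.fst ℚ C.1.V A.1.V +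
          f ∘ₗ LinearMap.snd ℚ C.1.V A.1.V
      refine ⟨⟨C.1.prod A.1, C.2.prod A.2⟩, (y, x), f', fun g => ?_⟩
      have h1 := g.2.1 ⟨C.1.prod A.1, C.2.prod A.2⟩ C _ f1 (1 ⊗ₜ[ℚ] (y, x))
      have h2 := g.2.1 ⟨C.1.prod A.1, C.2.prod A.2⟩ A _ f2 (1 ⊗ₜ[ℚ] (y, x))
      have e : ∀ z : ℂ ⊗[ℚ] (C.1.V × A.1.V), f'.baseChange ℂ z =
          Module.Dual.baseChange ℂ l ((LinearMap.fst ℚ C.1.V A.1.V).baseChange ℂ z) ⊗ₜ[ℚ] b i +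
          f.baseChange ℂ ((LinearMap.snd ℚ C.1.V A.1.V).baseChange ℂ z) := by
        intro z
        induction z using TensorProduct.induction_on with
        | zero => simp
        | tmul a w =>
          rw [LinearMap.baseChange_tmul, LinearMap.baseChange_tmul, LinearMap.baseChange_tmul,
            dual_baseChange_tmul, LinearMap.baseChange_tmul]
          simp only [f', LinearMap.add_apply, LinearMap.comp_apply, LinearMap.fst_apply,
            LinearMap.snd_apply, LinearMap.toSpanSingleton_apply, TensorProduct.tmul_add]
          rw [TensorProduct.tmul_smul, TensorProduct.smul_tmul', Rat.smul_def, mul_comm]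
        | add x y hx hy => simp only [map_add, hx, hy, TensorProduct.add_tmul]; abel
      refine (e _).trans ?_
      rw [Finset.sum_insert hi, ← hf]
      refine congrArg₂ (· + ·) (congrArg (· ⊗ₜ[ℚ] b i) ?_) (congrArg _ ?_)
      · exact (congrArg _ h1.symm).trans (congrFun hl g).symm
      · exact h2.symm
  obtain ⟨A, x, f, hf⟩ := key Finset.univ
  refine ⟨A, x, f, fun g => (hf g).trans ?_⟩
  have e : ∀ z : ℂ ⊗[ℚ] B.V, ∑ i, Module.Dual.baseChange ℂ (b.coord i) z ⊗ₜ[ℚ] b i = z := by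
    intro z
    induction z using TensorProduct.induction_on with
    | zero => simp
    | tmul a w =>
      conv_rhs => rw [← b.sum_repr w, TensorProduct.tmul_sum]
      refine Finset.sum_congr rfl fun i _ => ?_
      rw [dual_baseChange_tmul, TensorProduct.tmul_smul, TensorProduct.smul_tmul', Rat.smul_def,
        mul_comm]
      rfl
    | add x y hx hy =>
      conv_rhs => rw [← hx, ← hy]
      simp only [map_add, TensorProduct.add_tmul, Finset.sum_add_distrib]
  exact e _

/-- Every vector of a representation is in the image of an object of the Tannakian category. -/
theorem exists_mor (h₀ : IsMHS V₀.W V₀.F) (B : AlgRep (mumfordTate V₀)) (v : B.V) :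
    ∃ (A : TannakaObj V₀) (f : A.1.V →ₗ[ℚ] B.V) (x : A.1.V), IsMor A B f ∧ f x = v := by
  obtain ⟨A, x, f, hf⟩ := exists_orbit_map B v
  have hA := A.2.isMHS h₀
  have := hA.finite
  have hs := A.2.splitting h₀
  let Z : Submodule ℂ (ℂ ⊗[ℚ] A.1.V) :=
    Submodule.span ℂ (Set.range fun g : mumfordTate V₀ => g.1 A (1 ⊗ₜ x))
  have hZg : ∀ g : mumfordTate V₀, ∀ y ∈ Z, g.1 A y ∈ Z := fun g y hy => by
    have : Z ≤ Z.comap (g.1 A).toLinearMap := Submodule.span_le.2 (by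
      rintro _ ⟨g', rfl⟩
      exact Submodule.subset_span ⟨g * g', rfl⟩)
    exact this hy
  have hZσ : ∀ σ : ℂ ≃+* ℂ, ∀ y ∈ Z, twist (σ : ℂ →+* ℂ) A.1.V y ∈ Z := fun σ y hy => by
    induction hy using Submodule.span_induction with
    | mem y hy =>
      obtain ⟨g, rfl⟩ := hy
      refine Submodule.subset_span ⟨mtTwist σ g, ?_⟩
      change (mtTwist σ g).1 A (1 ⊗ₜ x) = _
      rw [← mtTwist_apply, twist_tmul, map_one]
    | zero => rw [map_zero]; exact zero_mem _
    | add y y' _ _ h1 h2 => rw [map_add]; exact add_mem h1 h2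
    | smul c y _ h1 => rw [LinearMap.map_smulₛₗ]; exact Submodule.smul_mem _ _ h1
  set P : Submodule ℚ A.1.V := (Z.restrictScalars ℚ).comap (TensorProduct.mk ℚ ℂ A.1.V 1) with hP
  have hPZ : P.baseChange ℂ = Z := exists_baseChange_of_twist Z hZσ
  have hr : LinearMap.range (P.subtype.baseChange ℂ) = Z := by
    rw [← hPZ, ← Submodule.map_top, ← Submodule.baseChange_top, ← baseChange_map, Submodule.map_top,
      Submodule.range_subtype]
  have hg : ∀ s y, gcomp hs.internal s (P.subtype.baseChange ℂ y) ∈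
      LinearMap.range (P.subtype.baseChange ℂ) := fun s y => by
    have hy : P.subtype.baseChange ℂ y ∈ Z := hr ▸ LinearMap.mem_range_self _ y
    rw [hr]
    exact gcomp_mem_of_stable hs.internal (fun z hz => hZg (torus h₀ (twoU, threeU)) z hz) s hy
  have hsP := hs.comap P.injective_subtype hg
  let C : FilSp := ⟨P, fun n => (A.1.W n).comap P.subtype,
    fun p => (A.1.F p).comap (P.subtype.baseChange ℂ)⟩
  have hC : TannakaGen V₀ C := A.2.sub (B := C) P.subtype hsP.isMHS
    ⟨fun n => Submodule.map_comap_le _ _, fun n => Submodule.map_comap_le _ _⟩ P.injective_subtype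
  have hi : C.IsHom A.1 P.subtype :=
    ⟨fun n => Submodule.map_comap_le _ _, fun n => Submodule.map_comap_le _ _⟩
  have hxP : x ∈ P := Submodule.subset_span ⟨1, rfl⟩
  refine ⟨⟨C, hC⟩, f ∘ₗ P.subtype, ⟨x, hxP⟩, fun g y => ?_, ?_⟩
  · have h1 := g.2.1 ⟨C, hC⟩ A P.subtype hi y
    have h2 : ∀ z : ℂ ⊗[ℚ] P, (f ∘ₗ P.subtype).baseChange ℂ z =
        f.baseChange ℂ (P.subtype.baseChange ℂ z) := fun z => by
      rw [LinearMap.baseChange_comp]; rfl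
    have hfz : ∀ z ∈ Z, f.baseChange ℂ (g.1 A z) = B.ρ g (f.baseChange ℂ z) := fun z hz => by
      induction hz using Submodule.span_induction with
      | mem z hz =>
        obtain ⟨g', rfl⟩ := hz
        rw [hf g']
        refine (hf (g * g')).trans ?_
        rw [map_mul]
        rfl
      | zero => simp
      | add z z' _ _ h1 h2 => simp only [map_add, h1, h2]
      | smul c z _ h1 => simp only [map_smul, h1]
    refine (h2 _).trans ((congrArg (f.baseChange ℂ) h1.symm).trans ?_)
    refine (hfz _ (hr ▸ LinearMap.mem_range_self _ y)).trans (congrArg _ (h2 y).symm)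
  · have h1 := hf 1
    rw [map_one] at h1
    exact one_tmul_injective h1

end Rep

/-! ## Families of Hodge splittings -/

section Fam

variable {G : Type*} [Group G] [AlgGp G]

/-- A functorial bigrading of the representations, compatible with tensor products. -/
structure IsGradFam (I : ∀ A : AlgRep G, Bideg → Submodule ℂ (ℂ ⊗[ℚ] A.V)) : Prop where
  functorial : ∀ (A B : AlgRep G) (f : A.V →ₗ[ℚ] B.V), A.IsHom B f →
    ∀ s, ∀ x ∈ I A s, f.baseChange ℂ x ∈ I B s
  tensor : ∀ (A B T : AlgRep G) (e : (A.V ⊗[ℚ] B.V) ≃ₗ[ℚ] T.V), A.IsTensorIso B T e →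
    ∀ s t, ∀ x ∈ I A s, ∀ y ∈ I B t, e.toLinearMap.baseChange ℂ (tmulC A.V B.V x y) ∈ I T (s + t)
  unit : ∀ A : AlgRep G, (∀ g, A.ρ g = 1) → ∀ x, x ∈ I A 0

theorem AlgRep.IsTensorIso.apply {A B T : AlgRep G} {e : (A.V ⊗[ℚ] B.V) ≃ₗ[ℚ] T.V}
    (he : A.IsTensorIso B T e) (g : G) (x : ℂ ⊗[ℚ] A.V) (y : ℂ ⊗[ℚ] B.V) :
    T.ρ g (e.toLinearMap.baseChange ℂ (tmulC A.V B.V x y)) =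
      e.toLinearMap.baseChange ℂ (tmulC A.V B.V (A.ρ g x) (B.ρ g y)) := by
  rw [he, tmulC_apply, LinearEquiv.apply_symm_apply, TensorProduct.map_tmul]
  rfl

/-- A family of Hodge splittings defines a `G`-mixed Hodge structure. -/
theorem IsGradFam.isGMHS {I : ∀ A : AlgRep G, Bideg → Submodule ℂ (ℂ ⊗[ℚ] A.V)}
    (hI : IsGradFam I) {h₀ : ℂˣ → ℂˣ → Set G} {H : FilFam G}
    (hs : ∀ A, IsHodgeSplitting (weightFil h₀ A) (H A) (I A)) : IsGMHS h₀ H where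
  mhs A := (hs A).isMHS
  functorial A B f hf p := by
    rw [(hs A).F_eq, (hs B).F_eq]
    exact map_gspan_le (hI.functorial A B f hf) _
  exact_left A B f hf hinj p := by
    rw [(hs A).F_eq, (hs B).F_eq]
    exact (comap_gspan_eq (hs A).internal (hs B).internal (hI.functorial A B f hf)
      (baseChange_injective hinj) _).symm
  exact_right A B f hf hsurj p := by
    rw [(hs A).F_eq, (hs B).F_eq]
    exact map_gspan_eq (hs A).internal (hs B).internal (hI.functorial A B f hf)
      (baseChange_surjective hsurj) _
  unit A _ hA p := by
    have h1 : unitGr A.V = I A := by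
      refine eq_of_le_grading (hs A).internal (fun s x hx => ?_)
        (isInternal_unitGr A.V).submodule_iSup_eq_top
      rw [unitGr] at hx
      split_ifs at hx with h
      · rw [h]; exact hI.unit A hA x
      · rw [Submodule.mem_bot] at hx; rw [hx]; exact zero_mem _
    classical
    rw [(hs A).F_eq, ← h1, gspan_unitGr]
    simp
  tensor A B T e he p := by
    have h1 := tensorF_eq (hs A).F_eq (hs B).F_eq p
    have h2 : (tensorF (H A) (H B) p).map (e.toLinearMap.baseChange ℂ) = H T p := by
      rw [h1, (hs T).F_eq]
      refine map_gspan_eq (isInternal_tensorGr (hs A).internal (hs B).internal) (hs T).internal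
        (fun s x hx => ?_) (baseChange_surjective e.surjective) _
      have : tensorGr (I A) (I B) s ≤ (I T s).comap (e.toLinearMap.baseChange ℂ) := by
        refine iSup_le fun a => Submodule.map₂_le.2 fun x hx y hy => ?_
        have := hI.tensor A B T e he a (s - a) x hx y hy
        rwa [add_sub_cancel] at this
      exact this hx
    exact h2.symm

/-- The translate of a graded family. -/
theorem IsGradFam.act {I : ∀ A : AlgRep G, Bideg → Submodule ℂ (ℂ ⊗[ℚ] A.V)}
    (hI : IsGradFam I) (g : G) : IsGradFam fun A s => (I A s).map (A.ρ g) where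
  functorial A B f hf s := by
    rintro _ ⟨x, hx, rfl⟩
    exact ⟨_, hI.functorial A B f hf s x hx, (hf g x).symm⟩
  tensor A B T e he s t := by
    rintro _ ⟨x, hx, rfl⟩ _ ⟨y, hy, rfl⟩
    exact ⟨_, hI.tensor A B T e he s t x hx y hy, he.apply g x y⟩
  unit A hA x := ⟨x, hI.unit A hA x, by rw [hA]; rfl⟩

end Fam

section MapTriv

variable {V : Type*} [AddCommGroup V] [Module ℚ V] {W : ℤ → Submodule ℚ V}
  {F : ℤ → Submodule ℂ (ℂ ⊗[ℚ] V)} {I : Bideg → Submodule ℂ (ℂ ⊗[ℚ] V)}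

theorem map_gspan {M N ι : Type*} [AddCommGroup M] [Module ℂ M] [AddCommGroup N] [Module ℂ N]
    (J : ι → Submodule ℂ M) (f : M →ₗ[ℂ] N) (S : Set ι) :
    (gspan J S).map f = gspan (fun s => (J s).map f) S := by
  simp only [gspan, Submodule.map_iSup]

theorem IsHodgeSplitting.le_W (h : IsHodgeSplitting W F I) (s : Bideg) :
    I s ≤ (W (s.1 + s.2)).baseChange ℂ := by
  rw [h.W_eq]
  exact le_gspan (s := s) (by simp)

theorem IsHodgeSplitting.W_mono (h : IsHodgeSplitting W F I) : Monotone W := fun a b hab =>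
  baseChange_le_iff.1 (by
    rw [h.W_eq, h.W_eq]
    exact gspan_mono fun s (hs : s.1 + s.2 ≤ a) => hs.trans hab)

/-- The translate of a Hodge splitting under an automorphism that is trivial on `gr^W`. -/
theorem IsHodgeSplitting.map (h : IsHodgeSplitting W F I) {a b : Module.End ℂ (ℂ ⊗[ℚ] V)}
    (hab : a * b = 1) (hba : b * a = 1) (ha : GrTriv W a) (hb : GrTriv W b) :
    IsHodgeSplitting W (fun p => (F p).map a) (fun s => (I s).map a) where
  internal := by
    have hab' : ∀ x, a (b x) = x := fun x => LinearMap.congr_fun hab x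
    have hba' : ∀ x, b (a x) = x := fun x => LinearMap.congr_fun hba x
    refine isInternal_of_torus (a * gscale h.internal (bichar twoU threeU) * b) ?_ ?_
    · rintro s _ ⟨x, hx, rfl⟩
      rw [Module.End.mul_apply, Module.End.mul_apply, hba', gscale_of_mem _ _ hx, map_smul]
    · rw [← Submodule.map_iSup, h.internal.submodule_iSup_eq_top, Submodule.map_top,
        LinearMap.range_eq_top]
      exact fun x => ⟨b x, hab' x⟩
  W_eq n := by
    rw [← map_gspan, ← h.W_eq]
    apply le_antisymm
    · exact fun x hx => ⟨b x, hb.mem h.W_mono hx, LinearMap.congr_fun hab x⟩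
    · rintro _ ⟨x, hx, rfl⟩
      exact ha.mem h.W_mono hx
  F_eq p := by rw [h.F_eq, map_gspan]
  conj := by
    rintro s _ ⟨x, hx, rfl⟩
    obtain ⟨y, hy, t, ht, hyt⟩ := Submodule.mem_sup.1 (h.conj s x hx)
    have h1 := ha _ x (h.le_W s hx)
    have hy' : y ∈ (W (s.1 + s.2)).baseChange ℂ := by
      have := h.le_W _ hy
      rwa [Prod.fst_swap, Prod.snd_swap, add_comm] at this
    have h2 := ha _ y hy'
    have e : conjC V (a x) = a y + (t + conjC V (a x - x) - (a y - y)) := by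
      rw [map_sub, ← hyt]
      abel
    rw [e]
    exact Submodule.mem_sup.2 ⟨a y, ⟨y, hy, rfl⟩, _,
      sub_mem (add_mem ht ((conjC_mem_baseChange _).2 h1)) h2, rfl⟩

theorem ActsOnSplit.map (h : IsHodgeSplitting W F I) {a g : Module.End ℂ (ℂ ⊗[ℚ] V)}
    (ha : GrTriv W a) {z w : ℂˣ} (hg : ActsOnSplit W I g z w) :
    ActsOnSplit W (fun s => (I s).map a) g z w := by
  rintro s _ ⟨x, hx, rfl⟩
  have h1 := ha _ x (h.le_W s hx)
  have e : g (a x) - bichar z w s • a x =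
      (g x - bichar z w s • x) + (g (a x - x) - bichar z w s • (a x - x)) := by
    rw [map_sub, smul_sub]
    abel
  rw [e]
  exact add_mem (hg s x hx) (sub_mem (hg.mem h h.W_mono h1) (Submodule.smul_mem _ _ h1))

end MapTriv

/-! ## The base point of the period domain of the Mumford–Tate group -/

section BasePoint

variable {V₀ : FilSp}

/-- The bigrading of a representation by the characters of the torus. -/
def repGr (h₀ : IsMHS V₀.W V₀.F) (B : AlgRep (mumfordTate V₀)) (s : Bideg) :
    Submodule ℂ (ℂ ⊗[ℚ] B.V) :=
  ⨅ z : ℂˣ × ℂˣ, LinearMap.ker (B.ρ (torus h₀ z) - bichar z.1 z.2 s • LinearMap.id)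

theorem mem_repGr (h₀ : IsMHS V₀.W V₀.F) {B : AlgRep (mumfordTate V₀)} {s : Bideg} {x : ℂ ⊗[ℚ] B.V} :
    x ∈ repGr h₀ B s ↔ ∀ z : ℂˣ × ℂˣ, B.ρ (torus h₀ z) x = bichar z.1 z.2 s • x := by
  simp only [repGr, Submodule.mem_iInf, LinearMap.mem_ker, LinearMap.sub_apply, sub_eq_zero,
    LinearMap.smul_apply, LinearMap.id_apply]

theorem IsMor.repGr (h₀ : IsMHS V₀.W V₀.F) {A : TannakaObj V₀} {B : AlgRep (mumfordTate V₀)} {f : A.1.V →ₗ[ℚ] B.V}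
    (hf : IsMor A B f) (s : Bideg) (x : ℂ ⊗[ℚ] A.1.V) (hx : x ∈ A.1.gr s) :
    f.baseChange ℂ x ∈ repGr h₀ B s := by
  rw [mem_repGr]
  intro z
  rw [← hf, torus_of_mem h₀ z A hx, map_smul]

theorem rep_induction (h₀ : IsMHS V₀.W V₀.F) (B : AlgRep (mumfordTate V₀)) {p : ℂ ⊗[ℚ] B.V → Prop}
    (mor : ∀ (A : TannakaObj V₀) (f : A.1.V →ₗ[ℚ] B.V), IsMor A B f → ∀ x, p (f.baseChange ℂ x))
    (add : ∀ x y, p x → p y → p (x + y)) (y : ℂ ⊗[ℚ] B.V) : p y := by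
  induction y using TensorProduct.induction_on with
  | zero =>
    have : IsMor ⟨FilSp.unit, TannakaGen.unit⟩ B 0 := fun g x => by simp
    simpa using mor _ _ this 0
  | tmul a v =>
    obtain ⟨A, f, x, hf, rfl⟩ := exists_mor h₀ B v
    exact mor A f hf (a ⊗ₜ x)
  | add x y hx hy => exact add x y hx hy

theorem isInternal_repGr (h₀ : IsMHS V₀.W V₀.F) (B : AlgRep (mumfordTate V₀)) : DirectSum.IsInternal (repGr h₀ B) := by
  refine isInternal_of_torus (B.ρ (torus h₀ (twoU, threeU)))
    (fun s x hx => (mem_repGr h₀).1 hx (twoU, threeU)) ?_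
  refine Submodule.eq_top_iff'.2 fun y => ?_
  induction y using rep_induction h₀ B with
  | mor A f hf x =>
    induction x using grading_induction (A.2.splitting h₀).internal.submodule_iSup_eq_top with
    | hom s x hx => exact Submodule.mem_iSup_of_mem s (hf.repGr h₀ s x hx)
    | zero => rw [map_zero]; exact zero_mem _
    | add x y hx hy => rw [map_add]; exact add_mem hx hy
  | add x y hx hy => exact add_mem hx hy

theorem IsMor.gcomp (h₀ : IsMHS V₀.W V₀.F) {A : TannakaObj V₀} {B : AlgRep (mumfordTate V₀)} {f : A.1.V →ₗ[ℚ] B.V}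
    (hf : IsMor A B f) (s : Bideg) (x : ℂ ⊗[ℚ] A.1.V) :
    gcomp (isInternal_repGr h₀ B) s (f.baseChange ℂ x) =
      f.baseChange ℂ (gcomp (A.2.splitting h₀).internal s x) :=
  gcomp_map _ _ (hf.repGr h₀) s x

/-- To prove a property of the elements of `repGr h₀ B s`, it suffices to prove it for the images of
the homogeneous elements of the objects of the Tannakian category. -/
theorem repGr_induction (h₀ : IsMHS V₀.W V₀.F) {B : AlgRep (mumfordTate V₀)} {s : Bideg} {p : ℂ ⊗[ℚ] B.V → Prop}
    (mor : ∀ (A : TannakaObj V₀) (f : A.1.V →ₗ[ℚ] B.V), IsMor A B f → ∀ x ∈ A.1.gr s,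
      p (f.baseChange ℂ x))
    (add : ∀ x y, p x → p y → p (x + y)) (y : ℂ ⊗[ℚ] B.V) (hy : y ∈ repGr h₀ B s) : p y := by
  rw [← gcomp_of_mem (isInternal_repGr h₀ B) hy]
  clear hy
  induction y using rep_induction h₀ B with
  | mor A f hf x =>
    rw [hf.gcomp h₀]
    exact mor A f hf _ (gcomp_mem _ _ _)
  | add x y hx hy => rw [map_add]; exact add _ _ hx hy

/-- The weight filtration of a representation. -/
def repW (B : AlgRep (mumfordTate V₀)) (n : ℤ) : Submodule ℚ B.V :=
  ⨆ (A : TannakaObj V₀) (f : A.1.V →ₗ[ℚ] B.V) (_ : IsMor A B f), (A.1.W n).map f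

theorem repW_eq (h₀ : IsMHS V₀.W V₀.F) (B : AlgRep (mumfordTate V₀)) (n : ℤ) :
    (repW B n).baseChange ℂ = gspan (repGr h₀ B) {s | s.1 + s.2 ≤ n} := by
  simp only [repW, baseChange_iSup, baseChange_map]
  apply le_antisymm
  · refine iSup_le fun A => iSup_le fun f => iSup_le fun hf => ?_
    rw [(A.2.splitting h₀).W_eq]
    exact map_gspan_le (hf.repGr h₀) _
  · refine gspan_le.2 fun s hs y hy => ?_
    refine repGr_induction h₀ (fun A f hf x hx => ?_) (fun x y hx hy => ?_) y hy
    · refine Submodule.mem_iSup_of_mem A (Submodule.mem_iSup_of_mem f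
        (Submodule.mem_iSup_of_mem hf ⟨x, ?_, rfl⟩))
      rw [SetLike.mem_coe, (A.2.splitting h₀).W_eq]
      exact le_gspan hs hx
    · exact add_mem hx hy

theorem basePointQ_eq (h₀ : IsMHS V₀.W V₀.F) (B : AlgRep (mumfordTate V₀)) (p : ℤ) :
    basePointQ V₀ B p = gspan (repGr h₀ B) {s | p ≤ s.1} := by
  apply le_antisymm
  · refine iSup_le fun A => iSup_le fun f => iSup_le fun hf => ?_
    rw [(A.2.splitting h₀).F_eq]
    exact map_gspan_le (IsMor.repGr h₀ hf) _
  · refine gspan_le.2 fun s hs y hy => ?_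
    refine repGr_induction h₀ (fun A f hf x hx => ?_) (fun x y hx hy => ?_) y hy
    · refine Submodule.mem_iSup_of_mem A (Submodule.mem_iSup_of_mem f
        (Submodule.mem_iSup_of_mem hf ⟨x, ?_, rfl⟩))
      rw [SetLike.mem_coe, (A.2.splitting h₀).F_eq]
      exact le_gspan hs hx
    · exact add_mem hx hy

theorem IsMor.mem_repW (h₀ : IsMHS V₀.W V₀.F) {A : TannakaObj V₀} {B : AlgRep (mumfordTate V₀)} {f : A.1.V →ₗ[ℚ] B.V}
    (hf : IsMor A B f) {n : ℤ} {x : ℂ ⊗[ℚ] A.1.V} (hx : x ∈ (A.1.W n).baseChange ℂ) :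
    f.baseChange ℂ x ∈ (repW B n).baseChange ℂ := by
  rw [repW_eq h₀]
  rw [(A.2.splitting h₀).W_eq] at hx
  exact map_gspan_le (hf.repGr h₀) _ ⟨x, hx, rfl⟩

theorem repSplitting (h₀ : IsMHS V₀.W V₀.F) (B : AlgRep (mumfordTate V₀)) :
    IsHodgeSplitting (repW B) (basePointQ V₀ B) (repGr h₀ B) where
  internal := isInternal_repGr h₀ B
  W_eq := repW_eq h₀ B
  F_eq := basePointQ_eq h₀ B
  conj s y hy := by
    refine repGr_induction h₀ (p := fun y => conjC B.V y ∈ repGr h₀ B s.swap ⊔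
      (repW B (s.1 + s.2 - 1)).baseChange ℂ) (fun A f hf x hx => ?_) (fun x y hx hy => ?_) y hy
    · rw [conjC_baseChange]
      obtain ⟨a, ha, b, hb, hab⟩ := Submodule.mem_sup.1 ((A.2.splitting h₀).conj s x hx)
      rw [← hab, map_add]
      exact Submodule.add_mem_sup (hf.repGr h₀ _ _ ha) (hf.mem_repW h₀ hb)
    · rw [map_add]; exact add_mem hx hy

theorem hodgeHom_actsOnSplit (h₀ : IsMHS V₀.W V₀.F) {z w : ℂˣ} {q : mumfordTate V₀} (hq : q ∈ hodgeHom V₀ z w)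
    (B : AlgRep (mumfordTate V₀)) : ActsOnSplit (repW B) (repGr h₀ B) (B.ρ q) z w := by
  intro s y hy
  refine repGr_induction h₀ (p := fun y => B.ρ q y - bichar z w s • y ∈
    (repW B (s.1 + s.2 - 1)).baseChange ℂ) (fun A f hf x hx => ?_) (fun x y hx hy => ?_) y hy
  · rw [← hf, ← map_smul, ← map_sub]
    exact hf.mem_repW h₀ (hodgeHom_acts h₀ hq A s x hx)
  · have := add_mem hx hy
    rw [map_add, smul_add]
    rwa [← add_sub_add_comm] at this

/-- An eigenvector of weight `k` for an element that acts on `gr^W_m` by `2 ^ m` lies in `W_k`. -/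
theorem mem_W_of_eigen {V : Type*} [AddCommGroup V] [Module ℚ V] [Module.Finite ℚ V]
    {W : ℤ → Submodule ℚ V}
    {F : ℤ → Submodule ℂ (ℂ ⊗[ℚ] V)} {I : Bideg → Submodule ℂ (ℂ ⊗[ℚ] V)}
    (h : IsHodgeSplitting W F I) {a : Module.End ℂ (ℂ ⊗[ℚ] V)}
    (ha : ActsOnSplit W I a twoU twoU) {k : ℤ} {x : ℂ ⊗[ℚ] V}
    (hx : a x = (2 : ℂ) ^ k • x) : x ∈ (W k).baseChange ℂ := by
  obtain ⟨N, hN⟩ := h.isMHS.W_top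
  have hW := h.W_mono
  have step : ∀ m, k < m → x ∈ (W m).baseChange ℂ → x ∈ (W (m - 1)).baseChange ℂ := by
    intro m hm hxm
    have h1 : gspan I {s | s.1 + s.2 ≤ m} ≤ ((W (m - 1)).baseChange ℂ).comap
        (a - (2 : ℂ) ^ m • LinearMap.id) := gspan_le.2 fun s hs y hy => by
      rw [Submodule.mem_comap, LinearMap.sub_apply, LinearMap.smul_apply, LinearMap.id_apply]
      by_cases hsm : s.1 + s.2 = m
      · have := ha s y hy
        rw [bichar, ← zpow_add₀ twoU.ne_zero, hsm] at this
        exact this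
      · have hy' : y ∈ (W (m - 1)).baseChange ℂ := by
          rw [h.W_eq]
          refine le_gspan (s := s) ?_ hy
          have : s.1 + s.2 ≤ m := hs
          change s.1 + s.2 ≤ m - 1
          omega
        exact sub_mem (ha.mem h hW hy') (Submodule.smul_mem _ _ hy')
    have h2 := h1 ((h.W_eq m).le hxm)
    rw [Submodule.mem_comap, LinearMap.sub_apply, hx, LinearMap.smul_apply, LinearMap.id_apply,
      ← sub_smul] at h2
    refine (Submodule.smul_mem_iff _ ?_).1 h2
    rw [sub_ne_zero]
    intro h3
    have h4 : ((2 : ℝ) ^ k) = 2 ^ m := by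
      have : (((2 : ℝ) ^ k : ℝ) : ℂ) = ((2 ^ m : ℝ) : ℂ) := by push_cast; exact h3
      exact_mod_cast this
    exact hm.ne (zpow_right_injective₀ (by norm_num) (by norm_num) h4)
  have all : ∀ n : ℕ, x ∈ (W (max k (N - n))).baseChange ℂ := by
    intro n
    induction n with
    | zero =>
      refine Submodule.baseChange_mono ℂ (hW (le_max_right k (N - (0 : ℕ)))) ?_
      rw [Nat.cast_zero, sub_zero, hN, Submodule.baseChange_top]
      exact Submodule.mem_top
    | succ n ih =>
      by_cases hk : k < N - n
      · rw [max_eq_right hk.le] at ih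
        have := step _ hk ih
        refine Submodule.baseChange_mono ℂ (hW ?_) this
        push_cast
        omega
      · rw [max_eq_left (by omega)] at ih
        exact Submodule.baseChange_mono ℂ (hW (le_max_left _ _)) ih
  have := all (N - k).toNat
  rwa [max_eq_left (by omega)] at this

/-- A criterion for the weight filtration to be the one of a splitting. -/
theorem weightFil_eq {G : Type*} [Group G] [AlgGp G] {h : ℂˣ → ℂˣ → Set G} {A : AlgRep G}
    {W : ℤ → Submodule ℚ A.V} {F : ℤ → Submodule ℂ (ℂ ⊗[ℚ] A.V)}
    {I : Bideg → Submodule ℂ (ℂ ⊗[ℚ] A.V)} (hs : IsHodgeSplitting W F I)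
    (hact : ∀ z w, ∀ g ∈ h z w, ActsOnSplit W I (A.ρ g) z w)
    (lam : ℂˣ →* G) (hlam : IsCocharacter lam) (hlam' : ∀ t, lam t ∈ h t t)
    (heig : ∀ t s, ∀ x ∈ I s, A.ρ (lam t) x = (t : ℂ) ^ (s.1 + s.2) • x) : weightFil h A = W := by
  funext n
  apply le_antisymm
  · refine iSup₂_le fun l hl v hv => ?_
    rw [← one_tmul_mem_baseChange_iff]
    have : (⨆ (k : ℤ) (_ : k ≤ n), ⨅ t : ℂˣ,
      LinearMap.ker (A.ρ (l t) - ((t : ℂ) ^ k) • 1)) ≤ (W n).baseChange ℂ := by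
      refine iSup₂_le fun k hk x hx => ?_
      have hx2 := (Submodule.mem_iInf _).1 hx twoU
      rw [LinearMap.mem_ker, LinearMap.sub_apply, sub_eq_zero] at hx2
      exact Submodule.baseChange_mono ℂ (hs.W_mono hk)
        (mem_W_of_eigen hs (hact _ _ _ (hl.2 twoU)) hx2)
    exact this hv
  · intro v hv
    refine Submodule.mem_iSup_of_mem lam (Submodule.mem_iSup_of_mem ⟨hlam, hlam'⟩ ?_)
    rw [← one_tmul_mem_baseChange_iff, hs.W_eq] at hv
    suffices this : gspan I {s | s.1 + s.2 ≤ n} ≤ ⨆ (k : ℤ) (_ : k ≤ n), ⨅ t : ℂˣ,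
        LinearMap.ker (A.ρ (lam t) - ((t : ℂ) ^ k) • 1) from this hv
    refine gspan_le.2 fun s hss x hx => ?_
    refine Submodule.mem_iSup_of_mem (s.1 + s.2) (Submodule.mem_iSup_of_mem hss ?_)
    rw [Submodule.mem_iInf]
    intro t
    rw [LinearMap.mem_ker, LinearMap.sub_apply, heig t s x hx, sub_eq_zero]
    rfl

/-- The weight cocharacter. -/
def weightCochar (h₀ : IsMHS V₀.W V₀.F) : ℂˣ →* mumfordTate V₀ := (torus h₀).comp ((MonoidHom.id ℂˣ).prod (MonoidHom.id ℂˣ))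

theorem weightCochar_apply (h₀ : IsMHS V₀.W V₀.F) (t : ℂˣ) : weightCochar h₀ t = torus h₀ (t, t) := rfl

theorem isCocharacter_weightCochar (h₀ : IsMHS V₀.W V₀.F) : IsCocharacter (weightCochar h₀) := by
  intro u hu
  obtain ⟨A, v, l, rfl⟩ := exists_eq_coeff hu
  have hs := A.2.splitting h₀
  have key : ∀ x : ℂ ⊗[ℚ] A.1.V, (fun t => Module.Dual.baseChange ℂ l ((weightCochar h₀ t).1 A x)) ∈
      Submodule.span ℂ (Set.range fun (k : ℤ) (t : ℂˣ) => (t : ℂ) ^ k) := by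
    intro x
    induction x using grading_induction hs.internal.submodule_iSup_eq_top with
    | hom s x hx =>
      have : (fun t => Module.Dual.baseChange ℂ l ((weightCochar h₀ t).1 A x)) =
          Module.Dual.baseChange ℂ l x • fun t : ℂˣ => (t : ℂ) ^ (s.1 + s.2) := by
        funext t
        rw [weightCochar_apply, torus_of_mem h₀ _ A hx, map_smul, bichar, Pi.smul_apply,
          ← zpow_add₀ t.ne_zero, smul_eq_mul, smul_eq_mul, mul_comm]
      rw [this]
      exact Submodule.smul_mem _ _ (Submodule.subset_span ⟨_, rfl⟩)
    | zero => simp only [map_zero]; exact zero_mem _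
    | add x y hx hy => simp only [map_add]; exact add_mem hx hy
  exact key _

theorem weightCochar_eigen (h₀ : IsMHS V₀.W V₀.F) (B : AlgRep (mumfordTate V₀)) (t : ℂˣ) (s : Bideg) (x : ℂ ⊗[ℚ] B.V)
    (hx : x ∈ repGr h₀ B s) : B.ρ (weightCochar h₀ t) x = (t : ℂ) ^ (s.1 + s.2) • x := by
  rw [weightCochar_apply, (mem_repGr h₀).1 hx, bichar, ← zpow_add₀ t.ne_zero]

theorem weightFil_hodgeHom (h₀ : IsMHS V₀.W V₀.F) (B : AlgRep (mumfordTate V₀)) :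
    weightFil (hodgeHom V₀) B = repW B :=
  weightFil_eq (repSplitting h₀ B) (fun _ _ _ hg => hodgeHom_actsOnSplit h₀ hg B)
    (weightCochar h₀) (isCocharacter_weightCochar h₀) (fun t => torus_mem_hodgeHom h₀ t t)
    (weightCochar_eigen h₀ B)

theorem tmulC_eigen {V V' : Type*} [AddCommGroup V] [Module ℚ V] [AddCommGroup V'] [Module ℚ V']
    {x x' : ℂ ⊗[ℚ] V} {y y' : ℂ ⊗[ℚ] V'} {c d : ℂ} (hx : x' = c • x) (hy : y' = d • y) :
    tmulC V V' x' y' = (c * d) • tmulC V V' x y := by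
  subst hx hy
  exact tmulC_smul_smul c d x y

theorem isGradFam_repGr (h₀ : IsMHS V₀.W V₀.F) : IsGradFam (repGr h₀) := by
  refine ⟨fun A B f hf s x hx => ?_, fun A B T e he s t x hx y hy => ?_, fun A hA x => ?_⟩
  · rw [mem_repGr] at hx ⊢
    intro z
    rw [← hf, hx z, map_smul]
  · rw [mem_repGr] at hx hy ⊢
    intro z
    have h1 := tmulC_eigen (hx z) (hy z)
    refine (he.apply _ x y).trans ((congrArg (e.toLinearMap.baseChange ℂ) h1).trans ?_)
    exact (LinearMap.map_smul _ _ _).trans (congrArg (· • _) (bichar_add z.1 z.2 s t).symm)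
  · rw [mem_repGr]
    intro z
    rw [hA, bichar_zero, one_smul]
    rfl

theorem coord_one_rat {u : mumfordTate V₀ → ℂ} (hu : u ∈ AlgGp.coord (G := mumfordTate V₀)) :
    ∃ c : ℚ, u 1 = c := by
  obtain ⟨A, v, l, rfl⟩ := exists_eq_coeff hu
  refine ⟨l v, ?_⟩
  exact (dual_baseChange_tmul l 1 v).trans (one_mul _)

theorem basePointQ_mem (h₀ : IsMHS V₀.W V₀.F) : basePointQ V₀ ∈ periodDomain (hodgeHom V₀) := by
  have hs : ∀ B, IsHodgeSplitting (weightFil (hodgeHom V₀) B) (basePointQ V₀ B) (repGr h₀ B) :=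
    fun B => by rw [weightFil_hodgeHom h₀]; exact repSplitting h₀ B
  refine ⟨(isGradFam_repGr h₀).isGMHS hs, 1, fun u hu _ => ?_, fun A z w g hg => ?_⟩
  · obtain ⟨c, hc⟩ := coord_one_rat hu
    rw [hc]
    exact Complex.ratCast_im c
  · rw [one_mul, inv_one, mul_one, weightFil_hodgeHom h₀]
    exact (actsAsHodge_iff (repSplitting h₀ A) (repSplitting h₀ A).W_mono).2
      (hodgeHom_actsOnSplit h₀ hg A)

end BasePoint

/-! ## Enveloping algebras and their augmentation quotients -/

section Lift

attribute [local instance 100] LieRing.ofAssociativeRing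

theorem ue_lie {k : Type*} [CommRing k] {L : Type*} [LieRing L] [LieAlgebra k L] (x y : L) :
    UniversalEnvelopingAlgebra.ι k ⁅x, y⁆ =
      (UniversalEnvelopingAlgebra.ι k x * UniversalEnvelopingAlgebra.ι k y -
        UniversalEnvelopingAlgebra.ι k y * UniversalEnvelopingAlgebra.ι k x :
          UniversalEnvelopingAlgebra k L) :=
  LieHom.map_lie (UniversalEnvelopingAlgebra.ι k : L →ₗ⁅k⁆ UniversalEnvelopingAlgebra k L) x y

theorem exists_ueLift {k : Type*} [CommRing k] {L : Type*} [LieRing L] [LieAlgebra k L] {A : Type*}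
    [Ring A] [Algebra k A] (f : L → A) (ha : ∀ x y, f (x + y) = f x + f y)
    (hs : ∀ (c : k) x, f (c • x) = c • f x) (hf : ∀ x y, f ⁅x, y⁆ = f x * f y - f y * f x) :
    ∃ F : UniversalEnvelopingAlgebra k L →ₐ[k] A, ∀ x, F (UniversalEnvelopingAlgebra.ι k x) = f x :=
  ⟨UniversalEnvelopingAlgebra.lift (A := A) k
    { toFun := f, map_add' := ha, map_smul' := hs, map_lie' := fun {x y} => hf x y },
    fun x => UniversalEnvelopingAlgebra.lift_ι_apply (A := A) k _ x⟩

theorem ue_ext {k : Type*} [CommRing k] {L : Type*} [LieRing L] [LieAlgebra k L] {A : Type*}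
    [Ring A] [Algebra k A] {f g : UniversalEnvelopingAlgebra k L →ₐ[k] A}
    (h : ∀ x, f (UniversalEnvelopingAlgebra.ι k x) = g (UniversalEnvelopingAlgebra.ι k x)) : f = g :=
  UniversalEnvelopingAlgebra.hom_ext (A := A) k (LieHom.ext h)

end Lift

section UE

variable {k : Type*} [CommRing k] {L : Type*} [LieRing L] [LieAlgebra k L]

/-- The canonical map from a Lie algebra to its enveloping algebra, as a linear map. -/
def ueι (k : Type*) [CommRing k] (L : Type*) [LieRing L] [LieAlgebra k L] :
    L →ₗ[k] UniversalEnvelopingAlgebra k L where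
  toFun x := UniversalEnvelopingAlgebra.ι k x
  map_add' x y := map_add (UniversalEnvelopingAlgebra.ι k) x y
  map_smul' c x := map_smul (UniversalEnvelopingAlgebra.ι k) c x

theorem ueι_lie (x y : L) : ueι k L ⁅x, y⁆ = ueι k L x * ueι k L y - ueι k L y * ueι k L x :=
  ue_lie x y

/-- The universal property of the enveloping algebra. -/
def ueLift {A : Type*} [Ring A] [Algebra k A] (f : L →ₗ[k] A)
    (hf : ∀ x y, f ⁅x, y⁆ = f x * f y - f y * f x) : UniversalEnvelopingAlgebra k L →ₐ[k] A :=
  (exists_ueLift f f.map_add f.map_smul hf).choose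

theorem ueLift_ι {A : Type*} [Ring A] [Algebra k A] (f : L →ₗ[k] A)
    (hf : ∀ x y, f ⁅x, y⁆ = f x * f y - f y * f x) (x : L) : ueLift f hf (ueι k L x) = f x :=
  (exists_ueLift f f.map_add f.map_smul hf).choose_spec x

theorem ueHom_ext {A : Type*} [Ring A] [Algebra k A] {f g : UniversalEnvelopingAlgebra k L →ₐ[k] A}
    (h : ∀ x, f (ueι k L x) = g (ueι k L x)) : f = g := ue_ext h

theorem adjoin_ueι : Algebra.adjoin k (Set.range (ueι k L)) = ⊤ := by
  set S := Algebra.adjoin k (Set.range (ueι k L)) with hS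
  have hmem : ∀ x, ueι k L x ∈ S := fun x => Algebra.subset_adjoin ⟨x, rfl⟩
  let f : L →ₗ[k] S := (ueι k L).codRestrict (Subalgebra.toSubmodule S) hmem
  have hf : ∀ x y, f ⁅x, y⁆ = f x * f y - f y * f x := fun x y =>
    Subtype.ext (ueι_lie x y)
  have h : S.val.comp (ueLift f hf) = AlgHom.id k _ := ueHom_ext fun x => by
    rw [AlgHom.comp_apply, ueLift_ι]
    rfl
  rw [eq_top_iff]
  intro u _
  have := DFunLike.congr_fun h u
  rw [AlgHom.comp_apply, AlgHom.id_apply] at this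
  rw [← this]
  exact (ueLift f hf u).2

theorem closure_ueι : Submodule.span k (Submonoid.closure (Set.range (ueι k L)) :
    Set (UniversalEnvelopingAlgebra k L)) = ⊤ := by
  rw [← Algebra.adjoin_eq_span, adjoin_ueι]
  rfl

theorem ue_induction {p : UniversalEnvelopingAlgebra k L → Prop} (u) (one : p 1)
    (mul : ∀ x u, p u → p (ueι k L x * u)) (zero : p 0) (add : ∀ u v, p u → p v → p (u + v))
    (smul : ∀ (c : k) u, p u → p (c • u)) : p u := by
  have hu : u ∈ Submodule.span k (Submonoid.closure (Set.range (ueι k L)) :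
    Set (UniversalEnvelopingAlgebra k L)) := by rw [closure_ueι]; trivial
  induction hu using Submodule.span_induction with
  | mem u hu =>
    induction hu using Submonoid.closure_induction_left with
    | one => exact one
    | mul_left x hx y hy ih => 
      obtain ⟨x, rfl⟩ := hx
      exact mul x y ih
  | zero => exact zero
  | add u v _ _ h1 h2 => exact add u v h1 h2
  | smul c u _ h => exact smul c u h

variable (k L)

/-- The augmentation of the enveloping algebra. -/
abbrev ueε : UniversalEnvelopingAlgebra k L →ₐ[k] k := AugAlg.ε

/-- The comultiplication of the enveloping algebra. -/
abbrev ueΔ : UniversalEnvelopingAlgebra k L →ₐ[k]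
    UniversalEnvelopingAlgebra k L ⊗[k] UniversalEnvelopingAlgebra k L := AugAlg.Δ

/-- The augmentation ideal of the enveloping algebra. -/
abbrev augI : Ideal (UniversalEnvelopingAlgebra k L) := RingHom.ker (ueε k L)

/-- The quotients of the enveloping algebra by the powers of the augmentation ideal. -/
def UEQ (m : ℕ) := UniversalEnvelopingAlgebra k L ⧸ augI k L ^ m

instance (m : ℕ) : Ring (UEQ k L m) :=
  inferInstanceAs (Ring (UniversalEnvelopingAlgebra k L ⧸ augI k L ^ m))

instance (m : ℕ) : Algebra k (UEQ k L m) :=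
  inferInstanceAs (Algebra k (UniversalEnvelopingAlgebra k L ⧸ augI k L ^ m))

/-- The projection to the quotient by a power of the augmentation ideal. -/
def UEQ.mk (m : ℕ) : UniversalEnvelopingAlgebra k L →ₐ[k] UEQ k L m := Ideal.Quotient.mkₐ k _

/-- The canonical map from the Lie algebra. -/
def UEQ.ι (m : ℕ) : L →ₗ[k] UEQ k L m := (UEQ.mk k L m).toLinearMap ∘ₗ ueι k L

variable {k L}

theorem UEQ.ι_apply (m : ℕ) (x : L) : UEQ.ι k L m x = UEQ.mk k L m (ueι k L x) := rfl

theorem UEQ.mk_surjective (m : ℕ) : Function.Surjective (UEQ.mk k L m) :=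
  Ideal.Quotient.mk_surjective

theorem UEQ.mk_eq_zero {m : ℕ} {u : UniversalEnvelopingAlgebra k L} :
    UEQ.mk k L m u = 0 ↔ u ∈ augI k L ^ m := Ideal.Quotient.eq_zero_iff_mem

/-- Homomorphisms from the quotients. -/
def UEQ.lift {A : Type*} [Ring A] [Algebra k A] {m : ℕ} (f : UniversalEnvelopingAlgebra k L →ₐ[k] A)
    (hf : ∀ u ∈ augI k L ^ m, f u = 0) : UEQ k L m →ₐ[k] A := Ideal.Quotient.liftₐ _ f hf

theorem UEQ.lift_mk {A : Type*} [Ring A] [Algebra k A] {m : ℕ}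
    (f : UniversalEnvelopingAlgebra k L →ₐ[k] A)
    (hf : ∀ u ∈ augI k L ^ m, f u = 0) (u) : UEQ.lift f hf (UEQ.mk k L m u) = f u := rfl

theorem UEQ.hom_ext {A : Type*} [Ring A] [Algebra k A] {m : ℕ} {f g : UEQ k L m →ₐ[k] A}
    (h : ∀ x, f (UEQ.ι k L m x) = g (UEQ.ι k L m x)) : f = g := by
  have : f.comp (UEQ.mk k L m) = g.comp (UEQ.mk k L m) := ueHom_ext h
  ext x
  obtain ⟨u, rfl⟩ := UEQ.mk_surjective m x
  exact DFunLike.congr_fun this u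

theorem UEQ.induction {m : ℕ} {p : UEQ k L m → Prop} (u) (one : p 1)
    (mul : ∀ x u, p u → p (UEQ.ι k L m x * u)) (zero : p 0) (add : ∀ u v, p u → p v → p (u + v))
    (smul : ∀ (c : k) u, p u → p (c • u)) : p u := by
  obtain ⟨u, rfl⟩ := UEQ.mk_surjective m u
  induction u using ue_induction with
  | one => rwa [map_one]
  | mul x u h => rw [map_mul]; exact mul x _ h
  | zero => rwa [map_zero]
  | add u v h1 h2 => rw [map_add]; exact add _ _ h1 h2
  | smul c u h => rw [map_smul]; exact smul c _ h

@[simp] theorem ueε_ι (x : L) : ueε k L (ueι k L x) = 0 :=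
  UniversalEnvelopingAlgebra.lift_ι_apply (A := k) k _ x

theorem ueΔ_ι (x : L) : ueΔ k L (ueι k L x) = ueι k L x ⊗ₜ 1 + 1 ⊗ₜ ueι k L x :=
  UniversalEnvelopingAlgebra.lift_ι_apply
    (A := UniversalEnvelopingAlgebra k L ⊗[k] UniversalEnvelopingAlgebra k L) k _ x

theorem ueι_mem (x : L) : ueι k L x ∈ augI k L := ueε_ι x

theorem exists_sum_of_mem_augI (u : UniversalEnvelopingAlgebra k L) :
    u - algebraMap k _ (ueε k L u) ∈
      Submodule.span (UniversalEnvelopingAlgebra k L) (Set.range (ueι k L)) := by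
  have key : ∀ u : UniversalEnvelopingAlgebra k L, ∀ x, ueι k L x * u ∈
      Submodule.span (UniversalEnvelopingAlgebra k L) (Set.range (ueι k L)) := by
    intro u
    induction u using ue_induction with
    | one => exact fun x => by rw [mul_one]; exact Submodule.subset_span ⟨x, rfl⟩
    | mul y u h => exact fun x => Submodule.smul_mem _ (ueι k L x) (h y)
    | zero => exact fun x => by rw [mul_zero]; exact zero_mem _
    | add u v h1 h2 => exact fun x => by rw [mul_add]; exact add_mem (h1 x) (h2 x)
    | smul c u h =>
      intro x
      rw [mul_smul_comm, Algebra.smul_def]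
      exact Submodule.smul_mem _ (algebraMap k _ c) (h x)
  induction u using ue_induction with
  | one => rw [map_one, map_one, sub_self]; exact zero_mem _
  | mul x u _ =>
    rw [map_mul, ueε_ι, zero_mul, map_zero, sub_zero]
    exact key u x
  | zero => rw [map_zero, map_zero, sub_self]; exact zero_mem _
  | add u v h1 h2 =>
    rw [map_add, map_add, add_sub_add_comm]
    exact add_mem h1 h2
  | smul c u h =>
    rw [map_smul, smul_eq_mul, map_mul, Algebra.smul_def, ← mul_sub]
    exact Submodule.smul_mem _ (algebraMap k _ c) h

theorem augI_eq_span : augI k L =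
    Submodule.span (UniversalEnvelopingAlgebra k L) (Set.range (ueι k L)) := by
  apply le_antisymm
  · intro u hu
    have := exists_sum_of_mem_augI u
    rwa [(RingHom.mem_ker.1 hu : ueε k L u = 0), map_zero, sub_zero] at this
  · rw [Submodule.span_le]
    rintro _ ⟨x, rfl⟩
    exact ueι_mem x

/-- Induction on the elements of the powers of the augmentation ideal. -/
theorem augI_pow_succ_induction {m : ℕ} {p : UniversalEnvelopingAlgebra k L → Prop} {u}
    (hu : u ∈ augI k L ^ (m + 1)) (mul : ∀ a ∈ augI k L ^ m, ∀ x, p (a * ueι k L x))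
    (zero : p 0) (add : ∀ u v, p u → p v → p (u + v)) : p u := by
  rw [Submodule.pow_succ] at hu
  refine Submodule.mul_induction_on hu (fun a ha b hb => ?_) add
  rw [augI_eq_span] at hb
  have : ∀ a ∈ augI k L ^ m, p (a * b) := by
    induction hb using Submodule.span_induction with
    | mem b hb =>
      obtain ⟨x, rfl⟩ := hb
      exact fun a ha => mul a ha x
    | zero => exact fun a _ => by rwa [mul_zero]
    | add b b' _ _ h1 h2 => exact fun a ha => by rw [mul_add]; exact add _ _ (h1 a ha) (h2 a ha)
    | smul c b _ h1 =>
      intro a ha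
      rw [smul_eq_mul, ← mul_assoc]
      exact h1 _ (Ideal.mul_mem_right c _ ha)
  exact this a ha

/-- A homomorphism maps the powers of the augmentation ideal to the steps of a filtration. -/
theorem map_augI_pow {A : Type*} [Ring A] [Algebra k A] (f : UniversalEnvelopingAlgebra k L →ₐ[k] A)
    (K : ℕ → AddSubgroup A) (h0 : ∀ u, f u ∈ K 0)
    (hK : ∀ n, ∀ a ∈ K n, ∀ x, a * f (ueι k L x) ∈ K (n + 1)) (m : ℕ) :
    ∀ u ∈ augI k L ^ m, f u ∈ K m := by
  induction m with
  | zero => exact fun u _ => h0 u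
  | succ m ih =>
    intro u hu
    refine augI_pow_succ_induction (p := fun u => f u ∈ K (m + 1)) hu (fun a ha x => ?_) ?_
      (fun u v h1 h2 => ?_)
    · rw [map_mul]; exact hK m _ (ih a ha) x
    · rw [map_zero]; exact zero_mem _
    · rw [map_add]; exact add_mem h1 h2

/-- The transition maps between the quotients. -/
def UEQ.trans {m n : ℕ} (h : m ≤ n) : UEQ k L n →ₐ[k] UEQ k L m :=
  UEQ.lift (UEQ.mk k L m) fun _ hu => UEQ.mk_eq_zero.2 (Ideal.pow_le_pow_right h hu)

@[simp] theorem UEQ.trans_mk {m n : ℕ} (h : m ≤ n) (u) :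
    UEQ.trans h (UEQ.mk k L n u) = UEQ.mk k L m u := rfl

@[simp] theorem UEQ.trans_ι {m n : ℕ} (h : m ≤ n) (x) :
    UEQ.trans h (UEQ.ι k L n x) = UEQ.ι k L m x := rfl

/-- The quotients are finite over `k`. -/
theorem UEQ.finite [Module.Finite k L] (m : ℕ) : Module.Finite k (UEQ k L m) := by
  induction m with
  | zero =>
    have : Subsingleton (UEQ k L 0) := by
      rw [UEQ, Submodule.pow_zero, Ideal.one_eq_top]
      exact Ideal.Quotient.subsingleton_iff.2 rfl
    infer_instance
  | succ m ih =>
    obtain ⟨S, hS⟩ := ih.fg_top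
    obtain ⟨T, hT⟩ := Module.Finite.fg_top (R := k) (M := L)
    classical
    choose s hs using fun x : UEQ k L m => UEQ.mk_surjective m x
    refine ⟨⟨insert 1 (Finset.image₂ (fun x t => UEQ.mk k L (m + 1) (s x) * UEQ.ι k L (m + 1) t)
      S T), ?_⟩⟩
    set Z := Submodule.span k (insert 1 (Finset.image₂
      (fun x t => UEQ.mk k L (m + 1) (s x) * UEQ.ι k L (m + 1) t) S T) : Set (UEQ k L (m + 1)))
      with hZ
    have h1 : ∀ u : UniversalEnvelopingAlgebra k L, ∀ x : L,
        UEQ.mk k L (m + 1) (u * ueι k L x) ∈ Z := by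
      have h2 : ∀ y ∈ S, ∀ x : L, UEQ.mk k L (m + 1) (s y) * UEQ.ι k L (m + 1) x ∈ Z := by
        intro y hy x
        have hx : x ∈ Submodule.span k (T : Set L) := by rw [hT]; trivial
        induction hx using Submodule.span_induction with
        | mem x hx =>
          refine Submodule.subset_span (Set.mem_insert_of_mem _ ?_)
          exact Finset.mem_coe.2 (Finset.mem_image₂_of_mem hy hx)
        | zero => rw [map_zero, mul_zero]; exact zero_mem _
        | add x x' _ _ h h' => rw [map_add, mul_add]; exact add_mem h h'
        | smul c x _ h => rw [map_smul, mul_smul_comm]; exact Submodule.smul_mem _ _ h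
      intro u x
      have hu : UEQ.mk k L m u ∈ Submodule.span k (S : Set (UEQ k L m)) := by rw [hS]; trivial
      have h3 : ∀ w ∈ Submodule.span k (S : Set (UEQ k L m)), ∀ u : UniversalEnvelopingAlgebra k L,
          UEQ.mk k L m u = w → UEQ.mk k L (m + 1) (u * ueι k L x) ∈ Z := by
        intro w hw
        induction hw using Submodule.span_induction with
        | mem w hw =>
          intro u hu
          have : u - s w ∈ augI k L ^ m := by
            rw [← UEQ.mk_eq_zero, map_sub, hu, hs, sub_self]
          have h4 : UEQ.mk k L (m + 1) ((u - s w) * ueι k L x) = 0 := by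
            rw [UEQ.mk_eq_zero, Submodule.pow_succ]
            exact Ideal.mul_mem_mul this (ueι_mem x)
          rw [sub_mul, map_sub, sub_eq_zero] at h4
          rw [h4, map_mul]
          exact h2 w hw x
        | zero =>
          intro u hu
          have h4 : UEQ.mk k L (m + 1) (u * ueι k L x) = 0 := by
            rw [UEQ.mk_eq_zero, Submodule.pow_succ]
            exact Ideal.mul_mem_mul (UEQ.mk_eq_zero.1 hu) (ueι_mem x)
          rw [h4]
          exact zero_mem _
        | add w w' _ _ h h' =>
          intro u hu
          obtain ⟨v, rfl⟩ := UEQ.mk_surjective m w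
          obtain ⟨v', rfl⟩ := UEQ.mk_surjective m w'
          have e : u * ueι k L x = (u - v') * ueι k L x + v' * ueι k L x := by
            rw [← add_mul, sub_add_cancel]
          rw [e, map_add]
          refine add_mem (h _ ?_) (h' _ rfl)
          rw [map_sub, hu, add_sub_cancel_right]
        | smul c w _ h =>
          intro u hu
          obtain ⟨v, rfl⟩ := UEQ.mk_surjective m w
          have h4 : UEQ.mk k L (m + 1) ((u - c • v) * ueι k L x) = 0 := by
            rw [UEQ.mk_eq_zero, Submodule.pow_succ]
            refine Ideal.mul_mem_mul (UEQ.mk_eq_zero.1 ?_) (ueι_mem x)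
            rw [map_sub, hu, map_smul, sub_self]
          rw [sub_mul, map_sub, sub_eq_zero, smul_mul_assoc, map_smul] at h4
          rw [h4]
          exact Submodule.smul_mem _ _ (h _ rfl)
      exact h3 _ hu u rfl
    rw [Finset.coe_insert, ← hZ, eq_top_iff]
    intro w _
    obtain ⟨u, rfl⟩ := UEQ.mk_surjective (m + 1) w
    have h5 := exists_sum_of_mem_augI u
    have h6 : ∀ v ∈ Submodule.span (UniversalEnvelopingAlgebra k L) (Set.range (ueι k L)),
        UEQ.mk k L (m + 1) v ∈ Z := by
      have : ∀ v ∈ Submodule.span (UniversalEnvelopingAlgebra k L) (Set.range (ueι k L)), ∀ a,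
        UEQ.mk k L (m + 1) (a * v) ∈ Z := by
        intro v hv
        induction hv using Submodule.span_induction with
        | mem v hv =>
          obtain ⟨x, rfl⟩ := hv
          exact fun a => h1 a x
        | zero => exact fun a => by rw [mul_zero, map_zero]; exact zero_mem _
        | add v v' _ _ h h' => exact fun a => by rw [mul_add, map_add]; exact add_mem (h a) (h' a)
        | smul c v _ h => exact fun a => by rw [smul_eq_mul, ← mul_assoc]; exact h _
      intro v hv
      simpa using this v hv 1
    have h7 := h6 _ h5
    rw [map_sub, AlgHom.commutes] at h7
    have h8 : algebraMap k (UEQ k L (m + 1)) (ueε k L u) ∈ Z := by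
      rw [Algebra.algebraMap_eq_smul_one]
      exact Submodule.smul_mem _ _ (Submodule.subset_span (Set.mem_insert _ _))
    have := add_mem h7 h8
    rwa [sub_add_cancel] at this

/-! ### The comultiplication on the quotients -/

theorem ker_ε₂_induction {p : UniversalEnvelopingAlgebra k L ⊗[k] UniversalEnvelopingAlgebra k L →
    Prop} {z} (hz : z ∈ RingHom.ker (ε₂ k (UniversalEnvelopingAlgebra k L)))
    (left : ∀ u ∈ augI k L, ∀ v, p (u ⊗ₜ v)) (right : ∀ u, ∀ v ∈ augI k L, p (u ⊗ₜ v))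
    (zero : p 0) (add : ∀ z w, p z → p w → p (z + w)) : p z := by
  have key : ∀ z : UniversalEnvelopingAlgebra k L ⊗[k] UniversalEnvelopingAlgebra k L,
      p (z - algebraMap k _ (ε₂ k _ z)) := by
    intro z
    induction z using TensorProduct.induction_on with
    | zero => simpa using zero
    | add z w h1 h2 =>
      rw [map_add, map_add, add_sub_add_comm]
      exact add _ _ h1 h2
    | tmul u v =>
      have e : u ⊗ₜ[k] v - algebraMap k _ (ε₂ k _ (u ⊗ₜ[k] v)) =
          (u - algebraMap k _ (ueε k L u)) ⊗ₜ[k] v +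
          algebraMap k _ (ueε k L u) ⊗ₜ[k] (v - algebraMap k _ (ueε k L v)) := by
        have : ε₂ k _ (u ⊗ₜ[k] v) = ueε k L u * ueε k L v := by simp
        rw [this, TensorProduct.sub_tmul, TensorProduct.tmul_sub, map_mul,
          Algebra.TensorProduct.algebraMap_apply, Algebra.TensorProduct.algebraMap_apply' ,
          Algebra.TensorProduct.tmul_mul_tmul, mul_one, one_mul]
        abel
      rw [e]
      refine add _ _ (left _ ?_ _) (right _ _ ?_)
      · rw [RingHom.mem_ker]
        simp [AlgHom.commutes]
      · rw [RingHom.mem_ker]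
        simp [AlgHom.commutes]
  have := key z
  rwa [(RingHom.mem_ker.1 hz : ε₂ k _ z = 0), map_zero, sub_zero] at this

/-- Induction on the elements of the powers of the augmentation ideal of `U ⊗ U`. -/
theorem ker_ε₂_pow_induction {n : ℕ}
    {p : UniversalEnvelopingAlgebra k L ⊗[k] UniversalEnvelopingAlgebra k L → Prop} {z}
    (hz : z ∈ RingHom.ker (ε₂ k (UniversalEnvelopingAlgebra k L)) ^ n)
    (tmul : ∀ i j, i + j = n → ∀ u ∈ augI k L ^ i, ∀ v ∈ augI k L ^ j, p (u ⊗ₜ v))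
    (zero : p 0) (add : ∀ z w, p z → p w → p (z + w)) : p z := by
  induction n generalizing z p with
  | zero =>
    clear hz
    induction z using TensorProduct.induction_on with
    | zero => exact zero
    | add z w h1 h2 => exact add _ _ h1 h2
    | tmul u v =>
      exact tmul 0 0 rfl u (by rw [Submodule.pow_zero, Ideal.one_eq_top]; trivial) v
        (by rw [Submodule.pow_zero, Ideal.one_eq_top]; trivial)
  | succ n ih =>
    rw [Submodule.pow_succ] at hz
    refine Submodule.mul_induction_on hz (fun a ha b hb => ?_) add
    refine ih (p := fun a => p (a * b)) ha (fun i j hij u hu v hv => ?_) (by rwa [zero_mul])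
      (fun z w h1 h2 => by rw [add_mul]; exact add _ _ h1 h2)
    refine ker_ε₂_induction (p := fun b => p (u ⊗ₜ v * b)) hb (fun u' hu' v' => ?_)
      (fun u' v' hv' => ?_) (by rwa [mul_zero])
      (fun z w h1 h2 => by rw [mul_add]; exact add _ _ h1 h2)
    · rw [Algebra.TensorProduct.tmul_mul_tmul]
      refine tmul (i + 1) j (by omega) _ ?_ _ (Ideal.mul_mem_right _ _ hv)
      rw [Submodule.pow_succ]
      exact Ideal.mul_mem_mul hu hu'
    · rw [Algebra.TensorProduct.tmul_mul_tmul]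
      refine tmul i (j + 1) (by omega) _ (Ideal.mul_mem_right _ _ hu) _ ?_
      rw [Submodule.pow_succ]
      exact Ideal.mul_mem_mul hv hv'

theorem map_mk_eq_zero {a b : ℕ} {z : UniversalEnvelopingAlgebra k L ⊗[k]
    UniversalEnvelopingAlgebra k L}
    (hz : z ∈ RingHom.ker (ε₂ k (UniversalEnvelopingAlgebra k L)) ^ (a + b)) :
    Algebra.TensorProduct.map (UEQ.mk k L a) (UEQ.mk k L b) z = 0 := by
  refine ker_ε₂_pow_induction
    (p := fun z => Algebra.TensorProduct.map (UEQ.mk k L a) (UEQ.mk k L b) z = 0) hz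
    (fun i j hij u hu v hv => ?_) (map_zero _) (fun z w h1 h2 => by rw [map_add, h1, h2, add_zero])
  rw [Algebra.TensorProduct.map_tmul]
  by_cases h : a ≤ i
  · rw [UEQ.mk_eq_zero.2 (Ideal.pow_le_pow_right h hu), TensorProduct.zero_tmul]
  · rw [UEQ.mk_eq_zero.2 (Ideal.pow_le_pow_right (by omega : b ≤ j) hv), TensorProduct.tmul_zero]

/-- The comultiplication on the quotients. -/
def UEQ.Δ (a b : ℕ) : UEQ k L (a + b) →ₐ[k] UEQ k L a ⊗[k] UEQ k L b :=
  UEQ.lift ((Algebra.TensorProduct.map (UEQ.mk k L a) (UEQ.mk k L b)).comp (ueΔ k L)) fun _ hu =>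
    map_mk_eq_zero (ker_pow_le (ueΔ k L) AugAlg.ε_Δ _ hu)

theorem UEQ.Δ_mk (a b : ℕ) (u : UniversalEnvelopingAlgebra k L) : UEQ.Δ a b (UEQ.mk k L (a + b) u) =
    Algebra.TensorProduct.map (UEQ.mk k L a) (UEQ.mk k L b) (ueΔ k L u) := rfl

theorem UEQ.Δ_ι (a b : ℕ) (x : L) : UEQ.Δ a b (UEQ.ι k L (a + b) x) =
    UEQ.ι k L a x ⊗ₜ 1 + 1 ⊗ₜ UEQ.ι k L b x := by
  rw [UEQ.ι_apply, UEQ.Δ_mk, ueΔ_ι, map_add, Algebra.TensorProduct.map_tmul,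
    Algebra.TensorProduct.map_tmul, map_one, map_one]
  rfl

/-! ### Group-like elements -/

/-- The component of an element of the group `exp(L)` in a quotient of the enveloping algebra. -/
def UniGp.lev (m : ℕ) : UniGp k L →* UEQ k L m where
  toFun g := g.val.1 m
  map_one' := rfl
  map_mul' _ _ := rfl

theorem UniGp.lev_apply (m : ℕ) (g : UniGp k L) : UniGp.lev m g = g.val.1 m := rfl

theorem UniGp.lev_ext {g h : UniGp k L} (H : ∀ m, UniGp.lev m g = UniGp.lev m h) : g = h :=
  Subtype.ext (Units.ext (Subtype.ext (funext H)))

theorem UniGp.trans_lev {m n : ℕ} (h : m ≤ n) (g : UniGp k L) :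
    UEQ.trans h (UniGp.lev n g) = UniGp.lev m g := by
  rw [UniGp.lev_apply, UniGp.lev_apply, ← g.val.2 m n h]
  obtain ⟨u, hu⟩ := UEQ.mk_surjective n (g.val.1 n)
  rw [← hu]
  rfl

theorem UniGp.Δ_lev (a b : ℕ) (g : UniGp k L) :
    UEQ.Δ a b (UniGp.lev (a + b) g) = UniGp.lev a g ⊗ₜ UniGp.lev b g := by
  have h : comul k _ g.val = incl₁ k _ g.val * incl₂ k _ g.val := g.2
  have h' := congrArg (fun z : Hat₂ k (UniversalEnvelopingAlgebra k L) => z.1 (a + b)) h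
  obtain ⟨u, hu⟩ := UEQ.mk_surjective (a + b) (g.val.1 (a + b))
  have h1 : Ideal.Quotient.mk (RingHom.ker (ε₂ k (UniversalEnvelopingAlgebra k L)) ^ (a + b))
      (ueΔ k L u) = Ideal.Quotient.mk _ ((u ⊗ₜ 1) * (1 ⊗ₜ u)) := by
    have e1 : (comul k _ g.val).1 (a + b) = Ideal.Quotient.mk _ (ueΔ k L u) := by
      change Ideal.quotientMap _ _ _ (g.val.1 (a + b)) = _
      rw [← hu]; rfl
    have e2 : (incl₁ k _ g.val).1 (a + b) = Ideal.Quotient.mk _ (u ⊗ₜ 1) := by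
      change Ideal.quotientMap _ _ _ (g.val.1 (a + b)) = _
      rw [← hu]; rfl
    have e3 : (incl₂ k _ g.val).1 (a + b) = Ideal.Quotient.mk _ (1 ⊗ₜ u) := by
      change Ideal.quotientMap _ _ _ (g.val.1 (a + b)) = _
      rw [← hu]; rfl
    rw [map_mul, ← e1, ← e2, ← e3]
    exact h'
  rw [Ideal.Quotient.eq] at h1
  have h2 := map_mk_eq_zero h1
  rw [map_sub, sub_eq_zero, Algebra.TensorProduct.tmul_mul_tmul, mul_one, one_mul,
    Algebra.TensorProduct.map_tmul] at h2
  rw [← UniGp.trans_lev (Nat.le_add_right a b) g, ← UniGp.trans_lev (Nat.le_add_left b a) g,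
    UniGp.lev_apply, ← hu, UEQ.Δ_mk, h2]
  rfl

/-- A homomorphism from `A ⊗ A` that factors over a quotient of `A` on both factors. -/
theorem exists_tensor_lift {A A' C : Type*} [Ring A] [Algebra k A] [Ring A'] [Algebra k A'] [Ring C]
    [Algebra k C] {p : A →ₐ[k] A'} (hp : Function.Surjective p) (f : A ⊗[k] A →ₐ[k] C)
    (φ₁ φ₂ : A' →ₐ[k] C) (h1 : ∀ a, φ₁ (p a) = f (a ⊗ₜ 1)) (h2 : ∀ a, φ₂ (p a) = f (1 ⊗ₜ a)) :
    ∃ φ : A' ⊗[k] A' →ₐ[k] C, (∀ z, φ (Algebra.TensorProduct.map p p z) = f z) ∧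
      ∀ a b, φ (a ⊗ₜ b) = φ₁ a * φ₂ b := by
  have hc : ∀ a b, Commute (φ₁ a) (φ₂ b) := by
    intro a b
    obtain ⟨a, rfl⟩ := hp a
    obtain ⟨b, rfl⟩ := hp b
    have : Commute (a ⊗ₜ[k] (1 : A)) (1 ⊗ₜ b) := by
      simp [Commute, SemiconjBy]
    rw [h1, h2]
    exact this.map f
  refine ⟨Algebra.TensorProduct.lift φ₁ φ₂ hc, fun z => ?_, fun a b =>
    Algebra.TensorProduct.lift_tmul _ _ _ _ _⟩
  have : (Algebra.TensorProduct.lift φ₁ φ₂ hc).comp (Algebra.TensorProduct.map p p) = f := by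
    refine Algebra.TensorProduct.ext' fun a b => ?_
    have e : a ⊗ₜ[k] b = (a ⊗ₜ 1) * (1 ⊗ₜ b) := by
      rw [Algebra.TensorProduct.tmul_mul_tmul, mul_one, one_mul]
    rw [AlgHom.comp_apply, Algebra.TensorProduct.map_tmul, Algebra.TensorProduct.lift_tmul,
      e, map_mul, h1, h2]
  exact DFunLike.congr_fun this z

theorem tmul_one_mem_ker_pow {A : Type*} [Ring A] [Algebra k A] [AugAlg k A] {m : ℕ} {v : A}
    (hv : v ∈ RingHom.ker (AugAlg.ε (k := k) (A := A)) ^ m) : v ⊗ₜ 1 ∈ RingHom.ker (ε₂ k A) ^ m := by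
  have h := ker_pow_le (Algebra.TensorProduct.includeLeft : A →ₐ[k] A ⊗[k] A) (ε₂_left k A) m hv
  rwa [Ideal.mem_comap] at h

theorem one_tmul_mem_ker_pow {A : Type*} [Ring A] [Algebra k A] [AugAlg k A] {m : ℕ} {v : A}
    (hv : v ∈ RingHom.ker (AugAlg.ε (k := k) (A := A)) ^ m) : 1 ⊗ₜ v ∈ RingHom.ker (ε₂ k A) ^ m := by
  have h := ker_pow_le (Algebra.TensorProduct.includeRight : A →ₐ[k] A ⊗[k] A) (ε₂_right k A) m hv
  rwa [Ideal.mem_comap] at h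

variable (k L) in
/-- The projection to the quotient of `U ⊗ U` by a power of its augmentation ideal. -/
def ueMk₂ (m : ℕ) : UniversalEnvelopingAlgebra k L ⊗[k] UniversalEnvelopingAlgebra k L →ₐ[k]
    (UniversalEnvelopingAlgebra k L ⊗[k] UniversalEnvelopingAlgebra k L) ⧸
      RingHom.ker (ε₂ k (UniversalEnvelopingAlgebra k L)) ^ m := Ideal.Quotient.mkₐ k _

theorem ueMk₂_eq_zero {m : ℕ} {z : UniversalEnvelopingAlgebra k L ⊗[k] UniversalEnvelopingAlgebra k L}
    (hz : z ∈ RingHom.ker (ε₂ k (UniversalEnvelopingAlgebra k L)) ^ m) : ueMk₂ k L m z = 0 :=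
  Ideal.Quotient.eq_zero_iff_mem.2 hz

theorem ueMk₂_left {m : ℕ} {v : UniversalEnvelopingAlgebra k L} (hv : v ∈ augI k L ^ m) :
    ueMk₂ k L m (v ⊗ₜ 1) = 0 :=
  ueMk₂_eq_zero (tmul_one_mem_ker_pow hv)

theorem ueMk₂_right {m : ℕ} {v : UniversalEnvelopingAlgebra k L} (hv : v ∈ augI k L ^ m) :
    ueMk₂ k L m (1 ⊗ₜ v) = 0 :=
  ueMk₂_eq_zero (one_tmul_mem_ker_pow hv)

theorem exists_ueMk₂_lift (m : ℕ) : ∃ φ : UEQ k L m ⊗[k] UEQ k L m →ₐ[k]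
    (UniversalEnvelopingAlgebra k L ⊗[k] UniversalEnvelopingAlgebra k L) ⧸
      RingHom.ker (ε₂ k (UniversalEnvelopingAlgebra k L)) ^ m,
    (∀ z, φ (Algebra.TensorProduct.map (UEQ.mk k L m) (UEQ.mk k L m) z) = ueMk₂ k L m z) ∧
    ∀ u v, φ (UEQ.mk k L m u ⊗ₜ UEQ.mk k L m v) = ueMk₂ k L m (u ⊗ₜ 1) * ueMk₂ k L m (1 ⊗ₜ v) := by
  obtain ⟨φ, h1, h2⟩ := exists_tensor_lift (UEQ.mk_surjective (k := k) (L := L) m) (ueMk₂ k L m)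
    (UEQ.lift ((ueMk₂ k L m).comp Algebra.TensorProduct.includeLeft) fun v hv => ueMk₂_left hv)
    (UEQ.lift ((ueMk₂ k L m).comp Algebra.TensorProduct.includeRight) fun v hv => ueMk₂_right hv)
    (fun _ => rfl) (fun _ => rfl)
  exact ⟨φ, h1, fun u v => h2 _ _⟩

/-- The elements of `exp(L)` are the compatible families of group-like units. -/
theorem UniGp.exists_of_family (x : ∀ m, UEQ k L m) (hu : ∀ m, IsUnit (x m))
    (hx : ∀ m n, ∀ h : m ≤ n, UEQ.trans h (x n) = x m)
    (hΔ : ∀ m, UEQ.Δ m m (x (m + m)) = x m ⊗ₜ x m) : ∃ g : UniGp k L, ∀ m, UniGp.lev m g = x m := by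
  have hfac : ∀ m n (h : m ≤ n) (z : UEQ k L n),
      Ideal.Quotient.factor (Ideal.pow_le_pow_right h) z = UEQ.trans h z := by
    intro m n h z
    obtain ⟨u, rfl⟩ := UEQ.mk_surjective n z
    rfl
  have hinv : ∀ m n (h : m ≤ n), UEQ.trans h (((hu n).unit⁻¹ : (UEQ k L n)ˣ) : UEQ k L n) =
      (((hu m).unit⁻¹ : (UEQ k L m)ˣ) : UEQ k L m) := by
    intro m n h
    refine left_inv_eq_right_inv (a := x m) ?_ ((hu m).mul_val_inv)
    rw [← hx m n h, ← map_mul, (hu n).val_inv_mul, map_one]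
  let X : Hat k (UniversalEnvelopingAlgebra k L) := ⟨x, fun m n h => (hfac m n h _).trans (hx m n h)⟩
  let Y : Hat k (UniversalEnvelopingAlgebra k L) :=
    ⟨fun m => (((hu m).unit⁻¹ : (UEQ k L m)ˣ) : UEQ k L m),
      fun m n h => (hfac m n h _).trans (hinv m n h)⟩
  let Z : (Hat k (UniversalEnvelopingAlgebra k L))ˣ :=
    ⟨X, Y, Subtype.ext (funext fun m => (hu m).mul_val_inv),
      Subtype.ext (funext fun m => (hu m).val_inv_mul)⟩
  have hZ : comul k _ X = incl₁ k _ X * incl₂ k _ X := by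
    refine Subtype.ext (funext fun m => ?_)
    obtain ⟨u, hu'⟩ := UEQ.mk_surjective (m + m) (x (m + m))
    have hm : UEQ.mk k L m u = x m := by rw [← hx m (m + m) (Nat.le_add_left m m), ← hu']; rfl
    obtain ⟨φ, hφ, hφ'⟩ := exists_ueMk₂_lift (k := k) (L := L) m
    have e1 : (comul k _ X).1 m = ueMk₂ k L m (ueΔ k L u) := by
      change Ideal.quotientMap _ _ _ (x m) = _
      rw [← hm]; rfl
    have e2 : (incl₁ k _ X).1 m = ueMk₂ k L m (u ⊗ₜ 1) := by
      change Ideal.quotientMap _ _ _ (x m) = _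
      rw [← hm]; rfl
    have e3 : (incl₂ k _ X).1 m = ueMk₂ k L m (1 ⊗ₜ u) := by
      change Ideal.quotientMap _ _ _ (x m) = _
      rw [← hm]; rfl
    refine e1.trans (Eq.trans ?_ (congrArg₂ (· * ·) e2 e3).symm)
    rw [← hφ, ← UEQ.Δ_mk, hu', hΔ, ← hm, hφ']
  exact ⟨⟨Z, hZ⟩, fun m => rfl⟩

end UE

/-! ## Exponentials -/

section Exp

variable {A B : Type*} [Ring A] [Algebra ℂ A] [Ring B] [Algebra ℂ B]

/-- The exponential of a nilpotent element of a complex algebra. -/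
def nexp (a : A) : A :=
  letI : Module ℚ A := Module.compHom A (algebraMap ℚ ℂ)
  IsNilpotent.exp a

theorem nexp_eq_sum {a : A} {k : ℕ} (h : a ^ k = 0) :
    nexp a = ∑ i ∈ Finset.range k, (i.factorial : ℂ)⁻¹ • a ^ i := by
  let _ : Module ℚ A := Module.compHom A (algebraMap ℚ ℂ)
  refine (IsNilpotent.exp_eq_sum h).trans (Finset.sum_congr rfl fun i _ => ?_)
  change (algebraMap ℚ ℂ (i.factorial : ℚ)⁻¹) • a ^ i = _
  simp

theorem nexp_add {a b : A} (h : Commute a b) (ha : IsNilpotent a) (hb : IsNilpotent b) :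
    nexp (a + b) = nexp a * nexp b := by
  let _ : Module ℚ A := Module.compHom A (algebraMap ℚ ℂ)
  exact IsNilpotent.exp_add_of_commute h ha hb

theorem isUnit_nexp {a : A} (ha : IsNilpotent a) : IsUnit (nexp a) := by
  let _ : Module ℚ A := Module.compHom A (algebraMap ℚ ℂ)
  exact IsNilpotent.isUnit_exp ha

theorem map_nexp {a : A} (ha : IsNilpotent a) (f : A →ₐ[ℂ] B) : f (nexp a) = nexp (f a) := by
  obtain ⟨k, hk⟩ := ha
  have hk' : f a ^ k = 0 := by rw [← map_pow, hk, map_zero]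
  rw [nexp_eq_sum hk, nexp_eq_sum hk', map_sum]
  exact Finset.sum_congr rfl fun i _ => by rw [map_smul, map_pow]

theorem nexp_tmul {a : A} (ha : IsNilpotent a) :
    nexp (a ⊗ₜ[ℂ] (1 : A) + 1 ⊗ₜ a) = nexp a ⊗ₜ nexp a := by
  have h1 : (a ⊗ₜ[ℂ] (1 : A)) = Algebra.TensorProduct.includeLeft (R := ℂ) (S := ℂ) a := rfl
  have h2 : ((1 : A) ⊗ₜ[ℂ] a) = Algebra.TensorProduct.includeRight (R := ℂ) a := rfl
  rw [nexp_add (by simp [Commute, SemiconjBy]) (by rw [h1]; exact ha.map _)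
    (by rw [h2]; exact ha.map _), h1, h2, ← map_nexp ha, ← map_nexp ha]
  simp

/-- A subspace that contains the values of a polynomial curve contains its coefficients. -/
theorem coeff_mem_of_forall_sum_mem {M : Type*} [AddCommGroup M] [Module ℂ M] (N : Submodule ℂ M)
    (n : ℕ) (c : ℕ → M) (h : ∀ t : ℂ, ∑ i ∈ Finset.range n, t ^ i • c i ∈ N) {j : ℕ} (hj : j < n) :
    c j ∈ N := by
  by_contra hc
  obtain ⟨φ, hφ, hN⟩ := Submodule.exists_le_ker_of_notMem hc
  let P : Polynomial ℂ := ∑ i ∈ Finset.range n, Polynomial.monomial i (φ (c i))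
  have hP : P = 0 := by
    refine Polynomial.funext fun t => ?_
    have := hN (h t)
    rw [LinearMap.mem_ker, map_sum] at this
    simp only [P, Polynomial.eval_finsetSum, Polynomial.eval_monomial, Polynomial.eval_zero]
    rw [← this]
    exact Finset.sum_congr rfl fun i _ => by rw [map_smul, smul_eq_mul, mul_comm]
  have h2 := congrArg (Polynomial.coeff · j) hP
  simp only [P, Polynomial.finsetSum_coeff, Polynomial.coeff_monomial, Polynomial.coeff_zero] at h2
  rw [Finset.sum_ite_eq' , if_pos (Finset.mem_range.2 hj)] at h2
  exact hφ h2

end Exp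

section UE

variable {L : Type*} [LieRing L] [LieAlgebra ℂ L]

theorem UEQ.ι_pow (m : ℕ) (x : L) : UEQ.ι ℂ L m x ^ m = 0 := by
  rw [UEQ.ι_apply, ← map_pow, UEQ.mk_eq_zero]
  exact Ideal.pow_mem_pow (ueι_mem x) m

theorem UEQ.isNilpotent_ι (m : ℕ) (x : L) : IsNilpotent (UEQ.ι ℂ L m x) := ⟨m, UEQ.ι_pow m x⟩

/-- The exponential map. -/
theorem UniGp.exists_exp (x : L) : ∃ g : UniGp ℂ L, ∀ m, UniGp.lev m g = nexp (UEQ.ι ℂ L m x) := by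
  refine UniGp.exists_of_family (fun m => nexp (UEQ.ι ℂ L m x))
    (fun m => isUnit_nexp (UEQ.isNilpotent_ι m x)) (fun m n h => ?_) (fun m => ?_)
  · rw [map_nexp (UEQ.isNilpotent_ι n x), UEQ.trans_ι]
  · rw [map_nexp (UEQ.isNilpotent_ι _ x), UEQ.Δ_ι, nexp_tmul (UEQ.isNilpotent_ι m x)]

/-- The group-like elements span the quotients of the enveloping algebra. -/
theorem UniGp.span_lev (m : ℕ) : Submodule.span ℂ (Set.range (UniGp.lev (k := ℂ) (L := L) m)) = ⊤ := by
  set N := Submodule.span ℂ (Set.range (UniGp.lev (k := ℂ) (L := L) m)) with hN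
  have hmul : ∀ u ∈ N, ∀ v ∈ N, u * v ∈ N := by
    intro u hu v hv
    induction hu using Submodule.span_induction with
    | mem u hu =>
      obtain ⟨g, rfl⟩ := hu
      induction hv using Submodule.span_induction with
      | mem v hv =>
        obtain ⟨h, rfl⟩ := hv
        rw [← map_mul]
        exact Submodule.subset_span ⟨_, rfl⟩
      | zero => rw [mul_zero]; exact zero_mem _
      | add a b _ _ h1 h2 => rw [mul_add]; exact add_mem h1 h2
      | smul c a _ h1 => rw [mul_smul_comm]; exact Submodule.smul_mem _ _ h1
    | zero => rw [zero_mul]; exact zero_mem _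
    | add a b _ _ h1 h2 => rw [add_mul]; exact add_mem h1 h2
    | smul c a _ h1 => rw [smul_mul_assoc]; exact Submodule.smul_mem _ _ h1
  have hι : ∀ x, UEQ.ι ℂ L m x ∈ N := by
    intro x
    have := coeff_mem_of_forall_sum_mem N (m + 2)
      (fun i => (i.factorial : ℂ)⁻¹ • UEQ.ι ℂ L m x ^ i) (fun t => ?_) (j := 1) (by omega)
    · simpa using this
    · obtain ⟨g, hg⟩ := UniGp.exists_exp (t • x)
      have : UniGp.lev m g ∈ N := Submodule.subset_span ⟨g, rfl⟩
      rw [hg, nexp_eq_sum (k := m + 2) (by rw [pow_add, UEQ.ι_pow, zero_mul])] at this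
      convert this using 2 with i _
      rw [map_smul, smul_pow, smul_comm]
  rw [Submodule.eq_top_iff']
  intro u
  induction u using UEQ.induction with
  | one => exact Submodule.subset_span ⟨1, map_one _⟩
  | mul x u h => exact hmul _ (hι x) _ h
  | zero => exact zero_mem _
  | add u v h1 h2 => exact add_mem h1 h2
  | smul c u h => exact Submodule.smul_mem _ _ h

end UE

/-! ## The rational structure of the quotients of the enveloping algebra -/

section BaseChange

variable {L : Type*} [LieRing L] [LieAlgebra ℚ L]

theorem baseChange_lie {A : Type*} [Ring A] [Algebra ℚ A] (f : L →ₗ[ℚ] A)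
    (hf : ∀ x y, f ⁅x, y⁆ = f x * f y - f y * f x) (x y : ℂ ⊗[ℚ] L) :
    f.baseChange ℂ ⁅x, y⁆ = f.baseChange ℂ x * f.baseChange ℂ y -
      f.baseChange ℂ y * f.baseChange ℂ x := by
  induction x using TensorProduct.induction_on with
  | zero => rw [zero_lie, map_zero, zero_mul, mul_zero, sub_self]
  | add x x' h1 h2 => rw [add_lie, map_add, h1, h2, map_add, add_mul, mul_add]; abel
  | tmul a u =>
    induction y using TensorProduct.induction_on with
    | zero => rw [lie_zero, map_zero, zero_mul, mul_zero, sub_self]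
    | add y y' h1 h2 => rw [lie_add, map_add, h1, h2, map_add, add_mul, mul_add]; abel
    | tmul b v =>
      rw [LieAlgebra.ExtendScalars.bracket_tmul]
      simp only [LinearMap.baseChange_tmul, Algebra.TensorProduct.tmul_mul_tmul, hf,
        TensorProduct.tmul_sub, mul_comm b a]

theorem UEQ.ι_lie {k L : Type*} [CommRing k] [LieRing L] [LieAlgebra k L] (m : ℕ) (x y : L) :
    UEQ.ι k L m ⁅x, y⁆ = UEQ.ι k L m x * UEQ.ι k L m y - UEQ.ι k L m y * UEQ.ι k L m x := by
  simp only [UEQ.ι_apply, ueι_lie, map_sub, map_mul]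

/-- The map `U(L_ℂ) → ℂ ⊗ U(L)/I^m`. -/
def ueBc (m : ℕ) : UniversalEnvelopingAlgebra ℂ (ℂ ⊗[ℚ] L) →ₐ[ℂ] ℂ ⊗[ℚ] UEQ ℚ L m :=
  ueLift ((UEQ.ι ℚ L m).baseChange ℂ) (baseChange_lie _ (UEQ.ι_lie m))

theorem ueBc_ι (m : ℕ) (x : ℂ ⊗[ℚ] L) : ueBc m (ueι ℂ (ℂ ⊗[ℚ] L) x) =
    (UEQ.ι ℚ L m).baseChange ℂ x := ueLift_ι _ _ x

theorem ueBc_eq_zero (m : ℕ) : ∀ u ∈ augI ℂ (ℂ ⊗[ℚ] L) ^ m, ueBc m u = 0 := by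
  intro u hu
  let K : ℕ → Submodule ℚ (UEQ ℚ L m) := fun n =>
    ((augI ℚ L ^ n).restrictScalars ℚ).map (UEQ.mk ℚ L m).toLinearMap
  have h := map_augI_pow (ueBc m) (fun n => ((K n).baseChange ℂ).toAddSubgroup) (fun v => ?_)
    (fun n a ha x => ?_) m u hu
  · have hK : K m = ⊥ := by
      rw [eq_bot_iff]
      rintro _ ⟨v, hv, rfl⟩
      exact (Submodule.mem_bot _).2 (UEQ.mk_eq_zero.2 hv)
    have h' : ueBc m u ∈ (K m).baseChange ℂ := h
    rwa [hK, Submodule.baseChange_bot, Submodule.mem_bot] at h'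
  · have hK : K 0 = ⊤ := by
      rw [eq_top_iff]
      rintro v -
      obtain ⟨v, rfl⟩ := UEQ.mk_surjective m v
      refine ⟨v, ?_, rfl⟩
      rw [Submodule.pow_zero, Ideal.one_eq_top]
      trivial
    change ueBc m v ∈ (K 0).baseChange ℂ
    rw [hK, Submodule.baseChange_top]
    trivial
  · change a * ueBc m _ ∈ (K (n + 1)).baseChange ℂ
    change a ∈ (K n).baseChange ℂ at ha
    rw [ueBc_ι]
    induction x using TensorProduct.induction_on with
    | zero => rw [map_zero, mul_zero]; exact zero_mem _
    | add x y h1 h2 => rw [map_add, mul_add]; exact add_mem h1 h2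
    | tmul b v =>
      suffices (K n).baseChange ℂ ≤ ((K (n + 1)).baseChange ℂ).comap
          (LinearMap.mulRight ℂ ((UEQ.ι ℚ L m).baseChange ℂ (b ⊗ₜ v))) from this ha
      rw [Submodule.baseChange_eq_span, Submodule.span_le]
      rintro _ ⟨_, ⟨w, hw, rfl⟩, rfl⟩
      change ((1 : ℂ) ⊗ₜ[ℚ] (UEQ.mk ℚ L m w)) * (UEQ.ι ℚ L m).baseChange ℂ (b ⊗ₜ v) ∈
        (K (n + 1)).baseChange ℂ
      rw [LinearMap.baseChange_tmul, Algebra.TensorProduct.tmul_mul_tmul]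
      refine Submodule.tmul_mem_baseChange_of_mem _ ⟨w * ueι ℚ L v, ?_, map_mul (UEQ.mk ℚ L m) _ _⟩
      change _ ∈ augI ℚ L ^ (n + 1)
      rw [Submodule.pow_succ]
      exact Ideal.mul_mem_mul hw (ueι_mem v)

/-- The map `U(L_ℂ)/I^m → ℂ ⊗ U(L)/I^m`. -/
def UEQ.bcHom (m : ℕ) : UEQ ℂ (ℂ ⊗[ℚ] L) m →ₐ[ℂ] ℂ ⊗[ℚ] UEQ ℚ L m :=
  UEQ.lift (ueBc m) (ueBc_eq_zero m)

theorem UEQ.bcHom_ι (m : ℕ) (x : ℂ ⊗[ℚ] L) : UEQ.bcHom m (UEQ.ι ℂ (ℂ ⊗[ℚ] L) m x) =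
    (UEQ.ι ℚ L m).baseChange ℂ x := ueBc_ι m x

theorem UEQ.bcHom_surjective (m : ℕ) : Function.Surjective (UEQ.bcHom (L := L) m) := by
  rw [← AlgHom.range_eq_top, eq_top_iff]
  have key : ∀ v : UEQ ℚ L m, (1 : ℂ) ⊗ₜ[ℚ] v ∈ (UEQ.bcHom (L := L) m).range := by
    intro v
    induction v using UEQ.induction with
    | one => exact one_mem _
    | mul x u h =>
      have e : (1 : ℂ) ⊗ₜ[ℚ] (UEQ.ι ℚ L m x * u) = ((1 : ℂ) ⊗ₜ UEQ.ι ℚ L m x) * (1 ⊗ₜ u) := by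
        rw [Algebra.TensorProduct.tmul_mul_tmul, one_mul]
      rw [e]
      refine mul_mem ⟨UEQ.ι ℂ _ m (1 ⊗ₜ x), ?_⟩ h
      exact (UEQ.bcHom_ι m _).trans (LinearMap.baseChange_tmul _ _ _)
    | zero => rw [TensorProduct.tmul_zero]; exact zero_mem _
    | add u v h1 h2 => rw [TensorProduct.tmul_add]; exact add_mem h1 h2
    | smul c u h =>
      have e : (1 : ℂ) ⊗ₜ[ℚ] (c • u) = (c : ℂ) • ((1 : ℂ) ⊗ₜ[ℚ] u) := by
        rw [TensorProduct.tmul_smul, TensorProduct.smul_tmul', TensorProduct.smul_tmul']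
        congr 1
      rw [e]
      exact Subalgebra.smul_mem _ h _
  rintro z -
  induction z using TensorProduct.induction_on with
  | zero => exact zero_mem _
  | add x y h1 h2 => exact add_mem (h1) (h2)
  | tmul a v =>
    have e : a ⊗ₜ[ℚ] v = a • ((1 : ℂ) ⊗ₜ[ℚ] v) := by
      rw [TensorProduct.smul_tmul', smul_eq_mul, mul_one]
    rw [e]
    exact Subalgebra.smul_mem _ (key v) _

/-- The map `U(L)/I^m → U(L_ℂ)/I^m`. -/
theorem exists_rat_hom (m : ℕ) : ∃ f : UEQ ℚ L m →+* UEQ ℂ (ℂ ⊗[ℚ] L) m,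
    (∀ (c : ℚ) u, f (c • u) = (c : ℂ) • f u) ∧
    ∀ x, f (UEQ.ι ℚ L m x) = UEQ.ι ℂ (ℂ ⊗[ℚ] L) m (1 ⊗ₜ x) := by
  let _ : Algebra ℚ (UEQ ℂ (ℂ ⊗[ℚ] L) m) := Algebra.compHom _ (algebraMap ℚ ℂ)
  have hsm : ∀ (c : ℚ) (u : UEQ ℂ (ℂ ⊗[ℚ] L) m), c • u = (c : ℂ) • u := fun c u => rfl
  let j : L →ₗ[ℚ] UEQ ℂ (ℂ ⊗[ℚ] L) m :=
    { toFun := fun x => UEQ.ι ℂ (ℂ ⊗[ℚ] L) m (1 ⊗ₜ x)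
      map_add' := fun x y => by rw [TensorProduct.tmul_add, map_add]
      map_smul' := fun c x => by
        have e : (1 : ℂ) ⊗ₜ[ℚ] (c • x) = (c : ℂ) • ((1 : ℂ) ⊗ₜ[ℚ] x) := by
          rw [TensorProduct.tmul_smul, TensorProduct.smul_tmul', TensorProduct.smul_tmul']
          congr 1
        rw [e, map_smul]
        exact (hsm c _).symm }
  have hj : ∀ x y, j ⁅x, y⁆ = j x * j y - j y * j x := by
    intro x y
    have := UEQ.ι_lie (k := ℂ) m ((1 : ℂ) ⊗ₜ[ℚ] x) ((1 : ℂ) ⊗ₜ[ℚ] y)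
    rwa [LieAlgebra.ExtendScalars.bracket_tmul, mul_one] at this
  have h0 : ∀ u ∈ augI ℚ L ^ m, ueLift j hj u = 0 := by
    intro u hu
    let K : ℕ → AddSubgroup (UEQ ℂ (ℂ ⊗[ℚ] L) m) := fun n =>
      (augI ℂ (ℂ ⊗[ℚ] L) ^ n).toAddSubgroup.map (UEQ.mk ℂ (ℂ ⊗[ℚ] L) m).toRingHom.toAddMonoidHom
    have h := map_augI_pow (ueLift j hj) K (fun v => ?_) (fun n a ha x => ?_) m u hu
    · obtain ⟨v, hv, hv'⟩ := h
      rw [← hv']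
      exact UEQ.mk_eq_zero.2 hv
    · obtain ⟨w, hw⟩ := UEQ.mk_surjective m (ueLift j hj v)
      refine ⟨w, ?_, hw⟩
      change w ∈ augI ℂ (ℂ ⊗[ℚ] L) ^ 0
      rw [Submodule.pow_zero, Ideal.one_eq_top]
      trivial
    · obtain ⟨w, hw, rfl⟩ := ha
      refine ⟨w * ueι ℂ _ (1 ⊗ₜ x), ?_, ?_⟩
      · change _ ∈ augI ℂ (ℂ ⊗[ℚ] L) ^ (n + 1)
        rw [Submodule.pow_succ]
        exact Ideal.mul_mem_mul hw (ueι_mem _)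
      · rw [ueLift_ι]
        exact map_mul (UEQ.mk ℂ (ℂ ⊗[ℚ] L) m) _ _
  refine ⟨(UEQ.lift (ueLift j hj) h0).toRingHom, fun c u => ?_, fun x => ?_⟩
  · exact (map_smul (UEQ.lift (ueLift j hj) h0) c u).trans (hsm c _)
  · exact ueLift_ι j hj x

theorem UEQ.bcHom_injective (m : ℕ) : Function.Injective (UEQ.bcHom (L := L) m) := by
  obtain ⟨f, hf, hfι⟩ := exists_rat_hom (L := L) m
  let α : (ℂ ⊗[ℚ] UEQ ℚ L m) →+ UEQ ℂ (ℂ ⊗[ℚ] L) m := TensorProduct.liftAddHom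
    { toFun := fun a => ((algebraMap ℂ (Module.End ℂ (UEQ ℂ (ℂ ⊗[ℚ] L) m)) a).toAddMonoidHom).comp
        f.toAddMonoidHom
      map_zero' := by ext u; simp
      map_add' := fun a b => by ext u; simp }
    (fun c a u => by
      change (c • a) • f u = a • f (c • u)
      rw [hf, smul_smul, Rat.smul_def, mul_comm])
  have hα : ∀ a u, α (a ⊗ₜ u) = a • f u := fun a u => rfl
  have hmul : ∀ x z, α ((UEQ.ι ℚ L m).baseChange ℂ x * z) = UEQ.ι ℂ (ℂ ⊗[ℚ] L) m x * α z := by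
    intro x z
    induction x using TensorProduct.induction_on with
    | zero => simp only [map_zero, zero_mul]
    | add x y h1 h2 => rw [map_add, add_mul, map_add, h1, h2, map_add, add_mul]
    | tmul a v =>
      induction z using TensorProduct.induction_on with
      | zero => simp only [map_zero, mul_zero]
      | add x y h1 h2 => rw [mul_add, map_add, h1, h2, map_add, mul_add]
      | tmul b w =>
        have e : a ⊗ₜ[ℚ] v = a • ((1 : ℂ) ⊗ₜ[ℚ] v) := by
          rw [TensorProduct.smul_tmul', smul_eq_mul, mul_one]
        rw [LinearMap.baseChange_tmul, Algebra.TensorProduct.tmul_mul_tmul, hα, map_mul, hfι, hα, e,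
          map_smul, smul_mul_smul_comm]
  have hsm : ∀ (c : ℂ) z, α (c • z) = c • α z := by
    intro c z
    induction z using TensorProduct.induction_on with
    | zero => simp only [smul_zero, map_zero]
    | add x y h1 h2 => rw [smul_add, map_add, h1, h2, map_add, smul_add]
    | tmul b w => rw [TensorProduct.smul_tmul', hα, hα, smul_smul, smul_eq_mul]
  refine Function.LeftInverse.injective (g := α) fun u => ?_
  induction u using UEQ.induction with
  | one =>
    rw [map_one]
    exact (hα 1 1).trans (by rw [map_one, one_smul])
  | mul x u h => rw [map_mul, UEQ.bcHom_ι, hmul, h]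
  | zero => rw [map_zero, map_zero]
  | add u v h1 h2 => rw [map_add, map_add, h1, h2]
  | smul c u h => rw [map_smul, hsm, h]

/-- The isomorphism `U(L_ℂ)/I^m ≅ ℂ ⊗ U(L)/I^m`. -/
def UEQ.bc (m : ℕ) : UEQ ℂ (ℂ ⊗[ℚ] L) m ≃ₐ[ℂ] ℂ ⊗[ℚ] UEQ ℚ L m :=
  AlgEquiv.ofBijective (UEQ.bcHom m) ⟨UEQ.bcHom_injective m, UEQ.bcHom_surjective m⟩

theorem UEQ.bc_ι (m : ℕ) (x : ℂ ⊗[ℚ] L) : UEQ.bc m (UEQ.ι ℂ (ℂ ⊗[ℚ] L) m x) =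
    (UEQ.ι ℚ L m).baseChange ℂ x := ueBc_ι m x

end BaseChange

/-! ## Vector-valued regular functions -/

section RegFun

variable {V V' : Type*} [AddCommGroup V] [Module ℚ V] [AddCommGroup V'] [Module ℚ V']

theorem dual_baseChange_comp (l : Module.Dual ℚ V') (f : V →ₗ[ℚ] V') (x : ℂ ⊗[ℚ] V) :
    Module.Dual.baseChange ℂ (l ∘ₗ f) x = Module.Dual.baseChange ℂ l (f.baseChange ℂ x) := by
  induction x using TensorProduct.induction_on with
  | zero => simp
  | tmul a v => rw [LinearMap.baseChange_tmul, dual_baseChange_tmul, dual_baseChange_tmul]; rfl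
  | add x y hx hy => simp only [map_add, hx, hy]

theorem eq_sum_coord [Module.Finite ℚ V] (x : ℂ ⊗[ℚ] V) :
    x = ∑ i, Module.Dual.baseChange ℂ ((Module.finBasis ℚ V).coord i) x •
      ((1 : ℂ) ⊗ₜ[ℚ] Module.finBasis ℚ V i) := by
  induction x using TensorProduct.induction_on with
  | zero => simp
  | add x y hx hy =>
    conv_lhs => rw [hx, hy]
    simp only [map_add, add_smul, Finset.sum_add_distrib]
  | tmul a v =>
    conv_lhs => rw [← (Module.finBasis ℚ V).sum_repr v, TensorProduct.tmul_sum]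
    refine Finset.sum_congr rfl fun i _ => ?_
    rw [dual_baseChange_tmul, TensorProduct.tmul_smul, TensorProduct.smul_tmul',
      TensorProduct.smul_tmul', Module.Basis.coord_apply, smul_eq_mul, mul_one, Rat.smul_def,
      mul_comm]

variable {G : Type*} [Group G] [AlgGp G]

/-- The function `x` with values in `V_ℂ` is regular and defined over `ℚ`. -/
def RegFun (x : G → ℂ ⊗[ℚ] V) : Prop :=
  ∀ l : Module.Dual ℚ V, (fun g => Module.Dual.baseChange ℂ l (x g)) ∈ AlgGp.coord (G := G)

theorem RegFun.const (v : V) : RegFun fun _ : G => (1 : ℂ) ⊗ₜ[ℚ] v := fun l => by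
  convert Subalgebra.algebraMap_mem (AlgGp.coord (G := G)) (l v) using 1
  funext g
  rw [dual_baseChange_tmul, one_mul]
  rfl

theorem RegFun.zero : RegFun fun _ : G => (0 : ℂ ⊗[ℚ] V) := fun l => by
  simp only [map_zero]
  exact zero_mem _

theorem RegFun.add {x y : G → ℂ ⊗[ℚ] V} (hx : RegFun x) (hy : RegFun y) :
    RegFun fun g => x g + y g := fun l => by
  simp only [map_add]
  exact add_mem (hx l) (hy l)

theorem RegFun.smul {x : G → ℂ ⊗[ℚ] V} (hx : RegFun x) (c : ℚ) :
    RegFun fun g => (c : ℂ) • x g := fun l => by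
  convert Subalgebra.smul_mem _ (hx l) c using 1
  funext g
  rw [map_smul, Pi.smul_apply, smul_eq_mul, Rat.smul_def]

theorem RegFun.map {x : G → ℂ ⊗[ℚ] V} (hx : RegFun x) (f : V →ₗ[ℚ] V') :
    RegFun fun g => f.baseChange ℂ (x g) := fun l => by
  simp only [← dual_baseChange_comp]
  exact hx _

theorem RegFun.apply [Module.Finite ℚ V] {ρ : G → (ℂ ⊗[ℚ] V) →ₗ[ℂ] (ℂ ⊗[ℚ] V')}
    (hρ : ∀ v, RegFun fun g => ρ g (1 ⊗ₜ v)) {x : G → ℂ ⊗[ℚ] V} (hx : RegFun x) :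
    RegFun fun g => ρ g (x g) := fun l => by
  have h : (fun g => Module.Dual.baseChange ℂ l (ρ g (x g))) =
      ∑ i, (fun g => Module.Dual.baseChange ℂ ((Module.finBasis ℚ V).coord i) (x g)) *
        fun g => Module.Dual.baseChange ℂ l (ρ g (1 ⊗ₜ Module.finBasis ℚ V i)) := by
    funext g
    conv_lhs => rw [eq_sum_coord (x g)]
    simp only [map_sum, map_smul, Finset.sum_apply, Pi.mul_apply, smul_eq_mul]
  rw [h]
  exact sum_mem fun i _ => mul_mem (hx _) (hρ _ l)

theorem RegFun.tmul [Module.Finite ℚ V] [Module.Finite ℚ V'] {x : G → ℂ ⊗[ℚ] V}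
    {y : G → ℂ ⊗[ℚ] V'} (hx : RegFun x) (hy : RegFun y) :
    RegFun fun g => tmulC V V' (x g) (y g) := by
  refine RegFun.apply (ρ := fun g => (tmulC V V').flip (y g)) (fun v => ?_) hx
  refine RegFun.apply (ρ := fun _ => tmulC V V' (1 ⊗ₜ v)) (fun w => ?_) hy
  simp only [tmulC_tmul, mul_one]
  exact RegFun.const _

theorem tmulC_mul {A B : Type*} [Ring A] [Algebra ℚ A] [Ring B] [Algebra ℚ B]
    (x x' : ℂ ⊗[ℚ] A) (y y' : ℂ ⊗[ℚ] B) :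
    tmulC A B (x * x') (y * y') = tmulC A B x y * tmulC A B x' y' := by
  induction x using TensorProduct.induction_on with
  | zero => simp
  | add a b h1 h2 => simp only [add_mul, map_add, LinearMap.add_apply, h1, h2]
  | tmul a v =>
    induction y using TensorProduct.induction_on with
    | zero => simp
    | add a b h1 h2 => simp only [add_mul, map_add, h1, h2]
    | tmul b w =>
      induction x' using TensorProduct.induction_on with
      | zero => simp
      | add a b h1 h2 => simp only [mul_add, map_add, LinearMap.add_apply, h1, h2]
      | tmul a' v' =>
        induction y' using TensorProduct.induction_on with
        | zero => simp
        | add a b h1 h2 => simp only [mul_add, map_add, h1, h2]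
        | tmul b' w' =>
          simp only [Algebra.TensorProduct.tmul_mul_tmul, tmulC_tmul, mul_mul_mul_comm]

theorem mul'_tmulC {A : Type*} [Ring A] [Algebra ℚ A] (x y : ℂ ⊗[ℚ] A) :
    (LinearMap.mul' ℚ A).baseChange ℂ (tmulC A A x y) = x * y := by
  induction x using TensorProduct.induction_on with
  | zero => simp
  | add a b h1 h2 => simp only [add_mul, map_add, LinearMap.add_apply, h1, h2]
  | tmul a v =>
    induction y using TensorProduct.induction_on with
    | zero => simp
    | add a b h1 h2 => simp only [mul_add, map_add, h1, h2]
    | tmul b w =>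
      rw [tmulC_tmul, LinearMap.baseChange_tmul, LinearMap.mul'_apply,
        Algebra.TensorProduct.tmul_mul_tmul]

theorem RegFun.mul {A : Type*} [Ring A] [Algebra ℚ A] [Module.Finite ℚ A] {x y : G → ℂ ⊗[ℚ] A}
    (hx : RegFun x) (hy : RegFun y) : RegFun fun g => x g * y g := by
  have := (hx.tmul hy).map (LinearMap.mul' ℚ A)
  simpa only [mul'_tmulC] using this

/-- The tensor product of representations. -/
abbrev AlgRep.tensor (A B : AlgRep G) : AlgRep G where
  V := A.V ⊗[ℚ] B.V
  ρ :=
    { toFun := fun g => tensorEnd (A.ρ g) (B.ρ g)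
      map_one' := by
        refine LinearMap.ext fun z => ?_
        induction z using tmulC_induction with
        | tmul x y => rw [tensorEnd_tmulC, map_one, map_one]; rfl
        | add x y h1 h2 => rw [map_add, map_add, h1, h2]
      map_mul' := fun g h => by
        refine LinearMap.ext fun z => ?_
        induction z using tmulC_induction with
        | tmul x y =>
          rw [Module.End.mul_apply, tensorEnd_tmulC, tensorEnd_tmulC, tensorEnd_tmulC, map_mul,
            map_mul]
          rfl
        | add x y h1 h2 => rw [map_add, map_add, h1, h2] }
  regular v := by
    suffices h : RegFun fun g : G => tensorEnd (A.ρ g) (B.ρ g) (1 ⊗ₜ v) from h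
    induction v using TensorProduct.induction_on with
    | zero => simp only [TensorProduct.tmul_zero, map_zero]; exact RegFun.zero
    | add x y h1 h2 => simp only [TensorProduct.tmul_add, map_add]; exact h1.add h2
    | tmul v w =>
      have h : ∀ g : G, tensorEnd (A.ρ g) (B.ρ g) ((1 : ℂ) ⊗ₜ (v ⊗ₜ w)) =
          tmulC A.V B.V (A.ρ g (1 ⊗ₜ v)) (B.ρ g (1 ⊗ₜ w)) := fun g => by
        rw [← tensorEnd_tmulC, tmulC_tmul, mul_one]
      simp only [h]
      exact RegFun.tmul (A.regular v) (B.regular w)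

theorem AlgRep.tensor_ρ (A B : AlgRep G) (g : G) (x : ℂ ⊗[ℚ] A.V) (y : ℂ ⊗[ℚ] B.V) :
    (A.tensor B).ρ g (tmulC A.V B.V x y) = tmulC A.V B.V (A.ρ g x) (B.ρ g y) :=
  tensorEnd_tmulC _ _ x y

theorem AlgRep.isTensorIso_tensor (A B : AlgRep G) :
    A.IsTensorIso B (A.tensor B) (LinearEquiv.refl ℚ (A.V ⊗[ℚ] B.V)) := by
  intro g x
  have h : ∀ z : ℂ ⊗[ℚ] (A.V ⊗[ℚ] B.V),
      (LinearEquiv.refl ℚ (A.V ⊗[ℚ] B.V)).toLinearMap.baseChange ℂ z = z := fun z =>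
    LinearMap.congr_fun (LinearMap.baseChange_id (R := ℚ) (A := ℂ) (M := A.V ⊗[ℚ] B.V)) z
  refine (congrArg _ (h x)).trans (Eq.trans ?_ (h _).symm)
  rfl

end RegFun

/-! ## The regular functions on a unipotent group -/

section Coord

section

variable {k : Type*} [CommRing k] {L L' L'' : Type*} [LieRing L] [LieAlgebra k L]
  [LieRing L'] [LieAlgebra k L'] [LieRing L''] [LieAlgebra k L'']

variable (k L) in
/-- The augmentation of the quotients of the enveloping algebra. -/
def UEQ.ε (m : ℕ) : UEQ k L (m + 1) →ₐ[k] k :=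
  UEQ.lift (ueε k L) fun u hu => by
    have : u ∈ augI k L ^ 1 := Ideal.pow_le_pow_right (by omega : 1 ≤ m + 1) hu
    rw [Submodule.pow_one] at this
    exact this

theorem UEQ.ε_mk (m : ℕ) (u : UniversalEnvelopingAlgebra k L) :
    UEQ.ε k L m (UEQ.mk k L (m + 1) u) = ueε k L u := UEQ.lift_mk _ _ u

theorem UEQ.ε_ι (m : ℕ) (x : L) : UEQ.ε k L m (UEQ.ι k L (m + 1) x) = 0 := by
  rw [UEQ.ι_apply, UEQ.ε_mk, ueε_ι]

theorem UEQ.ε_trans {m n : ℕ} (h : m + 1 ≤ n + 1) (u : UEQ k L (n + 1)) :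
    UEQ.ε k L m (UEQ.trans h u) = UEQ.ε k L n u := by
  obtain ⟨u, rfl⟩ := UEQ.mk_surjective _ u
  rw [UEQ.trans_mk, UEQ.ε_mk, UEQ.ε_mk]

/-- The homomorphism induced by a homomorphism of Lie algebras. -/
def UEQ.map (f : L →ₗ⁅k⁆ L') (m : ℕ) : UEQ k L m →ₐ[k] UEQ k L' m :=
  UEQ.lift ((UEQ.mk k L' m).comp (ueMap f)) fun u hu => UEQ.mk_eq_zero.2 (by
    have h := ker_pow_le (ueMap f) (ueMap_isAugHom f).ε m hu
    rwa [Ideal.mem_comap] at h)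

theorem UEQ.map_ι (f : L →ₗ⁅k⁆ L') (m : ℕ) (x : L) :
    UEQ.map f m (UEQ.ι k L m x) = UEQ.ι k L' m (f x) := by
  have : ueMap f (ueι k L x) = ueι k L' (f x) :=
    UniversalEnvelopingAlgebra.lift_ι_apply (A := UniversalEnvelopingAlgebra k L') k _ x
  rw [UEQ.ι_apply, UEQ.ι_apply, ← this]
  rfl

theorem UniGp.quotientMap_eq (f : L →ₗ⁅k⁆ L') (m : ℕ) (u : UEQ k L m) :
    Ideal.quotientMap (augI k L' ^ m) (ueMap f).toRingHom
      (ker_pow_le (ueMap f) (ueMap_isAugHom f).ε m) u = UEQ.map f m u := by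
  obtain ⟨u, rfl⟩ := UEQ.mk_surjective m u
  rfl

theorem UniGp.lev_map (f : L →ₗ⁅k⁆ L') (m : ℕ) (g : UniGp k L) :
    UniGp.lev m (UniGp.map f g) = UEQ.map f m (UniGp.lev m g) := by
  exact UniGp.quotientMap_eq f m _ 

theorem UEQ.counit (u : UEQ k L (1 + 1)) : Algebra.TensorProduct.lmul' k
    (Algebra.TensorProduct.map (UEQ.ε k L 0) (UEQ.ε k L 0) (UEQ.Δ 1 1 u)) = UEQ.ε k L 1 u := by
  have : ((Algebra.TensorProduct.lmul' k).comp (Algebra.TensorProduct.map (UEQ.ε k L 0)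
      (UEQ.ε k L 0))).comp (UEQ.Δ 1 1) = UEQ.ε k L 1 := UEQ.hom_ext fun x => by
    have h0 : UEQ.ε k L 0 (UEQ.ι k L 1 x) = 0 := UEQ.ε_ι 0 x
    have h1 := UEQ.ε_ι (k := k) 1 x
    rw [AlgHom.comp_apply, UEQ.Δ_ι, AlgHom.comp_apply, map_add, Algebra.TensorProduct.map_tmul,
      Algebra.TensorProduct.map_tmul, h0, h1]
    simp
  exact DFunLike.congr_fun this u

end

theorem UniGp.ε_lev {k : Type*} [Field k] {L : Type*} [LieRing L] [LieAlgebra k L] (m : ℕ)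
    (g : UniGp k L) : UEQ.ε k L m (UniGp.lev (m + 1) g) = 1 := by
  have h1 : ∀ n, UEQ.ε k L n (UniGp.lev (n + 1) g) = UEQ.ε k L 0 (UniGp.lev 1 g) := fun n => by
    rw [← UEQ.ε_trans (by omega : 0 + 1 ≤ n + 1), UniGp.trans_lev]
  have h2 := UEQ.counit (UniGp.lev (1 + 1) g)
  rw [UniGp.Δ_lev, Algebra.TensorProduct.map_tmul, Algebra.TensorProduct.lmul'_apply_tmul, h1] at h2
  have h3 : UEQ.ε k L 0 (UniGp.lev 1 g) ≠ 0 := by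
    intro h
    have := map_mul (UniGp.lev (k := k) (L := L) 1) g g⁻¹
    rw [mul_inv_cancel, map_one] at this
    have := congrArg (UEQ.ε k L 0) this
    rw [map_one, map_mul, h, zero_mul] at this
    exact one_ne_zero this
  rw [h1]
  exact mul_left_cancel₀ h3 (h2.trans ((h1 1).trans (mul_one _).symm))

variable {L : Type*} [LieRing L] [LieAlgebra ℚ L]

theorem UEQ.bc_trans {m n : ℕ} (h : m ≤ n) (u : UEQ ℂ (ℂ ⊗[ℚ] L) n) :
    (UEQ.trans h).toLinearMap.baseChange ℂ (UEQ.bc n u) = UEQ.bc m (UEQ.trans h u) := by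
  have : (Algebra.TensorProduct.map (AlgHom.id ℂ ℂ) (UEQ.trans (k := ℚ) (L := L) h)).comp
      (UEQ.bc n).toAlgHom = (UEQ.bc m).toAlgHom.comp (UEQ.trans h) := UEQ.hom_ext fun x => by
    refine (congrArg (Algebra.TensorProduct.map (AlgHom.id ℂ ℂ) (UEQ.trans (k := ℚ) (L := L) h))
      (UEQ.bc_ι n x)).trans (Eq.trans ?_ (UEQ.bc_ι m x).symm)
    induction x using TensorProduct.induction_on with
    | zero => simp only [map_zero]
    | add x y h1 h2 => simp only [map_add, h1, h2]
    | tmul a v => rfl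
  exact DFunLike.congr_fun this u

/-- The homomorphism of tensor products induced by homomorphisms to complexifications. -/
def tensorBc {A B A' B' : Type*} [Ring A] [Algebra ℂ A] [Ring B] [Algebra ℂ B] [Ring A']
    [Algebra ℚ A'] [Ring B'] [Algebra ℚ B'] (α : A →ₐ[ℂ] ℂ ⊗[ℚ] A') (β : B →ₐ[ℂ] ℂ ⊗[ℚ] B') :
    A ⊗[ℂ] B →ₐ[ℂ] ℂ ⊗[ℚ] (A' ⊗[ℚ] B') :=
  Algebra.TensorProduct.algHomOfLinearMapTensorProduct
    (TensorProduct.lift ((tmulC A' B').compl₁₂ α.toLinearMap β.toLinearMap))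
    (fun a a' b b' => by
      simp only [TensorProduct.lift.tmul, LinearMap.compl₁₂_apply, AlgHom.toLinearMap_apply,
        map_mul, tmulC_mul])
    (by
      simp only [TensorProduct.lift.tmul, LinearMap.compl₁₂_apply, AlgHom.toLinearMap_apply,
        map_one]
      simp only [Algebra.TensorProduct.one_def, tmulC_tmul, mul_one])

theorem tensorBc_tmul {A B A' B' : Type*} [Ring A] [Algebra ℂ A] [Ring B] [Algebra ℂ B] [Ring A']
    [Algebra ℚ A'] [Ring B'] [Algebra ℚ B'] (α : A →ₐ[ℂ] ℂ ⊗[ℚ] A') (β : B →ₐ[ℂ] ℂ ⊗[ℚ] B') (a b) :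
    tensorBc α β (a ⊗ₜ b) = tmulC A' B' (α a) (β b) := rfl

/-- The complexification of a homomorphism of algebras. -/
def algBc {A B : Type*} [Ring A] [Algebra ℚ A] [Ring B] [Algebra ℚ B] (f : A →ₐ[ℚ] B) :
    ℂ ⊗[ℚ] A →ₐ[ℂ] ℂ ⊗[ℚ] B := Algebra.TensorProduct.map (AlgHom.id ℂ ℂ) f

theorem algBc_apply {A B : Type*} [Ring A] [Algebra ℚ A] [Ring B] [Algebra ℚ B] (f : A →ₐ[ℚ] B)
    (x : ℂ ⊗[ℚ] A) : algBc f x = f.toLinearMap.baseChange ℂ x := rfl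

theorem UEQ.bc_Δ (a b : ℕ) (u : UEQ ℂ (ℂ ⊗[ℚ] L) (a + b)) :
    (UEQ.Δ a b).toLinearMap.baseChange ℂ (UEQ.bc (a + b) u) =
      tensorBc (UEQ.bc a).toAlgHom (UEQ.bc b).toAlgHom (UEQ.Δ a b u) := by
  have : (algBc (UEQ.Δ (k := ℚ) (L := L) a b)).comp (UEQ.bc (a + b)).toAlgHom =
      (tensorBc (UEQ.bc a).toAlgHom (UEQ.bc b).toAlgHom).comp (UEQ.Δ a b) := by
    refine UEQ.hom_ext fun x => ?_
    refine (congrArg (algBc (UEQ.Δ a b)) (UEQ.bc_ι _ x)).trans ?_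
    rw [AlgHom.comp_apply, UEQ.Δ_ι, map_add, tensorBc_tmul, tensorBc_tmul,
      map_one (UEQ.bc a).toAlgHom, map_one (UEQ.bc b).toAlgHom, algBc_apply]
    refine Eq.trans ?_ (congrArg₂ (fun y z => tmulC _ _ y 1 + tmulC _ _ 1 z) (UEQ.bc_ι a x)
      (UEQ.bc_ι b x)).symm
    induction x using TensorProduct.induction_on with
    | zero => simp only [map_zero, LinearMap.zero_apply, add_zero]
    | add x y h1 h2 =>
      simp only [map_add, LinearMap.add_apply, h1, h2]
      abel
    | tmul c v =>
      simp only [LinearMap.baseChange_tmul, AlgHom.toLinearMap_apply, UEQ.Δ_ι,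
        TensorProduct.tmul_add, Algebra.TensorProduct.one_def, tmulC_tmul, mul_one, one_mul]
  exact DFunLike.congr_fun this u

/-- The component of an element of `exp(L_ℂ)` in `ℂ ⊗ U(L)/I^m`. -/
def UniGp.glev (m : ℕ) (g : UniGp ℂ (ℂ ⊗[ℚ] L)) : ℂ ⊗[ℚ] UEQ ℚ L m := UEQ.bc m (UniGp.lev m g)

theorem UniGp.glev_one (m : ℕ) : UniGp.glev (L := L) m 1 = 1 := by
  rw [UniGp.glev, map_one, map_one]

theorem UniGp.glev_mul (m : ℕ) (g h : UniGp ℂ (ℂ ⊗[ℚ] L)) :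
    UniGp.glev m (g * h) = UniGp.glev m g * UniGp.glev m h := by
  rw [UniGp.glev, map_mul, map_mul]
  rfl

theorem UniGp.glev_ext {g h : UniGp ℂ (ℂ ⊗[ℚ] L)} (H : ∀ m, UniGp.glev m g = UniGp.glev m h) :
    g = h :=
  UniGp.lev_ext fun m => (UEQ.bc m).injective (H m)

theorem UniGp.glev_trans {m n : ℕ} (h : m ≤ n) (g : UniGp ℂ (ℂ ⊗[ℚ] L)) :
    (UEQ.trans h).toLinearMap.baseChange ℂ (UniGp.glev n g) = UniGp.glev m g := by
  rw [UniGp.glev, UEQ.bc_trans, UniGp.trans_lev]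
  rfl

theorem UniGp.glev_Δ (a b : ℕ) (g : UniGp ℂ (ℂ ⊗[ℚ] L)) :
    (UEQ.Δ a b).toLinearMap.baseChange ℂ (UniGp.glev (a + b) g) =
      tmulC _ _ (UniGp.glev a g) (UniGp.glev b g) := by
  rw [UniGp.glev, UEQ.bc_Δ, UniGp.Δ_lev]
  rfl

theorem UniGp.span_glev (m : ℕ) : Submodule.span ℂ (Set.range (UniGp.glev (L := L) m)) = ⊤ := by
  have := congrArg (Submodule.map (UEQ.bc (L := L) m).toLinearMap)
    (UniGp.span_lev (L := ℂ ⊗[ℚ] L) m)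
  rw [Submodule.map_span, ← Set.range_comp, Submodule.map_top] at this
  refine Eq.trans this (LinearMap.range_eq_top.2 (UEQ.bc m).surjective)

theorem exists_dual_of_rational {V : Type*} [AddCommGroup V] [Module ℚ V] (f : V → ℂ)
    (hadd : ∀ x y, f (x + y) = f x + f y) (hsmul : ∀ (c : ℚ) x, f (c • x) = c * f x)
    (hf : ∀ v, ∃ c : ℚ, f v = c) : ∃ l : Module.Dual ℚ V, ∀ v, f v = l v := by
  choose c hc using hf
  refine ⟨{ toFun := c, map_add' := fun x y => ?_, map_smul' := fun a x => ?_ }, hc⟩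
  · have := hadd x y
    rw [hc, hc, hc] at this
    exact_mod_cast this
  · have := hsmul a x
    rw [hc, hc] at this
    exact_mod_cast this

theorem one_tmul_smul {V : Type*} [AddCommGroup V] [Module ℚ V] (c : ℚ) (v : V) :
    (1 : ℂ) ⊗ₜ[ℚ] (c • v) = (c : ℂ) • ((1 : ℂ) ⊗ₜ[ℚ] v) := by
  rw [TensorProduct.tmul_smul, TensorProduct.smul_tmul', TensorProduct.smul_tmul']
  congr 1

variable (L) in
/-- The augmentation of the complexified quotients. -/
def UEQ.εC (m : ℕ) : ℂ ⊗[ℚ] UEQ ℚ L (m + 1) →ₐ[ℂ] ℂ :=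
  (Algebra.TensorProduct.rid ℚ ℂ ℂ).toAlgHom.comp (algBc (UEQ.ε ℚ L m))

theorem UEQ.εC_eq (m : ℕ) (z : ℂ ⊗[ℚ] UEQ ℚ L (m + 1)) :
    UEQ.εC L m z = Module.Dual.baseChange ℂ (UEQ.ε ℚ L m).toLinearMap z := by
  induction z using TensorProduct.induction_on with
  | zero => simp only [map_zero]
  | add x y h1 h2 => simp only [map_add, h1, h2]
  | tmul a v =>
    rw [dual_baseChange_tmul]
    change (Algebra.TensorProduct.rid ℚ ℂ ℂ) (a ⊗ₜ (UEQ.ε ℚ L m v)) = _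
    rw [Algebra.TensorProduct.rid_tmul, Rat.smul_def, mul_comm]
    rfl

theorem UEQ.εC_bc (m : ℕ) (w : UEQ ℂ (ℂ ⊗[ℚ] L) (m + 1)) :
    UEQ.εC L m (UEQ.bc (m + 1) w) = UEQ.ε ℂ (ℂ ⊗[ℚ] L) m w := by
  have : (UEQ.εC L m).comp (UEQ.bc (m + 1)).toAlgHom = UEQ.ε ℂ (ℂ ⊗[ℚ] L) m := by
    refine UEQ.hom_ext fun x => ?_
    refine (congrArg (UEQ.εC L m) (UEQ.bc_ι _ x)).trans (Eq.trans ?_ (UEQ.ε_ι m x).symm)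
    induction x using TensorProduct.induction_on with
    | zero => simp only [map_zero]
    | add x y h1 h2 => simp only [map_add, h1, h2, add_zero]
    | tmul a v =>
      rw [LinearMap.baseChange_tmul, UEQ.εC_eq, dual_baseChange_tmul, AlgHom.toLinearMap_apply,
        UEQ.ε_ι, Rat.cast_zero, mul_zero]
  exact DFunLike.congr_fun this w

theorem UniGp.εC_glev (m : ℕ) (g : UniGp ℂ (ℂ ⊗[ℚ] L)) :
    UEQ.εC L m (UniGp.glev (m + 1) g) = 1 := by
  rw [UniGp.glev, UEQ.εC_bc, UniGp.ε_lev]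

theorem UEQ.exists_dual (m : ℕ) (l : UEQ ℂ (ℂ ⊗[ℚ] L) m →ₗ[ℂ] ℂ)
    (hl : ∀ a ∈ Submonoid.closure (Set.range fun x : L =>
      UniversalEnvelopingAlgebra.ι ℂ ((1 : ℂ) ⊗ₜ[ℚ] x)),
      ∃ c : ℚ, l (UEQ.mk ℂ (ℂ ⊗[ℚ] L) m a) = c) :
    ∃ l' : Module.Dual ℚ (UEQ ℚ L m), ∀ w, l w = Module.Dual.baseChange ℂ l' (UEQ.bc m w) := by
  obtain ⟨l', hl'⟩ := exists_dual_of_rational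
    (fun v : UEQ ℚ L m => l ((UEQ.bc m).symm ((1 : ℂ) ⊗ₜ v)))
    (fun x y => by rw [TensorProduct.tmul_add, map_add, map_add])
    (fun c x => by rw [one_tmul_smul, map_smul, map_smul, smul_eq_mul]) (fun v => by
      obtain ⟨v, rfl⟩ := UEQ.mk_surjective m v
      have hv : v ∈ Submodule.span ℚ (Submonoid.closure (Set.range (ueι ℚ L)) :
        Set (UniversalEnvelopingAlgebra ℚ L)) := by rw [closure_ueι]; trivial
      induction hv using Submodule.span_induction with
      | mem v hv =>
        have : ∃ a ∈ Submonoid.closure (Set.range fun x : L =>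
            UniversalEnvelopingAlgebra.ι ℂ ((1 : ℂ) ⊗ₜ[ℚ] x)),
            UEQ.bc m (UEQ.mk ℂ (ℂ ⊗[ℚ] L) m a) = 1 ⊗ₜ UEQ.mk ℚ L m v := by
          induction hv using Submonoid.closure_induction with
          | mem v hv =>
            obtain ⟨x, rfl⟩ := hv
            refine ⟨_, Submonoid.subset_closure ⟨x, rfl⟩, ?_⟩
            exact (UEQ.bc_ι m _).trans (LinearMap.baseChange_tmul _ _ _)
          | one => exact ⟨1, one_mem _, by rw [map_one, map_one, map_one]; rfl⟩
          | mul v w _ _ h1 h2 =>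
            obtain ⟨a, ha, h1⟩ := h1
            obtain ⟨b, hb, h2⟩ := h2
            refine ⟨a * b, mul_mem ha hb, ?_⟩
            rw [map_mul, map_mul, h1, h2, Algebra.TensorProduct.tmul_mul_tmul, mul_one, map_mul]
        obtain ⟨a, ha, h⟩ := this
        rw [← h, AlgEquiv.symm_apply_apply]
        exact hl a ha
      | zero => exact ⟨0, by rw [map_zero, TensorProduct.tmul_zero, map_zero, map_zero]; simp⟩
      | add v w _ _ h1 h2 =>
        obtain ⟨a, h1⟩ := h1
        obtain ⟨b, h2⟩ := h2
        exact ⟨a + b, by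
          rw [map_add, TensorProduct.tmul_add, map_add, map_add, h1, h2, Rat.cast_add]⟩
      | smul c v _ h1 =>
        obtain ⟨a, h1⟩ := h1
        exact ⟨c * a, by
          rw [map_smul, one_tmul_smul, map_smul, map_smul, h1, Rat.cast_mul, smul_eq_mul]⟩)
  refine ⟨l', fun w => ?_⟩
  have key : ∀ z : ℂ ⊗[ℚ] UEQ ℚ L m,
      l ((UEQ.bc m).symm z) = Module.Dual.baseChange ℂ l' z := by
    intro z
    induction z using TensorProduct.induction_on with
    | zero => simp only [map_zero]
    | add x y h1 h2 => simp only [map_add, h1, h2]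
    | tmul a v =>
      rw [dual_baseChange_tmul, ← hl', ← smul_eq_mul a, ← map_smul, ← map_smul,
        TensorProduct.smul_tmul', smul_eq_mul, mul_one]
  exact (congrArg l ((UEQ.bc m).symm_apply_apply w).symm).trans (key _)

theorem UniGp.mem_coord_iff {u : UniGp ℂ (ℂ ⊗[ℚ] L) → ℂ} :
    u ∈ AlgGp.coord (G := UniGp ℂ (ℂ ⊗[ℚ] L)) ↔ ∃ (m : ℕ) (l : Module.Dual ℚ (UEQ ℚ L m)),
      u = fun g => Module.Dual.baseChange ℂ l (UniGp.glev m g) := by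
  constructor
  · intro hu
    have lift : ∀ {m n : ℕ} (_ : m ≤ n) (l : Module.Dual ℚ (UEQ ℚ L m)) g,
        Module.Dual.baseChange ℂ l (UniGp.glev m g) =
          Module.Dual.baseChange ℂ (l ∘ₗ (UEQ.trans (k := ℚ) (L := L) ‹m ≤ n›).toLinearMap)
            (UniGp.glev n g) := fun h l g => by
      rw [dual_baseChange_comp, UniGp.glev_trans]
    induction hu using Algebra.adjoin_induction with
    | mem u hu =>
      obtain ⟨m, l, hl, rfl⟩ := hu
      obtain ⟨l', hl'⟩ := UEQ.exists_dual m l hl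
      exact ⟨m, l', funext fun g => hl' _⟩
    | algebraMap r =>
      refine ⟨1, r • (UEQ.ε ℚ L 0).toLinearMap, funext fun g => ?_⟩
      rw [map_smul, LinearMap.smul_apply, ← UEQ.εC_eq, UniGp.εC_glev, Rat.smul_def, mul_one]
      rfl
    | add x y _ _ hx hy =>
      obtain ⟨m, l, rfl⟩ := hx
      obtain ⟨n, l', rfl⟩ := hy
      refine ⟨m + n, l ∘ₗ (UEQ.trans (Nat.le_add_right m n)).toLinearMap +
        l' ∘ₗ (UEQ.trans (Nat.le_add_left n m)).toLinearMap, funext fun g => ?_⟩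
      rw [Pi.add_apply, lift (Nat.le_add_right m n), lift (Nat.le_add_left n m), map_add]
      rfl
    | mul x y _ _ hx hy =>
      obtain ⟨m, l, rfl⟩ := hx
      obtain ⟨n, l', rfl⟩ := hy
      refine ⟨m + n, (LinearMap.mul' ℚ ℚ ∘ₗ TensorProduct.map l l') ∘ₗ (UEQ.Δ m n).toLinearMap,
        funext fun g => ?_⟩
      rw [dual_baseChange_comp, UniGp.glev_Δ, dual_baseChange_tmulC]
      rfl
  · rintro ⟨m, l, rfl⟩
    refine Algebra.subset_adjoin ⟨m, Module.Dual.baseChange ℂ l ∘ₗ (UEQ.bc m).toLinearMap, ?_, rfl⟩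
    intro a ha
    have : ∃ v, UEQ.bc m (UEQ.mk ℂ (ℂ ⊗[ℚ] L) m a) = 1 ⊗ₜ v := by
      induction ha using Submonoid.closure_induction with
      | mem v hv =>
        obtain ⟨x, rfl⟩ := hv
        exact ⟨_, (UEQ.bc_ι m _).trans (LinearMap.baseChange_tmul _ _ _)⟩
      | one => exact ⟨1, by rw [map_one, map_one]; rfl⟩
      | mul v w _ _ h1 h2 =>
        obtain ⟨a, h1⟩ := h1
        obtain ⟨b, h2⟩ := h2
        exact ⟨a * b, by rw [map_mul, map_mul, h1, h2, Algebra.TensorProduct.tmul_mul_tmul, mul_one]⟩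
    obtain ⟨v, hv⟩ := this
    refine ⟨l v, ?_⟩
    exact (congrArg (Module.Dual.baseChange ℂ l) hv).trans
      ((dual_baseChange_tmul l 1 v).trans (one_mul _))

theorem regFun_glev (m : ℕ) : RegFun (UniGp.glev (L := L) m) := fun l =>
  UniGp.mem_coord_iff.2 ⟨m, l, rfl⟩

end Coord

namespace LieMHS

section Env

variable {L : Type} [LieRing L] [LieAlgebra ℚ L] {M : LieMHS L} {V₀ : FilSp}
  (hS : M.fil.IsDirectSummand V₀)

/-! ## The representations on the quotients of the enveloping algebra -/

/-- The action of the Mumford–Tate group on `ℂ ⊗ U(L)/I^m`. -/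
def qEnv (m : ℕ) (q : mumfordTate V₀) : (ℂ ⊗[ℚ] UEQ ℚ L m) →ₐ[ℂ] (ℂ ⊗[ℚ] UEQ ℚ L m) :=
  (UEQ.bc m).toAlgHom.comp ((UEQ.map (actLie hS q) m).comp (UEQ.bc m).symm.toAlgHom)

theorem qEnv_bc (m : ℕ) (q : mumfordTate V₀) (u : UEQ ℂ (ℂ ⊗[ℚ] L) m) :
    qEnv hS m q (UEQ.bc m u) = UEQ.bc m (UEQ.map (actLie hS q) m u) :=
  congrArg (fun v => UEQ.bc m (UEQ.map (actLie hS q) m v)) ((UEQ.bc m).symm_apply_apply u)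

theorem qEnv_ι (m : ℕ) (q : mumfordTate V₀) (x : ℂ ⊗[ℚ] L) :
    qEnv hS m q ((UEQ.ι ℚ L m).baseChange ℂ x) = (UEQ.ι ℚ L m).baseChange ℂ (actLie hS q x) := by
  rw [← UEQ.bc_ι, ← UEQ.bc_ι, qEnv_bc, UEQ.map_ι]

theorem qEnv_glev (m : ℕ) (q : mumfordTate V₀) (g : UniGp ℂ (ℂ ⊗[ℚ] L)) :
    qEnv hS m q (UniGp.glev m g) = UniGp.glev m (actGp hS q g) := by
  rw [UniGp.glev, qEnv_bc, ← UniGp.lev_map]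
  rfl

theorem glev_induction {m : ℕ} {p : ℂ ⊗[ℚ] UEQ ℚ L m → Prop} (u : ℂ ⊗[ℚ] UEQ ℚ L m)
    (glev : ∀ g, p (UniGp.glev m g)) (zero : p 0) (add : ∀ u v, p u → p v → p (u + v))
    (smul : ∀ (c : ℂ) u, p u → p (c • u)) : p u := by
  have hu : u ∈ Submodule.span ℂ (Set.range (UniGp.glev (L := L) m)) := by
    rw [UniGp.span_glev]; trivial
  induction hu using Submodule.span_induction with
  | mem u hu => obtain ⟨g, rfl⟩ := hu; exact glev g
  | zero => exact zero
  | add u v _ _ h1 h2 => exact add u v h1 h2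
  | smul c u _ h => exact smul c u h

theorem qEnv_one (m : ℕ) (u : ℂ ⊗[ℚ] UEQ ℚ L m) : qEnv hS m 1 u = u := by
  induction u using glev_induction with
  | glev g => rw [qEnv_glev, map_one]; rfl
  | zero => rw [map_zero]
  | add u v h1 h2 => rw [map_add, h1, h2]
  | smul c u h => rw [map_smul, h]

theorem qEnv_mul (m : ℕ) (q q' : mumfordTate V₀) (u : ℂ ⊗[ℚ] UEQ ℚ L m) :
    qEnv hS m (q * q') u = qEnv hS m q (qEnv hS m q' u) := by
  induction u using glev_induction with
  | glev g => rw [qEnv_glev, qEnv_glev, qEnv_glev, map_mul]; rfl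
  | zero => simp only [map_zero]
  | add u v h1 h2 => simp only [map_add, h1, h2]
  | smul c u h => simp only [map_smul, h]

theorem regFun_actLie (x : L) : RegFun fun q : mumfordTate V₀ => actLie hS q (1 ⊗ₜ x) := fun l =>
  Algebra.subset_adjoin ⟨obj hS, x, l, rfl⟩

theorem regFun_qEnv [Module.Finite ℚ L] (m : ℕ) (v : UEQ ℚ L m) :
    RegFun fun q : mumfordTate V₀ => qEnv hS m q (1 ⊗ₜ v) := by
  have := UEQ.finite (k := ℚ) (L := L) m
  induction v using UEQ.induction with
  | one =>
    have : ∀ q, qEnv hS m q (1 ⊗ₜ 1) = (1 : ℂ) ⊗ₜ[ℚ] (1 : UEQ ℚ L m) := fun q =>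
      map_one (qEnv hS m q)
    simp only [this]
    exact RegFun.const _
  | mul x u h =>
    have : ∀ q, qEnv hS m q (1 ⊗ₜ (UEQ.ι ℚ L m x * u)) =
        (UEQ.ι ℚ L m).baseChange ℂ (actLie hS q (1 ⊗ₜ x)) * qEnv hS m q (1 ⊗ₜ u) := fun q => by
      rw [← qEnv_ι, ← map_mul, LinearMap.baseChange_tmul, Algebra.TensorProduct.tmul_mul_tmul,
        mul_one]
    simp only [this]
    exact ((regFun_actLie hS x).map (UEQ.ι ℚ L m)).mul h
  | zero => simp only [TensorProduct.tmul_zero, map_zero]; exact RegFun.zero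
  | add u v h1 h2 => simp only [TensorProduct.tmul_add, map_add]; exact h1.add h2
  | smul c u h => simp only [one_tmul_smul, map_smul]; exact h.smul c

theorem regFun_left {V : Type*} [AddCommGroup V] [Module ℚ V]
    {x : UniGp ℂ (ℂ ⊗[ℚ] L) → ℂ ⊗[ℚ] V} (hx : RegFun x) :
    RegFun fun g : SemiGp hS => x g.left := fun l =>
  Algebra.subset_adjoin (Or.inl ⟨_, hx l, rfl⟩)

theorem regFun_right {V : Type*} [AddCommGroup V] [Module ℚ V]
    {x : mumfordTate V₀ → ℂ ⊗[ℚ] V} (hx : RegFun x) :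
    RegFun fun g : SemiGp hS => x g.right := fun l =>
  Algebra.subset_adjoin (Or.inr ⟨_, hx l, rfl⟩)

/-- The representation of `G` on `U(L)/I^m`: `𝒢` acts by left multiplication. -/
abbrev envRep (m : ℕ) : AlgRep (SemiGp hS) :=
  letI : Module.Finite ℚ L := M.isMHS.finite
  { V := UEQ ℚ L m
    finite := UEQ.finite m
    ρ :=
      { toFun := fun g => LinearMap.mulLeft ℂ (UniGp.glev m g.left) ∘ₗ
          (qEnv hS m g.right).toLinearMap
        map_one' := LinearMap.ext fun u => by
          change UniGp.glev m 1 * qEnv hS m 1 u = u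
          rw [UniGp.glev_one, one_mul, qEnv_one]
        map_mul' := fun g h => LinearMap.ext fun u => by
          change UniGp.glev m (g.left * actGp hS g.right h.left) * qEnv hS m (g.right * h.right) u =
            UniGp.glev m g.left * qEnv hS m g.right (UniGp.glev m h.left * qEnv hS m h.right u)
          rw [UniGp.glev_mul, map_mul, qEnv_glev, qEnv_mul, mul_assoc] }
    regular := fun v => by
      have := UEQ.finite (k := ℚ) (L := L) m
      exact (regFun_left hS (regFun_glev m)).mul (regFun_right hS (regFun_qEnv hS m v)) }

theorem envRep_ρ (m : ℕ) (g : SemiGp hS) (u : ℂ ⊗[ℚ] UEQ ℚ L m) :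
    (envRep hS m).ρ g u = UniGp.glev m g.left * qEnv hS m g.right u := rfl

/-- The restriction of representations from `G` to `Q`. -/
abbrev resQ (A : AlgRep (SemiGp hS)) : AlgRep (mumfordTate V₀) :=
  A.pull SemidirectProduct.inr (regular_inr hS)

theorem resQ_envRep_ρ (m : ℕ) (q : mumfordTate V₀) (u : ℂ ⊗[ℚ] UEQ ℚ L m) :
    (resQ hS (envRep hS m)).ρ q u = qEnv hS m q u := by
  refine (envRep_ρ hS m (SemidirectProduct.inr q) u).trans ?_
  rw [SemidirectProduct.left_inr, SemidirectProduct.right_inr, UniGp.glev_one, one_mul]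

theorem regular_inl : ∀ u ∈ AlgGp.coord (G := SemiGp hS),
    u ∘ (SemidirectProduct.inl : UniGp ℂ (ℂ ⊗[ℚ] L) →* SemiGp hS) ∈
      AlgGp.coord (G := UniGp ℂ (ℂ ⊗[ℚ] L)) := by
  intro u hu
  induction hu using Algebra.adjoin_induction with
  | mem u hu =>
    rcases hu with ⟨v, hv, rfl⟩ | ⟨v, hv, rfl⟩
    · exact hv
    · obtain ⟨c, hc⟩ := coord_one_rat hv
      have h : (fun g : SemiGp hS => v g.right) ∘ SemidirectProduct.inl =
          algebraMap ℚ (UniGp ℂ (ℂ ⊗[ℚ] L) → ℂ) c := by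
        funext q
        exact hc
      rw [h]
      exact Subalgebra.algebraMap_mem _ _
  | algebraMap r => exact Subalgebra.algebraMap_mem _ _
  | add x y _ _ hx hy => exact Subalgebra.add_mem _ hx hy
  | mul x y _ _ hx hy => exact Subalgebra.mul_mem _ hx hy

theorem baseChange_sum_apply {V V' ι : Type*} [AddCommGroup V] [Module ℚ V] [AddCommGroup V']
    [Module ℚ V'] (s : Finset ι) (f : ι → V →ₗ[ℚ] V') (x : ℂ ⊗[ℚ] V) :
    (∑ i ∈ s, f i).baseChange ℂ x = ∑ i ∈ s, (f i).baseChange ℂ x := by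
  induction x using TensorProduct.induction_on with
  | zero => simp only [map_zero, Finset.sum_const_zero]
  | add x y h1 h2 => simp only [map_add, h1, h2, Finset.sum_add_distrib]
  | tmul a v => simp only [LinearMap.baseChange_tmul, LinearMap.sum_apply, TensorProduct.tmul_sum]

/-- A vector-valued regular function on the unipotent group is linear in some `U(L)/I^m`. -/
theorem exists_eq_glev {V : Type*} [AddCommGroup V] [Module ℚ V] [Module.Finite ℚ V]
    {x : UniGp ℂ (ℂ ⊗[ℚ] L) → ℂ ⊗[ℚ] V} (hx : RegFun x) :
    ∃ m, ∀ n, m ≤ n → ∃ f : UEQ ℚ L n →ₗ[ℚ] V, ∀ g, x g = f.baseChange ℂ (UniGp.glev n g) := by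
  choose m l hl using fun i => UniGp.mem_coord_iff.1 (hx ((Module.finBasis ℚ V).coord i))
  refine ⟨Finset.univ.sup m, fun n hn => ?_⟩
  have hm : ∀ i, m i ≤ n := fun i => (Finset.le_sup (Finset.mem_univ i)).trans hn
  refine ⟨∑ i, ((l i) ∘ₗ (UEQ.trans (hm i)).toLinearMap).smulRight (Module.finBasis ℚ V i),
    fun g => ?_⟩
  have key : ∀ (i) (z : ℂ ⊗[ℚ] UEQ ℚ L n),
      (((l i) ∘ₗ (UEQ.trans (hm i)).toLinearMap).smulRight (Module.finBasis ℚ V i)).baseChange ℂ z =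
      Module.Dual.baseChange ℂ ((l i) ∘ₗ (UEQ.trans (hm i)).toLinearMap) z •
        (1 ⊗ₜ Module.finBasis ℚ V i) := by
    intro i z
    induction z using TensorProduct.induction_on with
    | zero => simp only [map_zero, zero_smul]
    | add z w h1 h2 => simp only [map_add, add_smul, h1, h2]
    | tmul a v =>
      rw [dual_baseChange_tmul, LinearMap.baseChange_tmul, LinearMap.smulRight_apply, mul_smul,
        ← one_tmul_smul, TensorProduct.smul_tmul', smul_eq_mul, mul_one]
  rw [eq_sum_coord (x g), baseChange_sum_apply]
  refine Finset.sum_congr rfl fun i _ => ?_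
  rw [key, dual_baseChange_comp, UniGp.glev_trans, ← congrFun (hl i) g]

theorem hom_ext_finBasis {V N : Type*} [AddCommGroup V] [Module ℚ V] [Module.Finite ℚ V]
    [AddCommGroup N] [Module ℂ N] {f f' : (ℂ ⊗[ℚ] V) →ₗ[ℂ] N}
    (h : ∀ i, f (1 ⊗ₜ Module.finBasis ℚ V i) = f' (1 ⊗ₜ Module.finBasis ℚ V i)) (x) : f x = f' x := by
  rw [eq_sum_coord x, map_sum, map_sum]
  exact Finset.sum_congr rfl fun i _ => by rw [map_smul, map_smul, h]

theorem exists_action_of_regFun {V : Type*} [AddCommGroup V] [Module ℚ V] [Module.Finite ℚ V]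
    {ρ : UniGp ℂ (ℂ ⊗[ℚ] L) → (ℂ ⊗[ℚ] V) →ₗ[ℂ] (ℂ ⊗[ℚ] V)} (hρ : ∀ v, RegFun fun g => ρ g (1 ⊗ₜ v)) :
    ∃ (m : ℕ) (μ : UEQ ℚ L (m + 1) ⊗[ℚ] V →ₗ[ℚ] V), ∀ g x,
      μ.baseChange ℂ (tmulC _ _ (UniGp.glev (m + 1) g) x) = ρ g x := by
  choose m hm using fun i => exists_eq_glev (hρ (Module.finBasis ℚ V i))
  have hn : ∀ i, m i ≤ Finset.univ.sup m + 1 := fun i =>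
    (Finset.le_sup (Finset.mem_univ i)).trans (Nat.le_succ _)
  choose f hf using fun i => hm i _ (hn i)
  refine ⟨Finset.univ.sup m, TensorProduct.lift ((Module.finBasis ℚ V).constr ℚ f).flip,
    fun g x => ?_⟩
  have key : ∀ i z, (TensorProduct.lift ((Module.finBasis ℚ V).constr ℚ f).flip).baseChange ℂ
      (tmulC _ _ z (1 ⊗ₜ Module.finBasis ℚ V i)) = (f i).baseChange ℂ z := by
    intro i z
    induction z using TensorProduct.induction_on with
    | zero => simp only [map_zero, LinearMap.zero_apply]
    | add z w h1 h2 => simp only [map_add, LinearMap.add_apply, h1, h2]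
    | tmul a v =>
      rw [tmulC_tmul, LinearMap.baseChange_tmul, LinearMap.baseChange_tmul, TensorProduct.lift.tmul,
        LinearMap.flip_apply, Module.Basis.constr_basis, mul_one]
  exact hom_ext_finBasis (f := LinearMap.baseChange ℂ _ ∘ₗ tmulC _ _ (UniGp.glev _ g))
    (fun i => (key i _).trans (hf i g).symm) x

/-- The restriction to `𝒢` of a representation of `G` is given by an action of some `U(L)/I^m`. -/
theorem exists_action (A : AlgRep (SemiGp hS)) :
    ∃ (m : ℕ) (μ : UEQ ℚ L (m + 1) ⊗[ℚ] A.V →ₗ[ℚ] A.V), ∀ g x,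
      μ.baseChange ℂ (tmulC _ _ (UniGp.glev (m + 1) g) x) = A.ρ (SemidirectProduct.inl g) x :=
  exists_action_of_regFun fun v l => regular_inl hS _ (A.regular v l)

theorem rho_one {G : Type*} [Group G] [AlgGp G] (A : AlgRep G) {g : G} (hg : g = 1)
    (x : ℂ ⊗[ℚ] A.V) : A.ρ g x = x := by
  rw [hg, map_one]
  rfl

/-! ## The bigrading of the representations of `G` -/

variable {hS}

theorem rho_inl_mul_inr (A : AlgRep (SemiGp hS)) (g : SemiGp hS) (x : ℂ ⊗[ℚ] A.V) :
    A.ρ g x = A.ρ (SemidirectProduct.inl g.left) (A.ρ (SemidirectProduct.inr g.right) x) := by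
  conv_lhs => rw [← SemidirectProduct.inl_left_mul_inr_right g, map_mul]
  rfl

theorem rho_inr_inl (A : AlgRep (SemiGp hS)) (q : mumfordTate V₀) (g : UniGp ℂ (ℂ ⊗[ℚ] L))
    (x : ℂ ⊗[ℚ] A.V) : A.ρ (SemidirectProduct.inr q) (A.ρ (SemidirectProduct.inl g) x) =
      A.ρ (SemidirectProduct.inl (actGp hS q g)) (A.ρ (SemidirectProduct.inr q) x) := by
  have : (SemidirectProduct.inr q * SemidirectProduct.inl g : SemiGp hS) =
      SemidirectProduct.inl (actGp hS q g) * SemidirectProduct.inr q := by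
    rw [SemidirectProduct.inl_aut, map_inv, inv_mul_cancel_right]
  rw [← Module.End.mul_apply, ← map_mul, this, map_mul]
  rfl

theorem action_equivariant {A : AlgRep (SemiGp hS)} {m : ℕ} {μ : UEQ ℚ L m ⊗[ℚ] A.V →ₗ[ℚ] A.V}
    (hμ : ∀ g x, μ.baseChange ℂ (tmulC _ _ (UniGp.glev m g) x) = A.ρ (SemidirectProduct.inl g) x)
    (q : mumfordTate V₀) (u x) : A.ρ (SemidirectProduct.inr q) (μ.baseChange ℂ (tmulC _ _ u x)) =
      μ.baseChange ℂ (tmulC _ _ (qEnv hS m q u) (A.ρ (SemidirectProduct.inr q) x)) := by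
  induction u using glev_induction with
  | glev g => rw [hμ, rho_inr_inl, qEnv_glev, hμ]
  | zero => simp only [map_zero, LinearMap.zero_apply]
  | add u v h1 h2 => simp only [map_add, LinearMap.add_apply, h1, h2]
  | smul c u h => simp only [map_smul, LinearMap.smul_apply, h]

theorem action_sub_one {A : AlgRep (SemiGp hS)} {m : ℕ} {μ : UEQ ℚ L m ⊗[ℚ] A.V →ₗ[ℚ] A.V}
    (hμ : ∀ g x, μ.baseChange ℂ (tmulC _ _ (UniGp.glev m g) x) = A.ρ (SemidirectProduct.inl g) x)
    (g : UniGp ℂ (ℂ ⊗[ℚ] L)) (x : ℂ ⊗[ℚ] A.V) : A.ρ (SemidirectProduct.inl g) x - x =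
      μ.baseChange ℂ (tmulC _ _ (UniGp.glev m g - 1) x) := by
  have h1 := hμ 1 x
  rw [UniGp.glev_one, rho_one A (map_one SemidirectProduct.inl)] at h1
  rw [map_sub, LinearMap.sub_apply, map_sub, hμ, h1]

theorem action_mem_repGr (h₀ : IsMHS V₀.W V₀.F) {A : AlgRep (SemiGp hS)} {m : ℕ}
    {μ : UEQ ℚ L m ⊗[ℚ] A.V →ₗ[ℚ] A.V}
    (hμ : ∀ g x, μ.baseChange ℂ (tmulC _ _ (UniGp.glev m g) x) = A.ρ (SemidirectProduct.inl g) x)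
    {s t : Bideg} {u x} (hu : u ∈ repGr h₀ (resQ hS (envRep hS m)) s)
    (hx : x ∈ repGr h₀ (resQ hS A) t) :
    μ.baseChange ℂ (tmulC _ _ u x) ∈ repGr h₀ (resQ hS A) (s + t) := by
  refine (mem_repGr (B := resQ hS A) h₀).2 fun z => ?_
  refine (action_equivariant hμ (torus h₀ z) u x).trans ?_
  have h1 := (resQ_envRep_ρ hS m (torus h₀ z) u).symm.trans ((mem_repGr h₀).1 hu z)
  have h2 : A.ρ (SemidirectProduct.inr (torus h₀ z)) x = _ := (mem_repGr h₀).1 hx z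
  refine (congrArg (μ.baseChange ℂ) (tmulC_eigen h1 h2)).trans ((map_smul _ _ _).trans ?_)
  exact congrArg (· • _) (bichar_add z.1 z.2 s t).symm

/-- The bigrading of `ℂ ⊗ U(L)/I^m`. -/
abbrev envGr (h₀ : IsMHS V₀.W V₀.F) (hS : M.fil.IsDirectSummand V₀) (m : ℕ) (s : Bideg) :
    Submodule ℂ (ℂ ⊗[ℚ] UEQ ℚ L m) := repGr h₀ (resQ hS (envRep hS m)) s

theorem mem_envGr (h₀ : IsMHS V₀.W V₀.F) {m : ℕ} {s : Bideg} {u : ℂ ⊗[ℚ] UEQ ℚ L m} :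
    u ∈ envGr h₀ hS m s ↔ ∀ z : ℂˣ × ℂˣ, qEnv hS m (torus h₀ z) u = bichar z.1 z.2 s • u := by
  refine (mem_repGr (B := resQ hS (envRep hS m)) h₀).trans (forall_congr' fun z => ?_)
  exact Eq.congr_left (resQ_envRep_ρ hS m (torus h₀ z) u)

theorem one_mem_envGr (h₀ : IsMHS V₀.W V₀.F) (m : ℕ) : (1 : ℂ ⊗[ℚ] UEQ ℚ L m) ∈ envGr h₀ hS m 0 := by
  rw [mem_envGr]
  intro z
  rw [map_one, bichar_zero, one_smul]

theorem mul_mem_envGr (h₀ : IsMHS V₀.W V₀.F) {m : ℕ} {s t : Bideg} {u v : ℂ ⊗[ℚ] UEQ ℚ L m}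
    (hu : u ∈ envGr h₀ hS m s) (hv : v ∈ envGr h₀ hS m t) : u * v ∈ envGr h₀ hS m (s + t) := by
  rw [mem_envGr] at hu hv ⊢
  intro z
  rw [map_mul, hu, hv, smul_mul_smul_comm, bichar_add]

theorem actLie_torus (h₀ : IsMHS V₀.W V₀.F) {s : Bideg} {x : ℂ ⊗[ℚ] L} (hx : x ∈ M.fil.gr s)
    (z : ℂˣ × ℂˣ) : actLie hS (torus h₀ z) x = bichar z.1 z.2 s • x :=
  torus_of_mem h₀ z (obj hS) hx

theorem ι_mem_envGr (h₀ : IsMHS V₀.W V₀.F) (m : ℕ) {s : Bideg} {x : ℂ ⊗[ℚ] L}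
    (hx : x ∈ M.fil.gr s) : (UEQ.ι ℚ L m).baseChange ℂ x ∈ envGr h₀ hS m s := by
  rw [mem_envGr]
  intro z
  rw [qEnv_ι, actLie_torus h₀ hx, map_smul]

theorem lieSplitting (M : LieMHS L) : IsHodgeSplitting M.W M.F M.fil.gr := M.isMHS.isHodgeSplitting

/-- The sum of the components of negative weight. -/
abbrev envNeg (h₀ : IsMHS V₀.W V₀.F) (hS : M.fil.IsDirectSummand V₀) (m : ℕ) :
    Submodule ℂ (ℂ ⊗[ℚ] UEQ ℚ L m) := gspan (envGr h₀ hS m) {s | s.1 + s.2 ≤ -1}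

theorem ι_mem_envNeg (h₀ : IsMHS V₀.W V₀.F) (m : ℕ) (x : ℂ ⊗[ℚ] L) :
    (UEQ.ι ℚ L m).baseChange ℂ x ∈ envNeg h₀ hS m := by
  have hx : x ∈ (M.W (-1)).baseChange ℂ := by
    rw [M.weights, Submodule.baseChange_top]; trivial
  rw [(lieSplitting M).W_eq] at hx
  exact map_gspan_le (J := envGr h₀ hS m) (f := (UEQ.ι ℚ L m).baseChange ℂ)
    (fun s x hx => ι_mem_envGr h₀ m hx) _ ⟨x, hx, rfl⟩

theorem mul_mem_envNeg (h₀ : IsMHS V₀.W V₀.F) {m : ℕ} {u v : ℂ ⊗[ℚ] UEQ ℚ L m}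
    (hu : u ∈ envNeg h₀ hS m) (hv : v ∈ envNeg h₀ hS m) : u * v ∈ envNeg h₀ hS m := by
  have h1 : envNeg h₀ hS m ≤ (envNeg h₀ hS m).comap (LinearMap.mulRight ℂ v) := by
    refine gspan_le.2 fun s hs x hx => ?_
    have h2 : envNeg h₀ hS m ≤ (envNeg h₀ hS m).comap (LinearMap.mulLeft ℂ x) := by
      refine gspan_le.2 fun t ht y hy => ?_
      refine le_gspan (s := s + t) ?_ (mul_mem_envGr h₀ hx hy)
      have hs' : s.1 + s.2 ≤ -1 := hs
      have ht' : t.1 + t.2 ≤ -1 := ht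
      change s.1 + t.1 + (s.2 + t.2) ≤ -1
      omega
    exact h2 hv
  exact h1 hu

theorem sub_mem_envNeg (h₀ : IsMHS V₀.W V₀.F) (m : ℕ) (u : ℂ ⊗[ℚ] UEQ ℚ L (m + 1)) :
    u - UEQ.εC L m u • (1 : ℂ ⊗[ℚ] UEQ ℚ L (m + 1)) ∈ envNeg h₀ hS (m + 1) := by
  obtain ⟨w, rfl⟩ := (UEQ.bc (m + 1)).surjective u
  induction w using UEQ.induction with
  | one => rw [map_one, map_one, one_smul, sub_self]; exact zero_mem _
  | mul x u h =>
    have e : UEQ.εC L m (UEQ.bc (m + 1) (UEQ.ι ℂ (ℂ ⊗[ℚ] L) (m + 1) x * u)) = 0 := by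
      rw [UEQ.εC_bc, map_mul, UEQ.ε_ι, zero_mul]
    rw [e, zero_smul, sub_zero, map_mul, UEQ.bc_ι]
    have h1 := mul_mem_envNeg h₀ (ι_mem_envNeg h₀ (m + 1) x) h
    have h2 := add_mem h1 (Submodule.smul_mem _ (UEQ.εC L m (UEQ.bc (m + 1) u))
      (ι_mem_envNeg (hS := hS) h₀ (m + 1) x))
    rwa [mul_sub, mul_smul_comm, mul_one, sub_add_cancel] at h2
  | zero => simp only [map_zero, zero_smul, sub_zero]; exact zero_mem _
  | add u v h1 h2 =>
    simp only [map_add, add_smul, add_sub_add_comm]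
    exact add_mem h1 h2
  | smul c u h =>
    simp only [map_smul, smul_assoc, ← smul_sub]
    exact Submodule.smul_mem _ c h

/-- The unipotent group acts trivially on `gr^W`. -/
theorem grTriv_inl (h₀ : IsMHS V₀.W V₀.F) (A : AlgRep (SemiGp hS)) (g : UniGp ℂ (ℂ ⊗[ℚ] L)) :
    GrTriv (repW (resQ hS A)) (A.ρ (SemidirectProduct.inl g)) := by
  obtain ⟨m, μ, hμ⟩ := exists_action hS A
  intro k x hx
  have e := action_sub_one hμ g x
  refine (congrArg (· ∈ ((repW (resQ hS A) (k - 1)).baseChange ℂ)) e).mpr ?_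
  have hg := sub_mem_envNeg (hS := hS) h₀ m (UniGp.glev (m + 1) g)
  rw [UniGp.εC_glev, one_smul] at hg
  have hx' : x ∈ gspan (repGr h₀ (resQ hS A)) {s | s.1 + s.2 ≤ k} :=
    (repW_eq h₀ (resQ hS A) k).le hx
  refine (repW_eq h₀ (resQ hS A) (k - 1)).ge ?_
  have h1 : envNeg h₀ hS (m + 1) ≤
      (gspan (repGr h₀ (resQ hS A)) {s | s.1 + s.2 ≤ k - 1}).comap
        (μ.baseChange ℂ ∘ₗ (tmulC _ _).flip x) := by
    refine gspan_le.2 fun s hs u hu => ?_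
    have h2 : gspan (repGr h₀ (resQ hS A)) {s | s.1 + s.2 ≤ k} ≤
        (gspan (repGr h₀ (resQ hS A)) {s | s.1 + s.2 ≤ k - 1}).comap
          (μ.baseChange ℂ ∘ₗ (tmulC _ _) u) := by
      refine gspan_le.2 fun t ht y hy => ?_
      refine le_gspan (s := s + t) ?_ (action_mem_repGr h₀ hμ hu hy)
      have hs' : s.1 + s.2 ≤ -1 := hs
      have ht' : t.1 + t.2 ≤ k := ht
      change s.1 + t.1 + (s.2 + t.2) ≤ k - 1
      omega
    exact h2 hx'
  exact h1 hg

theorem hodgeHomG_actsOnSplit (h₀ : IsMHS V₀.W V₀.F) (A : AlgRep (SemiGp hS)) {z w : ℂˣ}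
    {g : SemiGp hS} (hg : g ∈ hodgeHomG hS z w) :
    ActsOnSplit (repW (resQ hS A)) (repGr h₀ (resQ hS A)) (A.ρ g) z w := by
  have e : A.ρ g = A.ρ (SemidirectProduct.inl g.left) * A.ρ (SemidirectProduct.inr g.right) :=
    LinearMap.ext fun x => rho_inl_mul_inr A g x
  rw [e]
  exact ActsOnSplit.mul_left (repSplitting h₀ (resQ hS A)) (repSplitting h₀ (resQ hS A)).W_mono
    (grTriv_inl h₀ A g.left) (hodgeHom_actsOnSplit h₀ (q := g.right) hg (resQ hS A))

theorem weightFil_hodgeHomG (h₀ : IsMHS V₀.W V₀.F) (A : AlgRep (SemiGp hS)) :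
    weightFil (hodgeHomG hS) A = repW (resQ hS A) :=
  weightFil_eq (A := A) (repSplitting h₀ (resQ hS A))
    (fun _ _ _ hg => hodgeHomG_actsOnSplit h₀ A hg)
    (SemidirectProduct.inr.comp (weightCochar h₀))
    (fun u hu => isCocharacter_weightCochar h₀ _ (regular_inr hS u hu))
    (fun t => torus_mem_hodgeHom h₀ t t) (weightCochar_eigen h₀ (resQ hS A))

theorem isGradFam_resQ (h₀ : IsMHS V₀.W V₀.F) :
    IsGradFam fun A : AlgRep (SemiGp hS) => repGr h₀ (resQ hS A) where
  functorial A B f hf := (isGradFam_repGr h₀).functorial (resQ hS A) (resQ hS B) f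
    fun _ x => hf _ x
  tensor A B T e he := (isGradFam_repGr h₀).tensor (resQ hS A) (resQ hS B) (resQ hS T) e
    fun _ x => he _ x
  unit A hA := (isGradFam_repGr h₀).unit (resQ hS A) fun _ => hA _

/-- The translate of the bigrading. -/
abbrev orbitGr (h₀ : IsMHS V₀.W V₀.F) (g : UniGp ℂ (ℂ ⊗[ℚ] L)) (A : AlgRep (SemiGp hS)) (s : Bideg) :
    Submodule ℂ (ℂ ⊗[ℚ] A.V) := (repGr h₀ (resQ hS A) s).map (A.ρ (SemidirectProduct.inl g))

theorem rho_mul_inv {G : Type*} [Group G] [AlgGp G] (A : AlgRep G) (g : G) : A.ρ g * A.ρ g⁻¹ = 1 := by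
  rw [← map_mul, mul_inv_cancel, map_one]

theorem rho_inv_mul {G : Type*} [Group G] [AlgGp G] (A : AlgRep G) (g : G) : A.ρ g⁻¹ * A.ρ g = 1 := by
  rw [← map_mul, inv_mul_cancel, map_one]

theorem orbitSplitting (h₀ : IsMHS V₀.W V₀.F) (g : UniGp ℂ (ℂ ⊗[ℚ] L)) (A : AlgRep (SemiGp hS)) :
    IsHodgeSplitting (repW (resQ hS A)) (orbitMap hS g A) (orbitGr h₀ g A) :=
  (repSplitting h₀ (resQ hS A)).map (rho_mul_inv A _) (rho_inv_mul A _) (grTriv_inl h₀ A g)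
    (by rw [← map_inv]; exact grTriv_inl h₀ A g⁻¹)

theorem isRealModUnipotent_one : IsRealModUnipotent (1 : SemiGp hS) := fun u hu _ => by
  obtain ⟨c, hc⟩ := coord_one_rat (regular_inr hS u hu)
  have : u 1 = c := hc
  rw [this]
  exact Complex.ratCast_im c

theorem orbitMap_mem_fiber (h₀ : IsMHS V₀.W V₀.F) (g : UniGp ℂ (ℂ ⊗[ℚ] L)) :
    orbitMap hS g ∈ fiber hS := by
  have hs : ∀ A, IsHodgeSplitting (weightFil (hodgeHomG hS) A) (orbitMap hS g A) (orbitGr h₀ g A) :=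
    fun A => by rw [weightFil_hodgeHomG h₀]; exact orbitSplitting h₀ g A
  refine ⟨⟨((isGradFam_resQ h₀).act (SemidirectProduct.inl g)).isGMHS hs, 1,
    isRealModUnipotent_one, fun A z w q hq => ?_⟩, ?_⟩
  · rw [one_mul, inv_one, mul_one, weightFil_hodgeHomG h₀]
    exact (actsAsHodge_iff (orbitSplitting h₀ g A) (orbitSplitting h₀ g A).W_mono).2
      ((hodgeHomG_actsOnSplit h₀ A hq).map (repSplitting h₀ (resQ hS A)) (grTriv_inl h₀ A g))
  · funext B p
    have e : (B.pull SemidirectProduct.rightHom (regular_rightHom hS)).ρ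
        (SemidirectProduct.inl g) = 1 := by
      change B.ρ (SemidirectProduct.rightHom (SemidirectProduct.inl g)) = 1
      rw [SemidirectProduct.rightHom_inl, map_one]
    change (basePointQ V₀ B p).map ((B.pull SemidirectProduct.rightHom (regular_rightHom hS)).ρ
        (SemidirectProduct.inl g)) = _
    rw [e]
    exact Submodule.map_id _

theorem orbitMap_one : orbitMap hS 1 = basePointG hS := by
  rw [orbitMap, map_one, FilFam.act_one]

end Env

end LieMHS

/-! ## Logarithmic derivatives of group-like elements -/

section LogDeriv

variable {k : Type*} [Field k] {K : Type*} [LieRing K] [LieAlgebra k K]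

/-- The representation of a Lie algebra `K` on `K × k` defined by a derivation `Y`. -/
def derivRep (Y : K →ₗ[k] K) : K →ₗ[k] Module.End k (K × k) where
  toFun x := LinearMap.inl k K k ∘ₗ
    (((LieModule.toEnd k K K x : K →ₗ[k] K) ∘ₗ LinearMap.fst k K k) +
      (LinearMap.toSpanSingleton k K (Y x)) ∘ₗ LinearMap.snd k K k)
  map_add' x y := by
    refine LinearMap.ext fun v => Prod.ext ?_ (add_zero (0 : k)).symm
    change ⁅x + y, v.1⁆ + v.2 • Y (x + y) = (⁅x, v.1⁆ + v.2 • Y x) + (⁅y, v.1⁆ + v.2 • Y y)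
    rw [add_lie, map_add, smul_add]
    abel
  map_smul' c x := by
    refine LinearMap.ext fun v => Prod.ext ?_ (mul_zero c).symm
    change ⁅c • x, v.1⁆ + v.2 • Y (c • x) = c • (⁅x, v.1⁆ + v.2 • Y x)
    rw [smul_lie, map_smul, smul_add, smul_comm c]

theorem derivRep_apply (Y : K →ₗ[k] K) (x : K) (v : K × k) :
    derivRep Y x v = (⁅x, v.1⁆ + v.2 • Y x, 0) := rfl

theorem derivRep_lie {Y : K →ₗ[k] K} (hY : ∀ x y, Y ⁅x, y⁆ = ⁅x, Y y⁆ - ⁅y, Y x⁆) (x y : K) :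
    derivRep Y ⁅x, y⁆ = derivRep Y x * derivRep Y y - derivRep Y y * derivRep Y x := by
  refine LinearMap.ext fun v => Prod.ext ?_ ?_
  · change ⁅⁅x, y⁆, v.1⁆ + v.2 • Y ⁅x, y⁆ =
      (⁅x, ⁅y, v.1⁆ + v.2 • Y y⁆ + (0 : k) • Y x) - (⁅y, ⁅x, v.1⁆ + v.2 • Y x⁆ + (0 : k) • Y y)
    rw [hY, lie_add, lie_add, lie_smul, lie_smul, lie_lie, smul_sub]
    module
  · exact (sub_zero (0 : k)).symm

theorem exists_lift_derivRep {Y : K →ₗ[k] K} (hY : ∀ x y, Y ⁅x, y⁆ = ⁅x, Y y⁆ - ⁅y, Y x⁆)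
    {P : ℕ → Submodule k K} (hP0 : P 0 = ⊤) (hP' : ∀ j, P (j + 1) ≤ P j)
    (hP : ∀ j, ∀ x : K, ∀ y ∈ P j, ⁅x, y⁆ ∈ P (j + 1)) {N : ℕ} (hN : P N = ⊥) :
    ∃ Θ : UEQ k K (N + 1) →ₐ[k] Module.End k (K × k), ∀ x, Θ (UEQ.ι k K (N + 1) x) = derivRep Y x := by
  let Θ := ueLift (derivRep Y) (derivRep_lie hY)
  have hι : ∀ x, Θ (ueι k K x) = derivRep Y x := ueLift_ι _ _
  let Q : ℕ → Submodule k (K × k) := fun j => Nat.casesOn j ⊤ fun j => (P j).prod ⊥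
  have hQ : ∀ j x, ∀ v ∈ Q j, derivRep Y x v ∈ Q (j + 1) := by
    intro j x v hv
    refine ⟨?_, rfl⟩
    cases j with
    | zero => rw [hP0]; trivial
    | succ j =>
      have h2 : v.2 = 0 := hv.2
      rw [derivRep_apply, h2, zero_smul, add_zero]
      exact hP j x _ hv.1
  have hQ' : ∀ j, Q (j + 1) ≤ Q j := by
    intro j
    cases j with
    | zero => exact le_top
    | succ j => exact fun v hv => ⟨hP' j hv.1, hv.2⟩
  have h0 : ∀ u j, ∀ v ∈ Q j, Θ u v ∈ Q j := by
    intro u j v hv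
    induction u using ue_induction with
    | one => rwa [map_one]
    | mul x u h => rw [map_mul, hι]; exact hQ' j (hQ j x _ h)
    | zero => rw [map_zero]; exact zero_mem _
    | add u u' h1 h2 => rw [map_add]; exact add_mem h1 h2
    | smul c u h => rw [map_smul]; exact Submodule.smul_mem _ c h
  have hΘ : ∀ n, ∀ u ∈ augI k K ^ n, ∀ j, ∀ v ∈ Q j, Θ u v ∈ Q (j + n) := by
    intro n
    induction n with
    | zero => exact fun u _ j v hv => h0 u j v hv
    | succ n ih =>
      intro u hu
      refine augI_pow_succ_induction (p := fun u => ∀ j, ∀ v ∈ Q j, Θ u v ∈ Q (j + (n + 1))) hu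
        (fun a ha x j v hv => ?_) (fun j v _ => ?_) (fun u v hu hv j w hw => ?_)
      · have := ih a ha (j + 1) _ (hQ j x v hv)
        rw [add_assoc, add_comm 1 n] at this
        rw [map_mul, hι]
        exact this
      · rw [map_zero]
        exact zero_mem _
      · rw [map_add]
        exact add_mem (hu j w hw) (hv j w hw)
  refine ⟨UEQ.lift Θ fun u hu => LinearMap.ext fun v => ?_, fun x => hι x⟩
  have h : Θ u v ∈ Q (0 + (N + 1)) := hΘ (N + 1) u hu 0 v trivial
  rw [zero_add] at h
  have h1 : (Θ u v).1 ∈ P N := h.1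
  rw [hN] at h1
  exact Prod.ext h1 h.2

theorem exists_logDeriv_aux {Y : K →ₗ[k] K} (hY : ∀ x y, Y ⁅x, y⁆ = ⁅x, Y y⁆ - ⁅y, Y x⁆)
    {P : ℕ → Submodule k K} (hP0 : P 0 = ⊤) (hP' : ∀ j, P (j + 1) ≤ P j)
    (hP : ∀ j, ∀ x : K, ∀ y ∈ P j, ⁅x, y⁆ ∈ P (j + 1)) {N : ℕ} (hN : P N = ⊥) :
    ∃ D : UEQ k K (N + 1) →ₗ[k] K, D 1 = 0 ∧
      ∀ x u, D (UEQ.ι k K (N + 1) x * u) = ⁅x, D u⁆ + UEQ.ε k K N u • Y x := by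
  obtain ⟨Θ, hΘ⟩ := exists_lift_derivRep hY hP0 hP' hP hN
  have h2 : ∀ u, (Θ u (0, 1)).2 = UEQ.ε k K N u := by
    intro u
    induction u using UEQ.induction with
    | one => rw [map_one, map_one]; rfl
    | mul x u h =>
      rw [map_mul, map_mul, hΘ, UEQ.ε_ι, zero_mul]
      rfl
    | zero => rw [map_zero, map_zero]; rfl
    | add u v h1 h2 => rw [map_add, map_add, ← h1, ← h2]; rfl
    | smul c u h => rw [map_smul, map_smul, ← h]; rfl
  refine ⟨LinearMap.fst k K k ∘ₗ LinearMap.applyₗ (0, 1) ∘ₗ Θ.toLinearMap, ?_, fun x u => ?_⟩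
  · change (Θ 1 (0, 1)).1 = 0
    rw [map_one]
    rfl
  · change (Θ (UEQ.ι k K (N + 1) x * u) (0, 1)).1 = ⁅x, (Θ u (0, 1)).1⁆ + _
    rw [map_mul, hΘ, ← h2]
    rfl

/-- If a derivation `Y` of a nilpotent Lie algebra extends to derivations `Z` of the quotients of
the enveloping algebra, then `Z(g) = ℓ g` on group-like elements, with `ℓ` in the Lie algebra. -/
theorem UniGp.exists_logDeriv {Y : K →ₗ[k] K} (hY : ∀ x y, Y ⁅x, y⁆ = ⁅x, Y y⁆ - ⁅y, Y x⁆)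
    {P : ℕ → Submodule k K} (hP0 : P 0 = ⊤) (hP' : ∀ j, P (j + 1) ≤ P j)
    (hP : ∀ j, ∀ x : K, ∀ y ∈ P j, ⁅x, y⁆ ∈ P (j + 1)) {N : ℕ} (hN : P N = ⊥)
    {Z : ∀ m, UEQ k K m →ₗ[k] UEQ k K m} (hZ1 : ∀ m, Z m 1 = 0)
    (hZ : ∀ m x u, Z m (UEQ.ι k K m x * u) = UEQ.ι k K m (Y x) * u + UEQ.ι k K m x * Z m u)
    (g : UniGp k K) : ∃ ℓ : K, ∀ m, Z m (UniGp.lev m g) = UEQ.ι k K m ℓ * UniGp.lev m g := by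
  obtain ⟨D, hD1, hD⟩ := exists_logDeriv_aux hY hP0 hP' hP hN
  refine ⟨D (UniGp.lev (N + 1) g), fun m => ?_⟩
  let φ : UEQ k K (N + 1) ⊗[k] UEQ k K m →ₗ[k] UEQ k K m :=
    LinearMap.mul' k _ ∘ₗ TensorProduct.map (UEQ.ι k K m ∘ₗ D) LinearMap.id
  let C : UEQ k K (N + 1) ⊗[k] UEQ k K m →ₐ[k] UEQ k K m :=
    (Algebra.TensorProduct.lid k _).toAlgHom.comp
      (Algebra.TensorProduct.map (UEQ.ε k K N) (AlgHom.id k _))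
  have hφ : ∀ x z, φ ((UEQ.ι k K (N + 1) x ⊗ₜ 1 + 1 ⊗ₜ UEQ.ι k K m x) * z) =
      UEQ.ι k K m (Y x) * C z + UEQ.ι k K m x * φ z := by
    intro x z
    induction z using TensorProduct.induction_on with
    | zero => simp only [mul_zero, map_zero, add_zero]
    | add z w h1 h2 =>
      simp only [mul_add, map_add, h1, h2]
      abel
    | tmul a b =>
      rw [add_mul, Algebra.TensorProduct.tmul_mul_tmul, Algebra.TensorProduct.tmul_mul_tmul,
        one_mul, one_mul, map_add]
      change UEQ.ι k K m (D (UEQ.ι k K (N + 1) x * a)) * b +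
        UEQ.ι k K m (D a) * (UEQ.ι k K m x * b) =
        UEQ.ι k K m (Y x) * (UEQ.ε k K N a • b) + UEQ.ι k K m x * (UEQ.ι k K m (D a) * b)
      rw [hD, map_add, map_smul, UEQ.ι_lie, add_mul, sub_mul, smul_mul_assoc, mul_smul_comm,
        mul_assoc, mul_assoc]
      abel
  have hC : C.comp (UEQ.Δ (N + 1) m) = UEQ.trans (Nat.le_add_left m (N + 1)) :=
    UEQ.hom_ext fun x => by
      rw [AlgHom.comp_apply, UEQ.Δ_ι, UEQ.trans_ι, map_add]
      change UEQ.ε k K N (UEQ.ι k K (N + 1) x) • (1 : UEQ k K m) +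
        UEQ.ε k K N 1 • UEQ.ι k K m x = UEQ.ι k K m x
      rw [UEQ.ε_ι, zero_smul, zero_add, map_one, one_smul]
  have key : ∀ u, φ (UEQ.Δ (N + 1) m u) = Z m (UEQ.trans (Nat.le_add_left m (N + 1)) u) := by
    intro u
    induction u using UEQ.induction with
    | one =>
      rw [map_one (UEQ.Δ (N + 1) m), map_one (UEQ.trans _), hZ1, Algebra.TensorProduct.one_def]
      change UEQ.ι k K m (D 1) * 1 = 0
      rw [hD1, map_zero, zero_mul]
    | mul x u h =>
      rw [map_mul (UEQ.Δ (N + 1) m), map_mul (UEQ.trans _), UEQ.trans_ι, UEQ.Δ_ι, hφ, hZ, h]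
      exact congrArg (fun w => _ * w + _) (DFunLike.congr_fun hC u)
    | zero => simp only [map_zero]
    | add u v h1 h2 => simp only [map_add, h1, h2]
    | smul c u h => simp only [map_smul, h]
  have := key (UniGp.lev (N + 1 + m) g)
  rw [UniGp.Δ_lev, UniGp.trans_lev] at this
  exact this.symm

theorem UEQ.ι_injective {Y : K →ₗ[k] K} (hY : ∀ x y, Y ⁅x, y⁆ = ⁅x, Y y⁆ - ⁅y, Y x⁆)
    (hinj : Function.Injective Y)
    {P : ℕ → Submodule k K} (hP0 : P 0 = ⊤) (hP' : ∀ j, P (j + 1) ≤ P j)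
    (hP : ∀ j, ∀ x : K, ∀ y ∈ P j, ⁅x, y⁆ ∈ P (j + 1)) {N : ℕ} (hN : P N = ⊥) :
    Function.Injective (UEQ.ι k K (N + 1)) := by
  obtain ⟨D, hD1, hD⟩ := exists_logDeriv_aux hY hP0 hP' hP hN
  have h : ∀ x, D (UEQ.ι k K (N + 1) x) = Y x := fun x => by
    have := hD x 1
    rwa [mul_one, hD1, lie_zero, zero_add, map_one, one_smul] at this
  intro x y hxy
  exact hinj (by rw [← h, ← h, hxy])

end LogDeriv

theorem nexp_eq_add {A : Type*} [Ring A] [Algebra ℂ A] {a : A} (ha : IsNilpotent a) :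
    ∃ r, nexp a = 1 + a + a * a * r := by
  obtain ⟨n, hn⟩ := ha
  have h : a ^ (n + 2) = 0 := by rw [pow_add, hn, zero_mul]
  refine ⟨∑ i ∈ Finset.range n, ((i + 2).factorial : ℂ)⁻¹ • a ^ i, ?_⟩
  rw [nexp_eq_sum h, Finset.sum_range_succ', Finset.sum_range_succ', Finset.mul_sum]
  have : ∀ i, a * a * (((i + 2).factorial : ℂ)⁻¹ • a ^ i) =
      ((i + 1 + 1).factorial : ℂ)⁻¹ • a ^ (i + 1 + 1) := fun i => by
    rw [mul_smul_comm, ← sq, ← pow_add, add_comm 2 i]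
  simp only [this]
  simp only [Nat.factorial, pow_one, pow_zero, Nat.cast_one, mul_one, inv_one, one_smul, zero_add]
  abel

theorem bilin_mem_gspan {M N P : Type*} [AddCommGroup M] [Module ℂ M] [AddCommGroup N] [Module ℂ N]
    [AddCommGroup P] [Module ℂ P] {I : Bideg → Submodule ℂ M} {J : Bideg → Submodule ℂ N}
    {K : Bideg → Submodule ℂ P} (f : M →ₗ[ℂ] N →ₗ[ℂ] P)
    (hf : ∀ s t, ∀ x ∈ I s, ∀ y ∈ J t, f x y ∈ K (s + t)) {S T U : Set Bideg}
    (h : ∀ s ∈ S, ∀ t ∈ T, s + t ∈ U) {x y} (hx : x ∈ gspan I S) (hy : y ∈ gspan J T) :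
    f x y ∈ gspan K U := by
  have h1 : gspan I S ≤ (gspan K U).comap (f.flip y) := by
    refine gspan_le.2 fun s hs x hx => ?_
    have h2 : gspan J T ≤ (gspan K U).comap (f x) :=
      gspan_le.2 fun t ht y hy => le_gspan (h s hs t ht) (hf s t x hx y hy)
    exact h2 hy
  exact h1 hx

theorem gscale_injOn_gspan {M : Type*} [AddCommGroup M] [Module ℂ M] {I : Bideg → Submodule ℂ M}
    (hI : DirectSum.IsInternal I) {c : Bideg → ℂ} {S : Set Bideg} (hc : ∀ s ∈ S, c s ≠ 0) {x : M}
    (hx : x ∈ gspan I S) (h : gscale hI c x = 0) : x = 0 := by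
  refine eq_zero_of_gcomp hI fun s => ?_
  by_cases hs : s ∈ S
  · have := gcomp_gscale hI c s x
    rw [h, map_zero] at this
    exact (smul_eq_zero.1 this.symm).resolve_left (hc s hs)
  · exact (mem_gspan_iff hI).1 hx s hs

/-- The canonical map from `L_ℂ` to `ℂ ⊗ U(L)/I^m`. -/
def UEQ.ιC (L : Type*) [LieRing L] [LieAlgebra ℚ L] (m : ℕ) : (ℂ ⊗[ℚ] L) →ₗ[ℂ] ℂ ⊗[ℚ] UEQ ℚ L m :=
  (UEQ.ι ℚ L m).baseChange ℂ

theorem UEQ.bc_ιC {L : Type*} [LieRing L] [LieAlgebra ℚ L] (m : ℕ) (x : ℂ ⊗[ℚ] L) :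
    UEQ.bc m (UEQ.ι ℂ (ℂ ⊗[ℚ] L) m x) = UEQ.ιC L m x := UEQ.bc_ι m x

theorem UEQ.bc_induction {L : Type*} [LieRing L] [LieAlgebra ℚ L] {m : ℕ}
    {p : ℂ ⊗[ℚ] UEQ ℚ L m → Prop} (u) (one : p 1)
    (mul : ∀ x u, p u → p (UEQ.ιC L m x * u)) (zero : p 0) (add : ∀ u v, p u → p v → p (u + v))
    (smul : ∀ (c : ℂ) u, p u → p (c • u)) : p u := by
  obtain ⟨w, rfl⟩ := (UEQ.bc m).surjective u
  induction w using UEQ.induction with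
  | one => rwa [map_one]
  | mul x u h => rw [map_mul, UEQ.bc_ιC]; exact mul x _ h
  | zero => rwa [map_zero]
  | add u v h1 h2 => rw [map_add]; exact add _ _ h1 h2
  | smul c u h => rw [map_smul]; exact smul c _ h

namespace LieMHS

variable {L : Type} [LieRing L] [LieAlgebra ℚ L] {M : LieMHS L} {V₀ : FilSp}
  {hS : M.fil.IsDirectSummand V₀}

/-! ## The weight derivation -/

/-- The Deligne bigrading of `L_ℂ`. -/
def lieGr (M : LieMHS L) : Bideg → Submodule ℂ (ℂ ⊗[ℚ] L) := delSplit M.W M.F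

theorem lieGrSplitting (M : LieMHS L) : IsHodgeSplitting M.W M.F (lieGr M) := M.isMHS.isHodgeSplitting

theorem lie_mem_gr (h₀ : IsMHS V₀.W V₀.F) (hS : M.fil.IsDirectSummand V₀) {s t : Bideg}
    {x y : ℂ ⊗[ℚ] L} (hx : x ∈ lieGr M s) (hy : y ∈ lieGr M t) : ⁅x, y⁆ ∈ lieGr M (s + t) := by
  have h := (((mem_tannakaGen hS).tensor (mem_tannakaGen hS)).isMHS h₀).W_mono
  have := (bracket_isHom (M := M)).gr (s + t) _ (tmulC_mem_gr h hx hy)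
  exact (congrArg (· ∈ lieGr M (s + t)) (bracket_tensorIso (M := M) x y)).mp this

/-- The weight of a bidegree. -/
def wt (s : Bideg) : ℂ := ((s.1 + s.2 : ℤ) : ℂ)

theorem wt_add (s t : Bideg) : wt (s + t) = wt s + wt t := by
  simp only [wt, Prod.fst_add, Prod.snd_add]
  push_cast
  ring

/-- Multiplication by the weights on `L_ℂ`. -/
def lieDeg (M : LieMHS L) : (ℂ ⊗[ℚ] L) →ₗ[ℂ] (ℂ ⊗[ℚ] L) := gscale (lieGrSplitting M).internal wt

theorem lieDeg_lie (h₀ : IsMHS V₀.W V₀.F) (hS : M.fil.IsDirectSummand V₀) (x y : ℂ ⊗[ℚ] L) :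
    lieDeg M ⁅x, y⁆ = ⁅x, lieDeg M y⁆ - ⁅y, lieDeg M x⁆ := by
  have hI := (lieGrSplitting M).internal
  refine grading_induction (p := fun x => lieDeg M ⁅x, y⁆ = ⁅x, lieDeg M y⁆ - ⁅y, lieDeg M x⁆)
    hI.submodule_iSup_eq_top x (fun s x hx => ?_) ?_ (fun x x' h1 h2 => ?_)
  · refine grading_induction (p := fun y => lieDeg M ⁅x, y⁆ = ⁅x, lieDeg M y⁆ - ⁅y, lieDeg M x⁆)
      hI.submodule_iSup_eq_top y (fun t y hy => ?_) ?_ (fun y y' h1 h2 => ?_)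
    · rw [lieDeg, gscale_of_mem hI _ hx, gscale_of_mem hI _ hy,
        gscale_of_mem hI _ (lie_mem_gr h₀ hS hx hy), lie_smul, lie_smul, ← lie_skew x y, wt_add]
      module
    · simp only [lie_zero, zero_lie, map_zero, sub_zero]
    · simp only [lie_add, add_lie, map_add, h1, h2]
      abel
  · simp only [lie_zero, zero_lie, map_zero, sub_zero]
  · simp only [lie_add, add_lie, map_add, h1, h2]
    abel

theorem mem_gspan_neg (M : LieMHS L) (x : ℂ ⊗[ℚ] L) : x ∈ gspan (lieGr M) {s | s.1 + s.2 ≤ -1} := by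
  rw [← (lieGrSplitting M).W_eq, M.weights, Submodule.baseChange_top]
  trivial

theorem wt_ne_zero {s : Bideg} (hs : s.1 + s.2 ≤ -1) : wt s ≠ 0 := by
  rw [wt, Int.cast_ne_zero]
  omega

theorem lieDeg_injective (M : LieMHS L) : Function.Injective (lieDeg M) := by
  rw [← LinearMap.ker_eq_bot, LinearMap.ker_eq_bot']
  exact fun x hx => gscale_injOn_gspan (lieGrSplitting M).internal (fun _ => wt_ne_zero)
    (mem_gspan_neg M x) hx

/-- The filtration of `L_ℂ` by the subspaces of weight `< -j`. -/
def lieNeg (M : LieMHS L) (j : ℕ) : Submodule ℂ (ℂ ⊗[ℚ] L) :=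
  gspan (lieGr M) {s | s.1 + s.2 ≤ -1 - j}

theorem lieNeg_zero (M : LieMHS L) : lieNeg M 0 = ⊤ := by
  rw [eq_top_iff]
  intro x _
  simpa [lieNeg] using mem_gspan_neg M x

theorem lieNeg_succ_le (M : LieMHS L) (j : ℕ) : lieNeg M (j + 1) ≤ lieNeg M j :=
  gspan_mono fun s hs => by
    simp only [Set.mem_ofPred_eq] at hs ⊢
    push_cast at hs
    omega

/-- The bracket of `L_ℂ` as a bilinear map. -/
def lieBilin (L : Type) [LieRing L] [LieAlgebra ℚ L] :
    (ℂ ⊗[ℚ] L) →ₗ[ℂ] (ℂ ⊗[ℚ] L) →ₗ[ℂ] ℂ ⊗[ℚ] L :=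
  LinearMap.mk₂ ℂ (fun x y => ⁅x, y⁆) add_lie smul_lie lie_add fun c x y => lie_smul c x y

theorem lie_mem_lieNeg (h₀ : IsMHS V₀.W V₀.F) (hS : M.fil.IsDirectSummand V₀) (j : ℕ)
    (x : ℂ ⊗[ℚ] L) : ∀ y ∈ lieNeg M j, ⁅x, y⁆ ∈ lieNeg M (j + 1) := by
  intro y hy
  have h : ∀ s ∈ {s : Bideg | s.1 + s.2 ≤ -1}, ∀ t ∈ {s : Bideg | s.1 + s.2 ≤ -1 - (j : ℤ)},
      s + t ∈ {s : Bideg | s.1 + s.2 ≤ -1 - ((j + 1 : ℕ) : ℤ)} := by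
    intro s hs t ht
    simp only [Set.mem_ofPred_eq, Prod.fst_add, Prod.snd_add] at hs ht ⊢
    push_cast
    linarith
  exact bilin_mem_gspan (lieBilin L) (fun s t x hx y hy => lie_mem_gr h₀ hS hx hy) h
    (mem_gspan_neg M x) hy

theorem exists_lieNeg_eq_bot (M : LieMHS L) : ∃ N, lieNeg M N = ⊥ := by
  have := M.isMHS.finite
  obtain ⟨N, hN⟩ := IsHodgeSplitting.exists_bound (lieGrSplitting M).internal
  refine ⟨N, eq_bot_iff.2 (gspan_le.2 fun s hs => (hN s ?_).le)⟩
  have := neg_abs_le (s.1 + s.2)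
  simp only [Set.mem_ofPred_eq] at hs
  omega

/-- Multiplication by the weights on `ℂ ⊗ U(L)/I^m`. -/
def envDeg (h₀ : IsMHS V₀.W V₀.F) (hS : M.fil.IsDirectSummand V₀) (m : ℕ) :
    (ℂ ⊗[ℚ] UEQ ℚ L m) →ₗ[ℂ] ℂ ⊗[ℚ] UEQ ℚ L m :=
  gscale (isInternal_repGr h₀ (resQ hS (envRep hS m))) wt

theorem isInternal_envGr (h₀ : IsMHS V₀.W V₀.F) (hS : M.fil.IsDirectSummand V₀) (m : ℕ) :
    DirectSum.IsInternal (envGr h₀ hS m) := isInternal_repGr h₀ (resQ hS (envRep hS m))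

theorem envDeg_of_mem (h₀ : IsMHS V₀.W V₀.F) {m : ℕ} {s : Bideg} {u : ℂ ⊗[ℚ] UEQ ℚ L m}
    (hu : u ∈ envGr h₀ hS m s) : envDeg h₀ hS m u = wt s • u :=
  gscale_of_mem (isInternal_envGr h₀ hS m) _ hu

theorem envDeg_one (h₀ : IsMHS V₀.W V₀.F) (m : ℕ) : envDeg h₀ hS m 1 = 0 := by
  rw [envDeg_of_mem h₀ (one_mem_envGr h₀ m)]
  simp [wt]

theorem ιC_mem_envGr (h₀ : IsMHS V₀.W V₀.F) (m : ℕ) {s : Bideg} {x : ℂ ⊗[ℚ] L}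
    (hx : x ∈ lieGr M s) : UEQ.ιC L m x ∈ envGr h₀ hS m s := ι_mem_envGr h₀ m hx

theorem envDeg_ιC_mul (h₀ : IsMHS V₀.W V₀.F) (m : ℕ) (x : ℂ ⊗[ℚ] L) (u : ℂ ⊗[ℚ] UEQ ℚ L m) :
    envDeg h₀ hS m (UEQ.ιC L m x * u) =
      UEQ.ιC L m (lieDeg M x) * u + UEQ.ιC L m x * envDeg h₀ hS m u := by
  have hI := (lieGrSplitting M).internal
  refine grading_induction (p := fun x => envDeg h₀ hS m (UEQ.ιC L m x * u) =
      UEQ.ιC L m (lieDeg M x) * u + UEQ.ιC L m x * envDeg h₀ hS m u)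
    hI.submodule_iSup_eq_top x (fun s x hx => ?_) ?_ (fun x x' h1 h2 => ?_)
  · refine grading_induction (p := fun u => envDeg h₀ hS m (UEQ.ιC L m x * u) =
      UEQ.ιC L m (lieDeg M x) * u + UEQ.ιC L m x * envDeg h₀ hS m u)
      (isInternal_envGr h₀ hS m).submodule_iSup_eq_top u (fun t u hu => ?_) ?_ (fun u v h1 h2 => ?_)
    · rw [envDeg_of_mem h₀ hu, envDeg_of_mem h₀ (mul_mem_envGr h₀ (ιC_mem_envGr h₀ m hx) hu),
        lieDeg, gscale_of_mem hI _ hx, map_smul, wt_add, smul_mul_assoc, mul_smul_comm, add_smul]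
    · simp only [mul_zero, map_zero, add_zero]
    · simp only [mul_add, map_add, h1, h2]
      abel
  · simp only [map_zero, zero_mul, add_zero]
  · simp only [map_add, add_mul, h1, h2]
    abel

theorem exists_logDeriv (h₀ : IsMHS V₀.W V₀.F) (hS : M.fil.IsDirectSummand V₀)
    (g : UniGp ℂ (ℂ ⊗[ℚ] L)) : ∃ ℓ : ℂ ⊗[ℚ] L, ∀ m,
      envDeg h₀ hS m (UniGp.glev m g) = UEQ.ιC L m ℓ * UniGp.glev m g := by
  obtain ⟨N, hN⟩ := exists_lieNeg_eq_bot M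
  obtain ⟨ℓ, hℓ⟩ := UniGp.exists_logDeriv (lieDeg_lie h₀ hS) (lieNeg_zero M) (lieNeg_succ_le M)
    (lie_mem_lieNeg h₀ hS) hN
    (Z := fun m => (UEQ.bc m).symm.toLinearMap ∘ₗ envDeg h₀ hS m ∘ₗ (UEQ.bc m).toLinearMap)
    (fun m => by
      change (UEQ.bc m).symm (envDeg h₀ hS m (UEQ.bc m 1)) = 0
      rw [map_one, envDeg_one, map_zero])
    (fun m x u => by
      change (UEQ.bc m).symm (envDeg h₀ hS m (UEQ.bc m _)) =
        _ + _ * (UEQ.bc m).symm (envDeg h₀ hS m (UEQ.bc m _))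
      apply (UEQ.bc m).injective
      simp only [map_add, map_mul, AlgEquiv.apply_symm_apply, UEQ.bc_ιC]
      exact envDeg_ιC_mul h₀ m x _) g
  refine ⟨ℓ, fun m => ?_⟩
  have := congrArg (UEQ.bc m) (hℓ m)
  rw [map_mul, UEQ.bc_ιC] at this
  exact ((UEQ.bc m).apply_symm_apply _).symm.trans this

theorem exists_ιC_injective (h₀ : IsMHS V₀.W V₀.F) (hS : M.fil.IsDirectSummand V₀) :
    ∃ N, Function.Injective (UEQ.ιC L (N + 1)) := by
  obtain ⟨N, hN⟩ := exists_lieNeg_eq_bot M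
  have := UEQ.ι_injective (lieDeg_lie h₀ hS) (lieDeg_injective M) (lieNeg_zero M)
    (lieNeg_succ_le M) (lie_mem_lieNeg h₀ hS) hN
  refine ⟨N, fun x y hxy => this ((UEQ.bc (N + 1)).injective ?_)⟩
  rwa [UEQ.bc_ιC, UEQ.bc_ιC]

theorem mem_gspan_of_ιC (h₀ : IsMHS V₀.W V₀.F) (hS : M.fil.IsDirectSummand V₀) {S : Set Bideg}
    {x : ℂ ⊗[ℚ] L} (hx : ∀ m, UEQ.ιC L (m + 1) x ∈ gspan (envGr h₀ hS (m + 1)) S) :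
    x ∈ gspan (lieGr M) S := by
  obtain ⟨N, hN⟩ := exists_ιC_injective h₀ hS
  rw [← comap_gspan_eq (lieGrSplitting M).internal (isInternal_envGr h₀ hS (N + 1))
    (fun s x hx => ιC_mem_envGr h₀ _ hx) hN]
  exact hx N

/-! ## The stabilizer of the base point -/

theorem mul_mem_gspan_envGr (h₀ : IsMHS V₀.W V₀.F) {m : ℕ} {S T U : Set Bideg}
    (h : ∀ s ∈ S, ∀ t ∈ T, s + t ∈ U) {u v : ℂ ⊗[ℚ] UEQ ℚ L m}
    (hu : u ∈ gspan (envGr h₀ hS m) S) (hv : v ∈ gspan (envGr h₀ hS m) T) :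
    u * v ∈ gspan (envGr h₀ hS m) U :=
  bilin_mem_gspan (LinearMap.mul ℂ _) (fun _ _ _ hx _ hy => mul_mem_envGr h₀ hx hy) h hu hv

theorem one_mem_gspan_envGr (h₀ : IsMHS V₀.W V₀.F) (m : ℕ) :
    (1 : ℂ ⊗[ℚ] UEQ ℚ L m) ∈ gspan (envGr h₀ hS m) {s | 0 ≤ s.1} :=
  le_gspan (s := (0 : Bideg)) (by simp) (one_mem_envGr h₀ m)

theorem ιC_mem_gspan (h₀ : IsMHS V₀.W V₀.F) (m : ℕ) {S : Set Bideg} {x : ℂ ⊗[ℚ] L}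
    (hx : x ∈ gspan (lieGr M) S) : UEQ.ιC L m x ∈ gspan (envGr h₀ hS m) S :=
  map_gspan_le (fun _ _ hx => ιC_mem_envGr h₀ m hx) S ⟨x, hx, rfl⟩

theorem mem_envGr_nonpos (h₀ : IsMHS V₀.W V₀.F) {m : ℕ} (u : ℂ ⊗[ℚ] UEQ ℚ L m) :
    u ∈ gspan (envGr h₀ hS m) {s | s.1 + s.2 ≤ 0} := by
  induction u using UEQ.bc_induction with
  | one => exact le_gspan (s := 0) (by simp) (one_mem_envGr h₀ m)
  | mul x u h =>
    refine mul_mem_gspan_envGr h₀ (fun s hs t ht => ?_) (ιC_mem_gspan h₀ m (mem_gspan_neg M x)) h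
    simp only [Set.mem_ofPred_eq, Prod.fst_add, Prod.snd_add] at hs ht ⊢
    omega
  | zero => exact zero_mem _
  | add u v h1 h2 => exact add_mem h1 h2
  | smul c u h => exact Submodule.smul_mem _ c h

theorem basePointG_eq (h₀ : IsMHS V₀.W V₀.F) (A : AlgRep (SemiGp hS)) (p : ℤ) :
    basePointG hS A p = gspan (repGr h₀ (resQ hS A)) {s | p ≤ s.1} := basePointQ_eq h₀ (resQ hS A) p

theorem action_mem_gspan (h₀ : IsMHS V₀.W V₀.F) {A : AlgRep (SemiGp hS)} {m : ℕ}
    {μ : UEQ ℚ L m ⊗[ℚ] A.V →ₗ[ℚ] A.V}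
    (hμ : ∀ g x, μ.baseChange ℂ (tmulC _ _ (UniGp.glev m g) x) = A.ρ (SemidirectProduct.inl g) x)
    {S T U : Set Bideg} (h : ∀ s ∈ S, ∀ t ∈ T, s + t ∈ U) {u} {x : ℂ ⊗[ℚ] A.V}
    (hu : u ∈ gspan (envGr h₀ hS m) S) (hx : x ∈ gspan (repGr h₀ (resQ hS A)) T) :
    μ.baseChange ℂ (tmulC _ _ u x) ∈ gspan (repGr h₀ (resQ hS A)) U :=
  bilin_mem_gspan ((tmulC _ _).compr₂ (μ.baseChange ℂ))
    (fun _ _ _ hx _ hy => action_mem_repGr h₀ hμ hx hy) h hu hx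

theorem map_basePointG_le (h₀ : IsMHS V₀.W V₀.F) {g : UniGp ℂ (ℂ ⊗[ℚ] L)}
    (hg : ∀ m, UniGp.glev (m + 1) g ∈ gspan (envGr h₀ hS (m + 1)) {s | 0 ≤ s.1})
    (A : AlgRep (SemiGp hS)) (p : ℤ) :
    (basePointG hS A p).map (A.ρ (SemidirectProduct.inl g)) ≤ basePointG hS A p := by
  obtain ⟨m, μ, hμ⟩ := exists_action hS A
  rintro _ ⟨x, hx, rfl⟩
  rw [basePointG_eq h₀] at hx ⊢
  rw [← hμ]
  refine action_mem_gspan h₀ hμ (fun s hs t ht => ?_) (hg m) hx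
  simp only [Set.mem_ofPred_eq, Prod.fst_add] at hs ht ⊢
  omega

theorem orbitMap_eq_basePointG (h₀ : IsMHS V₀.W V₀.F) {g : UniGp ℂ (ℂ ⊗[ℚ] L)}
    (hg : ∀ m, UniGp.glev (m + 1) g ∈ gspan (envGr h₀ hS (m + 1)) {s | 0 ≤ s.1})
    (hg' : ∀ m, UniGp.glev (m + 1) g⁻¹ ∈ gspan (envGr h₀ hS (m + 1)) {s | 0 ≤ s.1}) :
    orbitMap hS g = basePointG hS := by
  funext A p
  refine le_antisymm (map_basePointG_le h₀ hg A p) fun x hx => ?_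
  refine ⟨_, map_basePointG_le h₀ hg' A p ⟨x, hx, rfl⟩, ?_⟩
  rw [map_inv]
  exact LinearMap.congr_fun (rho_mul_inv A _) x

theorem glev_mem_of_orbitMap_eq (h₀ : IsMHS V₀.W V₀.F) {g : UniGp ℂ (ℂ ⊗[ℚ] L)}
    (hg : orbitMap hS g = basePointG hS) (m : ℕ) :
    UniGp.glev m g ∈ gspan (envGr h₀ hS m) {s | 0 ≤ s.1} := by
  have h1 : (1 : ℂ ⊗[ℚ] UEQ ℚ L m) ∈ basePointG hS (envRep hS m) 0 :=
     (basePointG_eq h₀ _ 0).ge (one_mem_gspan_envGr h₀ m)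
  have h2 : (envRep hS m).ρ (SemidirectProduct.inl g) (1 : ℂ ⊗[ℚ] UEQ ℚ L m) ∈
      orbitMap hS g (envRep hS m) 0 := ⟨_, h1, rfl⟩
  have h3 : (envRep hS m).ρ (SemidirectProduct.inl g) (1 : ℂ ⊗[ℚ] UEQ ℚ L m) ∈
      gspan (envGr h₀ hS m) {s | 0 ≤ s.1} :=
    (basePointG_eq h₀ _ 0).le ((congrFun (congrFun hg (envRep hS m)) 0).le h2)
  refine (congrArg (· ∈ gspan (envGr h₀ hS m) {s | 0 ≤ s.1}) ?_).mp h3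
  refine (envRep_ρ hS m _ _).trans ?_
  rw [map_one, mul_one, SemidirectProduct.left_inl]

theorem bc_map_incl_mem (h₀ : IsMHS V₀.W V₀.F) (m : ℕ) (u : UEQ ℂ M.F0 m) :
    UEQ.bc m (UEQ.map M.F0.incl m u) ∈ gspan (envGr h₀ hS m) {s | 0 ≤ s.1} := by
  induction u using UEQ.induction with
  | one =>
    rw [map_one, map_one]
    exact one_mem_gspan_envGr h₀ m
  | mul x u h =>
    rw [map_mul, map_mul, UEQ.map_ι, UEQ.bc_ιC]
    have hx : (x : ℂ ⊗[ℚ] L) ∈ M.F 0 := x.2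
    rw [(lieGrSplitting M).F_eq] at hx
    refine mul_mem_gspan_envGr h₀ (fun s hs t ht => ?_) (ιC_mem_gspan h₀ m hx) h
    simp only [Set.mem_ofPred_eq, Prod.fst_add] at hs ht ⊢
    omega
  | zero => rw [map_zero, map_zero]; exact zero_mem _
  | add u v h1 h2 => rw [map_add, map_add]; exact add_mem h1 h2
  | smul c u h => rw [map_smul, map_smul]; exact Submodule.smul_mem _ c h

theorem orbitMap_of_mem_F0Gp (h₀ : IsMHS V₀.W V₀.F) {g : UniGp ℂ (ℂ ⊗[ℚ] L)} (hg : g ∈ M.F0Gp) :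
    orbitMap hS g = basePointG hS := by
  have h : ∀ g ∈ M.F0Gp, ∀ m, UniGp.glev m g ∈ gspan (envGr h₀ hS m) {s | 0 ≤ s.1} := by
    rintro _ ⟨g, rfl⟩ m
    rw [UniGp.glev, UniGp.lev_map]
    exact bc_map_incl_mem h₀ m _
  exact orbitMap_eq_basePointG h₀ (fun m => h g hg _) fun m => h _ (M.F0Gp.inv_mem hg) _

theorem orbitMap_mul (g h : UniGp ℂ (ℂ ⊗[ℚ] L)) :
    orbitMap hS (g * h) = FilFam.act (SemidirectProduct.inl g) (orbitMap hS h) := by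
  rw [orbitMap, map_mul, FilFam.act_mul]
  rfl

theorem orbitMap_eq_basePointG_mul {g h : UniGp ℂ (ℂ ⊗[ℚ] L)} (hg : orbitMap hS g = basePointG hS)
    (hh : orbitMap hS h = basePointG hS) : orbitMap hS (g * h) = basePointG hS := by
  rw [orbitMap_mul, hh]
  exact hg

theorem orbitMap_eq_basePointG_inv {g : UniGp ℂ (ℂ ⊗[ℚ] L)} (hg : orbitMap hS g = basePointG hS) :
    orbitMap hS g⁻¹ = basePointG hS := by
  have := orbitMap_mul (hS := hS) g⁻¹ g
  rwa [inv_mul_cancel, orbitMap_one, hg, eq_comm] at this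

/-- The exponentials of the elements of `F^0`. -/
theorem exists_exp_F0 {x : ℂ ⊗[ℚ] L} (hx : x ∈ M.F 0) :
    ∃ g ∈ M.F0Gp, ∀ m, ∃ r, UniGp.glev m g = 1 + UEQ.ιC L m x + UEQ.ιC L m x * UEQ.ιC L m x * r := by
  obtain ⟨g, hg⟩ := UniGp.exists_exp (L := M.F0) ⟨x, hx⟩
  refine ⟨UniGp.map M.F0.incl g, ⟨g, rfl⟩, fun m => ?_⟩
  have h1 : UniGp.glev m (UniGp.map M.F0.incl g) = nexp (UEQ.ιC L m x) := by
    rw [UniGp.glev, UniGp.lev_map, hg, map_nexp (UEQ.isNilpotent_ι m _), UEQ.map_ι]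
    refine (map_nexp (UEQ.isNilpotent_ι m _) (UEQ.bc m).toAlgHom).trans ?_
    exact congrArg nexp (UEQ.bc_ιC m x)
  rw [h1]
  refine nexp_eq_add ?_
  rw [← UEQ.bc_ιC]
  exact (UEQ.isNilpotent_ι m x).map (UEQ.bc m)

theorem envDeg_add_mem (h₀ : IsMHS V₀.W V₀.F) {m : ℕ} {k : ℤ} {u : ℂ ⊗[ℚ] UEQ ℚ L m}
    (hu : u ∈ gspan (envGr h₀ hS m) {s | s.1 + s.2 ≤ -k}) :
    envDeg h₀ hS m u + (k : ℂ) • u ∈ gspan (envGr h₀ hS m) {s | s.1 + s.2 ≤ -k - 1} := by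
  have : gspan (envGr h₀ hS m) {s | s.1 + s.2 ≤ -k} ≤
      (gspan (envGr h₀ hS m) {s | s.1 + s.2 ≤ -k - 1}).comap
        (envDeg h₀ hS m + (k : ℂ) • LinearMap.id) := by
    refine gspan_le.2 fun s hs x hx => ?_
    change envDeg h₀ hS m x + (k : ℂ) • x ∈ gspan (envGr h₀ hS m) {s | s.1 + s.2 ≤ -k - 1}
    rw [envDeg_of_mem h₀ hx, ← add_smul]
    simp only [Set.mem_ofPred_eq] at hs
    by_cases h : s.1 + s.2 = -k
    · have : wt s + k = 0 := by rw [wt, h]; push_cast; ring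
      rw [this, zero_smul]
      exact zero_mem _
    · exact Submodule.smul_mem _ _ (le_gspan (s := s)
        (show s.1 + s.2 ≤ -k - 1 by omega) hx)
  exact this hu

/-- If `g` stabilizes the base point and `g - 1` has weight `≤ -k`, so does its logarithmic
derivative, which lies in `F^0`. -/
theorem logDeriv_mem (h₀ : IsMHS V₀.W V₀.F) {g : UniGp ℂ (ℂ ⊗[ℚ] L)}
    (hg : orbitMap hS g = basePointG hS) {k : ℤ}
    (hk : ∀ m, UniGp.glev (m + 1) g - 1 ∈ gspan (envGr h₀ hS (m + 1)) {s | s.1 + s.2 ≤ -k})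
    {ℓ : ℂ ⊗[ℚ] L} (hℓ : ∀ m, envDeg h₀ hS m (UniGp.glev m g) = UEQ.ιC L m ℓ * UniGp.glev m g) :
    ℓ ∈ gspan (lieGr M) {s | s.1 + s.2 ≤ -k} ∧ ℓ ∈ M.F 0 := by
  have e : ∀ m, UEQ.ιC L m ℓ = envDeg h₀ hS m (UniGp.glev m g) * UniGp.glev m g⁻¹ := fun m => by
    rw [hℓ, mul_assoc, ← UniGp.glev_mul, mul_inv_cancel, UniGp.glev_one, mul_one]
  have hdeg : ∀ m (S : Set Bideg), ∀ u ∈ gspan (envGr h₀ hS m) S,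
      envDeg h₀ hS m u ∈ gspan (envGr h₀ hS m) S := fun m S u hu =>
    map_gspan_le (f := envDeg h₀ hS m) (J := envGr h₀ hS m) (fun s x hx => by
      rw [envDeg_of_mem h₀ hx]; exact Submodule.smul_mem _ _ hx) S ⟨u, hu, rfl⟩
  constructor
  · refine mem_gspan_of_ιC h₀ hS fun m => ?_
    rw [e]
    refine mul_mem_gspan_envGr h₀ (fun s hs t ht => ?_) ?_ (mem_envGr_nonpos h₀ _)
      (S := {s | s.1 + s.2 ≤ -k})
    · simp only [Set.mem_ofPred_eq, Prod.fst_add, Prod.snd_add] at hs ht ⊢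
      omega
    · have := hdeg _ _ _ (hk m)
      rwa [map_sub, envDeg_one, sub_zero] at this
  · rw [(lieGrSplitting M).F_eq]
    refine mem_gspan_of_ιC h₀ hS fun m => ?_
    rw [e]
    refine mul_mem_gspan_envGr h₀ (fun s hs t ht => ?_)
      (hdeg _ _ _ (glev_mem_of_orbitMap_eq h₀ hg (m + 1)))
      (glev_mem_of_orbitMap_eq h₀ (orbitMap_eq_basePointG_inv hg) (m + 1))
    simp only [Set.mem_ofPred_eq, Prod.fst_add] at hs ht ⊢
    omega

theorem mem_F0Gp_of_orbitMap_eq (h₀ : IsMHS V₀.W V₀.F) {g : UniGp ℂ (ℂ ⊗[ℚ] L)}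
    (hg : orbitMap hS g = basePointG hS) : g ∈ M.F0Gp := by
  obtain ⟨N, hN⟩ := exists_lieNeg_eq_bot M
  have key : ∀ (n : ℕ) (k : ℤ), 1 ≤ k → (N : ℤ) + 1 ≤ k + n → ∀ g : UniGp ℂ (ℂ ⊗[ℚ] L),
      orbitMap hS g = basePointG hS →
      (∀ m, UniGp.glev (m + 1) g - 1 ∈ gspan (envGr h₀ hS (m + 1)) {s | s.1 + s.2 ≤ -k}) →
      g ∈ M.F0Gp := by
    intro n
    induction n with
    | zero =>
      intro k hk hn g hg hgk
      obtain ⟨ℓ, hℓ⟩ := exists_logDeriv h₀ hS g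
      have h0 : ℓ = 0 := by
        have h1 := gspan_mono (I := lieGr M) (T := {s | s.1 + s.2 ≤ -1 - N})
          (fun s hs => by
            simp only [Set.mem_ofPred_eq] at hs ⊢
            push_cast at hn
            omega) (logDeriv_mem h₀ hg hgk hℓ).1
        exact (Submodule.mem_bot ℂ).1 (hN.le h1)
      have h1 : ∀ m, UniGp.glev (m + 1) g = UniGp.glev (m + 1) 1 := fun m => by
        have h2 := hℓ (m + 1)
        rw [h0, map_zero, zero_mul] at h2
        rw [UniGp.glev_one, ← sub_eq_zero]
        refine gscale_injOn_gspan (isInternal_envGr h₀ hS (m + 1)) (c := wt) (fun s hs => ?_) (hgk m) ?_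
        · simp only [Set.mem_ofPred_eq] at hs
          exact wt_ne_zero (by omega)
        · refine (map_sub (envDeg h₀ hS (m + 1)) _ _).trans ?_
          rw [h2, envDeg_one, sub_zero]
      have : g = 1 := UniGp.glev_ext fun m => by
        rw [← UniGp.glev_trans (Nat.le_succ m), ← UniGp.glev_trans (Nat.le_succ m) 1, h1]
      rw [this]
      exact one_mem _
    | succ n ih =>
      intro k hk hn g hg hgk
      obtain ⟨ℓ, hℓ⟩ := exists_logDeriv h₀ hS g
      obtain ⟨hℓk, hℓF⟩ := logDeriv_mem h₀ hg hgk hℓ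
      obtain ⟨h, hh, hr⟩ := exists_exp_F0 (Submodule.smul_mem (M.F 0) (k : ℂ)⁻¹ hℓF)
      refine (Subgroup.mul_mem_cancel_left _ hh).1 (ih (k + 1) (by omega) (by push_cast at hn; omega) (h * g)
        (orbitMap_eq_basePointG_mul (orbitMap_of_mem_F0Gp h₀ hh) hg) fun m => ?_)
      obtain ⟨r, hr⟩ := hr (m + 1)
      set y := UEQ.ιC L (m + 1) ((k : ℂ)⁻¹ • ℓ) with hy
      set a := UniGp.glev (m + 1) g - 1 with ha
      have hyk : y ∈ gspan (envGr h₀ hS (m + 1)) {s | s.1 + s.2 ≤ -k} :=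
        ιC_mem_gspan h₀ _ (Submodule.smul_mem _ _ hℓk)
      have hk0 : (k : ℂ) ≠ 0 := Int.cast_ne_zero.2 (by omega)
      have hx : UEQ.ιC L (m + 1) ℓ = (k : ℂ) • y := by
        rw [hy, map_smul, smul_smul, mul_inv_cancel₀ hk0, one_smul]
      have hmul : ∀ u ∈ gspan (envGr h₀ hS (m + 1)) {s | s.1 + s.2 ≤ -k},
          y * u ∈ gspan (envGr h₀ hS (m + 1)) {s | s.1 + s.2 ≤ -(k + 1)} := fun u hu =>
        mul_mem_gspan_envGr h₀ (fun s hs t ht => by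
          simp only [Set.mem_ofPred_eq, Prod.fst_add, Prod.snd_add] at hs ht ⊢
          omega) hyk hu
      have hyr : ∀ u, y * u ∈ gspan (envGr h₀ hS (m + 1)) {s | s.1 + s.2 ≤ -k} := fun u =>
        mul_mem_gspan_envGr h₀ (fun s hs t ht => by
          simp only [Set.mem_ofPred_eq, Prod.fst_add, Prod.snd_add] at hs ht ⊢
          omega) hyk (mem_envGr_nonpos h₀ u)
      have h1 := envDeg_add_mem h₀ (hgk m)
      have h2 : envDeg h₀ hS (m + 1) a = (k : ℂ) • (y + y * a) := by
        rw [ha, map_sub, envDeg_one, sub_zero, hℓ, hx, mul_sub, mul_one, smul_mul_assoc,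
          add_sub_cancel]
      rw [← ha, h2, ← smul_add, show -k - 1 = -(k + 1) by ring,
        Submodule.smul_mem_iff _ hk0] at h1
      have e : UniGp.glev (m + 1) (h * g) - 1 = (y + y * a + a) + y * (y * (r * (1 + a))) := by
        rw [UniGp.glev_mul, hr, show UniGp.glev (m + 1) g = 1 + a by rw [ha]; abel]
        noncomm_ring
      rw [e]
      exact add_mem h1 (hmul _ (hyr _))
  refine key N 1 le_rfl (by omega) g hg fun m => ?_
  have := sub_mem_envNeg (hS := hS) h₀ m (UniGp.glev (m + 1) g)
  rwa [UniGp.εC_glev, one_smul] at this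

theorem orbitMap_eq_iff (h₀ : IsMHS V₀.W V₀.F) {g h : UniGp ℂ (ℂ ⊗[ℚ] L)} :
    orbitMap hS g = orbitMap hS h ↔ g⁻¹ * h ∈ M.F0Gp := by
  constructor
  · intro hgh
    refine mem_F0Gp_of_orbitMap_eq h₀ (hS := hS) ?_
    rw [orbitMap_mul, ← hgh, ← orbitMap_mul, inv_mul_cancel, orbitMap_one]
  · intro hgh
    have := orbitMap_mul (hS := hS) g (g⁻¹ * h)
    rw [mul_inv_cancel_left, orbitMap_of_mem_F0Gp h₀ hgh] at this
    exact this.symm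

end LieMHS

section

variable {k : Type*} [CommRing k] {L : Type*} [LieRing L] [LieAlgebra k L]

theorem UEQ.isUnit_of_ε {m : ℕ} {u : UEQ k L (m + 1)} (hu : UEQ.ε k L m u = 1) : IsUnit u := by
  have h : IsNilpotent (1 - u) := by
    obtain ⟨w, hw⟩ := UEQ.mk_surjective (m + 1) (1 - u)
    refine ⟨m + 1, ?_⟩
    have h1 : w ∈ augI k L := by
      rw [RingHom.mem_ker, ← UEQ.ε_mk m, hw, map_sub, map_one, hu, sub_self]
    rw [← hw, ← map_pow, UEQ.mk_eq_zero]
    exact Ideal.pow_mem_pow h1 _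
  have := h.isUnit_one_sub
  rwa [sub_sub_cancel] at this

theorem UEQ.Δ_trans {a b a' b' : ℕ} (ha : a ≤ a') (hb : b ≤ b') (u : UEQ k L (a' + b')) :
    UEQ.Δ a b (UEQ.trans (add_le_add ha hb) u) =
      Algebra.TensorProduct.map (UEQ.trans ha) (UEQ.trans hb) (UEQ.Δ a' b' u) := by
  have : (UEQ.Δ (k := k) (L := L) a b).comp (UEQ.trans (add_le_add ha hb)) =
      (Algebra.TensorProduct.map (UEQ.trans ha) (UEQ.trans hb)).comp (UEQ.Δ a' b') :=
    UEQ.hom_ext fun x => by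
      rw [AlgHom.comp_apply, AlgHom.comp_apply, UEQ.trans_ι, UEQ.Δ_ι, UEQ.Δ_ι, map_add,
        Algebra.TensorProduct.map_tmul, Algebra.TensorProduct.map_tmul, UEQ.trans_ι, UEQ.trans_ι,
        map_one, map_one]
  exact DFunLike.congr_fun this u

theorem UEQ.trans_trans {a b c : ℕ} (hab : a ≤ b) (hbc : b ≤ c) (u : UEQ k L c) :
    UEQ.trans hab (UEQ.trans hbc u) = UEQ.trans (hab.trans hbc) u := by
  obtain ⟨u, rfl⟩ := UEQ.mk_surjective _ u
  rfl

end

theorem tensorBc_injective {A B A' B' : Type*} [Ring A] [Algebra ℂ A] [Ring B] [Algebra ℂ B]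
    [Ring A'] [Algebra ℚ A'] [Ring B'] [Algebra ℚ B'] (α : A ≃ₐ[ℂ] ℂ ⊗[ℚ] A')
    (β : B ≃ₐ[ℂ] ℂ ⊗[ℚ] B') : Function.Injective (tensorBc α.toAlgHom β.toAlgHom) := by
  have h : ∀ z, tensorBc α.toAlgHom β.toAlgHom z =
      (TensorProduct.AlgebraTensorModule.distribBaseChange ℚ ℂ A' B').symm
        (TensorProduct.congr α.toLinearEquiv β.toLinearEquiv z) := fun z => by
    induction z using TensorProduct.induction_on with
    | zero => simp only [map_zero]
    | add z w h1 h2 => simp only [map_add, h1, h2]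
    | tmul a b => rfl
  intro z w hzw
  rw [h, h] at hzw
  exact (TensorProduct.congr α.toLinearEquiv β.toLinearEquiv).injective
    ((TensorProduct.AlgebraTensorModule.distribBaseChange ℚ ℂ A' B').symm.injective hzw)

theorem baseChange_comp_tmulC_ext {U V V' : Type*} [AddCommGroup U] [Module ℚ U] [AddCommGroup V]
    [Module ℚ V] [AddCommGroup V'] [Module ℚ V'] (μ : U ⊗[ℚ] V →ₗ[ℚ] V')
    {a : Module.End ℂ (ℂ ⊗[ℚ] U)} {b : Module.End ℂ (ℂ ⊗[ℚ] V)} {c : Module.End ℂ (ℂ ⊗[ℚ] V')}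
    {r : Module.End ℂ (ℂ ⊗[ℚ] (U ⊗[ℚ] V))} (hr : ∀ x y, r (tmulC U V x y) = tmulC U V (a x) (b y))
    {S : Set (ℂ ⊗[ℚ] U)} (hS : Submodule.span ℂ S = ⊤)
    (h : ∀ u ∈ S, ∀ x, μ.baseChange ℂ (tmulC U V (a u) (b x)) = c (μ.baseChange ℂ (tmulC U V u x)))
    (z : ℂ ⊗[ℚ] (U ⊗[ℚ] V)) : μ.baseChange ℂ (r z) = c (μ.baseChange ℂ z) := by
  induction z using tmulC_induction with
  | tmul u x =>
    rw [hr]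
    have hu : u ∈ Submodule.span ℂ S := hS ▸ Submodule.mem_top
    induction hu using Submodule.span_induction with
    | mem u hu => exact h u hu x
    | zero => simp only [map_zero, LinearMap.zero_apply]
    | add u v _ _ h1 h2 => simp only [map_add, LinearMap.add_apply, h1, h2]
    | smul t u _ h1 => simp only [map_smul, LinearMap.smul_apply, h1]
  | add x y h1 h2 => simp only [map_add, h1, h2]

theorem tmulC_sub_mem_gspan {U V : Type*} [AddCommGroup U] [Module ℚ U] [AddCommGroup V]
    [Module ℚ V] {I : Bideg → Submodule ℂ (ℂ ⊗[ℚ] U)} {J : Bideg → Submodule ℂ (ℂ ⊗[ℚ] V)}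
    {K : Bideg → Submodule ℂ (ℂ ⊗[ℚ] (U ⊗[ℚ] V))}
    (hK : ∀ s t, ∀ x ∈ I s, ∀ y ∈ J t, tmulC U V x y ∈ K (s + t)) {x x' : ℂ ⊗[ℚ] U}
    {y y' : ℂ ⊗[ℚ] V} (hx : x ∈ gspan I {s | s.1 + s.2 ≤ 0}) (hy : y' ∈ gspan J {s | s.1 + s.2 ≤ 0})
    (hx' : x - x' ∈ gspan I {s | s.1 + s.2 ≤ -1}) (hy' : y - y' ∈ gspan J {s | s.1 + s.2 ≤ -1}) :
    tmulC U V x y - tmulC U V x' y' ∈ gspan K {s | s.1 + s.2 ≤ -1} := by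
  have a1 : ∀ s ∈ {s : Bideg | s.1 + s.2 ≤ 0}, ∀ t ∈ {s : Bideg | s.1 + s.2 ≤ -1},
      s + t ∈ {s : Bideg | s.1 + s.2 ≤ -1} := fun s hs t ht => by
    simp only [Set.mem_ofPred_eq, Prod.fst_add, Prod.snd_add] at hs ht ⊢
    omega
  have a2 : ∀ s ∈ {s : Bideg | s.1 + s.2 ≤ -1}, ∀ t ∈ {s : Bideg | s.1 + s.2 ≤ 0},
      s + t ∈ {s : Bideg | s.1 + s.2 ≤ -1} := fun s hs t ht => add_comm t s ▸ a1 t ht s hs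
  have := add_mem (bilin_mem_gspan _ hK a1 hx hy') (bilin_mem_gspan _ hK a2 hx' hy)
  rwa [map_sub, map_sub, LinearMap.sub_apply, sub_add_sub_cancel] at this

section

variable {G : Type*} [Group G] [AlgGp G]

theorem IsGMHS.tmulC_mem {h₀ : ℂˣ → ℂˣ → Set G} {H : FilFam G} (hH : IsGMHS h₀ H) (A B : AlgRep G)
    (p : ℤ) : tensorF (H A) (H B) p ≤ H (A.tensor B) p := by
  rw [hH.tensor A B _ _ (AlgRep.isTensorIso_tensor A B) p]
  intro x hx
  exact ⟨x, hx, LinearMap.congr_fun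
    (LinearMap.baseChange_id (R := ℚ) (A := ℂ) (M := A.V ⊗[ℚ] B.V)) x⟩

theorem AlgRep.isHom_tensor {A B C : AlgRep G} {μ : A.V ⊗[ℚ] B.V →ₗ[ℚ] C.V}
    {S : Set (ℂ ⊗[ℚ] A.V)} (hS : Submodule.span ℂ S = ⊤)
    (h : ∀ g, ∀ u ∈ S, ∀ x, μ.baseChange ℂ (tmulC A.V B.V (A.ρ g u) (B.ρ g x)) =
      C.ρ g (μ.baseChange ℂ (tmulC A.V B.V u x))) : (A.tensor B).IsHom C μ := fun g =>
  baseChange_comp_tmulC_ext μ (AlgRep.tensor_ρ A B g) hS (h g)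

/-- The trivial representation. -/
def AlgRep.triv (G : Type*) [Group G] [AlgGp G] : AlgRep G where
  V := ℚ
  ρ := 1
  regular v l := RegFun.const v l

end

namespace LieMHS

variable {L : Type} [LieRing L] [LieAlgebra ℚ L] {M : LieMHS L} {V₀ : FilSp}
  {hS : M.fil.IsDirectSummand V₀}

/-- The action of `G` on `ℂ ⊗ U(L)/I^m`. -/
def envEnd (m : ℕ) (g : SemiGp hS) : Module.End ℂ (ℂ ⊗[ℚ] UEQ ℚ L m) :=
  LinearMap.mulLeft ℂ (UniGp.glev m g.left) ∘ₗ (qEnv hS m g.right).toLinearMap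

theorem envEnd_apply (m : ℕ) (g : SemiGp hS) (u : ℂ ⊗[ℚ] UEQ ℚ L m) :
    envEnd m g u = UniGp.glev m g.left * qEnv hS m g.right u := rfl

theorem envEnd_glev (m : ℕ) (g : SemiGp hS) (h : UniGp ℂ (ℂ ⊗[ℚ] L)) :
    envEnd m g (UniGp.glev m h) = UniGp.glev m (g.left * actGp hS g.right h) := by
  rw [envEnd_apply, qEnv_glev, UniGp.glev_mul]

theorem envEnd_hom_ext {m : ℕ} {N : Type*} [AddCommGroup N] [Module ℂ N]
    {f f' : (ℂ ⊗[ℚ] UEQ ℚ L m) →ₗ[ℂ] N} (h : ∀ g, f (UniGp.glev m g) = f' (UniGp.glev m g)) :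
    f = f' := LinearMap.ext fun u => by
  induction u using glev_induction with
  | glev g => exact h g
  | zero => rw [map_zero, map_zero]
  | add u v h1 h2 => rw [map_add, map_add, h1, h2]
  | smul c u h => rw [map_smul, map_smul, h]

theorem isHom_trans {m n : ℕ} (h : m ≤ n) :
    (envRep hS n).IsHom (envRep hS m) (UEQ.trans (k := ℚ) (L := L) h).toLinearMap := by
  intro g u
  have e : (UEQ.trans (k := ℚ) (L := L) h).toLinearMap.baseChange ℂ ∘ₗ envEnd n g =
      envEnd m g ∘ₗ (UEQ.trans (k := ℚ) (L := L) h).toLinearMap.baseChange ℂ :=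
    envEnd_hom_ext fun x => by
      rw [LinearMap.comp_apply, LinearMap.comp_apply, envEnd_glev, UniGp.glev_trans,
        UniGp.glev_trans, envEnd_glev]
  exact LinearMap.congr_fun e u

theorem isHom_Δ (a b : ℕ) : (envRep hS (a + b)).IsHom ((envRep hS a).tensor (envRep hS b))
    (UEQ.Δ (k := ℚ) (L := L) a b).toLinearMap := by
  intro g u
  have e : (UEQ.Δ (k := ℚ) (L := L) a b).toLinearMap.baseChange ℂ ∘ₗ envEnd (a + b) g =
      tensorEnd (envEnd a g) (envEnd b g) ∘ₗ
        (UEQ.Δ (k := ℚ) (L := L) a b).toLinearMap.baseChange ℂ :=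
    envEnd_hom_ext fun x => by
      rw [LinearMap.comp_apply, LinearMap.comp_apply, envEnd_glev, UniGp.glev_Δ, UniGp.glev_Δ,
        tensorEnd_tmulC, envEnd_glev, envEnd_glev]
  exact LinearMap.congr_fun e u

theorem isHom_ε (m : ℕ) : (envRep hS (m + 1)).IsHom (AlgRep.triv (SemiGp hS))
    (UEQ.ε ℚ L m).toLinearMap := by
  have e : ∀ u, (UEQ.ε ℚ L m).toLinearMap.baseChange ℂ u =
      (Algebra.TensorProduct.rid ℚ ℂ ℂ).symm (UEQ.εC L m u) := fun u =>
    ((Algebra.TensorProduct.rid ℚ ℂ ℂ).symm_apply_apply _).symm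
  intro g u
  have h : (UEQ.εC L m).toLinearMap ∘ₗ envEnd (m + 1) g = (UEQ.εC L m).toLinearMap :=
    envEnd_hom_ext fun x => by
      rw [LinearMap.comp_apply, envEnd_glev]
      exact (UniGp.εC_glev m _).trans (UniGp.εC_glev m _).symm
  exact (e _).trans ((congrArg _ (LinearMap.congr_fun h u)).trans (e u).symm)

/-- The representation of `G` obtained from a representation by forgetting the action of `𝒢`. -/
abbrev flat (A : AlgRep (SemiGp hS)) : AlgRep (SemiGp hS) where
  V := A.V
  ρ := (A.ρ.comp SemidirectProduct.inr).comp SemidirectProduct.rightHom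
  regular := ((resQ hS A).pull SemidirectProduct.rightHom (regular_rightHom hS)).regular

theorem span_range_glev (m : ℕ) :
    Submodule.span ℂ (Set.range (UniGp.glev (L := L) m)) = ⊤ :=
  Submodule.eq_top_iff'.2 fun u => by
    induction u using glev_induction with
    | glev g => exact Submodule.subset_span ⟨g, rfl⟩
    | zero => exact zero_mem _
    | add u v h1 h2 => exact add_mem h1 h2
    | smul c u h => exact Submodule.smul_mem _ c h

theorem isHom_tensor_flat {E A : AlgRep (SemiGp hS)} {l : UniGp ℂ (ℂ ⊗[ℚ] L) → ℂ ⊗[ℚ] E.V}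
    (hl : Submodule.span ℂ (Set.range l) = ⊤)
    (hE : ∀ g h, E.ρ g (l h) = l (g.left * actGp hS g.right h)) {μ : E.V ⊗[ℚ] A.V →ₗ[ℚ] A.V}
    (hμ : ∀ g x, μ.baseChange ℂ (tmulC E.V A.V (l g) x) = A.ρ (SemidirectProduct.inl g) x) :
    (E.tensor (flat A)).IsHom A μ := by
  have h : ∀ g, ∀ u ∈ Set.range l, ∀ x, μ.baseChange ℂ (tmulC E.V A.V (E.ρ g u)
      (A.ρ (SemidirectProduct.inr g.right) x)) = A.ρ g (μ.baseChange ℂ (tmulC E.V A.V u x)) := by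
    rintro g _ ⟨h, rfl⟩ x
    have e : A.ρ (SemidirectProduct.inl (g.left * actGp hS g.right h)) =
        A.ρ (SemidirectProduct.inl g.left) * A.ρ (SemidirectProduct.inl (actGp hS g.right h)) :=
      (congrArg A.ρ (map_mul SemidirectProduct.inl _ _)).trans (map_mul A.ρ _ _)
    have e' : A.ρ g (A.ρ (SemidirectProduct.inl h) x) =
        A.ρ (SemidirectProduct.inl (g.left * actGp hS g.right h))
          (A.ρ (SemidirectProduct.inr g.right) x) :=
      ((rho_inl_mul_inr A g _).trans (congrArg (A.ρ (SemidirectProduct.inl g.left))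
        (rho_inr_inl A g.right h x))).trans (LinearMap.congr_fun e _).symm
    exact (congrArg (fun w => μ.baseChange ℂ (tmulC E.V A.V w _)) (hE g h)).trans ((hμ _ _).trans
      (e'.symm.trans (congrArg (A.ρ g) (hμ h x)).symm))
  exact AlgRep.isHom_tensor (A := E) (B := flat A) (C := A) hl h

theorem isHom_action {A : AlgRep (SemiGp hS)} {m : ℕ} {μ : UEQ ℚ L m ⊗[ℚ] A.V →ₗ[ℚ] A.V}
    (hμ : ∀ g x, μ.baseChange ℂ (tmulC (UEQ ℚ L m) A.V (UniGp.glev m g) x) =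
      A.ρ (SemidirectProduct.inl g) x) : ((envRep hS m).tensor (flat A)).IsHom A μ :=
  isHom_tensor_flat (E := envRep hS m) (l := UniGp.glev m) (span_range_glev m) (envEnd_glev m) hμ

/-! ## The fibre is one orbit -/

/-- The weight filtration of a representation of `G`. -/
def repWt (A : AlgRep (SemiGp hS)) : ℤ → Submodule ℚ A.V := repW (resQ hS A)

/-- The bigrading of a representation of `G`. -/
def repBg (h₀ : IsMHS V₀.W V₀.F) (A : AlgRep (SemiGp hS)) : Bideg → Submodule ℂ (ℂ ⊗[ℚ] A.V) :=
  repGr h₀ (resQ hS A)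

theorem repWt_eq (h₀ : IsMHS V₀.W V₀.F) (A : AlgRep (SemiGp hS)) (n : ℤ) :
    (repWt A n).baseChange ℂ = gspan (repBg h₀ A) {s | s.1 + s.2 ≤ n} := repW_eq h₀ (resQ hS A) n

theorem map_repBg (h₀ : IsMHS V₀.W V₀.F) {A B : AlgRep (SemiGp hS)} {f : A.V →ₗ[ℚ] B.V}
    (hf : A.IsHom B f) : ∀ s, ∀ x ∈ repBg h₀ A s, f.baseChange ℂ x ∈ repBg h₀ B s :=
  (isGradFam_resQ h₀).functorial A B f hf

theorem tmulC_mem_repBg (h₀ : IsMHS V₀.W V₀.F) (A B : AlgRep (SemiGp hS)) (s t : Bideg)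
    (x : ℂ ⊗[ℚ] A.V) (hx : x ∈ repBg h₀ A s) (y : ℂ ⊗[ℚ] B.V) (hy : y ∈ repBg h₀ B t) :
    tmulC A.V B.V x y ∈ repBg h₀ (A.tensor B) (s + t) := by
  have := (isGradFam_resQ h₀).tensor A B _ _ (AlgRep.isTensorIso_tensor A B) s t x hx y hy
  refine (congrArg (· ∈ repBg h₀ (A.tensor B) (s + t)) ?_).mp this
  exact LinearMap.congr_fun (LinearMap.baseChange_id (R := ℚ) (A := ℂ) (M := A.V ⊗[ℚ] B.V)) _

theorem map_repWt_le (h₀ : IsMHS V₀.W V₀.F) {A B : AlgRep (SemiGp hS)} {f : A.V →ₗ[ℚ] B.V}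
    (hf : A.IsHom B f) (n : ℤ) : (repWt A n).map f ≤ repWt B n := by
  refine baseChange_le_iff.1 ?_
  rw [baseChange_map, repWt_eq h₀, repWt_eq h₀]
  exact map_gspan_le (map_repBg h₀ hf) _

theorem tensorW_repWt_le (h₀ : IsMHS V₀.W V₀.F) (A B : AlgRep (SemiGp hS)) (n : ℤ) :
    tensorW (repWt A) (repWt B) n ≤ repWt (A.tensor B) n := by
  refine baseChange_le_iff.1 ?_
  refine (tensorW_eq (repWt_eq h₀ A) (repWt_eq h₀ B) n).le.trans
    (le_trans ?_ (repWt_eq h₀ (A.tensor B) n).ge)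
  refine gspan_le.2 fun s hs => le_trans ?_ (le_gspan hs)
  refine iSup_le fun a => Submodule.map₂_le.2 fun x hx y hy => ?_
  have := tmulC_mem_repBg h₀ A B a (s - a) x hx y hy
  rwa [add_sub_cancel] at this

section Transitive

/-- The Deligne bigrading of a `G`-mixed Hodge structure. -/
def famGr (H : FilFam (SemiGp hS)) (A : AlgRep (SemiGp hS)) : Bideg → Submodule ℂ (ℂ ⊗[ℚ] A.V) :=
  delSplit (repWt A) (H A)

variable {H : FilFam (SemiGp hS)}

theorem isMHS_fam (h₀ : IsMHS V₀.W V₀.F) (hH : IsGMHS (hodgeHomG hS) H) (A : AlgRep (SemiGp hS)) :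
    IsMHS (repWt A) (H A) := by
  have := hH.mhs A
  rwa [weightFil_hodgeHomG h₀ A] at this

theorem famGrSplitting (h₀ : IsMHS V₀.W V₀.F) (hH : IsGMHS (hodgeHomG hS) H)
    (A : AlgRep (SemiGp hS)) : IsHodgeSplitting (repWt A) (H A) (famGr H A) :=
  (isMHS_fam h₀ hH A).isHodgeSplitting

theorem map_famGr (h₀ : IsMHS V₀.W V₀.F) (hH : IsGMHS (hodgeHomG hS) H) {A B : AlgRep (SemiGp hS)}
    {f : A.V →ₗ[ℚ] B.V} (hf : A.IsHom B f) (s : Bideg) (x : ℂ ⊗[ℚ] A.V) (hx : x ∈ famGr H A s) :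
    f.baseChange ℂ x ∈ famGr H B s :=
  delSplit_map (map_repWt_le h₀ hf) (hH.functorial A B f hf) s x hx

theorem tmulC_mem_famGr (h₀ : IsMHS V₀.W V₀.F) (hH : IsGMHS (hodgeHomG hS) H)
    (A B : AlgRep (SemiGp hS)) {x : ℂ ⊗[ℚ] A.V} {y : ℂ ⊗[ℚ] B.V}
    (hx : x ∈ famGr H A 0) (hy : y ∈ famGr H B 0) : tmulC A.V B.V x y ∈ famGr H (A.tensor B) 0 := by
  have := tmulC_mem_delSplit hx hy (tensorW_repWt_le h₀ A B) (isMHS_fam h₀ hH _).W_mono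
    (hH.tmulC_mem A B)
  rwa [add_zero] at this

theorem eq_of_mem_famGr (h₀ : IsMHS V₀.W V₀.F) (hH : IsGMHS (hodgeHomG hS) H)
    (A : AlgRep (SemiGp hS)) {x y : ℂ ⊗[ℚ] A.V} (hx : x ∈ famGr H A 0) (hy : y ∈ famGr H A 0)
    (hxy : x - y ∈ gspan (repBg h₀ A) {s | s.1 + s.2 ≤ -1}) : x = y := by
  have hs := famGrSplitting h₀ hH A
  rw [← repWt_eq, hs.W_eq] at hxy
  rw [← sub_eq_zero, ← gcomp_of_mem hs.internal (sub_mem hx hy)]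
  exact (mem_gspan_iff hs.internal).1 hxy 0 (by simp)

theorem mem_famGr_triv (h₀ : IsMHS V₀.W V₀.F) (hH : IsGMHS (hodgeHomG hS) H)
    (x : ℂ ⊗[ℚ] (AlgRep.triv (SemiGp hS)).V) : x ∈ famGr H (AlgRep.triv (SemiGp hS)) 0 := by
  have hF : H (AlgRep.triv (SemiGp hS)) 0 = ⊤ := by
    rw [hH.unit (AlgRep.triv (SemiGp hS)) (Module.finrank_self ℚ) (fun _ => rfl), if_pos le_rfl]
  have hW : x ∈ (repWt (AlgRep.triv (SemiGp hS)) 0).baseChange ℂ :=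
    (repWt_eq h₀ _ 0).ge (le_gspan (s := (0 : Bideg)) (by simp)
      ((isGradFam_resQ h₀).unit (AlgRep.triv (SemiGp hS)) (fun _ => rfl) x))
  refine ⟨⟨?_, hW⟩, Submodule.mem_sup_left ⟨mem_conjF.2 ?_, hW⟩⟩
  · rw [Prod.fst_zero, hF]; exact Submodule.mem_top
  · rw [Prod.snd_zero, hF]; exact Submodule.mem_top

theorem exists_famGr_map_eq (h₀ : IsMHS V₀.W V₀.F) (hH : IsGMHS (hodgeHomG hS) H)
    {A : AlgRep (SemiGp hS)} {f : A.V →ₗ[ℚ] (AlgRep.triv (SemiGp hS)).V} (hf : A.IsHom _ f)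
    (x : ℂ ⊗[ℚ] A.V) : ∃ y ∈ famGr H A 0, f.baseChange ℂ y = f.baseChange ℂ x := by
  have hs := famGrSplitting h₀ hH A
  refine ⟨_, gcomp_mem hs.internal 0 x, ?_⟩
  rw [← gcomp_map hs.internal (famGrSplitting h₀ hH _).internal (map_famGr h₀ hH hf),
    gcomp_of_mem _ (mem_famGr_triv h₀ hH _)]

/-- The element of type `(0, 0)` of `ℂ ⊗ U(L)/I^(m+1)` with augmentation `1`. -/
theorem exists_famElt (h₀ : IsMHS V₀.W V₀.F) (hH : IsGMHS (hodgeHomG hS) H) (m : ℕ) :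
    ∃ x : ℂ ⊗[ℚ] UEQ ℚ L (m + 1), x ∈ famGr H (envRep hS (m + 1)) 0 ∧ UEQ.εC L m x = 1 := by
  obtain ⟨x, hx, h⟩ := exists_famGr_map_eq h₀ hH (isHom_ε (hS := hS) m) (1 : ℂ ⊗[ℚ] UEQ ℚ L (m + 1))
  exact ⟨x, hx, (congrArg (Algebra.TensorProduct.rid ℚ ℂ ℂ) h).trans (map_one (UEQ.εC L m))⟩

theorem famElt_unique (h₀ : IsMHS V₀.W V₀.F) (hH : IsGMHS (hodgeHomG hS) H) {m : ℕ}
    {x y : ℂ ⊗[ℚ] UEQ ℚ L (m + 1)} (hx : x ∈ famGr H (envRep hS (m + 1)) 0)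
    (hy : y ∈ famGr H (envRep hS (m + 1)) 0) (hεx : UEQ.εC L m x = 1) (hεy : UEQ.εC L m y = 1) :
    x = y := by
  refine eq_of_mem_famGr h₀ hH (envRep hS (m + 1)) hx hy ?_
  have := sub_mem_envNeg (hS := hS) h₀ m (x - y)
  rw [map_sub, hεx, hεy, sub_self, zero_smul, sub_zero] at this
  exact this

theorem εC_trans {m n : ℕ} (h : m + 1 ≤ n + 1) (u : ℂ ⊗[ℚ] UEQ ℚ L (n + 1)) :
    UEQ.εC L m ((UEQ.trans h).toLinearMap.baseChange ℂ u) = UEQ.εC L n u := by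
  obtain ⟨u, rfl⟩ := (UEQ.bc (n + 1)).surjective u
  rw [UEQ.bc_trans, UEQ.εC_bc, UEQ.εC_bc, UEQ.ε_trans]

theorem sub_one_mem_envNeg (h₀ : IsMHS V₀.W V₀.F) (hS : M.fil.IsDirectSummand V₀) {m : ℕ}
    {x : ℂ ⊗[ℚ] UEQ ℚ L (m + 1)} (hx : UEQ.εC L m x = 1) : x - 1 ∈ envNeg h₀ hS (m + 1) := by
  have := sub_mem_envNeg (hS := hS) h₀ m x
  rwa [hx, one_smul] at this

theorem famElt_Δ (h₀ : IsMHS V₀.W V₀.F) (hH : IsGMHS (hodgeHomG hS) H) {m : ℕ}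
    {x : ℂ ⊗[ℚ] UEQ ℚ L (m + 1 + m + 1)} {y : ℂ ⊗[ℚ] UEQ ℚ L (m + 1)}
    (hx : x ∈ famGr H (envRep hS (m + 1 + m + 1)) 0)
    (hy : y ∈ famGr H (envRep hS (m + 1)) 0) (hεx : UEQ.εC L (m + 1 + m) x = 1)
    (hεy : UEQ.εC L m y = 1) :
    (UEQ.Δ (m + 1) (m + 1)).toLinearMap.baseChange ℂ x = tmulC _ _ y y := by
  refine eq_of_mem_famGr h₀ hH ((envRep hS (m + 1)).tensor (envRep hS (m + 1)))
    (map_famGr h₀ hH (isHom_Δ (m + 1) (m + 1)) 0 _ hx) (tmulC_mem_famGr h₀ hH _ _ hy hy) ?_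
  have h1 : algBc (UEQ.Δ (k := ℚ) (L := L) (m + 1) (m + 1)) (x - 1) ∈
      gspan (repBg h₀ ((envRep hS (m + 1)).tensor (envRep hS (m + 1)))) {s | s.1 + s.2 ≤ -1} :=
    map_gspan_le (map_repBg h₀ (isHom_Δ (m + 1) (m + 1))) _ ⟨_, sub_one_mem_envNeg h₀ hS hεx, rfl⟩
  have h2 := tmulC_sub_mem_gspan
    (tmulC_mem_repBg h₀ (envRep hS (m + 1)) (envRep hS (m + 1)))
    (mem_envGr_nonpos h₀ y) (mem_envGr_nonpos h₀ 1) (sub_one_mem_envNeg h₀ hS hεy)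
    (sub_one_mem_envNeg h₀ hS hεy)
  have e : algBc (UEQ.Δ (m + 1) (m + 1)) (x - 1) - (tmulC _ _ y y - tmulC _ _ 1 1) =
      algBc (UEQ.Δ (m + 1) (m + 1)) x - tmulC (UEQ ℚ L (m + 1)) (UEQ ℚ L (m + 1)) y y := by
    have h4 : algBc (UEQ.Δ (k := ℚ) (L := L) (m + 1) (m + 1)) 1 =
        tmulC (UEQ ℚ L (m + 1)) (UEQ ℚ L (m + 1)) 1 1 := by
      rw [map_one]
      simp only [Algebra.TensorProduct.one_def, tmulC_tmul, mul_one]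
    rw [map_sub, h4, sub_sub_sub_cancel_right]
  exact (congrArg (· ∈ gspan (repBg h₀ ((envRep hS (m + 1)).tensor (envRep hS (m + 1))))
    {s | s.1 + s.2 ≤ -1}) e).mp (sub_mem h1 h2)

theorem exists_glev_mem_famGr (h₀ : IsMHS V₀.W V₀.F) (hH : IsGMHS (hodgeHomG hS) H) :
    ∃ g : UniGp ℂ (ℂ ⊗[ℚ] L), ∀ m, UniGp.glev (m + 1) g ∈ famGr H (envRep hS (m + 1)) 0 := by
  choose z hz hεz using exists_famElt h₀ hH
  set y : ∀ m, UEQ ℂ (ℂ ⊗[ℚ] L) (m + 1) := fun m => (UEQ.bc (m + 1)).symm (z m) with hy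
  have hbc : ∀ m, UEQ.bc (m + 1) (y m) = z m := fun m => (UEQ.bc (m + 1)).apply_symm_apply _
  have htr : ∀ m n (h : m + 1 ≤ n + 1), UEQ.trans h (y n) = y m := fun m n h =>
    (UEQ.bc (m + 1)).injective (by
      rw [← UEQ.bc_trans, hbc, hbc]
      exact famElt_unique h₀ hH (map_famGr h₀ hH (isHom_trans h) 0 _ (hz n)) (hz m)
        ((εC_trans h _).trans (hεz n)) (hεz m))
  have hΔ : ∀ m, UEQ.Δ (m + 1) (m + 1) (y (m + 1 + m)) = y m ⊗ₜ y m := fun m => by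
    apply tensorBc_injective (UEQ.bc (m + 1)) (UEQ.bc (m + 1))
    refine (UEQ.bc_Δ (m + 1) (m + 1) (y (m + 1 + m))).symm.trans ?_
    have e := congrArg ((UEQ.Δ (m + 1) (m + 1)).toLinearMap.baseChange ℂ) (hbc (m + 1 + m))
    refine e.trans ((famElt_Δ h₀ hH (hz _) (hz m) (hεz _) (hεz m)).trans ?_)
    rw [← hbc m]
    rfl
  obtain ⟨g, hg⟩ := UniGp.exists_of_family (fun m => UEQ.trans (Nat.le_succ m) (y m))
    (fun m => (UEQ.isUnit_of_ε (by rw [← UEQ.εC_bc, hbc, hεz])).map _)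
    (fun m n h => by
      rw [UEQ.trans_trans, ← htr m n (Nat.succ_le_succ h), UEQ.trans_trans])
    (fun m => by
      have e : UEQ.trans (Nat.le_succ (m + m)) (y (m + m)) =
          UEQ.trans (add_le_add (Nat.le_succ m) (Nat.le_succ m)) (y (m + 1 + m)) := by
        rw [← htr (m + m) (m + 1 + m) (by omega), UEQ.trans_trans]
      rw [e, UEQ.Δ_trans (Nat.le_succ m) (Nat.le_succ m), hΔ, Algebra.TensorProduct.map_tmul])
  refine ⟨g, fun m => ?_⟩
  have : UniGp.glev (m + 1) g = z m := by
    rw [UniGp.glev, hg (m + 1)]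
    exact (congrArg (UEQ.bc (m + 1)) (htr m (m + 1) (Nat.le_succ _))).trans (hbc m)
  rw [this]
  exact hz m

theorem tmulC_mem_fam {h : ℂˣ → ℂˣ → Set (SemiGp hS)} (hH : IsGMHS h H) (A B : AlgRep (SemiGp hS))
    {p : ℤ} {x : ℂ ⊗[ℚ] A.V} {y : ℂ ⊗[ℚ] B.V} (hx : x ∈ H A 0) (hy : y ∈ H B p) :
    tmulC A.V B.V x y ∈ H (A.tensor B) p := by
  refine hH.tmulC_mem A B p (Submodule.mem_iSup_of_mem 0 ?_)
  rw [map₂_mk_map, sub_zero]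
  exact Submodule.apply_mem_map₂ _ hx hy

/-- `𝒢(ℂ)` acts transitively on the fibre. -/
theorem exists_orbitMap_eq (h₀ : IsMHS V₀.W V₀.F) (hH : H ∈ fiber hS) : ∃ g, orbitMap hS g = H := by
  obtain ⟨⟨hG, -⟩, hQ⟩ := hH
  obtain ⟨g, hg⟩ := exists_glev_mem_famGr h₀ hG
  refine ⟨g, funext fun A => ?_⟩
  refine IsMHS.eq_of_le (orbitSplitting h₀ g A).isMHS (isMHS_fam h₀ hG A) fun p => ?_
  rintro _ ⟨x, hx, rfl⟩
  obtain ⟨m, μ, hμ⟩ := exists_action hS A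
  have hx' : x ∈ H (flat A) p := (congrFun (congrFun hQ (resQ hS A)) p).ge hx
  have hg0 : UniGp.glev (m + 1) g ∈ H (envRep hS (m + 1)) 0 :=
    ((famGrSplitting h₀ hG (envRep hS (m + 1))).F_eq 0).ge
      (le_gspan (s := (0 : Bideg)) (by simp) (hg m))
  have h1 : tmulC (UEQ ℚ L (m + 1)) A.V (UniGp.glev (m + 1) g) x ∈
      H ((envRep hS (m + 1)).tensor (flat A)) p :=
    tmulC_mem_fam hG (envRep hS (m + 1)) (flat A) hg0 hx'
  have h2 : μ.baseChange ℂ (tmulC (UEQ ℚ L (m + 1)) A.V (UniGp.glev (m + 1) g) x) ∈ H A p :=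
    hG.functorial ((envRep hS (m + 1)).tensor (flat A)) A μ
      (isHom_action (A := A) (m := m + 1) (μ := μ) hμ) p (Submodule.mem_map_of_mem h1)
  exact (congrArg (· ∈ H A p) (hμ g x)).mp h2

end Transitive

end LieMHS

/-! ## Holomorphic functions on algebraic groups -/

section Hol

open Filter

variable {G : Type*} [Group G] [AlgGp G]

/-- The neighbourhoods of a point for the complex topology. -/
def hnhds (g : G) : Filter G := @nhds G (AlgGp.hol G).top g

theorem hnhds_eq (g : G) :
    hnhds g = ⨅ u : AlgGp.coord (G := G), (𝓝 (u.1 g)).comap u.1 := by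
  refine (@nhds_iInf G _ _ g).trans (iInf_congr fun u => ?_)
  exact nhds_induced u.1 g

theorem tendsto_hnhds {X : Type*} {l : Filter X} {ψ : X → G} {g : G} :
    Tendsto ψ l (hnhds g) ↔ ∀ u ∈ AlgGp.coord (G := G), Tendsto (fun x => u (ψ x)) l (𝓝 (u g)) := by
  rw [hnhds_eq, tendsto_iInf, Subtype.forall]
  exact forall₂_congr fun u _ => tendsto_comap_iff

theorem tendsto_coord {u : G → ℂ} (hu : u ∈ AlgGp.coord (G := G)) (g : G) :
    Tendsto u (hnhds g) (𝓝 (u g)) := tendsto_hnhds.1 tendsto_id u hu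

/-- The function `f` is holomorphic near `g`. -/
def HolAt (f : G → ℂ) (g : G) : Prop := (AlgGp.hol G).holAt f g

theorem holAt_iff {f : G → ℂ} {g : G} : HolAt f g ↔
    ∃ (n : ℕ) (u : Fin n → AlgGp.coord (G := G)) (Φ : (Fin n → ℂ) → ℂ),
      AnalyticAt ℂ Φ (fun i => (u i).1 g) ∧ f =ᶠ[hnhds g] fun x => Φ (fun i => (u i).1 x) := Iff.rfl

theorem HolAt.congr {f f' : G → ℂ} {g : G} (h : HolAt f g) (hf : f' =ᶠ[hnhds g] f) :
    HolAt f' g := by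
  obtain ⟨n, u, Φ, hΦ, h⟩ := holAt_iff.1 h
  exact holAt_iff.2 ⟨n, u, Φ, hΦ, hf.trans h⟩

theorem analyticAt_coord {ι : Type*} [Fintype ι] (i : ι) (z : ι → ℂ) :
    AnalyticAt ℂ (fun z : ι → ℂ => z i) z :=
  (ContinuousLinearMap.proj (R := ℂ) (φ := fun _ => ℂ) i).analyticAt z

theorem holAt_of_analyticAt {ι : Type*} [Fintype ι] {u : ι → G → ℂ} {g : G} {Φ : (ι → ℂ) → ℂ}
    (hu : ∀ i, u i ∈ AlgGp.coord (G := G)) (hΦ : AnalyticAt ℂ Φ fun i => u i g) :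
    HolAt (fun x => Φ fun i => u i x) g := by
  let e := Fintype.equivFin ι
  refine holAt_iff.2 ⟨_, fun i => ⟨u (e.symm i), hu _⟩, fun z => Φ fun i => z (e i), ?_,
    Eventually.of_forall fun x => by simp⟩
  refine AnalyticAt.comp_of_eq (f := fun (z : Fin _ → ℂ) i => z (e i)) hΦ ?_ (by simp)
  exact AnalyticAt.pi fun i => analyticAt_coord (e i) _

theorem holAt_coord {u : G → ℂ} (hu : u ∈ AlgGp.coord (G := G)) (g : G) : HolAt u g :=
  holAt_of_analyticAt (ι := Unit) (u := fun _ => u) (Φ := fun z => z ()) (fun _ => hu)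
    (analyticAt_coord () _)

theorem HolAt.eq_self {f f' : G → ℂ} {g : G} (h : f =ᶠ[hnhds g] f') : f g = f' g :=
  @Eventually.self_of_nhds G (AlgGp.hol G).top _ _ h

theorem HolAt.comp {ι : Type*} [Fintype ι] {f : ι → G → ℂ} {g : G} (hf : ∀ i, HolAt (f i) g)
    {Φ : (ι → ℂ) → ℂ} (hΦ : AnalyticAt ℂ Φ fun i => f i g) :
    HolAt (fun x => Φ fun i => f i x) g := by
  choose n u Ψ hΨ he using fun i => holAt_iff.1 (hf i)
  have hval : (fun i => Ψ i fun j => (u i j).1 g) = fun i => f i g :=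
    funext fun i => (HolAt.eq_self (he i)).symm
  have h1 : HolAt (fun x => Φ fun i => Ψ i fun j => (u i j).1 x) g := by
    refine holAt_of_analyticAt (ι := Σ i, Fin (n i)) (u := fun k => (u k.1 k.2).1)
      (Φ := fun z => Φ fun i => Ψ i fun j => z ⟨i, j⟩) (fun k => (u k.1 k.2).2) ?_
    refine AnalyticAt.comp_of_eq (f := fun (z : (Σ i, Fin (n i)) → ℂ) i => Ψ i fun j => z ⟨i, j⟩)
      hΦ (AnalyticAt.pi fun i => ?_) hval
    refine AnalyticAt.comp_of_eq (f := fun (z : (Σ i, Fin (n i)) → ℂ) (j : Fin (n i)) => z ⟨i, j⟩)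
      (hΨ i) (AnalyticAt.pi fun j => ?_) rfl
    exact analyticAt_coord (⟨i, j⟩ : Σ i, Fin (n i)) _
  refine h1.congr ?_
  filter_upwards [eventually_all.2 he] with x hx
  exact congrArg Φ (funext hx)

theorem HolAt.tendsto {f : G → ℂ} {g : G} (h : HolAt f g) : Tendsto f (hnhds g) (𝓝 (f g)) := by
  obtain ⟨n, u, Φ, hΦ, h⟩ := holAt_iff.1 h
  rw [HolAt.eq_self h]
  refine Tendsto.congr' h.symm (hΦ.continuousAt.tendsto.comp ?_)
  exact tendsto_pi_nhds.2 fun i => tendsto_coord (u i).2 g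

theorem HolAt.const (c : ℂ) (g : G) : HolAt (fun _ => c) g :=
  holAt_of_analyticAt (ι := Empty) (u := fun i _ => i.elim) (Φ := fun _ => c) (fun i => i.elim)
    analyticAt_const

theorem HolAt.add {f f' : G → ℂ} {g : G} (h : HolAt f g) (h' : HolAt f' g) :
    HolAt (fun x => f x + f' x) g := by
  exact HolAt.comp (ι := Bool) (f := fun b => if b then f else f') (Φ := fun z => z true + z false)
    (Bool.rec h' h) ((analyticAt_coord true _).add (analyticAt_coord false _))

theorem HolAt.mul {f f' : G → ℂ} {g : G} (h : HolAt f g) (h' : HolAt f' g) :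
    HolAt (fun x => f x * f' x) g := by
  exact HolAt.comp (ι := Bool) (f := fun b => if b then f else f') (Φ := fun z => z true * z false)
    (Bool.rec h' h) ((analyticAt_coord true _).mul (analyticAt_coord false _))

theorem HolAt.inv {f : G → ℂ} {g : G} (h : HolAt f g) (hg : f g ≠ 0) :
    HolAt (fun x => (f x)⁻¹) g :=
  HolAt.comp (ι := Unit) (f := fun _ => f) (Φ := fun z => (z ())⁻¹) (fun _ => h)
    (AnalyticAt.inv (analyticAt_coord () _) hg)

theorem HolAt.sum {ι : Type*} (s : Finset ι) {f : ι → G → ℂ} {g : G} (h : ∀ i, HolAt (f i) g) :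
    HolAt (fun x => ∑ i ∈ s, f i x) g := by
  classical
  induction s using Finset.induction_on with
  | empty => exact HolAt.const 0 g
  | insert i s hi ih => simpa only [Finset.sum_insert hi] using (h i).add ih

theorem HolAt.prod {ι : Type*} (s : Finset ι) {f : ι → G → ℂ} {g : G} (h : ∀ i, HolAt (f i) g) :
    HolAt (fun x => ∏ i ∈ s, f i x) g := by
  classical
  induction s using Finset.induction_on with
  | empty => exact HolAt.const 1 g
  | insert i s hi ih => simpa only [Finset.prod_insert hi] using (h i).mul ih

theorem HolAt.det {ι : Type*} [Fintype ι] [DecidableEq ι] {A : G → Matrix ι ι ℂ} {g : G}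
    (h : ∀ i j, HolAt (fun x => A x i j) g) : HolAt (fun x => (A x).det) g := by
  simp only [Matrix.det_apply']
  exact HolAt.sum _ fun σ => (HolAt.const _ g).mul (HolAt.prod _ fun i => h _ _)

theorem HolAt.matrix_inv {ι : Type*} [Fintype ι] [DecidableEq ι] {A : G → Matrix ι ι ℂ} {g : G}
    (h : ∀ i j, HolAt (fun x => A x i j) g) (hg : (A g).det ≠ 0) (i j : ι) :
    HolAt (fun x => (A x)⁻¹ i j) g := by
  simp only [Matrix.inv_def, Matrix.smul_apply, smul_eq_mul, Ring.inverse_eq_inv',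
    Matrix.adjugate_apply]
  refine ((HolAt.det h).inv hg).mul (HolAt.det fun k l => ?_)
  simp only [Matrix.updateRow_apply]
  split_ifs
  · exact HolAt.const _ g
  · exact h k l

/-- Pullback of holomorphic functions. -/
theorem HolAt.comp_map {H : Type*} [Group H] [AlgGp H] {ψ : H → G} {h : H} {f : G → ℂ}
    (hf : HolAt f (ψ h)) (hψ : ∀ u ∈ AlgGp.coord (G := G), HolAt (fun x => u (ψ x)) h) :
    HolAt (fun x => f (ψ x)) h := by
  obtain ⟨n, u, Φ, hΦ, he⟩ := holAt_iff.1 hf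
  refine (HolAt.comp (f := fun i x => (u i).1 (ψ x)) (fun i => hψ _ (u i).2) hΦ).congr ?_
  exact (tendsto_hnhds.2 fun u hu => (hψ u hu).tendsto).eventually he

section HolFun

variable {E E' : Type*} [AddCommGroup E] [Module ℂ E] [AddCommGroup E'] [Module ℂ E']

/-- The vector-valued function `f` is holomorphic near `g`. -/
def HolFun (f : G → E) (g : G) : Prop := ∀ l : E →ₗ[ℂ] ℂ, HolAt (fun x => l (f x)) g

theorem HolFun.congr {f f' : G → E} {g : G} (h : HolFun f g) (hf : f' =ᶠ[hnhds g] f) :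
    HolFun f' g := fun l => (h l).congr (hf.fun_comp l)

theorem HolFun.const (v : E) (g : G) : HolFun (fun _ => v) g := fun l => HolAt.const (l v) g

theorem HolFun.add {f f' : G → E} {g : G} (h : HolFun f g) (h' : HolFun f' g) :
    HolFun (fun x => f x + f' x) g := fun l => by
  simpa only [map_add] using (h l).add (h' l)

theorem HolFun.smul {c : G → ℂ} {f : G → E} {g : G} (hc : HolAt c g) (h : HolFun f g) :
    HolFun (fun x => c x • f x) g := fun l => by
  simpa only [map_smul, smul_eq_mul] using hc.mul (h l)

theorem HolFun.sub {f f' : G → E} {g : G} (h : HolFun f g) (h' : HolFun f' g) :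
    HolFun (fun x => f x - f' x) g := by
  simpa only [neg_smul, one_smul, sub_eq_add_neg] using h.add (h'.smul (HolAt.const (-1) g))

theorem HolFun.sum {ι : Type*} (s : Finset ι) {f : ι → G → E} {g : G} (h : ∀ i, HolFun (f i) g) :
    HolFun (fun x => ∑ i ∈ s, f i x) g := fun l => by
  simpa only [map_sum] using HolAt.sum s fun i => h i l

theorem HolFun.map {f : G → E} {g : G} (h : HolFun f g) (T : E →ₗ[ℂ] E') :
    HolFun (fun x => T (f x)) g := fun l => h (l ∘ₗ T)

theorem HolFun.apply [FiniteDimensional ℂ E] {A : G → E →ₗ[ℂ] E'} {f : G → E} {g : G}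
    (hA : ∀ v, HolFun (fun x => A x v) g) (hf : HolFun f g) : HolFun (fun x => A x (f x)) g := by
  let b := Module.finBasis ℂ E
  have e : (fun x => A x (f x)) = fun x => ∑ i, b.coord i (f x) • A x (b i) := funext fun x => by
    conv_lhs => rw [← b.sum_repr (f x), map_sum]
    exact Finset.sum_congr rfl fun i _ => map_smul _ _ _
  rw [e]
  exact HolFun.sum _ fun i => (hA (b i)).smul (hf (b.coord i))

theorem HolFun.inverse [FiniteDimensional ℂ E] {A : G → Module.End ℂ E} {g : G}
    (hA : ∀ v, HolFun (fun x => A x v) g) (hg : A g = 1) :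
    ∃ B : G → Module.End ℂ E, (∀ v, HolFun (fun x => B x v) g) ∧
      ∀ᶠ x in hnhds g, A x * B x = 1 ∧ B x * A x = 1 := by
  let b := Module.finBasis ℂ E
  have hM : ∀ i j, HolAt (fun x => LinearMap.toMatrix b b (A x) i j) g := fun i j => by
    simp only [LinearMap.toMatrix_apply]
    exact hA (b j) (b.coord i)
  have h1 : (LinearMap.toMatrix b b (A g)).det ≠ 0 := by
    rw [hg, LinearMap.toMatrix_one, Matrix.det_one]
    exact one_ne_zero
  refine ⟨fun x => Matrix.toLin b b (LinearMap.toMatrix b b (A x))⁻¹, fun v => ?_, ?_⟩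
  · have e : (fun x => Matrix.toLin b b (LinearMap.toMatrix b b (A x))⁻¹ v) = fun x => ∑ i,
        (∑ j, (LinearMap.toMatrix b b (A x))⁻¹ i j * b.repr v j) • b i := funext fun x => by
      rw [Matrix.toLin_apply]
      rfl
    rw [e]
    exact HolFun.sum _ fun i => HolFun.smul
      (HolAt.sum _ fun j => (HolAt.matrix_inv hM h1 i j).mul (HolAt.const _ g)) (HolFun.const _ g)
  · filter_upwards [(HolAt.det hM).tendsto.eventually_ne h1] with x hx
    have hu : IsUnit (LinearMap.toMatrix b b (A x)).det := isUnit_iff_ne_zero.2 hx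
    have hA' : A x = Matrix.toLin b b (LinearMap.toMatrix b b (A x)) :=
      (Matrix.toLin_toMatrix b b (A x)).symm
    constructor
    · conv_lhs => rw [hA']
      rw [Module.End.mul_eq_comp, LinearMap.toMatrix_toLin, ← Matrix.toLin_mul, Matrix.mul_nonsing_inv _ hu,
        Matrix.toLin_one]
      rfl
    · conv_lhs => rw [hA']
      rw [Module.End.mul_eq_comp, LinearMap.toMatrix_toLin, ← Matrix.toLin_mul, Matrix.nonsing_inv_mul _ hu,
        Matrix.toLin_one]
      rfl

end HolFun

theorem RegFun.holFun {V : Type*} [AddCommGroup V] [Module ℚ V] [Module.Finite ℚ V]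
    {x : G → ℂ ⊗[ℚ] V} (hx : RegFun x) (g : G) : HolFun x g := fun l => by
  have e : (fun g => l (x g)) = fun g => ∑ i, Module.Dual.baseChange ℂ ((Module.finBasis ℚ V).coord i)
      (x g) * l (1 ⊗ₜ Module.finBasis ℚ V i) := funext fun g => by
    conv_lhs => rw [eq_sum_coord (x g), map_sum]
    exact Finset.sum_congr rfl fun i _ => map_smul _ _ _
  rw [e]
  exact HolAt.sum _ fun i => (holAt_coord (hx _) g).mul (HolAt.const _ g)

end Hol

/-! ## Triangular retractions onto a filtration -/

section Retraction

variable {E : Type*} [AddCommGroup E] [Module ℂ E] {I : Bideg → Submodule ℂ E}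

/-- The projection to the sum of some of the components. -/
def gproj (hI : DirectSum.IsInternal I) (S : Set Bideg) : E →ₗ[ℂ] E := gscale hI (S.indicator 1)

theorem gproj_of_mem (hI : DirectSum.IsInternal I) {S : Set Bideg} {x : E} (hx : x ∈ gspan I S) :
    gproj hI S x = x := by
  have : gspan I S ≤ LinearMap.eqLocus (gproj hI S) LinearMap.id := gspan_le.2 fun s hs y hy => by
    rw [LinearMap.mem_eqLocus, gproj, gscale_of_mem hI _ hy, Set.indicator_of_mem hs, Pi.one_apply,
      one_smul, LinearMap.id_apply]
  exact this hx

theorem gproj_eq_zero (hI : DirectSum.IsInternal I) {S T : Set Bideg} (h : ∀ t ∈ T, t ∉ S) {x : E}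
    (hx : x ∈ gspan I T) : gproj hI S x = 0 := by
  have : gspan I T ≤ LinearMap.ker (gproj hI S) := gspan_le.2 fun t ht y hy => by
    rw [LinearMap.mem_ker, gproj, gscale_of_mem hI _ hy, Set.indicator_of_notMem (h t ht), zero_smul]
  exact this hx

theorem gproj_mem (hI : DirectSum.IsInternal I) (S : Set Bideg) (x : E) :
    gproj hI S x ∈ gspan I S ∧ x - gproj hI S x ∈ gspan I Sᶜ := by
  refine grading_induction (p := fun x => gproj hI S x ∈ gspan I S ∧ x - gproj hI S x ∈ gspan I Sᶜ)
    hI.submodule_iSup_eq_top x (fun s x hx => ?_) (by simp) fun x y h1 h2 => ?_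
  · by_cases hs : s ∈ S
    · rw [gproj_of_mem hI (le_gspan hs hx), sub_self]
      exact ⟨le_gspan hs hx, zero_mem _⟩
    · rw [gproj_eq_zero hI (T := Sᶜ) (fun _ h => h) (le_gspan (S := Sᶜ) hs hx), sub_zero]
      exact ⟨zero_mem _, le_gspan (S := Sᶜ) hs hx⟩
  · rw [map_add, add_sub_add_comm]
    exact ⟨add_mem h1.1 h2.1, add_mem h1.2 h2.2⟩

theorem sub_gproj_mem (hI : DirectSum.IsInternal I) {c : ℤ} {z : E}
    (hz : z ∈ gspan I {t | t.1 ≤ c}) :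
    z - gproj hI {t | t.1 = c} z ∈ gspan I {t | t.1 < c} := by
  have h1 : z - gproj hI {t | t.1 = c} z ∈ gspan I {t | t.1 ≤ c} :=
    sub_mem hz (gspan_mono (fun t ht => Int.le_of_eq ht) (gproj_mem hI _ z).1)
  have h2 := (gspan_inf hI {t | t.1 ≤ c} {t | t.1 = c}ᶜ).le ⟨h1, (gproj_mem hI _ z).2⟩
  refine gspan_mono (fun t ht => ?_) h2
  exact Int.lt_iff_le_and_ne.2 ⟨ht.1, ht.2⟩

/-- The components of a filtration that is opposed to the grading. -/
def oppPart (I : Bideg → Submodule ℂ E) (F : ℤ → Submodule ℂ E) (b : ℤ) : Submodule ℂ E :=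
  F b ⊓ gspan I {t | t.1 ≤ b}

/-- The unipotent map that transforms the filtration `F` to the one defined by the grading. -/
structure IsRetraction (hI : DirectSum.IsInternal I) (F : ℤ → Submodule ℂ E) (s : E →ₗ[ℂ] E) :
    Prop where
  span : ∀ a, F a ≤ ⨆ b ≥ a, oppPart I F b
  top : ∃ a, F a = ⊤
  eq : ∀ b, ∀ x ∈ oppPart I F b, s x = gproj hI {t | t.1 = b} x

variable {hI : DirectSum.IsInternal I} {F : ℤ → Submodule ℂ E}

theorem IsRetraction.iSup_eq_top {s : E →ₗ[ℂ] E} (h : IsRetraction hI F s) :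
    ⨆ b, oppPart I F b = ⊤ := by
  obtain ⟨a, ha⟩ := h.top
  exact top_le_iff.1 (ha ▸ (h.span a).trans (iSup₂_le fun b _ => le_iSup (oppPart I F) b))

theorem IsRetraction.unique {s s' : E →ₗ[ℂ] E} (h : IsRetraction hI F s)
    (h' : IsRetraction hI F s') : s = s' := by
  have : ⨆ b, oppPart I F b ≤ LinearMap.eqLocus s s' := iSup_le fun b x hx =>
    (h.eq b x hx).trans (h'.eq b x hx).symm
  rw [h.iSup_eq_top] at this
  exact LinearMap.ext fun x => this Submodule.mem_top

theorem IsRetraction.mem {s : E →ₗ[ℂ] E} (h : IsRetraction hI F s) {a : ℤ} {x : E} (hx : x ∈ F a) :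
    s x ∈ gspan I {t | a ≤ t.1} := by
  have : ⨆ b ≥ a, oppPart I F b ≤ (gspan I {t | a ≤ t.1}).comap s := iSup₂_le fun b hb y hy => by
    rw [Submodule.mem_comap, h.eq b y hy]
    exact gspan_mono (fun t ht => (ge_of_eq ht).trans' hb) (gproj_mem hI _ y).1
  exact this (h.span a hx)

theorem isRetraction_id (hF : ∀ a, F a = gspan I {t | a ≤ t.1}) (ht : ∃ a, F a = ⊤) :
    IsRetraction hI F LinearMap.id where
  top := ht
  span a := by
    rw [hF, gspan_le]
    refine fun t ht x hx => Submodule.mem_iSup_of_mem t.1 (Submodule.mem_iSup_of_mem ht ⟨?_, ?_⟩)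
    · rw [hF]; exact le_gspan (S := {u : Bideg | t.1 ≤ u.1}) (Int.le_refl t.1) hx
    · exact le_gspan (S := {u : Bideg | u.1 ≤ t.1}) (Int.le_refl t.1) hx
  eq b x hx := by
    obtain ⟨h1, h2⟩ := hx
    rw [hF] at h1
    have := gspan_inf hI {t | b ≤ t.1} {t | t.1 ≤ b}
    refine (gproj_of_mem hI (gspan_mono (fun t ht => ?_) (this.le ⟨h1, h2⟩))).symm
    exact le_antisymm ht.2 ht.1

theorem gproj_bilin (hI : DirectSum.IsInternal I) (β : E →ₗ[ℂ] E →ₗ[ℂ] E)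
    (hβ : ∀ a b, ∀ x ∈ I a, ∀ y ∈ I b, β x y ∈ I (a + b)) {a b : ℤ} {x y : E}
    (hx : x ∈ gspan I {t | t.1 ≤ a}) (hy : y ∈ gspan I {t | t.1 ≤ b}) :
    gproj hI {t | t.1 = a + b} (β x y) = β (gproj hI {t | t.1 = a} x) (gproj hI {t | t.1 = b} y) := by
  have hlt1 : ∀ s ∈ {t : Bideg | t.1 < a}, ∀ t ∈ {t : Bideg | t.1 ≤ b},
      s + t ∈ {t : Bideg | t.1 < a + b} := fun s hs t ht => Int.add_lt_add_of_lt_of_le hs ht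
  have hlt2 : ∀ s ∈ {t : Bideg | t.1 = a}, ∀ t ∈ {t : Bideg | t.1 < b},
      s + t ∈ {t : Bideg | t.1 < a + b} := fun s hs t ht =>
    Int.add_lt_add_of_le_of_lt (Int.le_of_eq hs) ht
  have heq : ∀ s ∈ {t : Bideg | t.1 = a}, ∀ t ∈ {t : Bideg | t.1 = b},
      s + t ∈ {t : Bideg | t.1 = a + b} := fun s hs t ht => congrArg₂ (· + ·) hs ht
  have hd : ∀ t ∈ {t : Bideg | t.1 < a + b}, t ∉ {t : Bideg | t.1 = a + b} :=
    fun t ht => Int.ne_of_lt ht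
  set px := gproj hI {t | t.1 = a} x with hpx
  set py := gproj hI {t | t.1 = b} y with hpy
  have e : β x y = β (x - px) y + (β px (y - py) + β px py) := by
    simp only [map_sub, LinearMap.sub_apply]
    abel
  have h1 : px ∈ gspan I {t | t.1 = a} := (gproj_mem hI _ x).1
  have h2 : py ∈ gspan I {t | t.1 = b} := (gproj_mem hI _ y).1
  have h3 : x - px ∈ gspan I {t | t.1 < a} := sub_gproj_mem hI hx
  have h4 : y - py ∈ gspan I {t | t.1 < b} := sub_gproj_mem hI hy
  rw [e, map_add, map_add, gproj_eq_zero hI hd (bilin_mem_gspan β hβ hlt1 h3 hy),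
    gproj_eq_zero hI hd (bilin_mem_gspan β hβ hlt2 h1 h4), zero_add, zero_add]
  exact gproj_of_mem hI (bilin_mem_gspan β hβ heq h1 h2)

theorem IsRetraction.bilin {s : E →ₗ[ℂ] E} (h : IsRetraction hI F s) (β : E →ₗ[ℂ] E →ₗ[ℂ] E)
    (hβ : ∀ a b, ∀ x ∈ I a, ∀ y ∈ I b, β x y ∈ I (a + b))
    (hF : ∀ a b, ∀ x ∈ F a, ∀ y ∈ F b, β x y ∈ F (a + b)) (x y : E) : s (β x y) = β (s x) (s y) := by
  have hle : ∀ a b : ℤ, ∀ s ∈ {t : Bideg | t.1 ≤ a}, ∀ t ∈ {t : Bideg | t.1 ≤ b},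
      s + t ∈ {t : Bideg | t.1 ≤ a + b} := fun a b s hs t ht => Int.add_le_add hs ht
  have key : ∀ a b, ∀ x ∈ oppPart I F a, ∀ y ∈ oppPart I F b, s (β x y) = β (s x) (s y) := by
    intro a b x hx y hy
    rw [h.eq a x hx, h.eq b y hy, h.eq (a + b) _
      ⟨hF a b x hx.1 y hy.1, bilin_mem_gspan β hβ (hle a b) hx.2 hy.2⟩]
    exact gproj_bilin hI β hβ hx.2 hy.2
  refine grading_induction (p := fun x => s (β x y) = β (s x) (s y)) h.iSup_eq_top x
    (fun a x hx => ?_) (by simp) fun x x' h1 h2 => by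
      simp only [map_add, LinearMap.add_apply, h1, h2]
  exact grading_induction (p := fun y => s (β x y) = β (s x) (s y)) h.iSup_eq_top y
    (fun b y hy => key a b x hx y hy) (by simp) fun y y' h1 h2 => by simp only [map_add, h1, h2]

end Retraction

section

open Filter

variable {G : Type*} [Group G] [AlgGp G] {E : Type*} [AddCommGroup E] [Module ℂ E]
  [FiniteDimensional ℂ E] {I : Bideg → Submodule ℂ E}

/-- Projections to the image of a step of the filtration along the opposite one. -/
theorem exists_holFun_proj (hI : DirectSum.IsInternal I) {A : G → Module.End ℂ E} {g : G} (hA : ∀ v, HolFun (fun x => A x v) g)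
    (hg : A g = 1) (a : ℤ) : ∃ P : G → Module.End ℂ E, (∀ v, HolFun (fun x => P x v) g) ∧
      ∀ᶠ x in hnhds g, (∀ v, P x v ∈ (gspan I {t | a ≤ t.1}).map (A x)) ∧
        (∀ v, v - P x v ∈ gspan I {t | t.1 < a}) ∧ (∀ v ∈ gspan I {t | t.1 < a}, P x v = 0) ∧
        ∀ v ∈ (gspan I {t | a ≤ t.1}).map (A x), P x v = v := by
  set p := gproj hI {t | a ≤ t.1} with hp
  have hc : {t : Bideg | a ≤ t.1}ᶜ = {t | t.1 < a} := Set.ext fun t => Int.not_le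
  have hp0 : ∀ v ∈ gspan I {t | t.1 < a}, p v = 0 := fun v hv =>
    gproj_eq_zero hI (fun t ht => Int.not_le.2 ht) hv
  have hp1 : ∀ v, v - p v ∈ gspan I {t | t.1 < a} := fun v => hc ▸ (gproj_mem hI _ v).2
  have hp2 : ∀ v, p v ∈ gspan I {t | a ≤ t.1} := fun v => (gproj_mem hI _ v).1
  have hp3 : ∀ v ∈ gspan I {t | a ≤ t.1}, p v = v := fun v hv => gproj_of_mem hI hv
  obtain ⟨B, hB, hAB⟩ := HolFun.inverse (A := fun x => p * A x * p + (1 - p)) (g := g)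
    (fun v => ((hA (p v)).map p).add (HolFun.const (v - p v) g)) (by
      rw [hg, mul_one]
      refine LinearMap.ext fun v => ?_
      change p (p v) + (v - p v) = v
      rw [hp3 _ (hp2 v), add_sub_cancel])
  refine ⟨fun x => A x * B x * p, fun v => HolFun.apply (A := A) (f := fun x => B x (p v)) hA (hB (p v)), ?_⟩
  filter_upwards [hAB] with x hx
  have h1 : ∀ v, p (A x (p (B x v))) + (B x v - p (B x v)) = v := LinearMap.congr_fun hx.1
  have h2 : ∀ v, B x (p (A x (p v)) + (v - p v)) = v := LinearMap.congr_fun hx.2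
  have h3 : ∀ v, p (B x (p v)) = B x (p v) := fun v => by
    have e := congrArg p (h1 (p v))
    rw [map_add, hp3 _ (hp2 _), hp0 _ (hp1 _), add_zero, hp3 _ (hp2 v)] at e
    have := h1 (p v)
    rw [e, add_eq_left, sub_eq_zero] at this
    exact this.symm
  refine ⟨fun v => ⟨_, h3 v ▸ hp2 _, rfl⟩, fun v => ?_, fun v hv => ?_, ?_⟩
  · have e := h1 (p v)
    rw [h3, sub_self, add_zero] at e
    change v - A x (B x (p v)) ∈ _
    have h4 : p (v - A x (B x (p v))) = 0 := by rw [map_sub, e, sub_self]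
    have := hp1 (v - A x (B x (p v)))
    rwa [h4, sub_zero] at this
  · change A x (B x (p v)) = 0
    rw [hp0 v hv, map_zero, map_zero]
  · rintro _ ⟨v, hv, rfl⟩
    change A x (B x (p (A x v))) = A x v
    have := h2 v
    rw [hp3 v hv, sub_self, add_zero] at this
    rw [this]

theorem exists_holFun_retraction (hI : DirectSum.IsInternal I) {N : ℕ} (hN : ∀ s : Bideg, N < |s.1| → I s = ⊥)
    {A : G → Module.End ℂ E} {g : G} (hA : ∀ v, HolFun (fun x => A x v) g) (hg : A g = 1) :
    ∃ s : G → Module.End ℂ E, (∀ v, HolFun (fun x => s x v) g) ∧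
      ∀ᶠ x in hnhds g, IsRetraction hI (fun a => (gspan I {t | a ≤ t.1}).map (A x)) (s x) := by
  choose P hP hPA using fun i : ℕ => exists_holFun_proj hI hA hg ((i : ℤ) - N)
  have bot : ∀ S : Set Bideg, (∀ t ∈ S, N < |t.1|) → gspan I S = ⊥ := fun S hS =>
    eq_bot_iff.2 (gspan_le.2 fun t ht => (hN t (hS t ht)).le)
  have hinv : ∀ᶠ x in hnhds g, ∃ B, A x * B = 1 := by
    obtain ⟨B, -, hB⟩ := HolFun.inverse hA hg
    exact hB.mono fun x hx => ⟨B x, hx.1⟩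
  refine ⟨fun x => ∑ i ∈ Finset.range (2 * N + 1),
    gproj hI {t | t.1 = (i : ℤ) - N} ∘ₗ (P i x - P (i + 1) x), fun v => ?_, ?_⟩
  · simp only [LinearMap.sum_apply, LinearMap.comp_apply, LinearMap.sub_apply]
    exact HolFun.sum _ fun i => ((hP i v).sub (hP (i + 1) v)).map _
  filter_upwards [(Finset.range (2 * N + 2)).eventually_all.2 fun i _ => hPA i,
    hinv] with x hx hB
  set F : ℤ → Submodule ℂ E := fun a => (gspan I {t | a ≤ t.1}).map (A x) with hF
  have mono : ∀ {a b : ℤ}, a ≤ b → F b ≤ F a := fun h =>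
    Submodule.map_mono (gspan_mono fun t ht => h.trans ht)
  have full : gspan I {t | (((0 : ℕ) : ℤ) - N) ≤ t.1} = ⊤ := by
    refine top_le_iff.1 (hI.submodule_iSup_eq_top ▸ iSup_le fun t => ?_)
    by_cases ht : N < |t.1|
    · rw [hN t ht]; exact bot_le
    · refine le_gspan (S := {t : Bideg | (((0 : ℕ) : ℤ) - N) ≤ t.1}) ?_
      have h : (((0 : ℕ) : ℤ) - N) ≤ t.1 := by have := neg_abs_le t.1; push_cast; omega
      exact h
  have top : F (((0 : ℕ) : ℤ) - N) = ⊤ := by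
    obtain ⟨B, hB⟩ := hB
    change (gspan I {t | (((0 : ℕ) : ℤ) - N) ≤ t.1}).map (A x) = ⊤
    rw [full]
    exact eq_top_iff.2 fun v _ => ⟨B v, Submodule.mem_top, LinearMap.congr_fun hB v⟩
  have zero : ∀ i ∈ Finset.range (2 * N + 2), ∀ c : ℤ, c < (i : ℤ) - N →
      ∀ v ∈ gspan I {t | t.1 ≤ c}, P i x v = 0 := fun i hi c hc v hv =>
    (hx i hi).2.2.1 v (gspan_mono (fun t ht => lt_of_le_of_lt ht hc) hv)
  have fix : ∀ i ∈ Finset.range (2 * N + 2), ∀ c : ℤ, (i : ℤ) - N ≤ c → ∀ v ∈ F c, P i x v = v :=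
    fun i hi c hc v hv => (hx i hi).2.2.2 v (mono hc hv)
  refine ⟨fun a v hv => ?_, ⟨_, top⟩, fun b v hv => ?_⟩
  · have e : v = ∑ i ∈ Finset.range (2 * N + 1), (P i x v - P (i + 1) x v) := by
      have h0 : P 0 x v = v := fix 0 (by simp) _ le_rfl v (top ▸ Submodule.mem_top)
      have h1 : P (2 * N + 1) x v = 0 := by
        have : gspan I {t : Bideg | ((2 * N + 1 : ℕ) : ℤ) - N ≤ t.1} = ⊥ := bot _ fun t ht => by
          have h : ((2 * N + 1 : ℕ) : ℤ) - N ≤ t.1 := ht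
          have := le_abs_self t.1
          push_cast at h
          omega
        have h2 := (hx (2 * N + 1) (by simp)).1 v
        rw [this, Submodule.map_bot] at h2
        exact h2
      rw [Finset.sum_range_sub' (fun i => P i x v), h0, h1, sub_zero]
    rw [e]
    refine Submodule.sum_mem _ fun i hi => ?_
    rw [Finset.mem_range] at hi
    have hi0 := Finset.mem_range.2 (show i < 2 * N + 2 by omega)
    have hi1 := Finset.mem_range.2 (show i + 1 < 2 * N + 2 by omega)
    by_cases ha : (i : ℤ) - N < a
    · rw [fix i hi0 a ha.le v hv, fix (i + 1) hi1 a (by push_cast; omega) v hv, sub_self]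
      exact zero_mem _
    · refine Submodule.mem_iSup_of_mem _ (Submodule.mem_iSup_of_mem (not_lt.1 ha) ⟨?_, ?_⟩)
      · exact sub_mem ((hx i hi0).1 v) (mono (by push_cast; omega) ((hx (i + 1) hi1).1 v))
      · have h1 : v - P i x v ∈ gspan I {t : Bideg | t.1 ≤ (i : ℤ) - N} :=
          gspan_mono (fun t ht => Int.le_of_lt ht) ((hx i hi0).2.1 v)
        have h2 : v - P (i + 1) x v ∈ gspan I {t : Bideg | t.1 ≤ (i : ℤ) - N} := by
          refine gspan_mono (fun t ht => ?_) ((hx (i + 1) hi1).2.1 v)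
          have h : t.1 < ((i + 1 : ℕ) : ℤ) - N := ht
          have h' : t.1 ≤ (i : ℤ) - N := by push_cast at h; omega
          exact h'
        have := sub_mem h2 h1
        rwa [sub_sub_sub_cancel_left] at this
  · obtain ⟨h1, h2⟩ := hv
    have key : ∀ i ∈ Finset.range (2 * N + 1), (i : ℤ) - N ≠ b → P i x v - P (i + 1) x v = 0 := by
      intro i hi hb
      rw [Finset.mem_range] at hi
      have hi0 := Finset.mem_range.2 (show i < 2 * N + 2 by omega)
      have hi1 := Finset.mem_range.2 (show i + 1 < 2 * N + 2 by omega)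
      rcases lt_or_gt_of_ne hb with h | h
      · rw [fix i hi0 b h.le v h1, fix (i + 1) hi1 b (by push_cast; omega) v h1, sub_self]
      · rw [zero i hi0 b h v h2, zero (i + 1) hi1 b (by push_cast; omega) v h2, sub_self]
    rw [LinearMap.sum_apply]
    by_cases hb : (N : ℤ) < |b|
    · have hz : gproj hI {t | t.1 = b} v = 0 := by
        have h3 := (gproj_mem hI {t | t.1 = b} v).1
        rw [bot {t | t.1 = b} fun t ht => by rw [show t.1 = b from ht]; exact hb] at h3
        exact h3
      rw [hz]
      refine Finset.sum_eq_zero fun i hi => ?_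
      rw [LinearMap.comp_apply, LinearMap.sub_apply, key i hi, map_zero]
      rintro rfl
      rw [Finset.mem_range] at hi
      exact absurd (abs_le.2 ⟨by omega, by omega⟩) (not_le.2 hb)
    · obtain ⟨h3, h4⟩ := abs_le.1 (not_lt.1 hb)
      obtain ⟨k, hk⟩ := Int.eq_ofNat_of_zero_le (show 0 ≤ b + N by omega)
      have hbk : (k : ℤ) - N = b := by omega
      have hk0 : k ∈ Finset.range (2 * N + 1) := Finset.mem_range.2 (by omega)
      rw [Finset.sum_eq_single_of_mem k hk0 fun i hi hik => by
        rw [LinearMap.comp_apply, LinearMap.sub_apply, key i hi (by omega), map_zero]]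
      rw [LinearMap.comp_apply, LinearMap.sub_apply, hbk,
        fix k (Finset.mem_range.2 (by omega)) b hbk.le v h1,
        zero (k + 1) (Finset.mem_range.2 (by omega)) b (by push_cast; omega) v h2, sub_zero]

end

/-! ## Quotients of spaces with holomorphic functions -/

theorem HolStr.quot_id {M : Type*} (S : HolStr M) : S.quot id = S := by
  cases S with
  | mk top holAt =>
    have h : (fun (f : M → ℂ) (y : M) => ∀ x, id x = y → holAt (f ∘ id) x) = holAt :=
      funext fun f => funext fun y => propext ⟨fun h => h y rfl, by rintro h _ rfl; exact h⟩
    exact congrArg₂ HolStr.mk coinduced_id h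

/-- A map that is open and respects holomorphy induces isomorphisms of quotients. -/
theorem exists_isBiholomorphic_quot {X Y A B : Type*} {S : HolStr X} {T : HolStr Y} {φ : X → Y}
    (hc : @Continuous X Y S.top T.top φ) (ho : @IsOpenMap X Y S.top T.top φ)
    (hs : Function.Surjective φ) (hh : ∀ (f : Y → ℂ) (x : X), T.holAt f (φ x) ↔ S.holAt (f ∘ φ) x)
    {π : X → A} {ρ : Y → B} (hπ : Function.Surjective π) (hρ : Function.Surjective ρ)
    (hrel : ∀ x x', π x = π x' ↔ ρ (φ x) = ρ (φ x')) :
    ∃ e : A → B, (∀ x, e (π x) = ρ (φ x)) ∧ IsBiholomorphic (S.quot π) (T.quot ρ) e := by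
  let e : A → B := fun a => ρ (φ (Function.surjInv hπ a))
  have he : ∀ x, e (π x) = ρ (φ x) := fun x => (hrel _ _).1 (Function.surjInv_eq hπ (π x))
  have inj : Function.Injective e := fun a b h => by
    obtain ⟨x, rfl⟩ := hπ a
    obtain ⟨y, rfl⟩ := hπ b
    rw [he, he] at h
    exact (hrel x y).2 h
  have surj : Function.Surjective e := fun b => by
    obtain ⟨y, rfl⟩ := hρ b
    obtain ⟨x, rfl⟩ := hs y
    exact ⟨π x, he x⟩
  refine ⟨e, he, ?_, fun f a => ?_⟩
  · let := S.top
    let := T.top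
    let : TopologicalSpace A := (S.quot π).top
    let : TopologicalSpace B := (T.quot ρ).top
    refine ⟨?_, fun W hW => ?_, inj, surj⟩
    · refine continuous_coinduced_dom.2 ?_
      have : e ∘ π = ρ ∘ φ := funext he
      rw [this]
      exact continuous_coinduced_rng.comp hc
    · refine isOpen_coinduced.2 ?_
      have : ρ ⁻¹' (e '' W) = φ '' (π ⁻¹' W) := by
        ext y
        obtain ⟨x, rfl⟩ := hs y
        constructor
        · rintro ⟨a, ha, h⟩
          rw [← he] at h
          exact ⟨x, by rw [Set.mem_preimage, ← inj h]; exact ha, rfl⟩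
        · rintro ⟨x', hx', h⟩
          exact ⟨π x', hx', by rw [he, h]⟩
      rw [this]
      exact ho _ (isOpen_coinduced.1 hW)
  · obtain ⟨x, rfl⟩ := hπ a
    have hf : (f ∘ e) ∘ π = (f ∘ ρ) ∘ φ := funext fun z => congrArg f (he z)
    constructor
    · intro h x' hx'
      rw [hf, ← hh]
      exact h _ (by rw [← he, hx'])
    · intro h y hy
      obtain ⟨x', rfl⟩ := hs y
      rw [hh, ← hf]
      exact h x' (inj (by rw [he, hy]))

/-! ## Holomorphic maps between algebraic groups -/

section

open Filter

variable {G H : Type*} [Group G] [AlgGp G] [Group H] [AlgGp H]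

theorem continuous_of_holAt {ψ : H → G}
    (hψ : ∀ u ∈ AlgGp.coord (G := G), ∀ h, HolAt (fun x => u (ψ x)) h) :
    @Continuous H G (AlgGp.hol H).top (AlgGp.hol G).top ψ := by
  let := (AlgGp.hol H).top
  let := (AlgGp.hol G).top
  exact continuous_iff_continuousAt.2 fun h => tendsto_hnhds.2 fun u hu => (hψ u hu h).tendsto

theorem HolFun.mul {A : Type*} [Ring A] [Algebra ℂ A] [FiniteDimensional ℂ A] {a b : G → A} {g : G}
    (ha : HolFun a g) (hb : HolFun b g) : HolFun (fun x => a x * b x) g :=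
  HolFun.apply (A := fun x => LinearMap.mulLeft ℂ (a x)) (fun v => ha.map (LinearMap.mulRight ℂ v)) hb

theorem holFun_of_regFun {V V' : Type*} [AddCommGroup V] [Module ℚ V] [AddCommGroup V']
    [Module ℚ V'] [Module.Finite ℚ V'] {ρ : G → (ℂ ⊗[ℚ] V) →ₗ[ℂ] ℂ ⊗[ℚ] V'}
    (h : ∀ v, RegFun fun g => ρ g (1 ⊗ₜ v)) (x : ℂ ⊗[ℚ] V) (g : G) : HolFun (fun g => ρ g x) g := by
  induction x using TensorProduct.induction_on with
  | zero => simpa only [map_zero] using HolFun.const 0 g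
  | tmul a v =>
    have e : a ⊗ₜ[ℚ] v = a • ((1 : ℂ) ⊗ₜ[ℚ] v) := by rw [TensorProduct.smul_tmul', smul_eq_mul, mul_one]
    rw [e]
    simpa only [map_smul] using ((h v).holFun g).smul (HolAt.const a g)
  | add x y h1 h2 => simpa only [map_add] using h1.add h2

theorem holAt_comp_uniGp {L : Type*} [LieRing L] [LieAlgebra ℚ L] {ψ : H → UniGp ℂ (ℂ ⊗[ℚ] L)}
    {h : H} (hψ : ∀ m, HolFun (fun x => UniGp.glev m (ψ x)) h) :
    ∀ u ∈ AlgGp.coord (G := UniGp ℂ (ℂ ⊗[ℚ] L)), HolAt (fun x => u (ψ x)) h := by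
  intro u hu
  obtain ⟨m, l, rfl⟩ := UniGp.mem_coord_iff.1 hu
  exact hψ m _

end

namespace LieMHS

open Filter

variable {L : Type} [LieRing L] [LieAlgebra ℚ L] {M : LieMHS L} {V₀ : FilSp}
  {hS : M.fil.IsDirectSummand V₀}

theorem holFun_actLie (x : ℂ ⊗[ℚ] L) (g : SemiGp hS) :
    HolFun (fun g : SemiGp hS => actLie hS g.right x) g := by
  have : Module.Finite ℚ L := M.isMHS.finite
  exact holFun_of_regFun (ρ := fun g : SemiGp hS => (actLie hS g.right).toLinearMap)
    (fun v => regFun_right hS (regFun_actLie hS v)) x g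

theorem holFun_glev_mul (m : ℕ) (c : UniGp ℂ (ℂ ⊗[ℚ] L)) (g : SemiGp hS) :
    HolFun (fun g : SemiGp hS => UniGp.glev m (g.left * actGp hS g.right c)) g := by
  have : Module.Finite ℚ L := M.isMHS.finite
  have := UEQ.finite (k := ℚ) (L := L) m
  simp only [UniGp.glev_mul, ← qEnv_glev]
  exact ((regFun_left hS (regFun_glev m)).holFun g).mul (holFun_of_regFun
    (ρ := fun g : SemiGp hS => (qEnv hS m g.right).toLinearMap)
    (fun v => regFun_right hS (regFun_qEnv hS m v)) (UniGp.glev m c) g)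

theorem holAt_inl_mul (c : UniGp ℂ (ℂ ⊗[ℚ] L)) :
    ∀ u ∈ AlgGp.coord (G := SemiGp hS), ∀ g,
      HolAt (fun x : UniGp ℂ (ℂ ⊗[ℚ] L) => u (SemidirectProduct.inl (x * c))) g := by
  intro u hu g
  have : Module.Finite ℚ L := M.isMHS.finite
  refine holAt_comp_uniGp (ψ := fun x => x * c) (fun m => ?_) _ (regular_inl hS u hu)
  have := UEQ.finite (k := ℚ) (L := L) m
  simp only [UniGp.glev_mul]
  exact ((regFun_glev m).holFun g).mul (HolFun.const _ g)

/-! ## Equality of points of the orbit of the base point -/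

/-- The representation of `Q` on `L`. -/
abbrev lieRep (hS : M.fil.IsDirectSummand V₀) : AlgRep (mumfordTate V₀) :=
  letI : Module.Finite ℚ L := M.isMHS.finite
  { V := L
    ρ :=
      { toFun := fun q => (actLie hS q).toLinearMap
        map_one' := rfl
        map_mul' := fun _ _ => rfl }
    regular := fun v => regFun_actLie hS v }

/-- The bigrading of `L` given by the torus. -/
def lieRepGr (h₀ : IsMHS V₀.W V₀.F) (hS : M.fil.IsDirectSummand V₀) :
    Bideg → Submodule ℂ (ℂ ⊗[ℚ] L) := repGr h₀ (lieRep hS)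

theorem lieGr_eq (h₀ : IsMHS V₀.W V₀.F) : lieGr M = lieRepGr h₀ hS := by
  have hint : DirectSum.IsInternal (lieRepGr h₀ hS) := isInternal_repGr h₀ (lieRep hS)
  exact eq_of_le_grading hint
    (fun s x hx => (mem_repGr (B := lieRep hS) h₀).2 fun z => actLie_torus h₀ hx z)
    (lieGrSplitting M).internal.submodule_iSup_eq_top

theorem basePointQ_lieRep (h₀ : IsMHS V₀.W V₀.F) (p : ℤ) : basePointQ V₀ (lieRep hS) p = M.F p := by
  rw [(lieGrSplitting M).F_eq p, lieGr_eq h₀]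
  exact basePointQ_eq h₀ (lieRep hS) p

theorem map_F_eq (h₀ : IsMHS V₀.W V₀.F) {q q' : mumfordTate V₀}
    (h : FilFam.act q (basePointQ V₀) = FilFam.act q' (basePointQ V₀)) (p : ℤ) :
    (M.F p).map (actLie hS q).toLinearMap = (M.F p).map (actLie hS q').toLinearMap := by
  rw [← basePointQ_lieRep (hS := hS) h₀ p]
  exact congrFun (congrFun h (lieRep hS)) p

theorem act_inr_eq {q q' : mumfordTate V₀}
    (h : FilFam.act q (basePointQ V₀) = FilFam.act q' (basePointQ V₀)) :
    FilFam.act (SemidirectProduct.inr q) (basePointG hS) =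
      FilFam.act (SemidirectProduct.inr q') (basePointG hS) :=
  funext fun A => congrFun h (resQ hS A)

theorem toQ_act (g : SemiGp hS) (x : FilFam (SemiGp hS)) :
    toQ hS (FilFam.act g x) = FilFam.act g.right (toQ hS x) := rfl

theorem toQ_basePointG (h₀ : IsMHS V₀.W V₀.F) : toQ hS (basePointG hS) = basePointQ V₀ := by
  rw [← orbitMap_one]
  exact (orbitMap_mem_fiber h₀ 1).2

theorem act_basePointQ_eq (h₀ : IsMHS V₀.W V₀.F) {g g' : SemiGp hS}
    (h : FilFam.act g (basePointG hS) = FilFam.act g' (basePointG hS)) :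
    FilFam.act g.right (basePointQ V₀) = FilFam.act g'.right (basePointQ V₀) := by
  have := congrArg (toQ hS) h
  rwa [toQ_act, toQ_act, toQ_basePointG h₀] at this

theorem act_inr_orbitMap (q : mumfordTate V₀) (u : UniGp ℂ (ℂ ⊗[ℚ] L)) :
    FilFam.act (SemidirectProduct.inr q) (orbitMap hS u) =
      FilFam.act (SemidirectProduct.inl (actGp hS q u) * SemidirectProduct.inr q) (basePointG hS) := by
  rw [orbitMap, ← FilFam.act_mul, SemidirectProduct.inl_aut, map_inv, inv_mul_cancel_right]

theorem act_injective {G : Type*} [Group G] [AlgGp G] (g : G) :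
    Function.Injective (FilFam.act (G := G) g) := fun x y h => by
  rw [← FilFam.act_one x, ← inv_mul_cancel g, FilFam.act_mul, h, ← FilFam.act_mul, inv_mul_cancel,
    FilFam.act_one]

theorem act_eq_iff (h₀ : IsMHS V₀.W V₀.F) {g g' : SemiGp hS} :
    FilFam.act g (basePointG hS) = FilFam.act g' (basePointG hS) ↔
      FilFam.act g.right (basePointQ V₀) = FilFam.act g'.right (basePointQ V₀) ∧
        ∃ f ∈ M.F0Gp, g'.left = g.left * actGp hS g.right f := by
  have key : ∀ g : SemiGp hS, FilFam.act g (basePointG hS) = FilFam.act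
      (SemidirectProduct.inl g.left) (FilFam.act (SemidirectProduct.inr g.right) (basePointG hS)) :=
    fun g => by rw [← FilFam.act_mul, SemidirectProduct.inl_left_mul_inr_right]
  have key' : ∀ (q : mumfordTate V₀) (u : UniGp ℂ (ℂ ⊗[ℚ] L)), FilFam.act (SemidirectProduct.inl u)
      (FilFam.act (SemidirectProduct.inr q) (basePointG hS)) =
      FilFam.act (SemidirectProduct.inr q) (orbitMap hS ((actGp hS q).symm u)) := fun q u => by
    rw [act_inr_orbitMap, MulEquiv.apply_symm_apply, FilFam.act_mul]
  have main : FilFam.act g.right (basePointQ V₀) = FilFam.act g'.right (basePointQ V₀) →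
      (FilFam.act g (basePointG hS) = FilFam.act g' (basePointG hS) ↔
        ∃ f ∈ M.F0Gp, g'.left = g.left * actGp hS g.right f) := fun h => by
    rw [key g, key g', ← act_inr_eq h, key', key', (act_injective _).eq_iff, orbitMap_eq_iff h₀,
      ← map_inv, ← map_mul]
    constructor
    · exact fun hf => ⟨_, hf, by rw [MulEquiv.apply_symm_apply, mul_inv_cancel_left]⟩
    · rintro ⟨f, hf, e⟩
      rwa [e, inv_mul_cancel_left, MulEquiv.symm_apply_apply]
  exact ⟨fun h => ⟨act_basePointQ_eq h₀ h, (main (act_basePointQ_eq h₀ h)).1 h⟩,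
    fun h => (main h.1).2 h.2⟩

/-! ## The topology of the fibre -/

/-- The orbit map with values in the fibre. -/
def toFiber (h₀ : IsMHS V₀.W V₀.F) (hS : M.fil.IsDirectSummand V₀) (g : UniGp ℂ (ℂ ⊗[ℚ] L)) :
    fiber hS := ⟨orbitMap hS g, orbitMap_mem_fiber h₀ g⟩

theorem toFiber_surjective (h₀ : IsMHS V₀.W V₀.F) : Function.Surjective (toFiber h₀ hS) := fun y => by
  obtain ⟨g, hg⟩ := exists_orbitMap_eq h₀ y.2
  exact ⟨g, Subtype.ext hg⟩

theorem isOpen_famHol {G : Type*} [Group G] [AlgGp G] {V : Set (FilFam G)} :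
    @IsOpen _ (FilFam.hol G).top V ↔
      ∀ H, @IsOpen _ (AlgGp.hol G).top ((fun g => FilFam.act g H) ⁻¹' V) := by
  refine (@isOpen_iSup_iff (FilFam G) (FilFam G) _ V).trans (forall_congr' fun H => ?_)
  exact isOpen_coinduced

theorem continuous_toFiber (h₀ : IsMHS V₀.W V₀.F) :
    @Continuous _ _ (AlgGp.hol (UniGp ℂ (ℂ ⊗[ℚ] L))).top (fiberHol hS).top (toFiber h₀ hS) := by
  let := (AlgGp.hol (UniGp ℂ (ℂ ⊗[ℚ] L))).top
  let := (AlgGp.hol (SemiGp hS)).top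
  let := (FilFam.hol (SemiGp hS)).top
  refine continuous_induced_rng.2 (continuous_def.2 fun V hV => ?_)
  have h1 : Continuous fun x : UniGp ℂ (ℂ ⊗[ℚ] L) => (SemidirectProduct.inl (x * 1) : SemiGp hS) :=
    continuous_of_holAt (holAt_inl_mul 1)
  simp only [mul_one] at h1
  exact (isOpen_famHol.1 hV (basePointG hS)).preimage h1

theorem isOpenMap_toFiber (h₀ : IsMHS V₀.W V₀.F) :
    @IsOpenMap _ _ (AlgGp.hol (UniGp ℂ (ℂ ⊗[ℚ] L))).top (fiberHol hS).top (toFiber h₀ hS) := by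
  let := (AlgGp.hol (UniGp ℂ (ℂ ⊗[ℚ] L))).top
  let := (AlgGp.hol (SemiGp hS)).top
  let := (FilFam.hol (SemiGp hS)).top
  intro U hU
  set V : Set (FilFam (SemiGp hS)) := {H | ∃ g : SemiGp hS, g.left ∈ U ∧
    H = FilFam.act g (basePointG hS)} with hV
  have hopen : IsOpen V := by
    refine isOpen_famHol.2 fun H => ?_
    by_cases hH : ∃ x : SemiGp hS, H = FilFam.act x (basePointG hS)
    · obtain ⟨x, rfl⟩ := hH
      have e : (fun g => FilFam.act g (FilFam.act x (basePointG hS))) ⁻¹' V =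
          ⋃ f ∈ M.F0Gp, {g : SemiGp hS | g.left * actGp hS g.right
            (x.left * actGp hS x.right f) ∈ U} := by
        ext g
        have eg : ∀ f, g.left * actGp hS g.right (x.left * actGp hS x.right f) =
            (g * x).left * actGp hS (g * x).right f := fun f => by
          rw [SemidirectProduct.mul_left, SemidirectProduct.mul_right, map_mul, map_mul, mul_assoc]
          rfl
        simp only [Set.mem_preimage, Set.mem_iUnion, Set.mem_ofPred_eq, hV, ← FilFam.act_mul,
          exists_prop, eg]
        constructor
        · rintro ⟨g', hg', h⟩
          obtain ⟨-, f, hf, e⟩ := (act_eq_iff h₀).1 h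
          exact ⟨f, hf, e ▸ hg'⟩
        · rintro ⟨f, hf, h⟩
          exact ⟨⟨_, (g * x).right⟩, h, (act_eq_iff h₀).2 ⟨rfl, f, hf, rfl⟩⟩
      rw [e]
      refine isOpen_biUnion fun f _ => IsOpen.preimage (f := fun g : SemiGp hS =>
        g.left * actGp hS g.right (x.left * actGp hS x.right f)) ?_ hU
      exact continuous_of_holAt fun u hu g => holAt_comp_uniGp (fun m => holFun_glev_mul m _ g) u hu
    · convert isOpen_empty
      refine Set.eq_empty_iff_forall_notMem.2 fun g ⟨g', _, h⟩ => hH ⟨g⁻¹ * g', ?_⟩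
      rw [FilFam.act_mul, ← h, ← FilFam.act_mul, inv_mul_cancel, FilFam.act_one]
  refine ⟨V, hopen, Set.ext fun y => ?_⟩
  constructor
  · rintro ⟨g, hg, h⟩
    obtain ⟨u, rfl⟩ := toFiber_surjective h₀ y
    obtain ⟨-, f, hf, e⟩ := (act_eq_iff h₀ (g := SemidirectProduct.inl u) (g' := g)).1 h
    refine ⟨g.left, hg, Subtype.ext ?_⟩
    refine ((orbitMap_eq_iff h₀).2 ?_).symm
    rw [e, SemidirectProduct.left_inl, SemidirectProduct.right_inl, inv_mul_cancel_left, map_one]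
    exact hf
  · rintro ⟨u, hu, rfl⟩
    exact ⟨SemidirectProduct.inl u, hu, rfl⟩

end LieMHS

namespace LieMHS

open Filter

variable {L : Type} [LieRing L] [LieAlgebra ℚ L] {M : LieMHS L} {V₀ : FilSp}
  {hS : M.fil.IsDirectSummand V₀}

/-! ## Lie algebra retractions -/

/-- The retraction `σ` transforms the Hodge filtration of `L` translated by `q` back to the Hodge
filtration of `L`. -/
def IsLieRetr (hS : M.fil.IsDirectSummand V₀) (q : mumfordTate V₀)
    (σ : (ℂ ⊗[ℚ] L) →ₗ⁅ℂ⁆ (ℂ ⊗[ℚ] L)) : Prop :=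
  IsRetraction (lieGrSplitting M).internal (fun a => (M.F a).map (actLie hS q).toLinearMap)
    σ.toLinearMap

theorem isLieRetr_one : IsLieRetr hS 1 LieHom.id := by
  have e : (fun a => (M.F a).map (actLie hS 1).toLinearMap) = M.F :=
    funext fun a => Submodule.map_id (M.F a)
  rw [IsLieRetr, e]
  exact isRetraction_id (lieGrSplitting M).F_eq M.isMHS.F_top

theorem map_mem_F0Gp {q : mumfordTate V₀} {σ : (ℂ ⊗[ℚ] L) →ₗ⁅ℂ⁆ (ℂ ⊗[ℚ] L)}
    (h : IsLieRetr hS q σ) {f : UniGp ℂ (ℂ ⊗[ℚ] L)} (hf : f ∈ M.F0Gp) :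
    UniGp.map σ (actGp hS q f) ∈ M.F0Gp := by
  obtain ⟨f, rfl⟩ := hf
  have hm : ∀ x : M.F0, σ (actLie hS q x.1) ∈ M.F0 := fun x =>
    ((lieGrSplitting M).F_eq 0).ge (IsRetraction.mem h ⟨x.1, x.2, rfl⟩)
  let τ : M.F0 →ₗ⁅ℂ⁆ M.F0 :=
    { toFun := fun x => ⟨σ (actLie hS q x.1), hm x⟩
      map_add' := fun x y => Subtype.ext (by simp)
      map_smul' := fun c x => Subtype.ext (by simp)
      map_lie' := fun {x y} => Subtype.ext (by simp) }
  refine ⟨UniGp.map τ f, ?_⟩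
  have h1 : actGp hS q (UniGp.map M.F0.incl f) = UniGp.map (actLie hS q) (UniGp.map M.F0.incl f) := rfl
  rw [h1, UniGp.map_map τ M.F0.incl (M.F0.incl.comp τ) (fun _ => rfl),
    UniGp.map_map M.F0.incl (actLie hS q) ((actLie hS q).comp M.F0.incl) (fun _ => rfl),
    UniGp.map_map _ σ (M.F0.incl.comp τ) (fun _ => rfl)]

theorem orbitMap_map_eq (h₀ : IsMHS V₀.W V₀.F) {g g' : SemiGp hS}
    {σ σ' : (ℂ ⊗[ℚ] L) →ₗ⁅ℂ⁆ (ℂ ⊗[ℚ] L)} (h : IsLieRetr hS g.right σ)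
    (h' : IsLieRetr hS g'.right σ')
    (e : FilFam.act g (basePointG hS) = FilFam.act g' (basePointG hS)) :
    orbitMap hS (UniGp.map σ g.left) = orbitMap hS (UniGp.map σ' g'.left) := by
  obtain ⟨hq, f, hf, hl⟩ := (act_eq_iff h₀).1 e
  have hF : (fun a => (M.F a).map (actLie hS g'.right).toLinearMap) =
      fun a => (M.F a).map (actLie hS g.right).toLinearMap := funext fun a => (map_F_eq h₀ hq a).symm
  rw [IsLieRetr, hF] at h'
  have hσ : σ' = σ := LieHom.ext fun x =>
    LinearMap.congr_fun (IsRetraction.unique h' h) x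
  rw [hσ, hl, map_mul, orbitMap_eq_iff h₀, inv_mul_cancel_left]
  exact map_mem_F0Gp h hf

theorem exists_lieRetr (h₀ : IsMHS V₀.W V₀.F) : ∃ σ : SemiGp hS → (ℂ ⊗[ℚ] L) →ₗ⁅ℂ⁆ (ℂ ⊗[ℚ] L),
    (∀ x, HolFun (fun g => σ g x) 1) ∧ ∀ᶠ g in hnhds 1, IsLieRetr hS g.right (σ g) := by
  classical
  have : Module.Finite ℚ L := M.isMHS.finite
  obtain ⟨N, hN⟩ := IsHodgeSplitting.exists_bound (lieGrSplitting M).internal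
  obtain ⟨s, hs, hr⟩ := exists_holFun_retraction (lieGrSplitting M).internal (N := N)
    (fun s h => hN s (Or.inl h)) (A := fun g : SemiGp hS => (actLie hS g.right).toLinearMap)
    (fun v => holFun_actLie v 1) rfl
  simp only [← (lieGrSplitting M).F_eq] at hr
  have hb : ∀ g : SemiGp hS, IsRetraction (lieGrSplitting M).internal
      (fun a => (M.F a).map (actLie hS g.right).toLinearMap) (s g) →
      ∀ x y, s g ⁅x, y⁆ = ⁅s g x, s g y⁆ := fun g hg => by
    refine IsRetraction.bilin hg (lieBilin L) (fun a b x hx y hy => lie_mem_gr h₀ hS hx hy) ?_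
    rintro a b _ ⟨x, hx, rfl⟩ _ ⟨y, hy, rfl⟩
    exact ⟨⁅x, y⁆, M.lie_F a b x hx y hy, (actLie hS g.right).map_lie x y⟩
  let σ : SemiGp hS → (ℂ ⊗[ℚ] L) →ₗ⁅ℂ⁆ (ℂ ⊗[ℚ] L) := fun g =>
    if h : ∀ x y, s g ⁅x, y⁆ = ⁅s g x, s g y⁆ then { s g with map_lie' := h _ _ } else LieHom.id
  have hσ : ∀ᶠ g in hnhds 1, IsRetraction (lieGrSplitting M).internal
      (fun a => (M.F a).map (actLie hS g.right).toLinearMap) (s g) ∧ (σ g).toLinearMap = s g :=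
    hr.mono fun g hg => ⟨hg, by simp only [σ, dif_pos (hb g hg)]⟩
  refine ⟨σ, fun x => (hs x).congr (hσ.mono fun g hg => LinearMap.congr_fun hg.2 x), hσ.mono ?_⟩
  intro g hg
  rw [IsLieRetr, hg.2]
  exact hg.1

theorem holFun_bc_map {σ : SemiGp hS → (ℂ ⊗[ℚ] L) →ₗ⁅ℂ⁆ (ℂ ⊗[ℚ] L)} {g : SemiGp hS}
    (hσ : ∀ x, HolFun (fun g => σ g x) g) (m : ℕ) (w : UEQ ℂ (ℂ ⊗[ℚ] L) m) :
    HolFun (fun g => UEQ.bc m (UEQ.map (σ g) m w)) g := by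
  have : Module.Finite ℚ L := M.isMHS.finite
  have := UEQ.finite (k := ℚ) (L := L) m
  induction w using UEQ.induction with
  | one => simpa only [map_one] using HolFun.const _ g
  | mul x u hu =>
    simp only [map_mul, UEQ.map_ι]
    refine HolFun.mul ?_ hu
    exact (hσ x).map ((UEQ.bc m).toLinearMap ∘ₗ (UEQ.ι ℂ (ℂ ⊗[ℚ] L) m))
  | zero => simpa only [map_zero] using HolFun.const _ g
  | add u v hu hv => simpa only [map_add] using hu.add hv
  | smul c u hu => simpa only [map_smul] using HolFun.smul (HolAt.const c g) hu

theorem holFun_glev_map {σ : SemiGp hS → (ℂ ⊗[ℚ] L) →ₗ⁅ℂ⁆ (ℂ ⊗[ℚ] L)} {g : SemiGp hS}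
    (hσ : ∀ x, HolFun (fun g => σ g x) g) (m : ℕ) (c : UniGp ℂ (ℂ ⊗[ℚ] L)) :
    HolFun (fun g => UniGp.glev m (UniGp.map (σ g) (g.left * actGp hS g.right c))) g := by
  have : Module.Finite ℚ L := M.isMHS.finite
  have := UEQ.finite (k := ℚ) (L := L) m
  have h := HolFun.apply (A := fun g => (UEQ.bc m).toLinearMap ∘ₗ (UEQ.map (σ g) m).toLinearMap ∘ₗ
    (UEQ.bc m).symm.toLinearMap) (fun v => holFun_bc_map hσ m ((UEQ.bc m).symm v))
    (holFun_glev_mul m c g)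
  refine h.congr (Eventually.of_forall fun x => ?_)
  change UEQ.bc m (UniGp.lev m (UniGp.map (σ x) _)) =
    UEQ.bc m (UEQ.map (σ x) m ((UEQ.bc m).symm (UEQ.bc m (UniGp.lev m _))))
  rw [UniGp.lev_map, AlgEquiv.symm_apply_apply]

/-! ## Holomorphic functions on the fibre -/

theorem holAt_toFiber_iff (h₀ : IsMHS V₀.W V₀.F) (f : fiber hS → ℂ) (g : UniGp ℂ (ℂ ⊗[ℚ] L)) :
    (fiberHol hS).holAt f (toFiber h₀ hS g) ↔
      (AlgGp.hol (UniGp ℂ (ℂ ⊗[ℚ] L))).holAt (f ∘ toFiber h₀ hS) g := by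
  constructor
  · rintro ⟨F, hF, he⟩
    have h1 : HolAt (fun x : SemiGp hS => F (FilFam.act x (orbitMap hS g)))
        (SemidirectProduct.inl (g * g⁻¹)) := by
      rw [mul_inv_cancel, map_one]
      exact hF
    have h2 := h1.comp_map (ψ := fun u => SemidirectProduct.inl (u * g⁻¹))
      fun u hu => holAt_inl_mul g⁻¹ u hu g
    simp only [← orbitMap_mul, inv_mul_cancel_right] at h2
    let _ := (AlgGp.hol (UniGp ℂ (ℂ ⊗[ℚ] L))).top
    let _ := (fiberHol hS).top
    exact h2.congr ((continuous_toFiber h₀).continuousAt.eventually he)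
  · intro hf
    classical
    let F : FilFam (SemiGp hS) → ℂ := fun H =>
      if h : ∃ p : SemiGp hS × ((ℂ ⊗[ℚ] L) →ₗ⁅ℂ⁆ (ℂ ⊗[ℚ] L)), IsLieRetr hS p.1.right p.2 ∧
        H = FilFam.act p.1 (basePointG hS) then f (toFiber h₀ hS (UniGp.map h.choose.2 h.choose.1.left))
      else 0
    have hF : ∀ (x : SemiGp hS) (σ : (ℂ ⊗[ℚ] L) →ₗ⁅ℂ⁆ (ℂ ⊗[ℚ] L)), IsLieRetr hS x.right σ →
        F (FilFam.act x (basePointG hS)) = f (toFiber h₀ hS (UniGp.map σ x.left)) := fun x σ hσ => by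
      have h : ∃ p : SemiGp hS × ((ℂ ⊗[ℚ] L) →ₗ⁅ℂ⁆ (ℂ ⊗[ℚ] L)), IsLieRetr hS p.1.right p.2 ∧
        FilFam.act x (basePointG hS) = FilFam.act p.1 (basePointG hS) := ⟨(x, σ), hσ, rfl⟩
      exact (dif_pos h).trans (congrArg f (Subtype.ext
        (orbitMap_map_eq h₀ h.choose_spec.1 hσ h.choose_spec.2.symm)))
    refine ⟨F, ?_, ?_⟩
    · obtain ⟨σ, hσ, hr⟩ := exists_lieRetr (hS := hS) h₀
      have h1 : UniGp.map (σ 1) ((1 : SemiGp hS).left * actGp hS (1 : SemiGp hS).right g) = g := by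
        have e : σ 1 = LieHom.id := LieHom.ext fun x => LinearMap.congr_fun
          (IsRetraction.unique (@Eventually.self_of_nhds _ (AlgGp.hol (SemiGp hS)).top _ _ hr)
            isLieRetr_one) x
        rw [e, UniGp.map_id _ fun _ => rfl, SemidirectProduct.one_left, SemidirectProduct.one_right,
          map_one, one_mul, MulAut.one_apply]
      have h2 : HolAt (f ∘ toFiber h₀ hS)
        (UniGp.map (σ 1) ((1 : SemiGp hS).left * actGp hS (1 : SemiGp hS).right g)) := h1.symm ▸ hf
      have h3 := h2.comp_map (ψ := fun x : SemiGp hS =>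
        UniGp.map (σ x) (x.left * actGp hS x.right g)) (holAt_comp_uniGp fun m => holFun_glev_map hσ m g)
      refine h3.congr (hr.mono fun x hx => ?_)
      have h4 := hF (x * SemidirectProduct.inl g) (σ x)
        (by rwa [SemidirectProduct.mul_right, SemidirectProduct.right_inl, mul_one])
      rwa [FilFam.act_mul, SemidirectProduct.mul_left, SemidirectProduct.left_inl] at h4
    · refine Eventually.of_forall fun y => ?_
      obtain ⟨u, rfl⟩ := toFiber_surjective h₀ y
      refine Eq.symm ((hF (SemidirectProduct.inl u) LieHom.id isLieRetr_one).trans ?_)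
      rw [UniGp.map_id _ fun _ => rfl, SemidirectProduct.left_inl]

end LieMHS

end HigherAlbanese

end

theorem theorem5p1p6 (Γ : Type) [Group Γ] [Group.FG Γ] [Group.IsNilpotent Γ]
    (hΓ : ∀ γ : Γ, IsOfFinOrder γ → γ = 1)
    (M : LieMHS (MalcevLie Γ))
    (V₀ : FilSp) (hV₀ : IsMHS V₀.W V₀.F) (hpol : GrPolarizable V₀.W V₀.F)
    (hS : M.fil.IsDirectSummand V₀) :
    basePointQ V₀ ∈ periodDomain (hodgeHom V₀) ∧
    LieMHS.basePointG hS ∈ LieMHS.fiber hS ∧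
    ∃ h𝒟 : ∀ g : MalcevGp Γ, LieMHS.orbitMap hS g ∈ LieMHS.fiber hS,
      (∃ e : MalcevGp Γ ⧸ M.F0Gp → LieMHS.fiber hS,
        (∀ g : MalcevGp Γ, e (QuotientGroup.mk g) = ⟨LieMHS.orbitMap hS g, h𝒟 g⟩) ∧
        IsBiholomorphic (flagHol M) (LieMHS.fiberHol hS) e) ∧
      (∃ e : Albanese Γ M → FiberQuot hS,
        (∀ g : MalcevGp Γ, e (Albanese.mk M g) = FiberQuot.mk hS ⟨LieMHS.orbitMap hS g, h𝒟 g⟩) ∧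
        IsBiholomorphic (Albanese.hol M) (FiberQuot.hol hS) e) := by
  have hφ := LieMHS.orbitMap_mem_fiber (hS := hS) hV₀
  refine ⟨basePointQ_mem hV₀, LieMHS.orbitMap_one (hS := hS) ▸ hφ 1, hφ, ?_, ?_⟩
  · have h := exists_isBiholomorphic_quot (LieMHS.continuous_toFiber (hS := hS) hV₀)
      (LieMHS.isOpenMap_toFiber hV₀) (LieMHS.toFiber_surjective hV₀)
      (LieMHS.holAt_toFiber_iff hV₀) (π := fun g : MalcevGp Γ => (QuotientGroup.mk g :
        MalcevGp Γ ⧸ M.F0Gp)) (ρ := id) QuotientGroup.mk_surjective Function.surjective_id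
      fun g g' => by
        rw [QuotientGroup.eq, ← LieMHS.orbitMap_eq_iff (hS := hS) hV₀]
        exact ⟨fun h => Subtype.ext h, fun h => congrArg Subtype.val h⟩
    rw [HolStr.quot_id] at h
    exact h
  · refine exists_isBiholomorphic_quot (LieMHS.continuous_toFiber (hS := hS) hV₀)
      (LieMHS.isOpenMap_toFiber hV₀) (LieMHS.toFiber_surjective hV₀)
      (LieMHS.holAt_toFiber_iff hV₀) (π := Albanese.mk M) (ρ := FiberQuot.mk hS)
      Quotient.mk_surjective Quotient.mk_surjective fun g g' => ?_
    refine (DoubleCoset.eq (latticeImage Γ) M.F0Gp g g').trans (Iff.trans ?_ Quotient.eq.symm)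
    refine exists_congr fun n => and_congr_right fun _ => ?_
    change _ ↔ LieMHS.orbitMap hS g' = FilFam.act (SemidirectProduct.inl n) (LieMHS.orbitMap hS g)
    rw [← LieMHS.orbitMap_mul, eq_comm (a := LieMHS.orbitMap hS g'), LieMHS.orbitMap_eq_iff hV₀]
    constructor
    · rintro ⟨f, hf, rfl⟩
      rwa [inv_mul_cancel_left]
    · exact fun h => ⟨_, h, (mul_inv_cancel_left _ _).symm⟩
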